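/- Let $d\ge 1$, let $\Omega\subset\mathbb R^d$ be a bounded open set with Lipschitz boundary, $T>0$, $J=(0,T)$, $\gamma>0$. Sobolev and Bochner spaces carry their standard norms; $H^1_0(\Omega)$ carries the norm of $H^1(\Omega)$, $H^{-1}(\Omega)$ is its dual (with $L^2(\Omega)\subset H^{-1}(\Omega)$ via the $L^2(\Omega)$ inner product), $\|f\|_{H^k(X)}^2=\sum_{j\le k}\|f^{(j)}\|_{L^2(X)}^2$ with weak time derivatives on $J$, and $L^p(X)=L^p(J;X)$. A norm is $\infty$ if the function is not in the space. Let $h=T/n$ with an integer $n\ge1$, $t_k=kh$ for $0\le k\le n$, and let $\Omega_h$ be an admissible (no hanging nodes) partition of $\Omega$ into $d$-simplices with numbered vertices $p_1,\dots,p_N$, uniform with constant $\gamma$: each simplex has diameter at most $\gamma h$ and contains a ball of radius $h/\gamma$. Let $S^1_0(\Omega_h)$ be the continuous functions on $\overline\Omega$ that are affine on each simplex and vanish on $\partial\Omega$, and let $\Pi_{0,h}:L^2(\Omega)\to S^1_0(\Omega_h)$ be the $L^2(\Omega)$-orthogonal projection. For $u\in C(\overline J;L^2(\Omega))$ let $J_{0,h}^\otimes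 u$ be the function that is continuous and piecewise affine in time with respect to the $t_k$ and satisfies $(J_{0,h}^\otimes u)(t_k)=\Pi_{0,h}(u(t_k))$. For each $\omega=\mathrm{conv}(p_{i_1},\dots,p_{i_{d+1}})\in\Omega_h$ with $i_1<\dots<i_{d+1}$ and each $0\le k<n$, split $\omega\times[t_k,t_{k+1}]$ into the $d+1$ simplices $\mathrm{conv}(p'_\ell,\dots,p'_{d+1},p''_1,\dots,p''_\ell)$, $\ell=1,\dots,d+1$, where $p'_m=(p_{i_m},t_k)$, $p''_m=(p_{i_m},t_{k+1})$. Let $\mathcal T_h$ be the set of all these simplices, and $S^1_0(\mathcal T_h)$ the continuous functions on $\overline J\times\overline\Omega$ that are affine on each $K\in\mathcal T_h$ and vanish on $\overline J\times\partial\Omega$. Then there is a constant $C>0$, which depends only on $d,\Omega,T,\gamma$ (not on $h$, $\Omega_h$, the numbering of its vertices, or $u$), such that for all such $n$ and $\Omega_h$: $\mathcal T_h$ is an admissible simplicial partition of $J\times\Omega$; and for every $u\in C(\overline J;L^2(\Omega))$ there is exactly one $J_{0,h}u\in S^1_0(\mathcal T_h)$ that has the same values as $J_{0,h}^\otimes u$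 at all vertices $(p_i,t_k)$, and \begin{align*} \|u-J_{0,h}u\|_{L^2(H^1_0(\Omega))}&\le Ch\big(\|u\|_{H^1(H^1_0(\Omega))}+\|u\|_{L^\infty(H^2(\Omega))}\big),\\ \|(u-J_{0,h}u)'\|_{L^2(H^{-1}(\Omega))}&\le Ch\big(\|u\|_{H^1(H^1_0(\Omega))}+\|u\|_{H^2(H^{-1}(\Omega))}+\|u\|_{L^\infty(H^2(\Omega))}\big),\\ \|(u-J_{0,h}u)'\|_{L^2(L^2(\Omega))}&\le Ch\big(\|u\|_{H^1(H^1_0(\Omega))}+\|u\|_{H^2(L^2(\Omega))}+\|u\|_{L^\infty(H^2(\Omega))}\big). \end{align*} -/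

import Mathlib

open MeasureTheory Set TopologicalSpace
open scoped Distributions ENNReal NNReal

noncomputable section

namespace SpaceTimeFEM

/-! ### Lipschitz domains and Sobolev spaces on the spatial domain -/

/-- The physical space `ℝ^d` with its Euclidean norm. -/
abbrev Space (d : ℕ) : Type := EuclideanSpace ℝ (Fin d)

/-- `Ω` has a Lipschitz boundary: near each boundary point there are a unit direction `e` and a
Lipschitz function `g` such that `Ω` is the region strictly above the graph of `g` over the
hyperplane orthogonal to `e` (only the values of `g` on that hyperplane are used). -/
def HasLipschitzBoundary {d : ℕ} (Ω : Set (Space d)) : Prop :=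
  ∀ x₀ ∈ frontier Ω, ∃ (e : Space d) (r : ℝ) (L : ℝ≥0) (g : Space d → ℝ),
    ‖e‖ = 1 ∧ 0 < r ∧ LipschitzWith L g ∧
      ∀ y ∈ Metric.ball x₀ r, y ∈ Ω ↔ g (y - inner ℝ e y • e) < inner ℝ e y

/-- The Lebesgue space `L²(Ω)`. -/
abbrev L2 {d : ℕ} (Ω : Opens (Space d)) : Type :=
  Lp ℝ 2 (volume.restrict (Ω : Set (Space d)))

open Classical in
/-- The class in `L²(Ω)` of a square integrable function on `Ω`; the value `0` in the other case is
never used below, see `memLp_testFunction`, `memLp_partial` and `memLp_of_continuousOn`. -/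
def toL2 {d : ℕ} (Ω : Opens (Space d)) (f : Space d → ℝ) : L2 Ω :=
  if h : MemLp f 2 (volume.restrict (Ω : Set (Space d))) then h.toLp f else 0

/-- The `i`-th partial derivative of a differentiable function. -/
def partialDeriv {d : ℕ} (i : Fin d) (φ : Space d → ℝ) (x : Space d) : ℝ :=
  fderiv ℝ φ x (EuclideanSpace.single i 1)

/-- `g` is the weak partial derivative `∂ᵢ f` in `Ω`:
`∫_Ω f ∂ᵢφ = - ∫_Ω g φ` for all test functions `φ`. -/
def IsWeakPartial {d : ℕ} (Ω : Opens (Space d)) (i : Fin d) (f g : L2 Ω) : Prop :=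
  ∀ φ : 𝓓(Ω, ℝ), inner ℝ f (toL2 Ω (partialDeriv i φ)) = -inner ℝ g (toL2 Ω φ)

/-- First order jets `(v, ∂₁ v, …, ∂_d v)` of `L²(Ω)` functions, with the norm
`(‖v‖² + ∑ᵢ ‖∂ᵢ v‖²)^(1/2)`. -/
abbrev Jet1 {d : ℕ} (Ω : Opens (Space d)) : Type :=
  PiLp 2 (fun _ : Option (Fin d) => L2 Ω)

/-- The jet `(φ, ∇φ)` of a test function. -/
def testJet {d : ℕ} (Ω : Opens (Space d)) (φ : 𝓓(Ω, ℝ)) : Jet1 Ω :=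
  WithLp.toLp 2 fun o => match o with
    | none => toL2 Ω φ
    | some i => toL2 Ω (partialDeriv i φ)

/-- The space `H¹₀(Ω)`, as the closure of the test functions in the norm of `H¹(Ω)`. A function
`v` is represented by the pair `(v, ∇v)`. -/
def H10 {d : ℕ} (Ω : Opens (Space d)) : Submodule ℝ (Jet1 Ω) :=
  (Submodule.span ℝ (Set.range (testJet Ω))).topologicalClosure

/-- The embedding `H¹₀(Ω) → L²(Ω)`. -/
def H10toL2 {d : ℕ} (Ω : Opens (Space d)) : H10 Ω →L[ℝ] L2 Ω :=
  (PiLp.proj 2 (fun _ : Option (Fin d) => L2 Ω) none : Jet1 Ω →L[ℝ] L2 Ω).comp (H10 Ω).subtypeL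

/-- The space `H⁻¹(Ω)`, the topological dual of `H¹₀(Ω)`, with the dual norm. -/
abbrev Hneg1 {d : ℕ} (Ω : Opens (Space d)) : Type := StrongDual ℝ (H10 Ω)

/-- The embedding `L²(Ω) → H⁻¹(Ω)`, `f ↦ (v ↦ ∫_Ω f v)`. -/
def L2toHneg1 {d : ℕ} (Ω : Opens (Space d)) (f : L2 Ω) : Hneg1 Ω :=
  (innerSL ℝ f).comp (H10toL2 Ω)

/-- Second order jets `(v, (∂ᵢ v)ᵢ, (∂ⱼ ∂ᵢ v)ᵢⱼ)` of `L²(Ω)` functions, with the norm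
`(‖v‖² + ∑ᵢ ‖∂ᵢ v‖² + ∑ᵢⱼ ‖∂ⱼ ∂ᵢ v‖²)^(1/2)`. -/
abbrev Jet2 {d : ℕ} (Ω : Opens (Space d)) : Type :=
  PiLp 2 (fun _ : Option (Fin d ⊕ Fin d × Fin d) => L2 Ω)

/-- The Sobolev space `H²(Ω)`. A function `v` is represented by its jet of weak derivatives. -/
def H2 {d : ℕ} (Ω : Opens (Space d)) : Submodule ℝ (Jet2 Ω) where
  carrier := {F | (∀ i, IsWeakPartial Ω i (F none) (F (some (.inl i)))) ∧
    ∀ i j, IsWeakPartial Ω j (F (some (.inl i))) (F (some (.inr (i, j))))}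
  zero_mem' := by
    constructor
    · intro i φ
      simp
    · intro i j φ
      simp
  add_mem' := by
    rintro F G ⟨hF1, hF2⟩ ⟨hG1, hG2⟩
    constructor
    · intro i φ
      have h1 := hF1 i φ
      have h2 := hG1 i φ
      simp only [PiLp.add_apply, inner_add_left, h1, h2]
      ring
    · intro i j φ
      have h1 := hF2 i j φ
      have h2 := hG2 i j φ
      simp only [PiLp.add_apply, inner_add_left, h1, h2]
      ring
  smul_mem' := by
    rintro c F ⟨hF1, hF2⟩
    constructor
    · intro i φ
      have h1 := hF1 i φ
      simp only [PiLp.smul_apply, real_inner_smul_left, h1]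
      ring
    · intro i j φ
      have h1 := hF2 i j φ
      simp only [PiLp.smul_apply, real_inner_smul_left, h1]
      ring

/-- The embedding `H²(Ω) → L²(Ω)`. -/
def H2toL2 {d : ℕ} (Ω : Opens (Space d)) : H2 Ω →L[ℝ] L2 Ω :=
  (PiLp.proj 2 (fun _ : Option (Fin d ⊕ Fin d × Fin d) => L2 Ω) none :
    Jet2 Ω →L[ℝ] L2 Ω).comp (H2 Ω).subtypeL

theorem coeFn_toL2 {d : ℕ} {Ω : Opens (Space d)} {f : Space d → ℝ}
    (h : MemLp f 2 (volume.restrict (Ω : Set (Space d)))) :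
    toL2 Ω f =ᵐ[volume.restrict (Ω : Set (Space d))] f := by
  rw [toL2, dif_pos h]
  exact h.coeFn_toLp

theorem memLp_testFunction {d : ℕ} {Ω : Opens (Space d)} (φ : 𝓓(Ω, ℝ)) :
    MemLp φ 2 (volume.restrict (Ω : Set (Space d))) :=
  (φ.continuous.memLp_of_hasCompactSupport φ.hasCompactSupport).restrict _

theorem memLp_partial {d : ℕ} {Ω : Opens (Space d)} (φ : 𝓓(Ω, ℝ)) (i : Fin d) :
    MemLp (partialDeriv i φ) 2 (volume.restrict (Ω : Set (Space d))) := by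
  have hc : Continuous (partialDeriv i φ) :=
    (φ.contDiff.continuous_fderiv (by simp)).clm_apply continuous_const
  have hs : HasCompactSupport (partialDeriv i φ) :=
    (φ.hasCompactSupport.fderiv ℝ).comp_left
      (g := fun A : Space d →L[ℝ] ℝ => A (EuclideanSpace.single i 1)) rfl
  exact (hc.memLp_of_hasCompactSupport hs).restrict _

theorem memLp_of_continuousOn {d : ℕ} {Ω : Opens (Space d)}
    (hb : Bornology.IsBounded (Ω : Set (Space d))) {f : Space d → ℝ}
    (hf : ContinuousOn f (closure (Ω : Set (Space d)))) :
    MemLp f 2 (volume.restrict (Ω : Set (Space d))) := by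
  have hK : IsCompact (closure (Ω : Set (Space d))) := hb.isCompact_closure
  have : IsFiniteMeasure (volume.restrict (Ω : Set (Space d))) :=
    ⟨by rw [Measure.restrict_apply_univ]; exact hb.measure_lt_top⟩
  obtain ⟨C, hC⟩ := hK.exists_bound_of_continuousOn hf
  refine MemLp.of_bound
    ((hf.mono subset_closure).aestronglyMeasurable Ω.isOpen.measurableSet) C ?_
  filter_upwards [ae_restrict_mem Ω.isOpen.measurableSet] with x hx
  exact hC x (subset_closure hx)

/-! ### Bochner spaces on the time interval `J = (0, T)`

The norms take values in `[0, ∞]`; the value `∞` means that the function does not belong to the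
space in question. -/

/-- Lebesgue measure on `J = (0, T)`. -/
abbrev timeMeasure (T : ℝ) : Measure ℝ := volume.restrict (Ioo 0 T)

/-- The open time interval `J = (0, T)`. -/
def timeInterval (T : ℝ) : Opens ℝ := ⟨Ioo 0 T, isOpen_Ioo⟩

/-- `f` and `g` belong to `L²(J; X)` and `g = f'` weakly: `∫_J φ g = - ∫_J φ' f` for all test
functions `φ` on `J`. -/
structure HasWeakTimeDeriv {X : Type*} [NormedAddCommGroup X] [NormedSpace ℝ X]
    (T : ℝ) (f g : ℝ → X) : Prop where
  memLp : MemLp f 2 (timeMeasure T)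
  memLp_deriv : MemLp g 2 (timeMeasure T)
  integral_eq : ∀ φ : 𝓓(timeInterval T, ℝ),
    ∫ s in Ioo 0 T, φ s • g s = -∫ s in Ioo 0 T, deriv φ s • f s

/-- For a continuous embedding `ι : X → Y` and `f : J → Y`, the norm of `f` in `L^p(J; X)`: it is
`‖g‖_{L^p(J; X)}` if `f = ι ∘ g` almost everywhere for a strongly measurable `g : J → X`
(unique up to null sets), and `∞` if there is no such `g`. -/
def bochnerNorm {X Y : Type*} [NormedAddCommGroup X] [NormedSpace ℝ X]
    [NormedAddCommGroup Y] [NormedSpace ℝ Y] (T : ℝ) (p : ℝ≥0∞) (ι : X →L[ℝ] Y) (f : ℝ → Y) :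
    ℝ≥0∞ :=
  ⨅ (g : ℝ → X) (_ : AEStronglyMeasurable g (timeMeasure T))
    (_ : ∀ᵐ t ∂(timeMeasure T), ι (g t) = f t), eLpNorm g p (timeMeasure T)

/-- `D 0, …, D k` are the weak time derivatives of orders `0, …, k` of `f`, all in `L²(J; X)`,
where `f : J → Y` is regarded as an `X`-valued function through the embedding `ι`. -/
structure IsTimeDerivChain {X Y : Type*} [NormedAddCommGroup X] [NormedSpace ℝ X]
    [NormedAddCommGroup Y] [NormedSpace ℝ Y] (T : ℝ) (k : ℕ) (ι : X →L[ℝ] Y) (f : ℝ → Y)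
    (D : ℕ → ℝ → X) : Prop where
  lift : ∀ᵐ t ∂(timeMeasure T), ι (D 0 t) = f t
  memLp : ∀ j ≤ k, MemLp (D j) 2 (timeMeasure T)
  deriv : ∀ j < k, HasWeakTimeDeriv T (D j) (D (j + 1))

/-- For a continuous embedding `ι : X → Y` and `f : J → Y`, the norm
`(∑_{j ≤ k} ‖f^{(j)}‖²_{L²(J; X)})^(1/2)` of `f` in `H^k(J; X)`; it is `∞` if `f` is not in this
space. -/
def sobolevNorm {X Y : Type*} [NormedAddCommGroup X] [NormedSpace ℝ X]
    [NormedAddCommGroup Y] [NormedSpace ℝ Y] (T : ℝ) (k : ℕ) (ι : X →L[ℝ] Y) (f : ℝ → Y) :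
    ℝ≥0∞ :=
  ⨅ (D : ℕ → ℝ → X) (_ : IsTimeDerivChain T k ι f D),
    (∑ j ∈ Finset.range (k + 1), eLpNorm (D j) 2 (timeMeasure T) ^ 2) ^ (1 / 2 : ℝ)

/-- The norm `‖f'‖_{L²(J; X)}` of the weak time derivative of `f : J → X`; it is `∞` if there is no
weak derivative in `L²(J; X)`. -/
def derivNorm {X : Type*} [NormedAddCommGroup X] [NormedSpace ℝ X] (T : ℝ) (f : ℝ → X) : ℝ≥0∞ :=
  ⨅ (g : ℝ → X) (_ : HasWeakTimeDeriv T f g), eLpNorm g 2 (timeMeasure T)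

/-! ### Simplicial meshes -/

/-- `𝒯` is (the set of the vertex sets of) an admissible partition of `D` into simplices of full
dimension: any two of the closed simplices meet in the convex hull of their common vertices. -/
structure IsAdmissibleMesh {F : Type*} [AddCommGroup F] [Module ℝ F]
    (𝒯 : Set (Set F)) (D : Set F) : Prop where
  finite : 𝒯.Finite
  finite_vertices : ∀ V ∈ 𝒯, V.Finite
  card_vertices : ∀ V ∈ 𝒯, V.ncard = Module.finrank ℝ F + 1
  affineIndependent : ∀ V ∈ 𝒯, AffineIndependent ℝ ((↑) : V → F)
  inter : ∀ V ∈ 𝒯, ∀ W ∈ 𝒯, convexHull ℝ V ∩ convexHull ℝ W = convexHull ℝ (V ∩ W)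
  cover : ⋃ V ∈ 𝒯, convexHull ℝ V = D

/-- `f` is continuous on `D` and affine on each of the closed simplices of `𝒯`. -/
def IsPiecewiseAffine {F : Type*} [AddCommGroup F] [Module ℝ F] [TopologicalSpace F]
    (𝒯 : Set (Set F)) (D : Set F) (f : F → ℝ) : Prop :=
  ContinuousOn f D ∧ ∀ V ∈ 𝒯, ∃ a : F →ᵃ[ℝ] ℝ, EqOn f a (convexHull ℝ V)

/-- A spatial mesh `Ω_h`: numbered vertices `p i`, and an admissible partition of `Ω` into
simplices, each given by the set of the numbers of its vertices. -/
structure SpatialMesh {d : ℕ} (Ω : Opens (Space d)) where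
  N : ℕ
  p : Fin N → Space d
  p_injective : Function.Injective p
  elems : Finset (Finset (Fin N))
  vertex_mem : ∀ i, ∃ ω ∈ elems, i ∈ ω
  admissible : IsAdmissibleMesh {V | ∃ ω ∈ elems, V = p '' (ω : Set (Fin N))}
    (closure (Ω : Set (Space d)))

namespace SpatialMesh

variable {d : ℕ} {Ω : Opens (Space d)} (M : SpatialMesh Ω)

/-- The vertex sets of the elements. -/
def simplices : Set (Set (Space d)) :=
  {V | ∃ ω ∈ M.elems, V = M.p '' (ω : Set (Fin M.N))}

/-- All elements have a diameter comparable to `h` and are shape regular, with the uniformity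
constant `γ`. -/
def IsUniform (γ h : ℝ) : Prop :=
  ∀ V ∈ M.simplices, Metric.diam (convexHull ℝ V) ≤ γ * h ∧
    ∃ c, Metric.ball c (h / γ) ⊆ convexHull ℝ V

/-- The space `S¹₀(Ω_h)`. -/
def IsS10 (v : Space d → ℝ) : Prop :=
  IsPiecewiseAffine M.simplices (closure (Ω : Set (Space d))) v ∧
    ∀ x ∈ frontier (Ω : Set (Space d)), v x = 0

/-- `v = Π_{0,h} f`, the `L²(Ω)`-orthogonal projection of `f` to `S¹₀(Ω_h)`. -/
def IsL2Projection (f : L2 Ω) (v : Space d → ℝ) : Prop :=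
  M.IsS10 v ∧ ∀ φ, M.IsS10 φ → ∫ x in (Ω : Set (Space d)), (f x - v x) * φ x = 0

/-- `v = J_{0,h}^⊗ u` on `[0, T] × Ω̄`, for the time steps `t_k = k h`, `k = 0, …, n`: at the time
`t_k` it is the `L²(Ω)`-projection of `u (t_k)` to `S¹₀(Ω_h)`, and it is affine in time on each
`[t_k, t_{k+1}]`. -/
def IsTensorInterpolant (h : ℝ) (n : ℕ) (u : ℝ → L2 Ω) (v : ℝ × Space d → ℝ) : Prop :=
  (∀ k : ℕ, k ≤ n → M.IsL2Projection (u (k * h)) fun x => v (k * h, x)) ∧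
    ∀ k : ℕ, k < n → ∀ t ∈ Icc (k * h) ((k + 1 : ℕ) * h), ∀ x ∈ closure (Ω : Set (Space d)),
      v (t, x) =
        (v ((k + 1 : ℕ) * h, x) * (t - k * h) + v (k * h, x) * ((k + 1 : ℕ) * h - t)) / h

/-- The vertices of the `ℓ`-th simplex of the splitting of `ω × [t_k, t_{k+1}]`, where the vertices
of `ω` are ordered by their numbers: the vertices `(p i, t_k)` for `i ≥ ℓ`, and
`(p i, t_{k+1})` for `i ≤ ℓ`. Space-time points are written `(t, x)`. -/
def splitVertices (h : ℝ) (k : ℕ) (ω : Finset (Fin M.N)) (ℓ : Fin M.N) : Set (ℝ × Space d) :=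
  {z | ∃ i ∈ ω, (ℓ ≤ i ∧ z = ((k : ℝ) * h, M.p i)) ∨ (i ≤ ℓ ∧ z = (((k + 1 : ℕ) : ℝ) * h, M.p i))}

/-- The simplicial space-time mesh `𝒯_h` obtained from the tensor product mesh with `n` time
steps of length `h`. -/
def spaceTimeMesh (h : ℝ) (n : ℕ) : Set (Set (ℝ × Space d)) :=
  {V | ∃ k < n, ∃ ω ∈ M.elems, ∃ ℓ ∈ ω, V = M.splitVertices h k ω ℓ}

/-- The space `S¹₀(𝒯_h)` on the space-time cylinder `[0, n h] × Ω̄`. -/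
def IsSpaceTimeS10 (h : ℝ) (n : ℕ) (w : ℝ × Space d → ℝ) : Prop :=
  IsPiecewiseAffine (M.spaceTimeMesh h n) (Icc 0 (n * h) ×ˢ closure (Ω : Set (Space d))) w ∧
    ∀ t ∈ Icc 0 (n * h), ∀ x ∈ frontier (Ω : Set (Space d)), w (t, x) = 0

/-- `w = J_{0,h} u` on `[0, n h] × Ω̄`: it is in `S¹₀(𝒯_h)` and has the same values as
`J_{0,h}^⊗ u` at all vertices of the mesh. -/
def IsSimplicialInterpolant (h : ℝ) (n : ℕ) (u : ℝ → L2 Ω) (w : ℝ × Space d → ℝ) : Prop :=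
  M.IsSpaceTimeS10 h n w ∧
    ∃ v, M.IsTensorInterpolant h n u v ∧
      ∀ k : ℕ, k ≤ n → ∀ i, w (k * h, M.p i) = v (k * h, M.p i)

end SpatialMesh

/-- The error `u - w`, as an `L²(Ω)`-valued function of time. -/
def interpError {d : ℕ} {Ω : Opens (Space d)} (u : ℝ → L2 Ω) (w : ℝ × Space d → ℝ) (t : ℝ) :
    L2 Ω :=
  u t - toL2 Ω fun x => w (t, x)

end SpaceTimeFEM

end

noncomputable section

namespace SpaceTimeFEM

section

/-! ### Square integrable functions and test functions -/

/-! Fix a time slab, let s in [0,1] be the relative height in it, Δ the increment of u over the slab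
and b_i the nodal values of ΠΔ. Splitting a prism along the order of its vertices makes the
simplicial interpolant explicit. If λ_i are the hat functions and L_m is the sum of the λ_j with j <
m, then the share of λ_i that sits at the upper vertex at height s is min(L_{i+1}, s) − min(L_i, s);
this is `cut`. So on the slab J_{0,h}u = Πu(t_k) + s ΠΔ + ∑ b_i (cut_i − s λ_i), that is, the tensor
product interpolant plus a correction (`toL2_interp`). One formula also gives the barycentric
weights in all space-time simplices, and with them admissibility of the mesh (`weights_of_split`).

The functions cut_i and s λ_i both sum to s. The correction therefore sees b only up to a constant
on each element, and the oscillation of b there is at most γh|∇ΠΔ|. Hence the correction is bounded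
in H¹ by ‖ΠΔ‖_{H¹}, and in L² it is Lipschitz in s with constant of order h‖ΠΔ‖_{H¹}
(`exists_corr_bound`).

What remains is classical once Π is known to be stable in H¹₀, of first order in L² on H¹₀, and of
first order in H¹ on H² ∩ H¹₀ (`exists_projection`). In H¹, u(t) − J_{0,h}u(t) is u(t) − Πu(t) plus
terms bounded by increments of u within the slab. For the time derivative, u' is compared with Δ/h,
Δ/h with ΠΔ/h, and ΠΔ/h with the derivative of the interpolant (`exists_pointwise_bounds`). An
increment over a slab is at most the integral of the norm of the derivative there, and taking slab
integrals costs a factor h in L²(J) (`eLpNorm_slabInt_le`). The estimates in L² and H⁻¹ are one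
argument, applied to a contraction of L².

The properties of Π follow from an inverse estimate and from quasi-interpolants of H¹₀ functions
(`quasi_optimal`). A quasi-interpolant takes its interior nodal values from local polynomials,
constant or affine, furnished by a Poincaré inequality that holds up to the Lipschitz boundary
(`exists_local_poincare`, `exists_local_affine`). The boundary nodal values are 0, so an affine
function q close to V ∈ H¹₀ has to be small at boundary vertices p (`sq_mul_volume_le`). The mesh
makes Ω a cone near p: halving distances to p maps the boundary near p into the boundary. So q(p) is
a combination of values of q at two boundary points, the foot of x and the midpoint of p and that
foot. These values are controlled in mean square because V vanishes on the boundary, by a Friedrichs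
inequality in a strip above the graph. -/

theorem abs_integral_mul_le_sqrt {α : Type*} [MeasurableSpace α] {μ : Measure α} {f g : α → ℝ}
    (hf : MemLp f 2 μ) (hg : MemLp g 2 μ) :
    |∫ x, f x * g x ∂μ| ≤ √(∫ x, f x ^ 2 ∂μ) * √(∫ x, g x ^ 2 ∂μ) := by
  have key : ∀ {u v : α → ℝ} (hu : MemLp u 2 μ) (hv : MemLp v 2 μ),
      inner ℝ (hu.toLp u) (hv.toLp v) = ∫ x, u x * v x ∂μ := by
    intro u v hu hv
    rw [L2.inner_def]
    refine integral_congr_ae ?_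
    filter_upwards [hu.coeFn_toLp, hv.coeFn_toLp] with x h1 h2
    simp [h1, h2, mul_comm]
  have norm : ∀ {u : α → ℝ} (hu : MemLp u 2 μ), ‖hu.toLp u‖ = √(∫ x, u x ^ 2 ∂μ) := by
    intro u hu
    rw [norm_eq_sqrt_real_inner, key hu hu]
    simp [sq]
  rw [← key hf hg, ← norm hf, ← norm hg]
  exact abs_real_inner_le_norm _ _

theorem integral_add_sq_le {α : Type*} [MeasurableSpace α] {μ : Measure α} {f g : α → ℝ}
    (hf : MemLp f 2 μ) (hg : MemLp g 2 μ) :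
    ∫ x, (f x + g x) ^ 2 ∂μ ≤ 2 * ∫ x, f x ^ 2 ∂μ + 2 * ∫ x, g x ^ 2 ∂μ := by
  rw [← integral_const_mul, ← integral_const_mul, ← integral_add]
  · refine integral_mono (hf.add hg).integrable_sq ?_ fun x => ?_
    · exact (hf.integrable_sq.const_mul 2).add (hg.integrable_sq.const_mul 2)
    · nlinarith [sq_nonneg (f x - g x)]
  · exact hf.integrable_sq.const_mul 2
  · exact hg.integrable_sq.const_mul 2

theorem setIntegral_sq_mono {α : Type*} [MeasurableSpace α] {μ : Measure α} {f : α → ℝ}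
    {s t : Set α} (hst : s ⊆ t) (hf : MemLp f 2 (μ.restrict t)) :
    ∫ x in s, f x ^ 2 ∂μ ≤ ∫ x in t, f x ^ 2 ∂μ :=
  setIntegral_mono_set hf.integrable_sq (.of_forall fun _ => sq_nonneg _) hst.eventuallyLE

theorem setIntegral_sq_le {α : Type*} [MeasurableSpace α] {μ : Measure α} {f : α → ℝ}
    {s : Set α} {c : ℝ} (hμ : μ s ≠ ∞) (hf : ∀ x ∈ s, |f x| ≤ c) :
    ∫ x in s, f x ^ 2 ∂μ ≤ c ^ 2 * μ.real s := by
  have h := norm_setIntegral_le_of_norm_le_const (f := fun x => f x ^ 2) (C := c ^ 2)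
    hμ.lt_top fun x hx => by
      rw [Real.norm_eq_abs, abs_pow]
      exact pow_le_pow_left₀ (abs_nonneg _) (hf x hx) 2
  exact (le_abs_self _).trans h

variable {d : ℕ} {Ω : Opens (Space d)}

theorem memLp_L2 (f : L2 Ω) : MemLp f 2 (volume.restrict (Ω : Set (Space d))) := Lp.memLp f

theorem memLp_L2_of_subset (f : L2 Ω) {A : Set (Space d)} (hA : A ⊆ Ω) :
    MemLp f 2 (volume.restrict A) :=
  (Lp.memLp f).mono_measure (Measure.restrict_mono hA le_rfl)

theorem toL2_congr {f g : Space d → ℝ} (h : EqOn f g Ω) : toL2 Ω f = toL2 Ω g := by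
  have hae : f =ᵐ[volume.restrict (Ω : Set (Space d))] g := by
    filter_upwards [ae_restrict_mem Ω.isOpen.measurableSet] with x hx using h hx
  by_cases hf : MemLp f 2 (volume.restrict (Ω : Set (Space d)))
  · have hg := hf.ae_eq hae
    rw [toL2, toL2, dif_pos hf, dif_pos hg]
    exact MemLp.toLp_congr _ _ hae
  · have hg : ¬ MemLp g 2 (volume.restrict (Ω : Set (Space d))) :=
      fun hg => hf (hg.ae_eq hae.symm)
    rw [toL2, toL2, dif_neg hf, dif_neg hg]

theorem toL2_add {f g : Space d → ℝ} (hf : MemLp f 2 (volume.restrict (Ω : Set (Space d))))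
    (hg : MemLp g 2 (volume.restrict (Ω : Set (Space d)))) :
    toL2 Ω (fun x => f x + g x) = toL2 Ω f + toL2 Ω g := by
  rw [toL2, toL2, toL2, dif_pos hf, dif_pos hg, dif_pos (show MemLp (fun x => f x + g x) 2 _ from
    hf.add hg)]
  rfl

theorem toL2_sub {f g : Space d → ℝ} (hf : MemLp f 2 (volume.restrict (Ω : Set (Space d))))
    (hg : MemLp g 2 (volume.restrict (Ω : Set (Space d)))) :
    toL2 Ω (fun x => f x - g x) = toL2 Ω f - toL2 Ω g := by
  rw [toL2, toL2, toL2, dif_pos hf, dif_pos hg, dif_pos (show MemLp (fun x => f x - g x) 2 _ from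
    hf.sub hg)]
  rfl

theorem toL2_const_mul {f : Space d → ℝ} (c : ℝ)
    (hf : MemLp f 2 (volume.restrict (Ω : Set (Space d)))) :
    toL2 Ω (fun x => c * f x) = c • toL2 Ω f := by
  rw [toL2, toL2, dif_pos hf, dif_pos (show MemLp (fun x => c * f x) 2 _ from hf.const_mul c)]
  rfl

theorem toL2_zero : toL2 Ω (fun _ => 0) = 0 := by
  have h : MemLp (fun _ : Space d => (0 : ℝ)) 2 (volume.restrict (Ω : Set (Space d))) :=
    MemLp.zero'
  rw [toL2, dif_pos h]
  rfl

theorem toL2_sum {ι : Type*} (s : Finset ι) {f : ι → Space d → ℝ}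
    (hf : ∀ i ∈ s, MemLp (f i) 2 (volume.restrict (Ω : Set (Space d)))) :
    toL2 Ω (fun x => ∑ i ∈ s, f i x) = ∑ i ∈ s, toL2 Ω (f i) := by
  classical
  induction s using Finset.induction_on with
  | empty => simpa using toL2_zero
  | insert a s ha ih =>
    have hs : ∀ i ∈ s, MemLp (f i) 2 (volume.restrict (Ω : Set (Space d))) := fun i hi =>
      hf i (Finset.mem_insert_of_mem hi)
    rw [Finset.sum_insert ha, ← ih hs, ← toL2_add (hf a (Finset.mem_insert_self a s))
      (memLp_finsetSum s hs)]
    simp_rw [Finset.sum_insert ha]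

theorem inner_toL2 (f : L2 Ω) {g : Space d → ℝ}
    (hg : MemLp g 2 (volume.restrict (Ω : Set (Space d)))) :
    inner ℝ f (toL2 Ω g) = ∫ x in (Ω : Set (Space d)), f x * g x := by
  rw [L2.inner_def]
  refine integral_congr_ae ?_
  filter_upwards [coeFn_toL2 hg] with x h2
  simp [h2, mul_comm]

theorem inner_toL2_toL2 {f g : Space d → ℝ}
    (hf : MemLp f 2 (volume.restrict (Ω : Set (Space d))))
    (hg : MemLp g 2 (volume.restrict (Ω : Set (Space d)))) :
    inner ℝ (toL2 Ω f) (toL2 Ω g) = ∫ x in (Ω : Set (Space d)), f x * g x := by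
  rw [inner_toL2 _ hg]
  refine integral_congr_ae ?_
  filter_upwards [coeFn_toL2 hf] with x h2
  simp [h2]

theorem norm_sq_L2 (f : L2 Ω) : ‖f‖ ^ 2 = ∫ x in (Ω : Set (Space d)), f x ^ 2 := by
  rw [← real_inner_self_eq_norm_sq, L2.inner_def]
  simp [sq]

theorem norm_sq_toL2 {f : Space d → ℝ}
    (hf : MemLp f 2 (volume.restrict (Ω : Set (Space d)))) :
    ‖toL2 Ω f‖ ^ 2 = ∫ x in (Ω : Set (Space d)), f x ^ 2 := by
  rw [← real_inner_self_eq_norm_sq, inner_toL2_toL2 hf hf]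
  simp [sq]

/-- The test functions, as a linear map into `L²(Ω)`. -/
def testL2 (Ω : Opens (Space d)) : 𝓓(Ω, ℝ) →ₗ[ℝ] L2 Ω where
  toFun φ := toL2 Ω φ
  map_add' φ ψ := toL2_add (memLp_testFunction φ) (memLp_testFunction ψ)
  map_smul' c φ := toL2_const_mul c (memLp_testFunction φ)

theorem eq_zero_of_inner_testFunction {f : L2 Ω} (h : ∀ φ : 𝓓(Ω, ℝ), inner ℝ f (toL2 Ω φ) = 0) :
    f = 0 := by
  have hloc : LocallyIntegrableOn f (Ω : Set (Space d)) volume :=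
    locallyIntegrableOn_of_locallyIntegrable_restrict
      ((memLp_L2 f).locallyIntegrable (by norm_num))
  have := Ω.isOpen.ae_eq_zero_of_integral_contDiff_smul_eq_zero hloc fun g hg1 hg2 hg3 => by
    have h1 := h ⟨g, hg1, hg2, hg3⟩
    rw [inner_toL2 _ (memLp_testFunction _)] at h1
    rw [← h1, ← setIntegral_eq_integral_of_forall_compl_eq_zero (s := (Ω : Set (Space d)))]
    · refine integral_congr_ae (.of_forall fun x => ?_)
      simp [mul_comm]
    · intro x hx
      rw [image_eq_zero_of_notMem_tsupport fun hx' => hx (hg3 hx'), zero_smul]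
  rw [Lp.eq_zero_iff_ae_eq_zero]
  rw [Filter.EventuallyEq, ae_restrict_iff' Ω.isOpen.measurableSet]
  exact this

theorem dense_range_testL2 : (LinearMap.range (testL2 Ω)).topologicalClosure = ⊤ := by
  rw [Submodule.topologicalClosure_eq_top_iff, Submodule.eq_bot_iff]
  intro f hf
  refine eq_zero_of_inner_testFunction fun φ => ?_
  rw [Submodule.mem_orthogonal'] at hf
  exact hf _ ⟨φ, rfl⟩

theorem exists_testFunction_near (f : L2 Ω) {ε : ℝ} (hε : 0 < ε) :
    ∃ φ : 𝓓(Ω, ℝ), ‖f - toL2 Ω φ‖ < ε := by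
  have h : f ∈ closure (LinearMap.range (testL2 Ω) : Set (L2 Ω)) := by
    rw [← Submodule.topologicalClosure_coe, dense_range_testL2]
    trivial
  obtain ⟨_, ⟨φ, rfl⟩, hφ⟩ := Metric.mem_closure_iff.1 h ε hε
  exact ⟨φ, by rwa [dist_eq_norm] at hφ⟩

/-- Duality with the dense set of test functions. It yields `L²` bounds for expressions that can
only be evaluated after moving a derivative to the test function. -/
theorem norm_le_of_inner_testFunction {k : L2 Ω} {N : ℝ} (hN : 0 ≤ N)
    (h : ∀ φ : 𝓓(Ω, ℝ), |inner ℝ k (toL2 Ω φ)| ≤ N * ‖toL2 Ω φ‖) : ‖k‖ ≤ N := by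
  have hall : ∀ g : L2 Ω, |inner ℝ k g| ≤ N * ‖g‖ := by
    intro g
    have hg : g ∈ closure (LinearMap.range (testL2 Ω) : Set (L2 Ω)) := by
      rw [← Submodule.topologicalClosure_coe, dense_range_testL2]
      trivial
    have hc : IsClosed {g : L2 Ω | |inner ℝ k g| ≤ N * ‖g‖} :=
      isClosed_le (by fun_prop) (by fun_prop)
    refine closure_minimal ?_ hc hg
    rintro _ ⟨φ, rfl⟩
    exact h φ
  have h1 := hall k
  rw [real_inner_self_eq_norm_sq, abs_of_nonneg (sq_nonneg _)] at h1
  by_contra hlt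
  push Not at hlt
  nlinarith

/-! ### Weak partial derivatives -/

theorem IsWeakPartial.sub {i : Fin d} {f₁ f₂ g₁ g₂ : L2 Ω} (h₁ : IsWeakPartial Ω i f₁ g₁)
    (h₂ : IsWeakPartial Ω i f₂ g₂) : IsWeakPartial Ω i (f₁ - f₂) (g₁ - g₂) := by
  intro φ
  rw [inner_sub_left, inner_sub_left, h₁ φ, h₂ φ]
  ring

theorem IsWeakPartial.unique {i : Fin d} {f g₁ g₂ : L2 Ω} (h₁ : IsWeakPartial Ω i f g₁)
    (h₂ : IsWeakPartial Ω i f g₂) : g₁ = g₂ := by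
  rw [← sub_eq_zero]
  refine eq_zero_of_inner_testFunction fun φ => ?_
  have := h₁ φ
  rw [h₂ φ] at this
  rw [inner_sub_left]
  linarith

theorem integral_mul_partialDeriv {a b : Space d → ℝ} (ha : ContDiff ℝ 1 a) (hb : ContDiff ℝ 1 b)
    (hbs : HasCompactSupport b) (i : Fin d) :
    ∫ x, a x * partialDeriv i b x = -∫ x, partialDeriv i a x * b x := by
  have hca : Continuous (partialDeriv i a) :=
    (ha.continuous_fderiv (by simp)).clm_apply continuous_const
  have hcb : Continuous (partialDeriv i b) :=
    (hb.continuous_fderiv (by simp)).clm_apply continuous_const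
  have hs : HasCompactSupport (partialDeriv i b) :=
    (hbs.fderiv ℝ).comp_left
      (g := fun A : Space d →L[ℝ] ℝ => A (EuclideanSpace.single i 1)) rfl
  refine integral_mul_fderiv_eq_neg_fderiv_mul_of_integrable ?_ ?_ ?_
    (fun x _ => (ha.differentiable (by simp)) x) (fun x _ => (hb.differentiable (by simp)) x)
  · exact (hca.mul hb.continuous).integrable_of_hasCompactSupport hbs.mul_left
  · exact (ha.continuous.mul hcb).integrable_of_hasCompactSupport hs.mul_left
  · exact (ha.continuous.mul hb.continuous).integrable_of_hasCompactSupport hbs.mul_left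

theorem setIntegral_mul_testFunction (a : Space d → ℝ) (φ : 𝓓(Ω, ℝ)) :
    ∫ x in (Ω : Set (Space d)), a x * φ x = ∫ x, a x * φ x :=
  setIntegral_eq_integral_of_forall_compl_eq_zero fun x hx => by
    rw [image_eq_zero_of_notMem_tsupport fun hx' => hx (φ.tsupport_subset hx'), mul_zero]

theorem partialDeriv_testFunction_eq_zero (φ : 𝓓(Ω, ℝ)) (i : Fin d) {x : Space d} (hx : x ∉ Ω) :
    partialDeriv i φ x = 0 := by
  have h1 : x ∉ tsupport (φ : Space d → ℝ) := fun hx' => hx (φ.tsupport_subset hx')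
  have h2 : fderiv ℝ φ x = 0 :=
    image_eq_zero_of_notMem_tsupport fun h => h1 (tsupport_fderiv_subset ℝ h)
  rw [partialDeriv, h2]
  rfl

theorem setIntegral_mul_partialDeriv_testFunction (a : Space d → ℝ) (φ : 𝓓(Ω, ℝ)) (i : Fin d) :
    ∫ x in (Ω : Set (Space d)), a x * partialDeriv i φ x = ∫ x, a x * partialDeriv i φ x :=
  setIntegral_eq_integral_of_forall_compl_eq_zero fun x hx => by
    rw [partialDeriv_testFunction_eq_zero φ i hx, mul_zero]

theorem isWeakPartial_of_contDiff {a : Space d → ℝ} (ha : ContDiff ℝ 1 a) (i : Fin d)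
    (h1 : MemLp a 2 (volume.restrict (Ω : Set (Space d))))
    (h2 : MemLp (partialDeriv i a) 2 (volume.restrict (Ω : Set (Space d)))) :
    IsWeakPartial Ω i (toL2 Ω a) (toL2 Ω (partialDeriv i a)) := by
  intro φ
  rw [inner_toL2_toL2 h1 (memLp_partial φ i), inner_toL2_toL2 h2 (memLp_testFunction φ),
    setIntegral_mul_partialDeriv_testFunction, setIntegral_mul_testFunction]
  exact integral_mul_partialDeriv ha (φ.contDiff.of_le (by exact_mod_cast le_top)) φ.hasCompactSupport i

/-- A closed linear condition holds on `H¹₀(Ω)` if it holds for the test functions. -/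
theorem H10_induction {p : Jet1 Ω → Prop} (hc : IsClosed {V | p V})
    (h0 : p 0) (hadd : ∀ V W, p V → p W → p (V + W)) (hsmul : ∀ (c : ℝ) V, p V → p (c • V))
    (htest : ∀ φ, p (testJet Ω φ)) {V : Jet1 Ω} (hV : V ∈ H10 Ω) : p V := by
  have hV' : V ∈ closure (Submodule.span ℝ (Set.range (testJet Ω)) : Set (Jet1 Ω)) := hV
  refine closure_minimal ?_ hc hV'
  intro W hW
  induction hW using Submodule.span_induction with
  | mem x h => obtain ⟨φ, rfl⟩ := h; exact htest φ
  | zero => exact h0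
  | add x y _ _ hx hy => exact hadd x y hx hy
  | smul a x _ hx => exact hsmul a x hx

theorem isWeakPartial_of_mem_H10 {V : Jet1 Ω} (hV : V ∈ H10 Ω) (i : Fin d) :
    IsWeakPartial Ω i (V none) (V (some i)) := by
  intro φ
  refine H10_induction
    (p := fun V => inner ℝ (V none) (toL2 Ω (partialDeriv i φ)) =
      -inner ℝ (V (some i)) (toL2 Ω φ)) ?_ ?_ ?_ ?_ ?_ hV
  · exact isClosed_eq (by fun_prop) (by fun_prop)
  · simp
  · intro V W hV hW
    simp only [PiLp.add_apply, inner_add_left, hV, hW]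
    ring
  · intro c V hV
    simp only [PiLp.smul_apply, real_inner_smul_left, hV]
    ring
  · intro ψ
    exact isWeakPartial_of_contDiff (ψ.contDiff.of_le (by exact_mod_cast le_top)) i
      (memLp_testFunction ψ) (memLp_partial ψ i) φ

theorem H10toL2_apply (V : H10 Ω) : H10toL2 Ω V = (V : Jet1 Ω) none := rfl

/-- The gradient entries of a jet in `H10` are weak derivatives of its first entry, and weak
derivatives are unique. Identities in `H¹₀` can thus be checked in `L²`. -/
theorem H10toL2_injective : Function.Injective (H10toL2 Ω) := by
  intro V W h
  rw [H10toL2_apply, H10toL2_apply] at h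
  apply Subtype.ext
  ext1 o
  cases o with
  | none => exact h
  | some i =>
    have h1 := isWeakPartial_of_mem_H10 V.2 i
    have h2 := isWeakPartial_of_mem_H10 W.2 i
    rw [h] at h1
    exact h1.unique h2

theorem norm_sq_H10 (V : H10 Ω) :
    ‖V‖ ^ 2 = ‖(V : Jet1 Ω) none‖ ^ 2 + ∑ i, ‖(V : Jet1 Ω) (some i)‖ ^ 2 := by
  rw [Submodule.coe_norm, PiLp.norm_sq_eq_of_L2, Fintype.sum_option]

theorem norm_H10toL2_le (V : H10 Ω) : ‖H10toL2 Ω V‖ ≤ ‖V‖ := by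
  have h := norm_sq_H10 V
  have h2 : 0 ≤ ∑ i, ‖(V : Jet1 Ω) (some i)‖ ^ 2 := by positivity
  rw [H10toL2_apply]
  exact abs_le_of_sq_le_sq' (by linarith) (norm_nonneg _) |>.2

end

section

variable {d : ℕ} {Ω : Opens (Space d)}

/-! ### Translations and the Poincaré inequality -/

theorem fderiv_eq_sum_partialDeriv (φ : Space d → ℝ) (x z : Space d) :
    fderiv ℝ φ x z = ∑ i, z i * partialDeriv i φ x := by
  conv_lhs => rw [← (EuclideanSpace.basisFun (Fin d) ℝ).sum_repr z]
  simp [partialDeriv]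

/-- The translation is put on the smooth factor, so `F` needs only to be integrable. -/
theorem hasDerivAt_integral_translate {F φ : Space d → ℝ} (hF : Integrable F)
    (hφ : ContDiff ℝ 1 φ) (hφs : HasCompactSupport φ) (z : Space d) (t : ℝ) :
    HasDerivAt (fun t : ℝ => ∫ y, F y * φ (y - t • z))
      (∫ y, F y * -(fderiv ℝ φ (y - t • z) z)) t := by
  obtain ⟨M, hM⟩ := (hφ.continuous_fderiv (by simp)).bounded_above_of_compact_support
    (hφs.fderiv ℝ)
  obtain ⟨M', hM'⟩ := hφ.continuous.bounded_above_of_compact_support hφs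
  have hc : Continuous (fderiv ℝ φ) := hφ.continuous_fderiv (by simp)
  have hcφ : Continuous φ := hφ.continuous
  refine (hasDerivAt_integral_of_dominated_loc_of_deriv_le (s := univ)
    (F := fun (t : ℝ) y => F y * φ (y - t • z))
    (F' := fun (t : ℝ) y => F y * -(fderiv ℝ φ (y - t • z) z))
    (bound := fun y => ‖F y‖ * (M * ‖z‖)) Filter.univ_mem ?_ ?_ ?_ ?_ ?_ ?_).2
  · refine .of_forall fun s => hF.aestronglyMeasurable.mul ?_
    exact (by fun_prop : Continuous fun y => φ (y - s • z)).aestronglyMeasurable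
  · exact hF.mul_bdd (c := M') (by fun_prop : Continuous fun y => φ (y - t • z)).aestronglyMeasurable
      (.of_forall fun x => hM' _)
  · refine hF.aestronglyMeasurable.mul ?_
    exact (by fun_prop : Continuous fun y => -(fderiv ℝ φ (y - t • z) z)).aestronglyMeasurable
  · refine .of_forall fun y s _ => ?_
    rw [norm_mul, norm_neg]
    refine mul_le_mul_of_nonneg_left ?_ (norm_nonneg _)
    exact (ContinuousLinearMap.le_opNorm _ _).trans
      (mul_le_mul_of_nonneg_right (hM _) (norm_nonneg _))
  · exact hF.norm.mul_const _
  · refine .of_forall fun y s _ => ?_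
    refine HasDerivAt.const_mul _ ?_
    have h1 : HasDerivAt (fun s : ℝ => y - s • z) (-z) s := by
      simpa using ((hasDerivAt_id s).smul_const z).const_sub y
    have h2 := ((hφ.differentiable (by simp) (y - s • z)).hasFDerivAt).comp_hasDerivAt s h1
    simpa [Function.comp_def] using h2

/-- The translate of a test function. -/
def translateTest {A : Opens (Space d)} (φ : 𝓓(A, ℝ)) (z : Space d)
    (h : ∀ x ∈ A, x + z ∈ Ω) : 𝓓(Ω, ℝ) where
  toFun y := φ (y - z)
  contDiff' := φ.contDiff.comp (contDiff_id.sub contDiff_const)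
  hasCompactSupport' := by
    have := φ.hasCompactSupport.comp_homeomorph (Homeomorph.addRight (-z))
    simpa [Function.comp_def, ← sub_eq_add_neg] using this
  tsupport_subset' := by
    intro y hy
    have h1 : y - z ∈ tsupport (φ : Space d → ℝ) :=
      tsupport_comp_subset_preimage (f := fun y : Space d => y - z) φ (by fun_prop) hy
    simpa using h _ (φ.tsupport_subset h1)

theorem translateTest_apply {A : Opens (Space d)} (φ : 𝓓(A, ℝ)) (z : Space d)
    (h : ∀ x ∈ A, x + z ∈ Ω) (y : Space d) : translateTest φ z h y = φ (y - z) := rfl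

theorem memLp_translate {A : Opens (Space d)} (f : L2 Ω) (z : Space d)
    (h : ∀ x ∈ A, x + z ∈ Ω) :
    MemLp (fun x => f (x + z)) 2 (volume.restrict (A : Set (Space d))) := by
  have h1 : MemLp (indicator (Ω : Set (Space d)) f) 2 volume :=
    (memLp_indicator_iff_restrict Ω.isOpen.measurableSet).2 (memLp_L2 f)
  have h2 := (h1.comp_measurePreserving (measurePreserving_add_right volume z)).restrict
    (A : Set (Space d))
  refine h2.ae_eq ?_
  filter_upwards [ae_restrict_mem A.isOpen.measurableSet] with x hx
  simp only [Function.comp]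
  rw [indicator_of_mem]
  exact h x hx

theorem integrable_indicator_L2 (hb : Bornology.IsBounded (Ω : Set (Space d))) (f : L2 Ω) :
    Integrable (indicator (Ω : Set (Space d)) f) := by
  rw [integrable_indicator_iff Ω.isOpen.measurableSet]
  have : IsFiniteMeasure (volume.restrict (Ω : Set (Space d))) :=
    ⟨by rw [Measure.restrict_apply_univ]; exact hb.measure_lt_top⟩
  exact (memLp_L2 f).integrable (by norm_num)

/-- Translating a function with weak partial derivatives changes it by at most the length of
the translation times its gradient. -/
theorem integral_translate_sub_sq_le (hb : Bornology.IsBounded (Ω : Set (Space d))) {f : L2 Ω}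
    {g : Fin d → L2 Ω} (hfg : ∀ i, IsWeakPartial Ω i f (g i)) {A : Opens (Space d)}
    {B : Set (Space d)} (hBΩ : B ⊆ Ω) {z : Space d}
    (hAB : ∀ x ∈ A, ∀ t ∈ Icc (0 : ℝ) 1, x + t • z ∈ B) :
    ∫ x in (A : Set (Space d)), (f (x + z) - f x) ^ 2 ≤
      ‖z‖ ^ 2 * ∑ i, ∫ x in B, g i x ^ 2 := by
  have hAz : ∀ x ∈ A, x + z ∈ Ω := fun x hx => hBΩ (by simpa using hAB x hx 1 (by simp))
  have hA : (A : Set (Space d)) ⊆ Ω := fun x hx => hBΩ (by simpa using hAB x hx 0 (by simp))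
  have hk : MemLp (fun x => f (x + z) - f x) 2 (volume.restrict (A : Set (Space d))) :=
    (memLp_translate f z hAz).sub (memLp_L2_of_subset f hA)
  set F : Space d → ℝ := indicator (Ω : Set (Space d)) f with hF
  have hFi : Integrable F := integrable_indicator_L2 hb f
  set S : ℝ := ∑ i, ∫ x in B, g i x ^ 2 with hS
  have hS0 : 0 ≤ S := Finset.sum_nonneg fun i _ => integral_nonneg fun x => sq_nonneg _
  have hN : ‖toL2 A fun x => f (x + z) - f x‖ ≤ ‖z‖ * √S := by
    refine norm_le_of_inner_testFunction (by positivity) fun φ => ?_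
    have hφ1 : ContDiff ℝ 1 φ := φ.contDiff.of_le (by exact_mod_cast le_top)
    -- The difference of `f` and its translate, tested with `φ`, is `Ψ 1 - Ψ 0`. Here `Ψ` is
    -- differentiable although `f` is not, so a bound for its derivative suffices.
    set Ψ : ℝ → ℝ := fun t => ∫ y, F y * φ (y - t • z) with hΨ
    have h1 : inner ℝ (toL2 A fun x => f (x + z) - f x) (toL2 A φ) = Ψ 1 - Ψ 0 := by
      rw [inner_toL2_toL2 hk (memLp_testFunction φ), hΨ]
      simp only [one_smul, zero_smul, sub_zero]
      have e1 : ∫ y, F y * φ (y - z) = ∫ x in (A : Set (Space d)), f (x + z) * φ x := by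
        rw [setIntegral_mul_testFunction, ← integral_add_right_eq_self _ z]
        refine integral_congr_ae (.of_forall fun x => ?_)
        simp only [add_sub_cancel_right]
        by_cases hx : x ∈ A
        · rw [hF, indicator_of_mem (hAz x hx)]
        · rw [image_eq_zero_of_notMem_tsupport fun hx' => hx (φ.tsupport_subset hx'), mul_zero,
            mul_zero]
      have e2 : ∫ y, F y * φ y = ∫ x in (A : Set (Space d)), f x * φ x := by
        rw [setIntegral_mul_testFunction]
        refine integral_congr_ae (.of_forall fun x => ?_)
        by_cases hx : x ∈ A
        · simp only [hF, indicator_of_mem (hA hx)]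
        · simp [image_eq_zero_of_notMem_tsupport fun hx' => hx (φ.tsupport_subset hx')]
      rw [e1, e2, ← integral_sub]
      · simp only [sub_mul]
      · exact (memLp_translate f z hAz).integrable_mul (memLp_testFunction φ)
      · exact (memLp_L2_of_subset f hA).integrable_mul (memLp_testFunction φ)
    have h2 := norm_image_sub_le_of_norm_deriv_le_segment_01' (f := Ψ)
      (f' := fun t => ∫ y, F y * -(fderiv ℝ φ (y - t • z) z)) (C := ‖z‖ * √S * ‖toL2 A φ‖)
      (fun t _ => (hasDerivAt_integral_translate hFi hφ1 φ.hasCompactSupport z t).hasDerivWithinAt)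
      (fun t ht => ?_)
    · rwa [h1]
    have htI : t ∈ Icc (0 : ℝ) 1 := ⟨ht.1, ht.2.le⟩
    set φt : 𝓓(Ω, ℝ) := translateTest φ (t • z) (fun x hx => hBΩ (hAB x hx t htI)) with hφt
    have hfd : ∀ y, fderiv ℝ φ (y - t • z) z = fderiv ℝ φt y z := by
      intro y
      have : fderiv ℝ (fun y => φ (y - t • z)) y = fderiv ℝ φ (y - t • z) :=
        fderiv_comp_sub _
      rw [← this]
      rfl
    have hgB : ∀ i, MemLp (g i) 2 (volume.restrict B) := fun i => memLp_L2_of_subset _ hBΩ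
    -- Weak differentiability of `f`, tested with the translate `φt`. As `φt` vanishes outside `B`,
    -- only the gradient on `B` enters.
    have e3 : ∫ y, F y * -(fderiv ℝ φ (y - t • z) z) =
        ∫ y in B, (∑ i, z i * g i y) * φt y := by
      have hi : ∀ i, ∫ y in (Ω : Set (Space d)), f y * partialDeriv i φt y =
          - ∫ y in B, g i y * φt y := by
        intro i
        have h := hfg i φt
        rw [inner_toL2 _ (memLp_partial _ i), inner_toL2 _ (memLp_testFunction _)] at h
        rw [h, setIntegral_mul_testFunction]
        congr 1
        symm
        refine setIntegral_eq_integral_of_forall_compl_eq_zero fun y hy => ?_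
        have : y - t • z ∉ A := fun h => hy (by simpa using hAB _ h t htI)
        rw [hφt, translateTest_apply, image_eq_zero_of_notMem_tsupport
          fun hx' => this (φ.tsupport_subset hx'), mul_zero]
      have e4 : ∫ y, F y * -(fderiv ℝ φ (y - t • z) z) =
          ∫ y in (Ω : Set (Space d)), ∑ i, (-z i) * (f y * partialDeriv i φt y) := by
        rw [← integral_indicator Ω.isOpen.measurableSet]
        refine integral_congr_ae (.of_forall fun y => ?_)
        simp only [hfd, fderiv_eq_sum_partialDeriv, hF]
        by_cases hy : y ∈ (Ω : Set (Space d))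
        · simp only [indicator_of_mem hy, ← Finset.sum_neg_distrib, Finset.mul_sum]
          exact Finset.sum_congr rfl fun i _ => by ring
        · simp [indicator_of_notMem hy]
      have i1 : ∀ i, Integrable (fun y => -z i * (f y * partialDeriv i φt y))
          (volume.restrict (Ω : Set (Space d))) := fun i =>
        ((memLp_L2 f).integrable_mul (memLp_partial φt i)).const_mul _
      have i2 : ∀ i, Integrable (fun y => z i * (g i y * φt y)) (volume.restrict B) := fun i =>
        ((hgB i).integrable_mul
          ((memLp_testFunction φt).mono_measure (Measure.restrict_mono hBΩ le_rfl))).const_mul _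
      rw [e4, integral_finsetSum _ fun i _ => i1 i]
      simp_rw [integral_const_mul, hi]
      have e5 : ∀ y, (∑ i, z i * g i y) * φt y = ∑ i, z i * (g i y * φt y) := fun y => by
        rw [Finset.sum_mul]; exact Finset.sum_congr rfl fun i _ => by ring
      simp_rw [e5]
      rw [integral_finsetSum _ fun i _ => i2 i]
      simp_rw [integral_const_mul]
      exact Finset.sum_congr rfl fun i _ => by ring
    have hsum : MemLp (fun y => ∑ i, z i * g i y) 2 (volume.restrict B) :=
      memLp_finsetSum _ fun i _ => (hgB i).const_mul _
    rw [e3, Real.norm_eq_abs]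
    refine (abs_integral_mul_le_sqrt hsum
      ((memLp_testFunction φt).mono_measure (Measure.restrict_mono hBΩ le_rfl))).trans ?_
    refine mul_le_mul ?_ ?_ (Real.sqrt_nonneg _) (by positivity)
    · rw [Real.sqrt_le_left (by positivity), mul_pow, Real.sq_sqrt hS0, hS,
        ← integral_finsetSum _ fun i _ => (hgB i).integrable_sq, ← integral_const_mul]
      refine integral_mono hsum.integrable_sq
        ((integrable_finsetSum _ fun i _ => (hgB i).integrable_sq).const_mul _) fun y => ?_
      refine (Finset.sum_mul_sq_le_sq_mul_sq _ _ _).trans (le_of_eq ?_)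
      rw [EuclideanSpace.norm_sq_eq]
      simp
    · rw [Real.sqrt_le_left (norm_nonneg _), norm_sq_toL2 (memLp_testFunction φ)]
      refine (setIntegral_sq_mono (subset_univ B) ?_).trans (le_of_eq ?_)
      · rw [Measure.restrict_univ]
        exact φt.continuous.memLp_of_hasCompactSupport φt.hasCompactSupport
      · have := setIntegral_mul_testFunction φ φ
        simp_rw [← sq] at this
        rw [Measure.restrict_univ, this]
        exact integral_sub_right_eq_self (fun y => φ y ^ 2) (t • z)
  have h3 : ‖toL2 A fun x => f (x + z) - f x‖ ^ 2 ≤ (‖z‖ * √S) ^ 2 :=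
    pow_le_pow_left₀ (norm_nonneg _) hN 2
  rwa [norm_sq_toL2 hk, mul_pow, Real.sq_sqrt hS0] at h3

/-- The Poincaré inequality on a ball contained in `Ω`. -/
theorem exists_integral_ball_sub_sq_le (hb : Bornology.IsBounded (Ω : Set (Space d))) {f : L2 Ω}
    {g : Fin d → L2 Ω} (hfg : ∀ i, IsWeakPartial Ω i f (g i)) {c : Space d} {r : ℝ} (hr : 0 < r)
    (hB : Metric.ball c r ⊆ Ω) :
    ∃ m : ℝ, ∫ x in Metric.ball c r, (f x - m) ^ 2 ≤
      2 ^ d * (2 * r) ^ 2 * ∑ i, ∫ x in Metric.ball c r, g i x ^ 2 := by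
  classical
  set B := Metric.ball c r with hBdef
  set S : ℝ := ∑ i, ∫ x in B, g i x ^ 2 with hS
  have hS0 : 0 ≤ S := Finset.sum_nonneg fun i _ => integral_nonneg fun x => sq_nonneg _
  have hfm : Measurable f := (Lp.stronglyMeasurable f).measurable
  have hBm : MeasurableSet B := measurableSet_ball
  have hvB : volume B ≠ 0 := (Metric.measure_ball_pos volume c hr).ne'
  have hvB' : volume B ≠ ∞ := measure_ball_lt_top.ne
  -- `Φ x z` is the squared increment from `x` to `x + z` when both points lie in the ball. For
  -- fixed `z` its integral is controlled by the translation estimate, and only `‖z‖ < 2r`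
  -- contributes.
  set Φ : Space d → Space d → ℝ≥0∞ := fun x z =>
    indicator B (fun x => indicator B (fun y => ENNReal.ofReal ((f y - f x) ^ 2)) (x + z)) x with hΦ
  have hΦm : Measurable (Function.uncurry Φ) := by
    have h1 : Measurable fun p : Space d × Space d =>
        ENNReal.ofReal ((f (p.1 + p.2) - f p.1) ^ 2) := by fun_prop
    have h2 : MeasurableSet {p : Space d × Space d | p.1 ∈ B ∧ p.1 + p.2 ∈ B} :=
      (measurable_fst hBm).inter ((measurable_fst.add measurable_snd) hBm)
    convert h1.indicator h2 using 1
    ext ⟨x, z⟩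
    simp only [Function.uncurry, hΦ, indicator_apply, mem_ofPred_eq]
    by_cases h1 : x ∈ B <;> by_cases h2 : x + z ∈ B <;> simp only [h1, h2, if_true, if_false,
      and_true, and_false]
  have hz : ∀ z, ∫⁻ x, Φ x z ≤
      indicator (Metric.ball (0 : Space d) (2 * r)) (fun _ => ENNReal.ofReal ((2 * r) ^ 2 * S)) z := by
    intro z
    by_cases hz : z ∈ Metric.ball (0 : Space d) (2 * r)
    · rw [indicator_of_mem hz]
      set A : Opens (Space d) := ⟨B ∩ (fun x => x + z) ⁻¹' B,
        Metric.isOpen_ball.inter (Metric.isOpen_ball.preimage (by fun_prop))⟩ with hA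
      have hAB : ∀ x ∈ A, ∀ t ∈ Icc (0 : ℝ) 1, x + t • z ∈ B := by
        intro x hx t ht
        have := (convex_ball c r).add_smul_mem hx.1 (y := z) hx.2 ht
        exact this
      have h1 := integral_translate_sub_sq_le hb hfg hB hAB
      have hAz : ∀ x ∈ A, x + z ∈ Ω := fun x hx => hB hx.2
      have h2 : MemLp (fun x => f (x + z) - f x) 2 (volume.restrict (A : Set (Space d))) :=
        (memLp_translate f z hAz).sub (memLp_L2_of_subset f fun x hx => hB hx.1)
      have h3 : ∫⁻ x, Φ x z = ∫⁻ x in (A : Set (Space d)),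
          ENNReal.ofReal ((f (x + z) - f x) ^ 2) := by
        rw [← lintegral_indicator A.isOpen.measurableSet]
        refine lintegral_congr fun x => ?_
        simp only [hΦ, hA, indicator_apply, Opens.coe_mk, mem_inter_iff, mem_preimage]
        by_cases h1 : x ∈ B <;> by_cases h2 : x + z ∈ B <;> simp only [h1, h2, if_true, if_false,
          and_true, and_false]
      rw [h3, ← ofReal_integral_eq_lintegral_ofReal h2.integrable_sq
        (.of_forall fun _ => sq_nonneg _)]
      refine ENNReal.ofReal_le_ofReal (h1.trans ?_)
      refine mul_le_mul_of_nonneg_right ?_ hS0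
      exact pow_le_pow_left₀ (norm_nonneg _) (by simpa using (mem_ball_zero_iff.1 hz).le) 2
    · rw [indicator_of_notMem hz]
      refine le_of_eq ((lintegral_congr fun x => ?_).trans lintegral_zero)
      simp only [hΦ, indicator_apply]
      split_ifs with h1 h2
      · exfalso
        apply hz
        rw [mem_ball_zero_iff]
        have e : z = (x + z - c) - (x - c) := by abel
        rw [e]
        refine (norm_sub_le _ _).trans_lt ?_
        rw [hBdef, mem_ball_iff_norm] at h1 h2
        linarith
      · rfl
      · rfl
  have htot : ∫⁻ y in B, ∫⁻ x in B, ENNReal.ofReal ((f x - f y) ^ 2) ≤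
      ENNReal.ofReal ((2 * r) ^ 2 * S) * volume (Metric.ball (0 : Space d) (2 * r)) := by
    have e : ∫⁻ y in B, ∫⁻ x in B, ENNReal.ofReal ((f x - f y) ^ 2) = ∫⁻ x, ∫⁻ z, Φ x z := by
      rw [← lintegral_indicator hBm]
      refine lintegral_congr fun x => ?_
      by_cases hx : x ∈ B
      · simp only [hΦ, indicator_of_mem hx]
        rw [← lintegral_indicator hBm]
        exact (lintegral_add_left_eq_self _ x).symm
      · simp only [hΦ, indicator_of_notMem hx]
        simp
    rw [e, lintegral_lintegral_swap hΦm.aemeasurable]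
    refine (lintegral_mono hz).trans (le_of_eq ?_)
    rw [lintegral_indicator measurableSet_ball, setLIntegral_const]
  have hmeas : Measurable fun y => ∫⁻ x in B, ENNReal.ofReal ((f x - f y) ^ 2) := by
    refine Measurable.lintegral_prod_right' (f := fun p : Space d × Space d =>
      ENNReal.ofReal ((f p.2 - f p.1) ^ 2)) ?_
    fun_prop
  -- Instead of the mean of `f`, a value `f y` at a point where the inner integral does not exceed
  -- its average over `y` serves as the constant. The factor `2 ^ d` is the ratio of the volumes of
  -- the balls of radii `2r` and `r`.
  obtain ⟨y, hy, hle⟩ := exists_le_setLAverage hvB hvB' hmeas.aemeasurable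
  refine ⟨f y, ?_⟩
  have hfin : IsFiniteMeasure (volume.restrict B) := ⟨by
    rw [Measure.restrict_apply_univ]; exact hvB'.lt_top⟩
  have hmem : MemLp (fun x => f x - f y) 2 (volume.restrict B) :=
    (memLp_L2_of_subset f hB).sub (memLp_const _)
  have hfinal : ENNReal.ofReal (∫ x in B, (f x - f y) ^ 2) ≤
      ENNReal.ofReal (2 ^ d * (2 * r) ^ 2 * S) := by
    rw [ofReal_integral_eq_lintegral_ofReal hmem.integrable_sq (.of_forall fun _ => sq_nonneg _)]
    refine hle.trans ?_
    rw [setLAverage_eq]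
    refine ENNReal.div_le_of_le_mul (htot.trans (le_of_eq ?_))
    rw [hBdef, Measure.addHaar_ball_mul_of_pos volume (0 : Space d) two_pos r, Measure.addHaar_ball_center volume c r,
      ← mul_assoc]
    congr 1
    rw [← ENNReal.ofReal_mul (by positivity)]
    congr 1
    simp
    ring
  exact (ENNReal.ofReal_le_ofReal_iff (by positivity)).1 hfinal

end

section

variable {d : ℕ} {Ω : Opens (Space d)}

/-! ### Lipschitz functions that vanish outside `Ω` belong to `H¹₀(Ω)` -/

theorem isFiniteMeasure_restrict (hb : Bornology.IsBounded (Ω : Set (Space d))) :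
    IsFiniteMeasure (volume.restrict (Ω : Set (Space d))) :=
  ⟨by rw [Measure.restrict_apply_univ]; exact hb.measure_lt_top⟩

theorem abs_partialDeriv_le {f : Space d → ℝ} {L : ℝ≥0} (hf : LipschitzWith L f) (i : Fin d)
    (x : Space d) : |partialDeriv i f x| ≤ L := by
  have h1 := (fderiv ℝ f x).le_opNorm (EuclideanSpace.single i 1)
  rw [PiLp.norm_single, norm_one, mul_one] at h1
  exact h1.trans (norm_fderiv_le_of_lipschitz ℝ hf)

theorem measurable_partialDeriv (f : Space d → ℝ) (i : Fin d) : Measurable (partialDeriv i f) :=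
  measurable_fderiv_apply_const ℝ f _

theorem memLp_partialDeriv_of_lipschitz (hb : Bornology.IsBounded (Ω : Set (Space d)))
    {f : Space d → ℝ} {L : ℝ≥0} (hf : LipschitzWith L f) (i : Fin d) :
    MemLp (partialDeriv i f) 2 (volume.restrict (Ω : Set (Space d))) := by
  have := isFiniteMeasure_restrict hb
  exact MemLp.of_bound (measurable_partialDeriv f i).aestronglyMeasurable L
    (.of_forall fun x => abs_partialDeriv_le hf i x)

theorem memLp_of_continuous (hb : Bornology.IsBounded (Ω : Set (Space d)))
    {f : Space d → ℝ} (hf : Continuous f) :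
    MemLp f 2 (volume.restrict (Ω : Set (Space d))) :=
  memLp_of_continuousOn hb hf.continuousOn

theorem isWeakPartial_of_lipschitz (hb : Bornology.IsBounded (Ω : Set (Space d)))
    {f : Space d → ℝ} {L : ℝ≥0} (hf : LipschitzWith L f) (i : Fin d) :
    IsWeakPartial Ω i (toL2 Ω f) (toL2 Ω (partialDeriv i f)) := by
  intro φ
  rw [inner_toL2_toL2 (memLp_of_continuous hb hf.continuous) (memLp_partial φ i),
    inner_toL2_toL2 (memLp_partialDeriv_of_lipschitz hb hf i) (memLp_testFunction φ),
    setIntegral_mul_partialDeriv_testFunction, setIntegral_mul_testFunction]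
  obtain ⟨D, hD⟩ := (φ.contDiff.of_le (show (1 : WithTop ℕ∞) ≤ _ by
    exact_mod_cast le_top)).lipschitzWith_of_hasCompactSupport φ.hasCompactSupport (by simp)
  have h := LipschitzWith.integral_lineDeriv_mul_eq (μ := volume) hf hD φ.hasCompactSupport
    (EuclideanSpace.single i 1)
  have e1 : ∫ x, partialDeriv i f x * φ x =
      ∫ x, lineDeriv ℝ f x (EuclideanSpace.single i 1) * φ x := by
    refine integral_congr_ae ?_
    filter_upwards [hf.ae_differentiableAt (μ := volume)] with x hx
    rw [hx.lineDeriv_eq_fderiv, partialDeriv]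
  rw [e1, h, ← integral_neg]
  refine integral_congr_ae (.of_forall fun x => ?_)
  have hx : DifferentiableAt ℝ φ x := φ.contDiff.differentiable (by simp) x
  simp only [hx.lineDeriv_eq_fderiv, partialDeriv, map_neg]
  ring

/-- This function is zero on `[-δ, δ]` and moves values by at most `δ`. Composition with it makes
the support of a function that vanishes off `Ω` compact in `Ω`, without increasing the Lipschitz
constant. -/
theorem lipschitzWith_softThreshold {δ : ℝ} (hδ : 0 ≤ δ) :
    LipschitzWith 1 fun r : ℝ => max (r - δ) 0 + min (r + δ) 0 := by
  refine LipschitzWith.of_dist_le_mul fun a b => ?_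
  rw [Real.dist_eq, Real.dist_eq, NNReal.coe_one, one_mul]
  wlog hab : b ≤ a generalizing a b
  · rw [abs_sub_comm, abs_sub_comm a]
    exact this b a (le_of_not_ge hab)
  rw [abs_of_nonneg (sub_nonneg.2 hab), abs_le]
  constructor
  · rcases max_cases (a - δ) 0 with h1 | h1 <;> rcases max_cases (b - δ) 0 with h2 | h2 <;>
    rcases min_cases (a + δ) 0 with h3 | h3 <;> rcases min_cases (b + δ) 0 with h4 | h4 <;> linarith
  · rcases max_cases (a - δ) 0 with h1 | h1 <;> rcases max_cases (b - δ) 0 with h2 | h2 <;>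
    rcases min_cases (a + δ) 0 with h3 | h3 <;> rcases min_cases (b + δ) 0 with h4 | h4 <;> linarith

/-- A Lipschitz function that vanishes outside `Ω` is the uniform limit of test functions with the
same Lipschitz constant. -/
theorem exists_testFunction_lipschitz (hb : Bornology.IsBounded (Ω : Set (Space d)))
    {f : Space d → ℝ} {L : ℝ≥0} (hf : LipschitzWith L f) (h0 : ∀ x ∉ Ω, f x = 0) {ε : ℝ}
    (hε : 0 < ε) : ∃ ψ : 𝓓(Ω, ℝ), LipschitzWith L ψ ∧ ∀ x, |ψ x - f x| ≤ ε := by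
  set δ : ℝ := ε / 2 with hδ
  have hδ0 : 0 < δ := by positivity
  set s : ℝ → ℝ := fun r => max (r - δ) 0 + min (r + δ) 0 with hs
  have hs1 : LipschitzWith 1 s := lipschitzWith_softThreshold hδ0.le
  set f₁ : Space d → ℝ := fun x => s (f x) with hf₁
  have hf₁L : LipschitzWith L f₁ := by
    have := hs1.comp hf
    rwa [one_mul] at this
  have hf₁f : ∀ x, |f₁ x - f x| ≤ δ := by
    intro x
    rw [abs_le]
    simp only [hf₁, hs]
    constructor <;>
    rcases max_cases (f x - δ) 0 with h1 | h1 <;> rcases min_cases (f x + δ) 0 with h3 | h3 <;>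
    linarith
  set K : Set (Space d) := {x | δ ≤ |f x|} with hK
  have hKΩ : K ⊆ Ω := by
    intro x hx
    by_contra hxΩ
    rw [hK, mem_ofPred_eq, h0 x hxΩ, abs_zero] at hx
    linarith
  have hKc : IsCompact K := Metric.isCompact_of_isClosed_isBounded
    (isClosed_le continuous_const hf.continuous.abs) (hb.subset hKΩ)
  have hsupp : Function.support f₁ ⊆ K := by
    intro x hx
    by_contra hxK
    rw [hK, mem_ofPred_eq, not_le, abs_lt] at hxK
    apply hx
    simp only [hf₁, hs]
    rw [max_eq_right (by linarith), min_eq_right (by linarith), add_zero]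
  obtain ⟨ρ, hρ, hρΩ⟩ := hKc.exists_cthickening_subset_open Ω.isOpen hKΩ
  -- The mollification radius: at most `ρ`, so that supports stay in `Ω`, and with `L * ρ' ≤ δ`, so
  -- that mollification moves values by at most `δ`. Together with the threshold this gives `2δ =
  -- ε`.
  set ρ' : ℝ := min ρ (δ / (L + 1)) with hρ'
  have hρ'0 : 0 < ρ' := lt_min hρ (by positivity)
  have hρ'L : L * ρ' ≤ δ := by
    have h1 : ρ' ≤ δ / (L + 1) := min_le_right _ _
    have h2 : (L : ℝ) * ρ' ≤ L * (δ / (L + 1)) := mul_le_mul_of_nonneg_left h1 L.2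
    refine h2.trans ?_
    rw [mul_div_assoc', div_le_iff₀ (by positivity)]
    nlinarith [L.2]
  set φ : ContDiffBump (0 : Space d) := ⟨ρ' / 2, ρ', by positivity, by linarith⟩ with hφ
  set ψ : Space d → ℝ := convolution (φ.normed volume) f₁ (ContinuousLinearMap.lsmul ℝ ℝ) volume
    with hψ
  have hloc : LocallyIntegrable f₁ volume := hf₁L.continuous.locallyIntegrable
  have hψs : Function.support ψ ⊆ Metric.cthickening ρ K := by
    intro x hx
    obtain ⟨y, hy, z, hz, rfl⟩ := support_convolution_subset_swap _ hx
    rw [φ.support_normed_eq, mem_ball_zero_iff] at hz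
    refine Metric.mem_cthickening_of_dist_le _ y ρ K (hsupp hy) ?_
    simp only [dist_eq_norm, add_sub_cancel_left]
    exact hz.le.trans (min_le_left _ _)
  have hψts : tsupport ψ ⊆ Metric.cthickening ρ K :=
    closure_minimal hψs Metric.isClosed_cthickening
  refine ⟨⟨ψ, ?_, ?_, hψts.trans hρΩ⟩, ?_, ?_⟩
  · exact φ.hasCompactSupport_normed.contDiff_convolution_left _ φ.contDiff_normed hloc
  · exact (hKc.cthickening).of_isClosed_subset (isClosed_tsupport _) hψts
  · refine LipschitzWith.of_dist_le_mul fun x y => ?_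
    change dist (ψ x) (ψ y) ≤ _
    have hint : ∀ x, Integrable fun t => φ.normed volume t * f₁ (x - t) := by
      intro x
      exact (φ.continuous_normed.mul (hf₁L.continuous.comp
        (continuous_const.sub continuous_id))).integrable_of_hasCompactSupport
        φ.hasCompactSupport_normed.mul_right
    have hint' : Integrable fun t => φ.normed volume t := φ.continuous_normed.integrable_of_hasCompactSupport
        φ.hasCompactSupport_normed
    have e : ψ x - ψ y = ∫ t, φ.normed volume t * (f₁ (x - t) - f₁ (y - t)) := by
      simp only [hψ, convolution, ContinuousLinearMap.lsmul_apply, smul_eq_mul, mul_sub]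
      rw [integral_sub (hint x) (hint y)]
    rw [Real.dist_eq, e]
    calc |∫ t, φ.normed volume t * (f₁ (x - t) - f₁ (y - t))|
        ≤ ∫ t, φ.normed volume t * (L * dist x y) := by
          rw [← Real.norm_eq_abs]
          refine norm_integral_le_of_norm_le (hint'.mul_const _) (.of_forall fun t => ?_)
          rw [norm_mul, Real.norm_of_nonneg (φ.nonneg_normed t)]
          refine mul_le_mul_of_nonneg_left ?_ (φ.nonneg_normed t)
          have := hf₁L.dist_le_mul (x - t) (y - t)
          rwa [dist_sub_right] at this
      _ = L * dist x y := by rw [integral_mul_const, φ.integral_normed, one_mul]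
  · intro x
    change |ψ x - f x| ≤ ε
    have h1 : dist (ψ x) (f₁ x) ≤ δ := by
      refine φ.dist_normed_convolution_le hf₁L.continuous.aestronglyMeasurable fun y hy => ?_
      refine (hf₁L.dist_le_mul y x).trans ((mul_le_mul_of_nonneg_left ?_ L.2).trans hρ'L)
      exact (Metric.mem_ball.1 hy).le
    rw [Real.dist_eq] at h1
    have h2 := abs_add_le (ψ x - f₁ x) (f₁ x - f x)
    rw [sub_add_sub_cancel] at h2
    linarith [hf₁f x]

/-- A closed subspace is its own double orthogonal complement, hence weakly closed. -/
theorem mem_H10_of_tendsto_inner {V : Jet1 Ω} {W : ℕ → Jet1 Ω} (hW : ∀ n, W n ∈ H10 Ω)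
    (h : ∀ Z : Jet1 Ω, Filter.Tendsto (fun n => inner ℝ (W n) Z) Filter.atTop
      (nhds (inner ℝ V Z))) : V ∈ H10 Ω := by
  have hcl : (H10 Ω).topologicalClosure = H10 Ω :=
    (Submodule.isClosed_topologicalClosure _).submodule_topologicalClosure_eq
  rw [← hcl, ← Submodule.orthogonal_orthogonal_eq_closure, Submodule.mem_orthogonal']
  intro Z hZ
  refine tendsto_nhds_unique (h Z) ?_
  have : ∀ n, inner ℝ (W n) Z = 0 := fun n => (Submodule.mem_orthogonal _ _).1 hZ _ (hW n)
  simp only [this]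
  exact tendsto_const_nhds

/-- Boundedness carries convergence from a dense set to all `Z`. For approximations with uniformly
bounded gradients, pairings with test functions converge after integration by parts, so weak
convergence of the gradients comes for free. -/
theorem tendsto_inner_of_dense {g : ℕ → L2 Ω} {G : L2 Ω} {M : ℝ} (hM : ∀ n, ‖g n‖ ≤ M)
    (h : ∀ φ : 𝓓(Ω, ℝ), Filter.Tendsto (fun n => inner ℝ (g n) (toL2 Ω φ)) Filter.atTop
      (nhds (inner ℝ G (toL2 Ω φ)))) (Z : L2 Ω) :
    Filter.Tendsto (fun n => inner ℝ (g n) Z) Filter.atTop (nhds (inner ℝ G Z)) := by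
  rw [Metric.tendsto_atTop]
  intro ε hε
  have hM0 : 0 ≤ M := (norm_nonneg _).trans (hM 0)
  set N : ℝ := M + ‖G‖ + 1 with hN
  have hN0 : 0 < N := by positivity
  obtain ⟨φ, hφ⟩ := exists_testFunction_near Z (show 0 < ε / (2 * N) by positivity)
  obtain ⟨n₀, hn₀⟩ := (Metric.tendsto_atTop.1 (h φ)) (ε / 2) (by positivity)
  refine ⟨n₀, fun n hn => ?_⟩
  have h1 := hn₀ n hn
  rw [Real.dist_eq] at h1 ⊢
  have e : (inner ℝ (g n) Z - inner ℝ G Z : ℝ) =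
      (inner ℝ (g n) (toL2 Ω φ) - inner ℝ G (toL2 Ω φ)) + inner ℝ (g n - G) (Z - toL2 Ω φ) := by
    simp only [inner_sub_left, inner_sub_right]
    ring
  have h2 : |(inner ℝ (g n - G) (Z - toL2 Ω φ) : ℝ)| ≤ N * ‖Z - toL2 Ω φ‖ := by
    refine (abs_real_inner_le_norm _ _).trans (mul_le_mul_of_nonneg_right ?_ (norm_nonneg _))
    have := norm_sub_le (g n) G
    linarith [hM n]
  have h3 : N * ‖Z - toL2 Ω φ‖ < ε / 2 := by
    calc N * ‖Z - toL2 Ω φ‖ < N * (ε / (2 * N)) := by gcongr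
      _ = ε / 2 := by field_simp
  rw [e]
  exact (abs_add_le _ _).trans_lt (by linarith)

theorem norm_toL2_le_of_bound (hb : Bornology.IsBounded (Ω : Set (Space d))) {f : Space d → ℝ}
    {c : ℝ} (hc : 0 ≤ c) (hf : ∀ x ∈ Ω, |f x| ≤ c) :
    ‖toL2 Ω f‖ ≤ c * √(volume.real (Ω : Set (Space d))) := by
  by_cases h : MemLp f 2 (volume.restrict (Ω : Set (Space d)))
  · have h1 := norm_sq_toL2 h
    have h2 := setIntegral_sq_le (μ := volume) (f := f) hb.measure_lt_top.ne hf
    refine abs_le_of_sq_le_sq' ?_ (by positivity) |>.2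
    rw [h1, mul_pow, Real.sq_sqrt measureReal_nonneg]
    exact h2
  · rw [toL2, dif_neg h, norm_zero]
    positivity

/-- A Lipschitz function that vanishes outside `Ω` belongs to `H¹₀(Ω)`, with the almost everywhere
defined gradient. -/
theorem exists_H10_of_lipschitz (hb : Bornology.IsBounded (Ω : Set (Space d)))
    {f : Space d → ℝ} {L : ℝ≥0} (hf : LipschitzWith L f) (h0 : ∀ x ∉ Ω, f x = 0) :
    ∃ V : H10 Ω, (V : Jet1 Ω) none = toL2 Ω f ∧
      ∀ i, (V : Jet1 Ω) (some i) = toL2 Ω (partialDeriv i f) := by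
  choose ψ hψL hψf using fun n : ℕ =>
    exists_testFunction_lipschitz hb hf h0 (show (0 : ℝ) < 1 / (n + 1) by positivity)
  have hmf := memLp_of_continuous hb hf.continuous
  set V : Jet1 Ω := WithLp.toLp 2 fun o => match o with
    | none => toL2 Ω f
    | some i => toL2 Ω (partialDeriv i f) with hV
  have hconv : Filter.Tendsto (fun n => toL2 Ω (ψ n)) Filter.atTop (nhds (toL2 Ω f)) := by
    rw [tendsto_iff_norm_sub_tendsto_zero]
    refine squeeze_zero (fun _ => norm_nonneg _)
      (g := fun n : ℕ => (1 / ((n : ℝ) + 1)) * √(volume.real (Ω : Set (Space d)))) (fun n => ?_) ?_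
    · rw [← toL2_sub (memLp_testFunction _) hmf]
      exact norm_toL2_le_of_bound hb (by positivity) fun x _ => hψf n x
    · simpa using tendsto_one_div_add_atTop_nhds_zero_nat.mul_const
        √(volume.real (Ω : Set (Space d)))
  have hmem : V ∈ H10 Ω := by
    refine mem_H10_of_tendsto_inner (W := fun n => testJet Ω (ψ n))
      (fun n => Submodule.le_topologicalClosure _ (Submodule.subset_span ⟨_, rfl⟩)) fun Z => ?_
    simp only [PiLp.inner_apply]
    refine tendsto_finsetSum _ fun o _ => ?_
    cases o with
    | none => exact hconv.inner tendsto_const_nhds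
    | some i =>
      refine tendsto_inner_of_dense (g := fun n => toL2 Ω (partialDeriv i (ψ n)))
        (G := toL2 Ω (partialDeriv i f)) (M := L * √(volume.real (Ω : Set (Space d)))) (fun n => ?_)
        (fun φ => ?_) (Z (some i))
      · exact norm_toL2_le_of_bound hb L.2 fun x _ => abs_partialDeriv_le (hψL n) i x
      · have h1 : ∀ n, inner ℝ (toL2 Ω (partialDeriv i (ψ n))) (toL2 Ω φ) =
            -inner ℝ (toL2 Ω (ψ n)) (toL2 Ω (partialDeriv i φ)) := fun n => by
          rw [isWeakPartial_of_lipschitz hb (hψL n) i φ, neg_neg]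
        have h2 : inner ℝ (toL2 Ω (partialDeriv i f)) (toL2 Ω φ) =
            -inner ℝ (toL2 Ω f) (toL2 Ω (partialDeriv i φ)) := by
          rw [isWeakPartial_of_lipschitz hb hf i φ, neg_neg]
        simp only [h1]
        rw [h2]
        exact (hconv.inner tendsto_const_nhds).neg
  exact ⟨⟨V, hmem⟩, rfl, fun i => rfl⟩

end

section

/-! ### Convex combinations and barycentric coordinates -/

section Simplex

variable {ι F : Type*} [AddCommGroup F] [Module ℝ F]

/-- `x = ∑ i ∈ A, c i • P i` is a convex combination. -/
structure IsConvexComb (P : ι → F) (A : Finset ι) (c : ι → ℝ) (x : F) : Prop where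
  nonneg : ∀ i, 0 ≤ c i
  eq_zero : ∀ i ∉ A, c i = 0
  sum_eq : ∑ i ∈ A, c i = 1
  sum_smul : ∑ i ∈ A, c i • P i = x

theorem IsConvexComb.mem_convexHull {P : ι → F} {A : Finset ι} {c : ι → ℝ} {x : F}
    (h : IsConvexComb P A c x) {s : Set F} (hs : ∀ i ∈ A, c i ≠ 0 → P i ∈ s) :
    x ∈ convexHull ℝ s := by
  classical
  rw [← h.sum_smul, ← Finset.sum_filter_of_ne (p := fun i => c i ≠ 0)]
  · refine (convex_convexHull ℝ s).sum_mem (fun i _ => h.nonneg i) ?_ fun i hi => ?_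
    · rw [Finset.sum_filter_ne_zero, h.sum_eq]
    · rw [Finset.mem_filter] at hi
      exact subset_convexHull ℝ s (hs i hi.1 hi.2)
  · intro i _ hi hc
    exact hi (by rw [hc, zero_smul])

theorem isConvexComb_single [DecidableEq ι] (P : ι → F) {A : Finset ι} {i : ι} (hi : i ∈ A) :
    IsConvexComb P A (fun j => if j = i then 1 else 0) (P i) where
  nonneg j := by split_ifs <;> norm_num
  eq_zero j hj := if_neg fun h => hj (by rwa [h])
  sum_eq := by simp [hi]
  sum_smul := by simp [hi]

theorem mem_convexHull_image_iff {P : ι → F} {A : Finset ι} {x : F} :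
    x ∈ convexHull ℝ (P '' (A : Set ι)) ↔ ∃ c, IsConvexComb P A c x := by
  classical
  constructor
  · intro hx
    refine convexHull_min (t := {x | ∃ c, IsConvexComb P A c x}) ?_ ?_ hx
    · rintro _ ⟨i, hi, rfl⟩
      exact ⟨_, isConvexComb_single P hi⟩
    · rintro y ⟨c, hc⟩ z ⟨c', hc'⟩ a b ha hb hab
      refine ⟨fun i => a * c i + b * c' i, fun i => ?_, fun i hi => ?_, ?_, ?_⟩
      · have := hc.nonneg i
        have := hc'.nonneg i
        positivity
      · rw [hc.eq_zero i hi, hc'.eq_zero i hi, mul_zero, mul_zero, add_zero]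
      · rw [Finset.sum_add_distrib, ← Finset.mul_sum, ← Finset.mul_sum, hc.sum_eq, hc'.sum_eq,
          mul_one, mul_one, hab]
      · simp only [add_smul, mul_smul, Finset.sum_add_distrib, ← Finset.smul_sum, hc.sum_smul,
          hc'.sum_smul]
  · rintro ⟨c, hc⟩
    exact hc.mem_convexHull fun i hi _ => ⟨i, hi, rfl⟩

theorem eq_zero_of_affineIndependent {P : ι → F} {A : Finset ι}
    (h : AffineIndependent ℝ fun i : A => P i) {a : ι → ℝ} (h0 : ∑ i ∈ A, a i = 0)
    (h1 : ∑ i ∈ A, a i • P i = 0) : ∀ i ∈ A, a i = 0 := by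
  rw [affineIndependent_iff] at h
  intro i hi
  refine h Finset.univ (fun i => a i) ?_ ?_ ⟨i, hi⟩ (Finset.mem_univ _)
  · rw [← h0, ← Finset.sum_coe_sort A]
  · rw [← h1, ← Finset.sum_coe_sort A]

theorem eq_of_affineIndependent {P : ι → F} {A : Finset ι}
    (h : AffineIndependent ℝ fun i : A => P i) {a b : ι → ℝ} (h0 : ∑ i ∈ A, a i = ∑ i ∈ A, b i)
    (h1 : ∑ i ∈ A, a i • P i = ∑ i ∈ A, b i • P i) : ∀ i ∈ A, a i = b i := by
  intro i hi
  refine sub_eq_zero.1 (eq_zero_of_affineIndependent h (a := fun i => a i - b i) ?_ ?_ i hi)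
  · rw [Finset.sum_sub_distrib, h0, sub_self]
  · simp only [sub_smul, Finset.sum_sub_distrib, h1, sub_self]

theorem affineIndependent_image_iff {P : ι → F} {A : Finset ι} (hP : InjOn P A) :
    AffineIndependent ℝ ((↑) : P '' (A : Set ι) → F) ↔ AffineIndependent ℝ fun i : A => P i := by
  rw [← affineIndependent_equiv (Equiv.Set.imageOfInjOn P (A : Set ι) hP)]
  rfl

theorem exists_barycentric_coord [FiniteDimensional ℝ F] {P : ι → F} {A : Finset ι}
    (h : AffineIndependent ℝ fun i : A => P i) (hA : A.card = Module.finrank ℝ F + 1) :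
    ∃ φ : ι → F →ᵃ[ℝ] ℝ, (∀ i ∉ A, φ i = 0) ∧ (∀ x, ∑ i ∈ A, φ i x = 1) ∧
      ∀ x, ∑ i ∈ A, φ i x • P i = x := by
  classical
  have htop : affineSpan ℝ (Set.range fun i : A => P i) = ⊤ := by
    rw [h.affineSpan_eq_top_iff_card_eq_finrank_add_one, Fintype.card_coe, hA]
  set b : AffineBasis A ℝ F := ⟨fun i : A => P i, h, htop⟩ with hb
  refine ⟨fun i => if hi : i ∈ A then b.coord ⟨i, hi⟩ else 0, fun i hi => dif_neg hi,
    fun x => ?_, fun x => ?_⟩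
  · rw [← b.sum_coord_apply_eq_one x, ← Finset.sum_coe_sort A]
    exact Finset.sum_congr rfl fun i _ => by simp
  · conv_rhs => rw [← b.linear_combination_coord_eq_self x]
    rw [← Finset.sum_coe_sort A]
    exact Finset.sum_congr rfl fun i _ => by simp; rfl

/-- If functions `β i` compute the weights of all convex combinations of the vertices of the
simplices in `𝒜`, then the simplices are non-degenerate and fit together. -/
theorem affineIndependent_of_weights {P : ι → F} {A : Finset ι} {β : ι → F → ℝ}
    (hβ : ∀ c x, IsConvexComb P A c x → ∀ i, β i x = c i) :
    AffineIndependent ℝ fun i : A => P i := by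
  classical
  rw [affineIndependent_iff]
  intro s w hw0 hw1 e he
  set a : ι → ℝ := fun i => if hi : i ∈ A then (if (⟨i, hi⟩ : A) ∈ s then w ⟨i, hi⟩ else 0) else 0
    with ha
  have ha' : ∀ i : A, a i = if i ∈ s then w i else 0 := fun i => by simp [ha]
  have h0 : ∑ i ∈ A, a i = 0 := by
    rw [← Finset.sum_coe_sort A]
    simp only [ha', Finset.sum_ite_mem, Finset.univ_inter, hw0]
  have h1 : ∑ i ∈ A, a i • P i = 0 := by
    rw [← Finset.sum_coe_sort A]
    simp only [ha', ite_smul, zero_smul, Finset.sum_ite_mem, Finset.univ_inter, hw1]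
  have hne : (A.card : ℝ) ≠ 0 := by
    have := Finset.card_pos.2 ⟨(e : ι), e.2⟩
    positivity
  have hApos : (0 : ℝ) < A.card := lt_of_le_of_ne (Nat.cast_nonneg _) hne.symm
  set m : ℝ := ∑ i ∈ A, |a i| + 1 with hm
  have hm0 : 0 < m := by
    have : 0 ≤ ∑ i ∈ A, |a i| := Finset.sum_nonneg fun i _ => abs_nonneg _
    linarith
  have hmi : ∀ i ∈ A, |a i| ≤ m := fun i hi => by
    have := Finset.single_le_sum (f := fun i => |a i|) (fun i _ => abs_nonneg _) hi
    linarith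
  -- Small enough that the weights `1 / card` of the barycentre stay nonnegative after adding `δ *
  -- a`. The barycentre then has two convex representations, and `β` evaluates to the weights of
  -- both, which forces `a = 0`.
  set δ : ℝ := (A.card * m)⁻¹ with hδ
  have hδ0 : 0 < δ := by positivity
  set x₀ : F := ∑ i ∈ A, (A.card : ℝ)⁻¹ • P i with hx₀
  have hc : IsConvexComb P A (fun i => if i ∈ A then (A.card : ℝ)⁻¹ else 0) x₀ := by
    refine ⟨fun i => by split_ifs <;> positivity, fun i hi => if_neg hi, ?_, ?_⟩
    · rw [Finset.sum_ite_mem, Finset.inter_self, Finset.sum_const, nsmul_eq_mul, mul_inv_cancel₀ hne]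
    · simp only [ite_smul, zero_smul, Finset.sum_ite_mem, Finset.inter_self, hx₀]
  have hc' : IsConvexComb P A (fun i => if i ∈ A then (A.card : ℝ)⁻¹ + δ * a i else 0) x₀ := by
    refine ⟨fun i => ?_, fun i hi => if_neg hi, ?_, ?_⟩
    · split_ifs with hi
      · have h2 : δ * |a i| ≤ δ * m := mul_le_mul_of_nonneg_left (hmi i hi) hδ0.le
        have h3 : δ * m = (A.card : ℝ)⁻¹ := by rw [hδ]; field_simp
        have h4 : -(δ * |a i|) ≤ δ * a i := by
          rw [← mul_neg]
          exact mul_le_mul_of_nonneg_left (neg_abs_le _) hδ0.le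
        linarith
      · exact le_rfl
    · rw [Finset.sum_ite_mem, Finset.inter_self, Finset.sum_add_distrib, ← Finset.mul_sum, h0,
        Finset.sum_const, nsmul_eq_mul, mul_inv_cancel₀ hne, mul_zero, add_zero]
    · simp only [ite_smul, zero_smul, Finset.sum_ite_mem, Finset.inter_self, hx₀, add_smul,
        Finset.sum_add_distrib, mul_smul, ← Finset.smul_sum, h1, smul_zero, add_zero]
  have h5 := (hβ _ _ hc e).symm.trans (hβ _ _ hc' e)
  simp only [e.2, if_true] at h5
  have h6 : δ * a e = 0 := by linarith
  have h7 : a e = 0 := (mul_eq_zero.1 h6).resolve_left hδ0.ne'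
  rw [ha' e, if_pos he] at h7
  exact h7

/-- A point of both hulls has the same weights in both representations, since `β` computes each. A
weight that is not zero thus belongs to a common vertex. -/
theorem convexHull_inter_of_weights {P : ι → F} {A B : Finset ι} {β : ι → F → ℝ}
    (hA : ∀ c x, IsConvexComb P A c x → ∀ i, β i x = c i)
    (hB : ∀ c x, IsConvexComb P B c x → ∀ i, β i x = c i) :
    convexHull ℝ (P '' (A : Set ι)) ∩ convexHull ℝ (P '' (B : Set ι)) =
      convexHull ℝ (P '' (A : Set ι) ∩ P '' (B : Set ι)) := by
  refine Subset.antisymm ?_ (subset_inter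
    (convexHull_mono inter_subset_left) (convexHull_mono inter_subset_right))
  rintro x ⟨hx1, hx2⟩
  obtain ⟨c, hc⟩ := mem_convexHull_image_iff.1 hx1
  obtain ⟨c', hc'⟩ := mem_convexHull_image_iff.1 hx2
  refine hc.mem_convexHull fun i hi hci => ⟨⟨i, hi, rfl⟩, i, ?_, rfl⟩
  by_contra hiB
  apply hci
  rw [← hA c x hc i, hB c' x hc' i, hc'.eq_zero i hiB]

end Simplex

end

section

/-! ### Hat functions of a spatial mesh -/

namespace SpatialMesh

variable {d : ℕ} {Ω : Opens (Space d)} (M : SpatialMesh Ω)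

/-- The closed simplex with the vertex numbers in `ω`. -/
def simplex (ω : Finset (Fin M.N)) : Set (Space d) := convexHull ℝ (M.p '' (ω : Set (Fin M.N)))

theorem card_elem {ω : Finset (Fin M.N)} (hω : ω ∈ M.elems) : ω.card = d + 1 := by
  have h := M.admissible.card_vertices _ ⟨ω, hω, rfl⟩
  rwa [Set.ncard_image_of_injective _ M.p_injective, Set.ncard_coe_finset,
    finrank_euclideanSpace_fin] at h

theorem affineIndependent_elem {ω : Finset (Fin M.N)} (hω : ω ∈ M.elems) :
    AffineIndependent ℝ fun i : ω => M.p i :=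
  (affineIndependent_image_iff M.p_injective.injOn).1
    (M.admissible.affineIndependent _ ⟨ω, hω, rfl⟩)

theorem iUnion_simplex : ⋃ ω ∈ M.elems, M.simplex ω = closure (Ω : Set (Space d)) := by
  rw [← M.admissible.cover]
  ext x
  simp only [mem_iUnion, simplex, exists_prop]
  constructor
  · rintro ⟨ω, hω, hx⟩
    exact ⟨_, ⟨ω, hω, rfl⟩, hx⟩
  · rintro ⟨_, ⟨ω, hω, rfl⟩, hx⟩
    exact ⟨ω, hω, hx⟩

theorem simplex_subset {ω : Finset (Fin M.N)} (hω : ω ∈ M.elems) :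
    M.simplex ω ⊆ closure (Ω : Set (Space d)) := by
  rw [← M.iUnion_simplex]
  exact subset_biUnion_of_mem (u := fun ω => M.simplex ω) hω

theorem exists_mem_simplex {x : Space d} (hx : x ∈ closure (Ω : Set (Space d))) :
    ∃ ω ∈ M.elems, x ∈ M.simplex ω := by
  rw [← M.iUnion_simplex] at hx
  simpa using hx

theorem isCompact_simplex (ω : Finset (Fin M.N)) : IsCompact (M.simplex ω) :=
  (ω.finite_toSet.image M.p).isCompact_convexHull ℝ

theorem isClosed_simplex (ω : Finset (Fin M.N)) : IsClosed (M.simplex ω) :=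
  (M.isCompact_simplex ω).isClosed

theorem convex_simplex (ω : Finset (Fin M.N)) : Convex ℝ (M.simplex ω) := convex_convexHull ℝ _

/-- By admissibility a common point of two elements lies in the hull of the common vertices. Its
weights there agree with those in either element by affine independence. This makes `hat` well
defined. -/
theorem isConvexComb_unique {ω ω' : Finset (Fin M.N)} (hω : ω ∈ M.elems) (hω' : ω' ∈ M.elems)
    {c c' : Fin M.N → ℝ} {x : Space d} (hc : IsConvexComb M.p ω c x)
    (hc' : IsConvexComb M.p ω' c' x) : c = c' := by
  classical
  have key : ∀ {ω ω' : Finset (Fin M.N)}, ω ∈ M.elems → ω' ⊆ ω → ∀ {c c' : Fin M.N → ℝ},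
      IsConvexComb M.p ω c x → IsConvexComb M.p ω' c' x → c = c' := by
    intro ω ω' hω hsub c c' hc hc'
    have e1 : ∑ i ∈ ω, c' i = 1 := by
      rw [← hc'.sum_eq]
      exact (Finset.sum_subset hsub fun i _ hi => hc'.eq_zero i hi).symm
    have e2 : ∑ i ∈ ω, c' i • M.p i = x := by
      rw [← hc'.sum_smul]
      exact (Finset.sum_subset hsub fun i _ hi => by rw [hc'.eq_zero i hi, zero_smul]).symm
    ext i
    by_cases hi : i ∈ ω
    · exact eq_of_affineIndependent (M.affineIndependent_elem hω) (hc.sum_eq.trans e1.symm)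
        (hc.sum_smul.trans e2.symm) i hi
    · rw [hc.eq_zero i hi, hc'.eq_zero i fun h => hi (hsub h)]
  have hx : x ∈ convexHull ℝ (M.p '' ((ω ∩ ω' : Finset (Fin M.N)) : Set (Fin M.N))) := by
    rw [Finset.coe_inter, image_inter M.p_injective, ← M.admissible.inter _ ⟨ω, hω, rfl⟩ _
      ⟨ω', hω', rfl⟩]
    exact ⟨mem_convexHull_image_iff.2 ⟨c, hc⟩, mem_convexHull_image_iff.2 ⟨c', hc'⟩⟩
  obtain ⟨c'', hc''⟩ := mem_convexHull_image_iff.1 hx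
  rw [key hω Finset.inter_subset_left hc hc'', key hω' Finset.inter_subset_right hc' hc'']

open Classical in
/-- The hat function of the `i`-th vertex, extended by `0`. -/
def hat (i : Fin M.N) (x : Space d) : ℝ :=
  if h : ∃ c, ∃ ω ∈ M.elems, IsConvexComb M.p ω c x then h.choose i else 0

theorem hat_eq {ω : Finset (Fin M.N)} (hω : ω ∈ M.elems) {c : Fin M.N → ℝ} {x : Space d}
    (hc : IsConvexComb M.p ω c x) (i : Fin M.N) : M.hat i x = c i := by
  have h : ∃ c, ∃ ω ∈ M.elems, IsConvexComb M.p ω c x := ⟨c, ω, hω, hc⟩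
  rw [hat, dif_pos h]
  obtain ⟨ω', hω', hc'⟩ := h.choose_spec
  rw [M.isConvexComb_unique hω' hω hc' hc]

theorem isConvexComb_hat {ω : Finset (Fin M.N)} (hω : ω ∈ M.elems) {x : Space d}
    (hx : x ∈ M.simplex ω) : IsConvexComb M.p ω (fun i => M.hat i x) x := by
  obtain ⟨c, hc⟩ := mem_convexHull_image_iff.1 hx
  have : (fun i => M.hat i x) = c := funext fun i => M.hat_eq hω hc i
  rwa [this]

theorem hat_eq_zero_of_notMem (i : Fin M.N) {x : Space d}
    (hx : x ∉ closure (Ω : Set (Space d))) : M.hat i x = 0 := by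
  rw [hat, dif_neg]
  rintro ⟨c, ω, hω, hc⟩
  exact hx (M.simplex_subset hω (mem_convexHull_image_iff.2 ⟨c, hc⟩))

theorem hat_nonneg (i : Fin M.N) (x : Space d) : 0 ≤ M.hat i x := by
  by_cases hx : x ∈ closure (Ω : Set (Space d))
  · obtain ⟨ω, hω, hxω⟩ := M.exists_mem_simplex hx
    exact (M.isConvexComb_hat hω hxω).nonneg i
  · rw [M.hat_eq_zero_of_notMem i hx]

theorem sum_hat {x : Space d} (hx : x ∈ closure (Ω : Set (Space d))) : ∑ i, M.hat i x = 1 := by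
  obtain ⟨ω, hω, hxω⟩ := M.exists_mem_simplex hx
  have h := M.isConvexComb_hat hω hxω
  rw [← h.sum_eq]
  exact (Finset.sum_subset (Finset.subset_univ _) fun i _ hi => h.eq_zero i hi).symm

theorem sum_hat_le_one (x : Space d) : ∑ i, M.hat i x ≤ 1 := by
  by_cases hx : x ∈ closure (Ω : Set (Space d))
  · exact (M.sum_hat hx).le
  · simp [M.hat_eq_zero_of_notMem _ hx]

theorem hat_vertex (i j : Fin M.N) : M.hat i (M.p j) = if i = j then 1 else 0 := by
  obtain ⟨ω, hω, hj⟩ := M.vertex_mem j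
  exact M.hat_eq hω (isConvexComb_single M.p hj) i

theorem vertex_mem_closure (i : Fin M.N) : M.p i ∈ closure (Ω : Set (Space d)) := by
  obtain ⟨ω, hω, hi⟩ := M.vertex_mem i
  exact M.simplex_subset hω (subset_convexHull ℝ _ ⟨i, hi, rfl⟩)

theorem mem_elem_of_hat_ne_zero {ω : Finset (Fin M.N)} (hω : ω ∈ M.elems) {x : Space d}
    (hx : x ∈ M.simplex ω) {i : Fin M.N} (hi : M.hat i x ≠ 0) : i ∈ ω := by
  by_contra h
  exact hi ((M.isConvexComb_hat hω hx).eq_zero i h)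

theorem mem_simplex_of_hat {ω : Finset (Fin M.N)} {x : Space d}
    (hx : x ∈ closure (Ω : Set (Space d))) (h : ∀ i, M.hat i x ≠ 0 → i ∈ ω) :
    x ∈ M.simplex ω := by
  obtain ⟨ω', hω', hx'⟩ := M.exists_mem_simplex hx
  exact (M.isConvexComb_hat hω' hx').mem_convexHull fun i _ hi => ⟨i, h i hi, rfl⟩

theorem exists_coord (ω : Finset (Fin M.N)) : ∃ φ : Fin M.N → Space d →ᵃ[ℝ] ℝ, ω ∈ M.elems →
    (∀ i ∉ ω, φ i = 0) ∧ (∀ x, ∑ i ∈ ω, φ i x = 1) ∧ ∀ x, ∑ i ∈ ω, φ i x • M.p i = x := by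
  by_cases hω : ω ∈ M.elems
  · obtain ⟨φ, hφ⟩ := exists_barycentric_coord (M.affineIndependent_elem hω)
      (by rw [M.card_elem hω, finrank_euclideanSpace_fin])
    exact ⟨φ, fun _ => hφ⟩
  · exact ⟨0, fun h => absurd h hω⟩

/-- The barycentric coordinates with respect to an element. -/
def coord (ω : Finset (Fin M.N)) (i : Fin M.N) : Space d →ᵃ[ℝ] ℝ := (M.exists_coord ω).choose i

variable {M}
variable {ω : Finset (Fin M.N)}

theorem coord_eq_zero (hω : ω ∈ M.elems) {i : Fin M.N} (hi : i ∉ ω) : M.coord ω i = 0 :=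
  ((M.exists_coord ω).choose_spec hω).1 i hi

theorem sum_coord (hω : ω ∈ M.elems) (x : Space d) : ∑ i ∈ ω, M.coord ω i x = 1 :=
  ((M.exists_coord ω).choose_spec hω).2.1 x

theorem sum_coord_smul (hω : ω ∈ M.elems) (x : Space d) : ∑ i ∈ ω, M.coord ω i x • M.p i = x :=
  ((M.exists_coord ω).choose_spec hω).2.2 x

theorem isConvexComb_coord (hω : ω ∈ M.elems) {x : Space d} (hx : ∀ i ∈ ω, 0 ≤ M.coord ω i x) :
    IsConvexComb M.p ω (fun i => M.coord ω i x) x where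
  nonneg i := by
    by_cases hi : i ∈ ω
    · exact hx i hi
    · rw [coord_eq_zero hω hi]; rfl
  eq_zero i hi := by rw [coord_eq_zero hω hi]; rfl
  sum_eq := sum_coord hω x
  sum_smul := sum_coord_smul hω x

theorem coord_eq_hat (hω : ω ∈ M.elems) {x : Space d} (hx : x ∈ M.simplex ω) (i : Fin M.N) :
    M.coord ω i x = M.hat i x := by
  have h := M.isConvexComb_hat hω hx
  by_cases hi : i ∈ ω
  · exact eq_of_affineIndependent (M.affineIndependent_elem hω)
      (a := fun i => M.coord ω i x) (b := fun i => M.hat i x)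
      ((sum_coord hω x).trans h.sum_eq.symm) ((sum_coord_smul hω x).trans h.sum_smul.symm) i hi
  · rw [coord_eq_zero hω hi, h.eq_zero i hi]; rfl

theorem mem_simplex_of_coord_nonneg (hω : ω ∈ M.elems) {x : Space d}
    (hx : ∀ i ∈ ω, 0 ≤ M.coord ω i x) : x ∈ M.simplex ω :=
  mem_convexHull_image_iff.2 ⟨_, isConvexComb_coord hω hx⟩

theorem coord_vertex (hω : ω ∈ M.elems) (i : Fin M.N) {j : Fin M.N} (hj : j ∈ ω) :
    M.coord ω i (M.p j) = if i = j then 1 else 0 := by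
  rw [coord_eq_hat hω (subset_convexHull ℝ _ ⟨j, hj, rfl⟩), M.hat_vertex]

theorem continuous_affineMap (a : Space d →ᵃ[ℝ] ℝ) : Continuous a :=
  AffineMap.continuous_of_finiteDimensional a

variable (M) in
theorem continuousOn_of_simplices {f : Space d → ℝ}
    (hf : ∀ ω ∈ M.elems, ContinuousOn f (M.simplex ω)) :
    ContinuousOn f (closure (Ω : Set (Space d))) := by
  rw [← M.iUnion_simplex]
  have : ⋃ ω ∈ M.elems, M.simplex ω = ⋃ ω : M.elems, M.simplex ω := by
    rw [iUnion_subtype]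
  rw [this]
  exact LocallyFinite.continuousOn_iUnion (locallyFinite_of_finite _)
    (fun ω => M.isClosed_simplex ω) fun ω => hf ω ω.2

theorem continuousOn_hat (i : Fin M.N) : ContinuousOn (M.hat i) (closure (Ω : Set (Space d))) :=
  M.continuousOn_of_simplices fun _ hω => (continuous_affineMap _).continuousOn.congr
    fun _ hx => (coord_eq_hat hω hx i).symm

/-- Near a point of an element with a positive coordinate for the vertex `i`, the mesh is a cone
with apex `p i`. -/
theorem mem_of_mem_homothety (hint : interior (closure (Ω : Set (Space d))) ⊆ Ω) {x : Space d}
    (hx : x ∈ closure (Ω : Set (Space d))) {i : Fin M.N} (hi : 0 < M.hat i x) {δ : ℝ} (hδ : 0 < δ)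
    (hδ1 : δ ≤ 1) (hy : AffineMap.lineMap (M.p i) x δ ∈ (Ω : Set (Space d))) :
    x ∈ (Ω : Set (Space d)) := by
  classical
  set H : Space d → Space d := fun z => AffineMap.lineMap (M.p i) z δ with hH
  have hHc : Continuous H := by
    simp only [hH, AffineMap.lineMap_apply]
    fun_prop
  apply hint
  rw [mem_interior_iff_mem_nhds]
  have e1 : ∀ᶠ z in nhds x, H z ∈ (Ω : Set (Space d)) :=
    hHc.continuousAt.eventually (Ω.isOpen.mem_nhds hy)
  -- There are finitely many closed elements, so close to `H x` only those that contain `H x` occur.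
  have e2 : ∀ᶠ z in nhds x, ∀ ω ∈ M.elems, H x ∉ M.simplex ω → H z ∉ M.simplex ω := by
    rw [Filter.eventually_all_finset]
    intro ω _
    by_cases h : H x ∈ M.simplex ω
    · exact .of_forall fun z hz => absurd h hz
    · filter_upwards [hHc.continuousAt.eventually ((M.isClosed_simplex ω).isOpen_compl.mem_nhds h)]
        with z hz _ using hz
  have e3 : ∀ᶠ z in nhds x, ∀ ω ∈ M.elems, 0 < M.coord ω i x → 0 < M.coord ω i z := by
    rw [Filter.eventually_all_finset]
    intro ω _
    by_cases h : 0 < M.coord ω i x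
    · filter_upwards [(continuous_affineMap (M.coord ω i)).continuousAt.eventually
        (lt_mem_nhds h)] with z hz _ using hz
    · exact .of_forall fun z hz => absurd hz h
  filter_upwards [e1, e2, e3] with z h1 h2 h3
  obtain ⟨ω, hω, hzω⟩ := M.exists_mem_simplex (subset_closure h1)
  have hxω : H x ∈ M.simplex ω := by
    by_contra h
    exact h2 ω hω h hzω
  obtain ⟨ω', hω', hxω'⟩ := M.exists_mem_simplex hx
  have hiω' : i ∈ ω' := M.mem_elem_of_hat_ne_zero hω' hxω' hi.ne'
  have hHx' : H x ∈ M.simplex ω' := by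
    rw [hH]
    exact (M.convex_simplex ω').lineMap_mem (subset_convexHull ℝ _ ⟨i, hiω', rfl⟩) hxω'
      ⟨hδ.le, hδ1⟩
  -- Moving from `x` towards `p i` scales the coordinates by `δ` and adds weight to `i` only. Hence
  -- an element that contains `H x` contains every vertex that carries `x`, and so contains `x`.
  have hHhat : ∀ j, M.hat j (H x) = δ * M.hat j x + (1 - δ) * (if j = i then 1 else 0) := by
    intro j
    rw [← coord_eq_hat hω' hHx', ← coord_eq_hat hω' hxω', hH, AffineMap.apply_lineMap,
      coord_vertex hω' j hiω', AffineMap.lineMap_apply_ring']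
    ring
  have hnn : 0 ≤ (1 - δ) := by linarith
  have hsupp : ∀ j, M.hat j x ≠ 0 → j ∈ ω := by
    intro j hj
    refine M.mem_elem_of_hat_ne_zero hω hxω ?_
    rw [hHhat]
    have := (M.hat_nonneg j x).lt_of_ne hj.symm
    have : 0 ≤ (1 - δ) * (if j = i then 1 else 0) := by split_ifs <;> simp [hnn]
    positivity
  have hxω2 : x ∈ M.simplex ω := M.mem_simplex_of_hat hx hsupp
  have hiω : i ∈ ω := hsupp i hi.ne'
  have hci : 0 < M.coord ω i z := h3 ω hω (by rwa [coord_eq_hat hω hxω2])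
  -- For `z` near `x` the coordinate of `i` is positive by continuity. The others are, up to the
  -- factor `δ`, those of `H z`, which lies in `ω`. So a neighbourhood of `x` lies in the closure of
  -- `Ω`, and `hint` gives `x ∈ Ω`.
  refine M.simplex_subset hω (mem_simplex_of_coord_nonneg hω fun j hj => ?_)
  by_cases hji : j = i
  · rw [hji]; exact hci.le
  · have h4 : 0 ≤ M.coord ω j (H z) := by
      rw [coord_eq_hat hω hzω]
      exact M.hat_nonneg _ _
    rw [hH, AffineMap.apply_lineMap, coord_vertex hω j hiω, if_neg hji,
      AffineMap.lineMap_apply_ring'] at h4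
    have h5 : 0 ≤ δ * M.coord ω j z := by linarith
    exact nonneg_of_mul_nonneg_right h5 hδ

/-- If the hat function of an interior vertex were positive at a boundary point `x`, then the points
of the segment close to the vertex would lie in `Ω`, and the cone property would put `x` in `Ω`. -/
theorem hat_eq_zero_of_mem_frontier (hint : interior (closure (Ω : Set (Space d))) ⊆ Ω)
    {i : Fin M.N} (hi : M.p i ∈ (Ω : Set (Space d))) {x : Space d}
    (hx : x ∈ frontier (Ω : Set (Space d))) : M.hat i x = 0 := by
  by_contra h
  have hpos : 0 < M.hat i x := (M.hat_nonneg i x).lt_of_ne (Ne.symm h)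
  have hc : Filter.Tendsto (fun δ : ℝ => AffineMap.lineMap (M.p i) x δ) (nhds 0)
      (nhds (M.p i)) := by
    have : Continuous fun δ : ℝ => (AffineMap.lineMap (M.p i) x δ : Space d) :=
      AffineMap.lineMap_continuous
    simpa using this.tendsto 0
  have h1 : ∀ᶠ δ in nhdsWithin (0 : ℝ) (Ioi 0),
      AffineMap.lineMap (M.p i) x δ ∈ (Ω : Set (Space d)) :=
    (hc.eventually (Ω.isOpen.mem_nhds hi)).filter_mono nhdsWithin_le_nhds
  have h2 : ∀ᶠ δ in nhdsWithin (0 : ℝ) (Ioi 0), δ < 1 :=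
    (eventually_lt_nhds one_pos).filter_mono nhdsWithin_le_nhds
  obtain ⟨δ, hδ, hδ1, hδ0⟩ := (h1.and (h2.and self_mem_nhdsWithin)).exists
  have := mem_of_mem_homothety hint (frontier_subset_closure hx) hpos hδ0 hδ1.le hδ
  rw [Ω.isOpen.frontier_eq] at hx
  exact hx.2 this

/-- The piecewise affine function with given nodal values, extended by `0`. -/
def nodal (M : SpatialMesh Ω) (a : Fin M.N → ℝ) (x : Space d) : ℝ := ∑ i, a i * M.hat i x

theorem nodal_eq_of_mem (hω : ω ∈ M.elems) {x : Space d} (hx : x ∈ M.simplex ω)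
    (a : Fin M.N → ℝ) : M.nodal a x = ∑ i ∈ ω, a i * M.coord ω i x := by
  rw [nodal]
  symm
  rw [Finset.sum_congr rfl fun i _ => by rw [coord_eq_hat hω hx]]
  exact Finset.sum_subset (Finset.subset_univ _) fun i _ hi => by
    rw [(M.isConvexComb_hat hω hx).eq_zero i hi, mul_zero]

theorem nodal_vertex (a : Fin M.N → ℝ) (j : Fin M.N) : M.nodal a (M.p j) = a j := by
  simp [nodal, M.hat_vertex]

theorem affineMap_sum_smul {F : Type*} [AddCommGroup F] [Module ℝ F] {ι : Type*} {P : ι → F}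
    {A : Finset ι} {c : ι → ℝ} (a : F →ᵃ[ℝ] ℝ) (h1 : ∑ i ∈ A, c i = 1) :
    a (∑ i ∈ A, c i • P i) = ∑ i ∈ A, c i * a (P i) := by
  have h2 := A.map_affineCombination P c h1 a
  rw [A.affineCombination_eq_linear_combination _ _ h1,
    A.affineCombination_eq_linear_combination _ _ h1] at h2
  simpa using h2

theorem affineMap_eq_sum_coord (hω : ω ∈ M.elems) (a : Space d →ᵃ[ℝ] ℝ) (x : Space d) :
    a x = ∑ i ∈ ω, a (M.p i) * M.coord ω i x := by
  conv_lhs => rw [← sum_coord_smul hω x]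
  rw [affineMap_sum_smul a (sum_coord hω x)]
  exact Finset.sum_congr rfl fun i _ => mul_comm _ _

theorem affineMap_sum_apply {F : Type*} [AddCommGroup F] [Module ℝ F] {ι : Type*}
    (A : Finset ι) (φ : ι → F →ᵃ[ℝ] ℝ) (x : F) : (∑ i ∈ A, φ i) x = ∑ i ∈ A, φ i x := by
  classical
  induction A using Finset.induction_on with
  | empty => rfl
  | insert i s hi ih => rw [Finset.sum_insert hi, Finset.sum_insert hi, ← ih]; rfl

theorem isPiecewiseAffine_nodal (a : Fin M.N → ℝ) :
    IsPiecewiseAffine M.simplices (closure (Ω : Set (Space d))) (M.nodal a) := by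
  constructor
  · exact continuousOn_finsetSum _ fun i _ => continuousOn_const.mul (continuousOn_hat i)
  · rintro _ ⟨ω, hω, rfl⟩
    refine ⟨∑ i ∈ ω, a i • M.coord ω i, fun x hx => ?_⟩
    rw [nodal_eq_of_mem hω hx, affineMap_sum_apply]
    rfl

theorem eq_nodal_of_isPiecewiseAffine {v : Space d → ℝ}
    (hv : IsPiecewiseAffine M.simplices (closure (Ω : Set (Space d))) v) {x : Space d}
    (hx : x ∈ closure (Ω : Set (Space d))) : v x = M.nodal (fun i => v (M.p i)) x := by
  obtain ⟨ω, hω, hxω⟩ := M.exists_mem_simplex hx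
  obtain ⟨a, ha⟩ := hv.2 _ ⟨ω, hω, rfl⟩
  rw [nodal_eq_of_mem hω hxω, ha hxω, affineMap_eq_sum_coord hω a x]
  refine Finset.sum_congr rfl fun i hi => ?_
  rw [ha (subset_convexHull ℝ _ ⟨i, hi, rfl⟩)]

theorem isS10_nodal (hint : interior (closure (Ω : Set (Space d))) ⊆ Ω) {a : Fin M.N → ℝ}
    (ha : ∀ i, M.p i ∉ Ω → a i = 0) : M.IsS10 (M.nodal a) := by
  refine ⟨isPiecewiseAffine_nodal a, fun x hx => Finset.sum_eq_zero fun i _ => ?_⟩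
  by_cases hi : M.p i ∈ Ω
  · rw [hat_eq_zero_of_mem_frontier hint hi hx, mul_zero]
  · rw [ha i hi, zero_mul]

theorem IsS10.vertex_eq_zero {v : Space d → ℝ} (hv : M.IsS10 v) (i : Fin M.N)
    (hi : M.p i ∉ Ω) : v (M.p i) = 0 := by
  refine hv.2 _ ?_
  rw [Ω.isOpen.frontier_eq]
  exact ⟨M.vertex_mem_closure i, hi⟩

theorem nodal_eq_zero (hint : interior (closure (Ω : Set (Space d))) ⊆ Ω) {a : Fin M.N → ℝ}
    (ha : ∀ i, M.p i ∉ Ω → a i = 0) {x : Space d} (hx : x ∉ Ω) : M.nodal a x = 0 := by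
  by_cases hxc : x ∈ closure (Ω : Set (Space d))
  · refine (isS10_nodal hint ha).2 x ?_
    rw [Ω.isOpen.frontier_eq]
    exact ⟨hxc, hx⟩
  · exact Finset.sum_eq_zero fun i _ => by rw [M.hat_eq_zero_of_notMem i hxc, mul_zero]

end SpatialMesh

end

section

/-! ### The simplicial space-time mesh -/

/-- A telescoping sum; with `F = min · s` it shows that the truncated shares of the hat functions
add up to `s`. -/
theorem sum_sub_prefix {N : ℕ} (g : Fin N → ℝ) (F : ℝ → ℝ) :
    ∑ i : Fin N, (F (∑ j : Fin N with j.1 < i.1 + 1, g j) - F (∑ j : Fin N with j.1 < i.1, g j)) =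
      F (∑ j, g j) - F 0 := by
  rw [Fin.sum_univ_eq_sum_range (fun m => F (∑ j : Fin N with j.1 < m + 1, g j) -
    F (∑ j : Fin N with j.1 < m, g j)) N,
    Finset.sum_range_sub (fun m => F (∑ j : Fin N with j.1 < m, g j))]
  simp

namespace SpatialMesh

variable {d : ℕ} {Ω : Opens (Space d)} (M : SpatialMesh Ω)

/-- The sum of the first `m` hat functions. -/
def lev (m : ℕ) (x : Space d) : ℝ := ∑ j : Fin M.N with j.1 < m, M.hat j x

/-- The part of the `i`-th hat function that is attached to the upper vertex at the relative
height `s` of a prism. -/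
def cut (s : ℝ) (i : Fin M.N) (x : Space d) : ℝ :=
  min (M.lev (i.1 + 1) x) s - min (M.lev i.1 x) s

theorem lev_succ (i : Fin M.N) (x : Space d) :
    M.lev (i.1 + 1) x = M.lev i.1 x + M.hat i x := by
  rw [lev, lev]
  have : (Finset.univ.filter fun j : Fin M.N => j.1 < i.1 + 1) =
      insert i (Finset.univ.filter fun j : Fin M.N => j.1 < i.1) := by
    ext j
    simp only [Finset.mem_filter, Finset.mem_univ, true_and, Finset.mem_insert, Fin.ext_iff]
    omega
  rw [this, Finset.sum_insert (by simp), add_comm]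

theorem lev_nonneg (m : ℕ) (x : Space d) : 0 ≤ M.lev m x :=
  Finset.sum_nonneg fun j _ => M.hat_nonneg j x

theorem lev_mono {m m' : ℕ} (h : m ≤ m') (x : Space d) : M.lev m x ≤ M.lev m' x :=
  Finset.sum_le_sum_of_subset_of_nonneg
    (fun j hj => by
      rw [Finset.mem_filter] at hj ⊢
      exact ⟨hj.1, hj.2.trans_le h⟩)
    fun j _ _ => M.hat_nonneg j x

theorem lev_le_one (m : ℕ) (x : Space d) : M.lev m x ≤ 1 :=
  (Finset.sum_le_sum_of_subset_of_nonneg (Finset.filter_subset _ _)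
    fun j _ _ => M.hat_nonneg j x).trans (M.sum_hat_le_one x)

theorem cut_nonneg (s : ℝ) (i : Fin M.N) (x : Space d) : 0 ≤ M.cut s i x :=
  sub_nonneg.2 (min_le_min_right _ (M.lev_mono (Nat.le_succ _) x))

theorem cut_le_hat (s : ℝ) (i : Fin M.N) (x : Space d) : M.cut s i x ≤ M.hat i x := by
  have h := M.lev_succ i x
  have h0 := M.hat_nonneg i x
  rw [cut, h]
  rcases min_cases (M.lev i.1 x + M.hat i x) s with h1 | h1 <;>
  rcases min_cases (M.lev i.1 x) s with h2 | h2 <;> linarith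

theorem cut_of_one_le {s : ℝ} (hs : 1 ≤ s) (i : Fin M.N) (x : Space d) :
    M.cut s i x = M.hat i x := by
  rw [cut, min_eq_left ((M.lev_le_one _ x).trans hs), min_eq_left ((M.lev_le_one _ x).trans hs),
    lev_succ, add_sub_cancel_left]

theorem cut_zero (i : Fin M.N) (x : Space d) : M.cut 0 i x = 0 := by
  rw [cut, min_eq_right (M.lev_nonneg _ x), min_eq_right (M.lev_nonneg _ x), sub_self]

theorem cut_eq_zero {s : ℝ} {i : Fin M.N} {x : Space d} (h : M.hat i x = 0) : M.cut s i x = 0 :=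
  le_antisymm (h ▸ M.cut_le_hat s i x) (M.cut_nonneg s i x)

theorem sum_cut {s : ℝ} (hs : s ∈ Icc (0 : ℝ) 1) {x : Space d}
    (hx : x ∈ closure (Ω : Set (Space d))) : ∑ i, M.cut s i x = s := by
  have h := sum_sub_prefix (fun j => M.hat j x) (fun r => min r s)
  rw [M.sum_hat hx, min_eq_right hs.2, min_eq_left hs.1, sub_zero] at h
  exact h

/-- The continuous function, piecewise affine on the space-time mesh, with prescribed values at
the vertices. -/
def interp (h : ℝ) (n : ℕ) (a : Fin M.N → ℕ → ℝ) (z : ℝ × Space d) : ℝ :=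
  ∑ i, (a i 0 * M.hat i z.2 +
    ∑ k ∈ Finset.range n, (a i (k + 1) - a i k) * M.cut (max 0 ((z.1 - k * h) / h)) i z.2)

/-- In the slabs below, the relative height is at least 1, truncation has no effect, and the
increments telescope to `a i K`. In the slabs above, the relative height is clipped to 0 and nothing
is added. -/
theorem interp_eq_of_mem {h : ℝ} (hh : 0 < h) {n K : ℕ} (hK : K < n) (a : Fin M.N → ℕ → ℝ) {t : ℝ}
    (ht : t ∈ Icc (K * h) ((K + 1 : ℕ) * h)) (x : Space d) :
    M.interp h n a (t, x) =
      ∑ i, (a i K * M.hat i x + (a i (K + 1) - a i K) * M.cut ((t - K * h) / h) i x) := by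
  refine Finset.sum_congr rfl fun i _ => ?_
  have key : ∀ m, m ≤ K → a i 0 * M.hat i x +
      ∑ k ∈ Finset.range m, (a i (k + 1) - a i k) * M.cut (max 0 ((t - k * h) / h)) i x =
      a i m * M.hat i x := by
    intro m hm
    have : ∀ k ∈ Finset.range m, (a i (k + 1) - a i k) * M.cut (max 0 ((t - k * h) / h)) i x =
        a i (k + 1) * M.hat i x - a i k * M.hat i x := by
      intro k hk
      have hkK : ((k : ℝ) + 1) ≤ K := by
        have := Finset.mem_range.1 hk
        exact_mod_cast (by omega : k + 1 ≤ K)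
      rw [M.cut_of_one_le, sub_mul]
      refine le_max_of_le_right ?_
      rw [le_div_iff₀ hh]
      have := ht.1
      nlinarith
    rw [Finset.sum_congr rfl this, Finset.sum_range_sub (fun k => a i k * M.hat i x)]
    ring
  obtain ⟨m, rfl⟩ : ∃ m, n = K + 1 + m := ⟨n - (K + 1), by omega⟩
  rw [Finset.sum_range_add, Finset.sum_range_succ, ← add_assoc, ← add_assoc, key K le_rfl]
  have hz : ∑ k ∈ Finset.range m, (a i (K + 1 + k + 1) - a i (K + 1 + k)) *
      M.cut (max 0 ((t - ((K + 1 + k : ℕ) : ℝ) * h) / h)) i x = 0 := by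
    refine Finset.sum_eq_zero fun k _ => ?_
    rw [max_eq_left, M.cut_zero, mul_zero]
    refine div_nonpos_of_nonpos_of_nonneg ?_ hh.le
    have := ht.2
    push_cast at this ⊢
    have : 0 ≤ (k : ℝ) * h := by positivity
    nlinarith
  rw [hz, add_zero, max_eq_right]
  exact div_nonneg (sub_nonneg.2 ht.1) hh.le

/-- The vertices of the space-time mesh. -/
def vertex (h : ℝ) (q : Fin M.N × ℕ) : ℝ × Space d := ((q.2 : ℝ) * h, M.p q.1)

theorem vertex_injective {h : ℝ} (hh : 0 < h) : Function.Injective (M.vertex h) := by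
  rintro ⟨i, k⟩ ⟨j, l⟩ hq
  simp only [vertex, Prod.mk.injEq] at hq
  have h1 := M.p_injective hq.2
  have h2 := mul_right_cancel₀ hh.ne' hq.1
  rw [h1, Nat.cast_inj.1 h2]

/-- The labels of the vertices of a simplex in the splitting of a prism. -/
def splitLabels (k : ℕ) (ω : Finset (Fin M.N)) (ℓ : Fin M.N) : Finset (Fin M.N × ℕ) :=
  (ω.filter (ℓ ≤ ·)) ×ˢ {k} ∪ (ω.filter (· ≤ ℓ)) ×ˢ {k + 1}

theorem mem_splitLabels {k : ℕ} {ω : Finset (Fin M.N)} {ℓ : Fin M.N} {q : Fin M.N × ℕ} :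
    q ∈ M.splitLabels k ω ℓ ↔ q.1 ∈ ω ∧ ((ℓ ≤ q.1 ∧ q.2 = k) ∨ (q.1 ≤ ℓ ∧ q.2 = k + 1)) := by
  simp only [splitLabels, Finset.mem_union, Finset.mem_product, Finset.mem_filter,
    Finset.mem_singleton]
  tauto

theorem splitVertices_eq (h : ℝ) (k : ℕ) (ω : Finset (Fin M.N)) (ℓ : Fin M.N) :
    M.splitVertices h k ω ℓ = M.vertex h '' (M.splitLabels k ω ℓ : Set (Fin M.N × ℕ)) := by
  ext z
  simp only [splitVertices, mem_ofPred_eq, mem_image, Finset.mem_coe, mem_splitLabels, vertex]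
  constructor
  · rintro ⟨i, hi, h1 | h1⟩
    · exact ⟨(i, k), ⟨hi, Or.inl ⟨h1.1, rfl⟩⟩, h1.2.symm⟩
    · exact ⟨(i, k + 1), ⟨hi, Or.inr ⟨h1.1, rfl⟩⟩, h1.2.symm⟩
  · rintro ⟨⟨i, l⟩, ⟨hi, h1 | h1⟩, rfl⟩
    · exact ⟨i, hi, Or.inl ⟨h1.1, by rw [← h1.2]⟩⟩
    · exact ⟨i, hi, Or.inr ⟨h1.1, by rw [← h1.2]⟩⟩

theorem card_splitLabels (k : ℕ) {ω : Finset (Fin M.N)} {ℓ : Fin M.N} (hℓ : ℓ ∈ ω) :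
    (M.splitLabels k ω ℓ).card = ω.card + 1 := by
  rw [splitLabels, Finset.card_union_of_disjoint, Finset.card_product, Finset.card_product,
    Finset.card_singleton, Finset.card_singleton, mul_one, mul_one]
  · have h1 := Finset.card_filter_add_card_filter_not (s := ω) (ℓ ≤ ·)
    have h2 : ω.filter (· ≤ ℓ) = insert ℓ (ω.filter fun i => ¬ ℓ ≤ i) := by
      ext i
      simp only [Finset.mem_filter, Finset.mem_insert, not_le]
      constructor
      · rintro ⟨h3, h4⟩
        exact h4.eq_or_lt.imp id fun h5 => ⟨h3, h5⟩
      · rintro (rfl | h3)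
        · exact ⟨hℓ, le_rfl⟩
        · exact ⟨h3.1, h3.2.le⟩
    rw [h2, Finset.card_insert_of_notMem (by simp)]
    omega
  · rw [Finset.disjoint_left]
    rintro ⟨i, l⟩ h1 h2
    simp only [Finset.mem_product, Finset.mem_singleton] at h1 h2
    omega

variable {M}

theorem sum_splitLabels {E : Type*} [AddCommMonoid E] {k : ℕ} {ω : Finset (Fin M.N)} {ℓ : Fin M.N}
    {F : Fin M.N × ℕ → E} (hF : ∀ q ∉ M.splitLabels k ω ℓ, F q = 0) :
    ∑ q ∈ M.splitLabels k ω ℓ, F q = ∑ i ∈ ω, (F (i, k) + F (i, k + 1)) := by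
  have hsub : M.splitLabels k ω ℓ ⊆ ω ×ˢ {k, k + 1} := by
    rintro ⟨i, l⟩ hq
    rw [mem_splitLabels] at hq
    simp only [Finset.mem_product, Finset.mem_insert, Finset.mem_singleton]
    tauto
  rw [Finset.sum_subset hsub fun q _ hq => hF q hq, Finset.sum_product]
  refine Finset.sum_congr rfl fun i _ => ?_
  rw [Finset.sum_insert (by simp), Finset.sum_singleton]

variable {h : ℝ} {n K : ℕ} {ω : Finset (Fin M.N)} {ℓ : Fin M.N} {c : Fin M.N × ℕ → ℝ}
  {z : ℝ × Space d}

theorem isConvexComb_of_split (hc : IsConvexComb (M.vertex h) (M.splitLabels K ω ℓ) c z) :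
    IsConvexComb M.p ω (fun i => c (i, K) + c (i, K + 1)) z.2 where
  nonneg i := add_nonneg (hc.nonneg _) (hc.nonneg _)
  eq_zero i hi := by
    rw [hc.eq_zero _ fun h => hi (M.mem_splitLabels.1 h).1,
      hc.eq_zero _ fun h => hi (M.mem_splitLabels.1 h).1, add_zero]
  sum_eq := by rw [← hc.sum_eq, sum_splitLabels hc.eq_zero]
  sum_smul := by
    rw [← hc.sum_smul, Prod.snd_sum, sum_splitLabels]
    · simp [vertex, add_smul]
    · intro q hq
      rw [hc.eq_zero q hq, zero_smul]
      rfl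

theorem time_of_split (hc : IsConvexComb (M.vertex h) (M.splitLabels K ω ℓ) c z) :
    z.1 = K * h + (∑ i ∈ ω, c (i, K + 1)) * h := by
  have h1 := (isConvexComb_of_split hc).sum_eq
  rw [← hc.sum_smul, Prod.fst_sum, sum_splitLabels]
  · simp only [vertex, Prod.smul_fst, smul_eq_mul]
    have : ∀ i, c (i, K) * ((K : ℝ) * h) + c (i, K + 1) * (((K + 1 : ℕ) : ℝ) * h) =
        (c (i, K) + c (i, K + 1)) * (K * h) + c (i, K + 1) * h := fun i => by push_cast; ring
    simp only [this]
    rw [Finset.sum_add_distrib, ← Finset.sum_mul, h1, ← Finset.sum_mul, one_mul]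
  · intro q hq
    rw [hc.eq_zero q hq, zero_smul]
    rfl

theorem time_mem_of_split (hh : 0 < h)
    (hc : IsConvexComb (M.vertex h) (M.splitLabels K ω ℓ) c z) :
    z.1 ∈ Icc (K * h) ((K + 1 : ℕ) * h) := by
  have h1 := (isConvexComb_of_split hc).sum_eq
  rw [Finset.sum_add_distrib] at h1
  have h2 : 0 ≤ ∑ i ∈ ω, c (i, K) := Finset.sum_nonneg fun i _ => hc.nonneg _
  have h3 : 0 ≤ ∑ i ∈ ω, c (i, K + 1) := Finset.sum_nonneg fun i _ => hc.nonneg _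
  rw [time_of_split hc]
  push_cast
  constructor <;> nlinarith

/-- Only `i ≥ ℓ` have weight at the lower level and only `i ≤ ℓ` at the upper one, and the upper
weights sum to the relative height `τ`. A prefix sum of hat values is the sum of a lower part `R`
and an upper part `S`. Up to `ℓ` the part `R` is zero, so the prefix sum is `S ≤ τ` and truncation
does nothing. Beyond `ℓ` the part `S` has reached `τ`, so the truncated sum stays constant.
Differences of truncated prefix sums are therefore the upper weights. -/
theorem cut_of_split (hh : 0 < h) (hω : ω ∈ M.elems)
    (hc : IsConvexComb (M.vertex h) (M.splitLabels K ω ℓ) c z) (i : Fin M.N) :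
    M.cut ((z.1 - K * h) / h) i z.2 = c (i, K + 1) := by
  have hb := isConvexComb_of_split hc
  have hhat : ∀ i, M.hat i z.2 = c (i, K) + c (i, K + 1) := fun i => M.hat_eq hω hb i
  have h0 : ∀ i, i < ℓ → c (i, K) = 0 := fun i hi => hc.eq_zero _ fun hq => by
    have := (M.mem_splitLabels.1 hq).2
    simp only at this
    rcases this with h1 | h1
    · exact absurd hi (not_lt.2 h1.1)
    · omega
  have h1 : ∀ i, ℓ < i → c (i, K + 1) = 0 := fun i hi => hc.eq_zero _ fun hq => by
    have := (M.mem_splitLabels.1 hq).2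
    simp only at this
    rcases this with h1 | h1
    · omega
    · exact absurd hi (not_lt.2 h1.1)
  set S : ℕ → ℝ := fun m => ∑ j : Fin M.N with j.1 < m, c (j, K + 1) with hS
  set R : ℕ → ℝ := fun m => ∑ j : Fin M.N with j.1 < m, c (j, K) with hR
  have hlev : ∀ m, M.lev m z.2 = R m + S m := fun m => by
    simp only [lev, hhat, Finset.sum_add_distrib, hR, hS]
  have hSmono : ∀ {m m'}, m ≤ m' → S m ≤ S m' := fun {m m'} hm =>
    Finset.sum_le_sum_of_subset_of_nonneg (fun j hj => by
      rw [Finset.mem_filter] at hj ⊢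
      exact ⟨hj.1, hj.2.trans_le hm⟩) fun j _ _ => hc.nonneg _
  have hR0 : ∀ m, 0 ≤ R m := fun m => Finset.sum_nonneg fun j _ => hc.nonneg _
  have hRz : ∀ m, m ≤ ℓ.1 → R m = 0 := fun m hm => Finset.sum_eq_zero fun j hj => by
    rw [Finset.mem_filter] at hj
    exact h0 j (Fin.lt_def.2 (hj.2.trans_le hm))
  have hτ : (z.1 - K * h) / h = S M.N := by
    rw [time_of_split hc, add_sub_cancel_left, mul_div_cancel_right₀ _ hh.ne']
    have : (Finset.univ.filter fun j : Fin M.N => j.1 < M.N) = Finset.univ := by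
      ext j; simp
    simp only [hS, this]
    exact Finset.sum_subset (Finset.subset_univ _) fun j _ hj =>
      hc.eq_zero _ fun hq => hj (M.mem_splitLabels.1 hq).1
  have hStop : ∀ m, ℓ.1 < m → S m = S M.N := fun m hm => by
    have hfilter : (Finset.univ.filter fun j : Fin M.N => j.1 < M.N) = Finset.univ := by
      ext j; simp
    simp only [hS, hfilter]
    refine Finset.sum_subset (Finset.subset_univ _) fun j _ hj => h1 j ?_
    rw [Finset.mem_filter] at hj
    have : ¬ j.1 < m := fun h => hj ⟨Finset.mem_univ _, h⟩
    exact Fin.lt_def.2 (by omega)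
  have hdiff : ∀ i : Fin M.N, S (i.1 + 1) = S i.1 + c (i, K + 1) := fun i => by
    have : (Finset.univ.filter fun j : Fin M.N => j.1 < i.1 + 1) =
        insert i (Finset.univ.filter fun j : Fin M.N => j.1 < i.1) := by
      ext j
      simp only [Finset.mem_filter, Finset.mem_univ, true_and, Finset.mem_insert, Fin.ext_iff]
      omega
    simp only [hS, this]
    rw [Finset.sum_insert (by simp), add_comm]
  have htop : ∀ m, S m ≤ S M.N := fun m => by
    rcases le_or_gt m M.N with hm | hm
    · exact hSmono hm
    · exact (hStop m (by have := ℓ.2; omega)).le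
  rw [cut, hτ, hlev, hlev]
  rcases lt_trichotomy i ℓ with hi | hi | hi
  · have hi' := Fin.lt_def.1 hi
    rw [hRz _ (by omega), hRz _ (by omega), zero_add, zero_add, min_eq_left (htop _),
      min_eq_left (htop _), hdiff, add_sub_cancel_left]
  · rw [hi, hRz _ le_rfl, zero_add, min_eq_left (htop ℓ.1), hStop _ (Nat.lt_succ_self _),
      min_eq_right (by linarith [hR0 (ℓ.1 + 1)]), ← hStop _ (Nat.lt_succ_self _), hdiff,
      add_sub_cancel_left]
  · have hi' := Fin.lt_def.1 hi
    rw [hStop _ hi', hStop (i.1 + 1) (by omega), min_eq_right (by linarith [hR0 i.1, hR0 (i.1 + 1)]),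
      min_eq_right (by linarith [hR0 i.1, hR0 (i.1 + 1)]), h1 i hi, sub_self]

theorem interp_of_split (hh : 0 < h) (hK : K < n) (hω : ω ∈ M.elems)
    (hc : IsConvexComb (M.vertex h) (M.splitLabels K ω ℓ) c z) (a : Fin M.N → ℕ → ℝ) :
    M.interp h n a z = ∑ q ∈ M.splitLabels K ω ℓ, c q * a q.1 q.2 := by
  have h1 := M.interp_eq_of_mem hh hK a (time_mem_of_split hh hc) z.2
  rw [sum_splitLabels fun q hq => by rw [hc.eq_zero q hq, zero_mul]]
  rw [show z = (z.1, z.2) from rfl, h1]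
  have h2 : ∀ i, M.hat i z.2 = c (i, K) + c (i, K + 1) :=
    fun i => M.hat_eq hω (isConvexComb_of_split hc) i
  simp only [h2, cut_of_split hh hω hc]
  symm
  rw [Finset.sum_congr rfl fun i _ => show c (i, K) * a i K + c (i, K + 1) * a i (K + 1) =
    a i K * (c (i, K) + c (i, K + 1)) + (a i (K + 1) - a i K) * c (i, K + 1) by ring]
  refine Finset.sum_subset (Finset.subset_univ _) fun i _ hi => ?_
  rw [hc.eq_zero (i, K) fun hq => hi (M.mem_splitLabels.1 hq).1,
    hc.eq_zero (i, K + 1) fun hq => hi (M.mem_splitLabels.1 hq).1]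
  ring

/-- The interpolant of a nodal delta computes the weight of its vertex, by the same formula in every
simplex of the mesh. `affineIndependent_of_weights` and `convexHull_inter_of_weights` turn this into
admissibility. -/
theorem weights_of_split (hh : 0 < h) (hK : K < n) (hω : ω ∈ M.elems)
    (hc : IsConvexComb (M.vertex h) (M.splitLabels K ω ℓ) c z) (q : Fin M.N × ℕ) :
    M.interp h n (fun i k => if (i, k) = q then 1 else 0) z = c q := by
  rw [interp_of_split hh hK hω hc]
  simp only [mul_ite, mul_one, mul_zero, Prod.mk.eta, Finset.sum_ite_eq']
  split_ifs with hq
  · rfl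
  · exact (hc.eq_zero q hq).symm

theorem exists_split_of_mem (hh : 0 < h) (hω : ω ∈ M.elems) {t : ℝ} {x : Space d}
    (ht : t ∈ Icc (K * h) ((K + 1 : ℕ) * h)) (hx : x ∈ M.simplex ω) :
    ∃ ℓ ∈ ω, ∃ c, IsConvexComb (M.vertex h) (M.splitLabels K ω ℓ) c (t, x) := by
  classical
  set τ : ℝ := (t - K * h) / h with hτ
  have hτ0 : 0 ≤ τ := div_nonneg (sub_nonneg.2 ht.1) hh.le
  have hτ1 : τ ≤ 1 := by
    rw [hτ, div_le_one hh]
    have := ht.2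
    push_cast at this
    linarith
  have hb := M.isConvexComb_hat hω hx
  have hxc := M.simplex_subset hω hx
  have hne : ω.Nonempty := by
    rw [← Finset.card_pos, M.card_elem hω]
    omega
  have hex : (ω.filter fun i => τ ≤ M.lev (i.1 + 1) x).Nonempty := by
    refine ⟨ω.max' hne, Finset.mem_filter.2 ⟨ω.max'_mem hne, ?_⟩⟩
    refine hτ1.trans ?_
    rw [← hb.sum_eq, lev]
    refine Finset.sum_le_sum_of_subset_of_nonneg (fun j hj => ?_) fun j _ _ => M.hat_nonneg j x
    rw [Finset.mem_filter]
    exact ⟨Finset.mem_univ _, Nat.lt_succ_of_le (Fin.le_def.1 (ω.le_max' j hj))⟩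
  -- The switching vertex is the first vertex of `ω` at which the prefix sum of the hat values
  -- reaches the relative height `τ`.
  obtain ⟨ℓ, hℓmem, hℓmin⟩ : ∃ ℓ, (ℓ ∈ ω ∧ τ ≤ M.lev (ℓ.1 + 1) x) ∧
      ∀ i ∈ ω, τ ≤ M.lev (i.1 + 1) x → ℓ ≤ i :=
    ⟨_, Finset.mem_filter.1 (Finset.min'_mem _ hex), fun i hi hi' =>
      Finset.min'_le _ i (Finset.mem_filter.2 ⟨hi, hi'⟩)⟩
  refine ⟨ℓ, hℓmem.1, fun q => if q.2 = K then M.hat q.1 x - M.cut τ q.1 x else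
    if q.2 = K + 1 then M.cut τ q.1 x else 0, ?_⟩
  have hlow : ∀ i ∈ ω, i < ℓ → M.cut τ i x = M.hat i x := by
    intro i hi hiℓ
    have h1 : M.lev (i.1 + 1) x < τ := by
      by_contra h2
      exact absurd (hℓmin i hi (not_lt.1 h2)) (not_le.2 hiℓ)
    rw [cut, min_eq_left h1.le, min_eq_left ((M.lev_mono (Nat.le_succ _) x).trans h1.le),
      lev_succ, add_sub_cancel_left]
  have hup : ∀ i, ℓ < i → M.cut τ i x = 0 := by
    intro i hi
    have h1 : τ ≤ M.lev i.1 x := hℓmem.2.trans (M.lev_mono (Fin.lt_def.1 hi) x)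
    rw [cut, min_eq_right h1, min_eq_right (h1.trans (M.lev_mono (Nat.le_succ _) x)), sub_self]
  have hzero : ∀ q : Fin M.N × ℕ, q ∉ M.splitLabels K ω ℓ →
      (if q.2 = K then M.hat q.1 x - M.cut τ q.1 x else
        if q.2 = K + 1 then M.cut τ q.1 x else 0) = 0 := by
    rintro ⟨i, k⟩ hq
    rw [mem_splitLabels] at hq
    by_cases hi : i ∈ ω
    · split_ifs with h1 h2
      · simp only at h1
        have : i < ℓ := not_le.1 fun h3 => hq ⟨hi, Or.inl ⟨h3, h1⟩⟩
        simp only [hlow i hi this, sub_self]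
      · simp only at h2
        exact hup i (not_le.1 fun h3 => hq ⟨hi, Or.inr ⟨h3, h2⟩⟩)
      · rfl
    · have h1 : M.hat i x = 0 := hb.eq_zero i hi
      simp [h1, M.cut_eq_zero h1]
  have hcut : ∑ i ∈ ω, M.cut τ i x = τ := by
    refine Eq.trans ?_ (M.sum_cut ⟨hτ0, hτ1⟩ hxc)
    exact Finset.sum_subset (Finset.subset_univ _) fun i _ hi => M.cut_eq_zero (hb.eq_zero i hi)
  refine ⟨fun q => ?_, hzero, ?_, ?_⟩
  · split_ifs
    · exact sub_nonneg.2 (M.cut_le_hat _ _ _)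
    · exact M.cut_nonneg _ _ _
    · exact le_rfl
  · rw [sum_splitLabels hzero]
    simp [hb.sum_eq]
  · rw [sum_splitLabels fun q hq => by rw [hzero q hq, zero_smul]]
    simp only [if_true, Nat.succ_ne_self, if_false, vertex]
    ext1
    · rw [Prod.fst_sum]
      simp only [Prod.fst_add, Prod.smul_fst, smul_eq_mul]
      rw [Finset.sum_congr rfl fun i _ => show (M.hat i x - M.cut τ i x) * (K * h) +
        M.cut τ i x * ((K + 1 : ℕ) * h) = M.hat i x * (K * h) + M.cut τ i x * h by push_cast; ring]
      rw [Finset.sum_add_distrib, ← Finset.sum_mul, ← Finset.sum_mul, hb.sum_eq, hcut, hτ]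
      field_simp
      ring
    · rw [Prod.snd_sum]
      simp only [Prod.snd_add, Prod.smul_snd, ← add_smul, sub_add_cancel, hb.sum_smul]

theorem exists_slab (hh : 0 < h) (hn : 1 ≤ n) {t : ℝ} (ht : t ∈ Icc 0 (n * h)) :
    ∃ K < n, t ∈ Icc ((K : ℝ) * h) ((K + 1 : ℕ) * h) := by
  by_cases hlt : ⌊t / h⌋₊ < n
  · refine ⟨⌊t / h⌋₊, hlt, ?_, ?_⟩
    · rw [← le_div_iff₀ hh]
      exact Nat.floor_le (div_nonneg ht.1 hh.le)
    · rw [← div_le_iff₀ hh]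
      push_cast
      exact (Nat.lt_floor_add_one _).le
  -- The final time, where the floor is `n`, is assigned to the last slab.
  · have h1 : (n : ℝ) ≤ t / h := (Nat.le_floor_iff (div_nonneg ht.1 hh.le)).1 (not_lt.1 hlt)
    rw [le_div_iff₀ hh] at h1
    have h2 : t = n * h := le_antisymm ht.2 h1
    refine ⟨n - 1, by omega, ?_, ?_⟩
    · rw [h2]
      exact mul_le_mul_of_nonneg_right (by exact_mod_cast Nat.sub_le n 1) hh.le
    · rw [Nat.sub_add_cancel hn, h2]

variable (M)

theorem isAdmissibleMesh_spaceTimeMesh (hh : 0 < h) (hn : 1 ≤ n) :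
    IsAdmissibleMesh (M.spaceTimeMesh h n) (Icc 0 (n * h) ×ˢ closure (Ω : Set (Space d))) where
  finite := by
    refine (((Finset.range n ×ˢ M.elems ×ˢ Finset.univ).image fun q =>
      M.splitVertices h q.1 q.2.1 q.2.2).finite_toSet).subset ?_
    rintro _ ⟨k, hk, ω, hω, ℓ, _, rfl⟩
    rw [Finset.mem_coe, Finset.mem_image]
    exact ⟨(k, ω, ℓ), by simp [hk, hω], rfl⟩
  finite_vertices := by
    rintro _ ⟨k, hk, ω, hω, ℓ, _, rfl⟩
    rw [splitVertices_eq]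
    exact (Finset.finite_toSet _).image _
  card_vertices := by
    rintro _ ⟨k, hk, ω, hω, ℓ, hℓ, rfl⟩
    rw [splitVertices_eq, ncard_image_of_injective _ (M.vertex_injective hh), ncard_coe_finset,
      M.card_splitLabels k hℓ, M.card_elem hω]
    simp [add_comm]
  affineIndependent := by
    rintro _ ⟨k, hk, ω, hω, ℓ, hℓ, rfl⟩
    rw [splitVertices_eq, affineIndependent_image_iff (M.vertex_injective hh).injOn]
    exact affineIndependent_of_weights
      (β := fun q z => M.interp h n (fun i k => if (i, k) = q then 1 else 0) z)
      fun c z hc q => weights_of_split hh hk hω hc q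
  inter := by
    rintro _ ⟨k, hk, ω, hω, ℓ, hℓ, rfl⟩ _ ⟨k', hk', ω', hω', ℓ', hℓ', rfl⟩
    rw [splitVertices_eq, splitVertices_eq]
    exact convexHull_inter_of_weights
      (β := fun q z => M.interp h n (fun i k => if (i, k) = q then 1 else 0) z)
      (fun c z hc q => weights_of_split hh hk hω hc q)
      (fun c z hc q => weights_of_split hh hk' hω' hc q)
  cover := by
    ext ⟨t, x⟩
    simp only [mem_iUnion, exists_prop, mem_prod]
    constructor
    · rintro ⟨_, ⟨k, hk, ω, hω, ℓ, hℓ, rfl⟩, hz⟩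
      rw [splitVertices_eq, mem_convexHull_image_iff] at hz
      obtain ⟨c, hc⟩ := hz
      have h1 := time_mem_of_split hh hc
      refine ⟨⟨le_trans (by positivity) h1.1, h1.2.trans ?_⟩, M.simplex_subset hω
        (mem_convexHull_image_iff.2 ⟨_, isConvexComb_of_split hc⟩)⟩
      exact mul_le_mul_of_nonneg_right (by exact_mod_cast hk) hh.le
    · rintro ⟨ht, hx⟩
      obtain ⟨K, hK, htK⟩ := exists_slab hh hn ht
      obtain ⟨ω, hω, hxω⟩ := M.exists_mem_simplex hx
      obtain ⟨ℓ, hℓ, c, hc⟩ := exists_split_of_mem hh hω htK hxω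
      refine ⟨_, ⟨K, hK, ω, hω, ℓ, hℓ, rfl⟩, ?_⟩
      rw [splitVertices_eq, mem_convexHull_image_iff]
      exact ⟨c, hc⟩

theorem continuousOn_lev (m : ℕ) : ContinuousOn (M.lev m) (closure (Ω : Set (Space d))) :=
  continuousOn_finsetSum _ fun i _ => continuousOn_hat i

theorem isSpaceTimeS10_interp (hint : interior (closure (Ω : Set (Space d))) ⊆ Ω) (hh : 0 < h)
    {a : Fin M.N → ℕ → ℝ} (ha : ∀ i, M.p i ∉ Ω → ∀ k, a i k = 0) :
    M.IsSpaceTimeS10 h n (M.interp h n a) := by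
  classical
  refine ⟨⟨?_, ?_⟩, ?_⟩
  · have hsnd : MapsTo Prod.snd (Icc 0 (n * h) ×ˢ closure (Ω : Set (Space d)))
        (closure (Ω : Set (Space d))) := fun z hz => hz.2
    have hlev : ∀ m, ContinuousOn (fun z : ℝ × Space d => M.lev m z.2)
        (Icc 0 (n * h) ×ˢ closure (Ω : Set (Space d))) := fun m =>
      (M.continuousOn_lev m).comp continuousOn_snd hsnd
    refine continuousOn_finsetSum _ fun i _ => ContinuousOn.add ?_ ?_
    · exact continuousOn_const.mul ((continuousOn_hat i).comp continuousOn_snd hsnd)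
    · refine continuousOn_finsetSum _ fun k _ => continuousOn_const.mul ?_
      have h2 : ContinuousOn (fun z : ℝ × Space d => max 0 ((z.1 - k * h) / h))
          (Icc 0 (n * h) ×ˢ closure (Ω : Set (Space d))) :=
        (by fun_prop : Continuous fun z : ℝ × Space d => max 0 ((z.1 - k * h) / h)).continuousOn
      exact ((hlev _).inf h2).sub ((hlev _).inf h2)
  · rintro _ ⟨k, hk, ω, hω, ℓ, hℓ, rfl⟩
    have hind : AffineIndependent ℝ fun q : M.splitLabels k ω ℓ => M.vertex h q :=
      affineIndependent_of_weights
        (β := fun q z => M.interp h n (fun i k => if (i, k) = q then 1 else 0) z)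
        fun c z hc q => weights_of_split hh hk hω hc q
    obtain ⟨φ, hφ0, hφ1, hφ2⟩ := exists_barycentric_coord hind (by
      rw [M.card_splitLabels k hℓ, M.card_elem hω]; simp [add_comm])
    refine ⟨∑ q ∈ M.splitLabels k ω ℓ, a q.1 q.2 • φ q, fun z hz => ?_⟩
    rw [splitVertices_eq, mem_convexHull_image_iff] at hz
    obtain ⟨c, hc⟩ := hz
    rw [interp_of_split hh hk hω hc, affineMap_sum_apply]
    refine Finset.sum_congr rfl fun q hq => ?_
    have : φ q z = c q := eq_of_affineIndependent hind (a := fun q => φ q z) (b := c)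
      ((hφ1 z).trans hc.sum_eq.symm) ((hφ2 z).trans hc.sum_smul.symm) q hq
    change _ = a q.1 q.2 * φ q z
    rw [this, mul_comm]
  · intro t ht x hx
    refine Finset.sum_eq_zero fun i _ => ?_
    by_cases hi : M.p i ∈ Ω
    · have h0 := hat_eq_zero_of_mem_frontier hint hi hx
      simp [h0, M.cut_eq_zero h0]
    · simp [ha i hi]

theorem eq_interp_of_isSpaceTimeS10 (hh : 0 < h) (hn : 1 ≤ n) {w : ℝ × Space d → ℝ}
    (hw : M.IsSpaceTimeS10 h n w) {z : ℝ × Space d}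
    (hz : z ∈ Icc 0 (n * h) ×ˢ closure (Ω : Set (Space d))) :
    w z = M.interp h n (fun i k => w (k * h, M.p i)) z := by
  obtain ⟨K, hK, htK⟩ := exists_slab hh hn hz.1
  obtain ⟨ω, hω, hxω⟩ := M.exists_mem_simplex hz.2
  obtain ⟨ℓ, hℓ, c, hc⟩ := exists_split_of_mem hh hω htK hxω
  obtain ⟨a, ha⟩ := hw.1.2 _ ⟨K, hK, ω, hω, ℓ, hℓ, rfl⟩
  rw [splitVertices_eq] at ha
  rw [show z = (z.1, z.2) from rfl, interp_of_split hh hK hω hc,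
    ha (mem_convexHull_image_iff.2 ⟨c, hc⟩), ← hc.sum_smul, affineMap_sum_smul a hc.sum_eq]
  refine Finset.sum_congr rfl fun q hq => ?_
  rw [← ha (subset_convexHull ℝ _ ⟨q, hq, rfl⟩)]
  rfl

end SpatialMesh

end

section

variable {d : ℕ} {Ω : Opens (Space d)}

/-! ### Lipschitz domains -/

/-- Near `z`, the set `Ω` is the region above the graph `η = 0` in the direction `e`. -/
structure IsChart (Ω : Opens (Space d)) (z : Space d) (r : ℝ) (Λ : ℝ≥0) (e : Space d)
    (η : Space d → ℝ) : Prop where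
  norm_eq : ‖e‖ = 1
  lipschitz : LipschitzWith Λ η
  add_smul : ∀ y t, η (y + t • e) = η y + t
  mem_iff : ∀ y ∈ Metric.ball z r, y ∈ Ω ↔ 0 < η y

theorem IsChart.mono {z z' : Space d} {r r' : ℝ} {Λ Λ' : ℝ≥0} {e : Space d} {η : Space d → ℝ}
    (h : IsChart Ω z r Λ e η) (hb : Metric.ball z' r' ⊆ Metric.ball z r) (hΛ : Λ ≤ Λ') :
    IsChart Ω z' r' Λ' e η :=
  ⟨h.norm_eq, h.lipschitz.weaken hΛ, h.add_smul, fun y hy => h.mem_iff y (hb hy)⟩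

/-- Take `η y = ⟨e, y⟩ - g (y - ⟨e, y⟩ e)`. It is Lipschitz on the whole space and grows at unit
rate along `e`. In this form a chart can be recentred at nearby points, which gives uniform
constants by compactness. -/
theorem exists_isChart (hL : HasLipschitzBoundary (Ω : Set (Space d))) {z : Space d}
    (hz : z ∈ frontier (Ω : Set (Space d))) :
    ∃ r > 0, ∃ Λ e η, IsChart Ω z r Λ e η := by
  obtain ⟨e, r, L, g, he, hr, hg, h⟩ := hL z hz
  have he2 : inner ℝ e e = (1 : ℝ) := by rw [real_inner_self_eq_norm_sq, he, one_pow]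
  have h1 : LipschitzWith 1 fun y : Space d => inner ℝ e y := by
    refine LipschitzWith.of_dist_le_mul fun x y => ?_
    rw [Real.dist_eq, ← inner_sub_right, NNReal.coe_one, dist_eq_norm]
    exact (abs_real_inner_le_norm _ _).trans (by rw [he])
  have h2 : LipschitzWith (1 + 1) fun y : Space d => y - inner ℝ e y • e := by
    refine LipschitzWith.id.sub (LipschitzWith.of_dist_le_mul fun x y => ?_)
    rw [dist_eq_norm, ← sub_smul, norm_smul, he, mul_one, ← dist_eq_norm]
    exact h1.dist_le_mul x y
  refine ⟨r, hr, 1 + L * (1 + 1), e, fun y => inner ℝ e y - g (y - inner ℝ e y • e), he,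
    h1.sub (hg.comp h2), fun y t => ?_, fun y hy => ?_⟩
  · have h3 : y + t • e - inner ℝ e (y + t • e) • e = y - inner ℝ e y • e := by
      rw [inner_add_right, real_inner_smul_right, he2, mul_one, add_smul]
      abel
    simp only [h3]
    rw [inner_add_right, real_inner_smul_right, he2, mul_one]
    ring
  · rw [sub_pos]
    exact h y hy

/-- Charts exist at all boundary points with uniform constants. -/
theorem exists_uniform_chart (hb : Bornology.IsBounded (Ω : Set (Space d)))
    (hL : HasLipschitzBoundary (Ω : Set (Space d))) :
    ∃ r > 0, ∃ Λ : ℝ≥0, ∀ z ∈ frontier (Ω : Set (Space d)), ∃ e η, IsChart Ω z r Λ e η := by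
  have hc : IsCompact (frontier (Ω : Set (Space d))) :=
    hb.isCompact_closure.of_isClosed_subset isClosed_frontier frontier_subset_closure
  refine hc.induction_on (p := fun s => ∃ r > 0, ∃ Λ : ℝ≥0, ∀ z ∈ s, ∃ e η, IsChart Ω z r Λ e η)
    ⟨1, one_pos, 0, by simp⟩ ?_ ?_ ?_
  · rintro s t hst ⟨r, hr, Λ, h⟩
    exact ⟨r, hr, Λ, fun z hz => h z (hst hz)⟩
  · rintro s t ⟨r, hr, Λ, h⟩ ⟨r', hr', Λ', h'⟩
    refine ⟨min r r', lt_min hr hr', max Λ Λ', ?_⟩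
    rintro z (hz | hz)
    · obtain ⟨e, η, hc⟩ := h z hz
      exact ⟨e, η, hc.mono (Metric.ball_subset_ball (min_le_left _ _)) (le_max_left _ _)⟩
    · obtain ⟨e, η, hc⟩ := h' z hz
      exact ⟨e, η, hc.mono (Metric.ball_subset_ball (min_le_right _ _)) (le_max_right _ _)⟩
  · intro x hx
    obtain ⟨r, hr, Λ, e, η, h⟩ := exists_isChart hL hx
    refine ⟨Metric.ball x (r / 2), mem_nhdsWithin_of_mem_nhds (Metric.ball_mem_nhds x (by positivity)),
      r / 2, by positivity, Λ, fun z hz => ⟨e, η, h.mono ?_ le_rfl⟩⟩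
    intro y hy
    rw [Metric.mem_ball] at *
    linarith [dist_triangle y z x]

namespace IsChart

variable {z : Space d} {r : ℝ} {Λ : ℝ≥0} {e : Space d} {η : Space d → ℝ}

theorem abs_sub_le (h : IsChart Ω z r Λ e η) (x y : Space d) : |η x - η y| ≤ Λ * ‖x - y‖ := by
  have := h.lipschitz.dist_le_mul x y
  rwa [Real.dist_eq, dist_eq_norm] at this

theorem nonneg_of_mem_closure (h : IsChart Ω z r Λ e η) {y : Space d} (hy : y ∈ Metric.ball z r)
    (hyc : y ∈ closure (Ω : Set (Space d))) : 0 ≤ η y := by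
  by_contra hlt
  push Not at hlt
  have h1 : ∀ᶠ x in nhds y, x ∈ Metric.ball z r ∧ η x < 0 :=
    Filter.Eventually.and (p := fun x => x ∈ Metric.ball z r) (Metric.isOpen_ball.mem_nhds hy)
      (h.lipschitz.continuous.continuousAt.eventually (gt_mem_nhds hlt))
  obtain ⟨x, hx, hxΩ⟩ := (mem_closure_iff_nhds.1 hyc _ h1)
  exact absurd ((h.mem_iff x hx.1).1 hxΩ) (not_lt.2 hx.2.le)

theorem eq_zero_of_mem_frontier (h : IsChart Ω z r Λ e η) {y : Space d}
    (hy : y ∈ Metric.ball z r) (hyf : y ∈ frontier (Ω : Set (Space d))) : η y = 0 := by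
  refine le_antisymm ?_ (h.nonneg_of_mem_closure hy (frontier_subset_closure hyf))
  rw [Ω.isOpen.frontier_eq] at hyf
  exact not_lt.1 fun h1 => hyf.2 ((h.mem_iff y hy).2 h1)

theorem mem_closure_of_nonneg (h : IsChart Ω z r Λ e η) {y : Space d} (hy : y ∈ Metric.ball z r)
    (h0 : 0 ≤ η y) : y ∈ closure (Ω : Set (Space d)) := by
  have hc : Filter.Tendsto (fun t : ℝ => y + t • e) (nhdsWithin 0 (Ioi 0)) (nhds y) := by
    have : Continuous fun t : ℝ => y + t • e := by fun_prop
    have h1 := this.tendsto 0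
    rw [zero_smul, add_zero] at h1
    exact h1.mono_left nhdsWithin_le_nhds
  refine mem_closure_of_tendsto hc ?_
  filter_upwards [hc.eventually (Metric.isOpen_ball.mem_nhds hy), self_mem_nhdsWithin] with t ht ht0
  refine (h.mem_iff _ ht).2 ?_
  rw [h.add_smul]
  have : (0 : ℝ) < t := ht0
  linarith

theorem mem_frontier_of_eq_zero (h : IsChart Ω z r Λ e η) {y : Space d}
    (hy : y ∈ Metric.ball z r) (h0 : η y = 0) : y ∈ frontier (Ω : Set (Space d)) := by
  rw [Ω.isOpen.frontier_eq]
  exact ⟨h.mem_closure_of_nonneg hy h0.ge, fun h1 => absurd ((h.mem_iff y hy).1 h1) (by rw [h0]; exact lt_irrefl _)⟩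

end IsChart

/-- From a boundary point one leaves the closure in the direction `-e`, because `η` becomes
negative: `Ω` lies on one side of its boundary, without slits. -/
theorem interior_closure_subset (hL : HasLipschitzBoundary (Ω : Set (Space d))) :
    interior (closure (Ω : Set (Space d))) ⊆ Ω := by
  intro x hx
  by_contra hxΩ
  have hxf : x ∈ frontier (Ω : Set (Space d)) := by
    rw [Ω.isOpen.frontier_eq]
    exact ⟨interior_subset hx, hxΩ⟩
  obtain ⟨r, hr, Λ, e, η, h⟩ := exists_isChart hL hxf
  have h0 : η x = 0 := h.eq_zero_of_mem_frontier (Metric.mem_ball_self hr) hxf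
  have hc : Filter.Tendsto (fun t : ℝ => x + t • e) (nhdsWithin 0 (Iio 0)) (nhds x) := by
    have : Continuous fun t : ℝ => x + t • e := by fun_prop
    have h1 := this.tendsto 0
    rw [zero_smul, add_zero] at h1
    exact h1.mono_left nhdsWithin_le_nhds
  obtain ⟨t, ⟨h1, h2⟩, h3⟩ := ((hc.eventually ((Metric.ball_mem_nhds x hr))).and
    (hc.eventually (isOpen_interior.mem_nhds hx)) |>.and self_mem_nhdsWithin).exists
  have h4 := h.nonneg_of_mem_closure h1 (interior_subset h2)
  rw [h.add_smul, h0, zero_add] at h4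
  exact absurd h3 (not_lt.2 h4)

/-! ### Piecewise Lipschitz functions -/

/-- Comparison of lower right slopes. If points of some `C j` accumulate at `x` from the right, then
`x` is in the closed set `C j` as well, and the slopes to these points are at most `B`. Otherwise
`φ` vanishes just to the right of `x`, by continuity also at `x`, and the slope is 0. -/
theorem sub_le_of_finite_closed_cover {ι : Type*} {s : Finset ι} {C : ι → Set ℝ}
    (hC : ∀ j ∈ s, IsClosed (C j)) {φ : ℝ → ℝ} (hφ : ContinuousOn φ (Icc 0 1)) {B : ℝ}
    (hB : 0 ≤ B)
    (hlip : ∀ j ∈ s, ∀ u ∈ C j ∩ Icc 0 1, ∀ v ∈ C j ∩ Icc 0 1, |φ u - φ v| ≤ B * |u - v|)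
    (hout : ∀ u ∈ Icc (0 : ℝ) 1, (∀ j ∈ s, u ∉ C j) → φ u = 0) : φ 1 - φ 0 ≤ B := by
  have key := image_le_of_liminf_slope_right_le_deriv_boundary (f := φ) (a := 0) (b := 1) hφ
    (B := fun t => φ 0 + B * t) (B' := fun _ => B) (by simp) (by fun_prop)
    (fun x _ => by simpa using (((hasDerivAt_id x).const_mul B).const_add (φ 0)).hasDerivWithinAt)
    ?_ (x := 1) (by simp)
  · linarith
  intro x hx r hr
  have hIcc : ∀ᶠ u in nhdsWithin x (Ioi x), u ∈ Ioc x 1 := by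
    filter_upwards [Ioo_mem_nhdsGT hx.2] with u hu using ⟨hu.1, hu.2.le⟩
  by_cases hfreq : ∃ j ∈ s, ∃ᶠ u in nhdsWithin x (Ioi x), u ∈ C j
  · obtain ⟨j, hj, hfj⟩ := hfreq
    have hxC : x ∈ C j := by
      rw [← (hC j hj).closure_eq]
      exact mem_closure_of_frequently_of_tendsto hfj
        (Filter.tendsto_id.mono_left nhdsWithin_le_nhds)
    refine (hfj.and_eventually hIcc).mono fun u ⟨hu1, hu2⟩ => ?_
    have h1 := hlip j hj u ⟨hu1, hx.1.trans hu2.1.le, hu2.2⟩ x ⟨hxC, hx.1, hx.2.le⟩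
    have h2 : 0 < u - x := sub_pos.2 hu2.1
    rw [slope_def_field]
    refine lt_of_le_of_lt ?_ hr
    rw [div_le_iff₀ h2]
    rw [abs_of_pos h2] at h1
    exact (le_abs_self _).trans h1
  · push Not at hfreq
    have hev : ∀ᶠ u in nhdsWithin x (Ioi x), ∀ j ∈ s, u ∉ C j := by
      rw [Filter.eventually_all_finset]
      exact fun j hj => hfreq j hj
    have hz : ∀ᶠ u in nhdsWithin x (Ioi x), φ u = 0 := by
      filter_upwards [hev, hIcc] with u hu1 hu2
      exact hout u ⟨hx.1.trans hu2.1.le, hu2.2⟩ hu1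
    have hx0 : φ x = 0 := by
      have h1 : Filter.Tendsto φ (nhdsWithin x (Ioi x)) (nhds (φ x)) := by
        refine (hφ x ⟨hx.1, hx.2.le⟩).mono_left ?_
        exact (nhdsWithin_le_iff.2 (hIcc.mono fun u hu => ⟨hx.1.trans hu.1.le, hu.2⟩))
      exact tendsto_nhds_unique (h1.congr' hz) tendsto_const_nhds
    refine (hz.mono fun u hu => ?_).frequently
    rw [slope_def_field, hu, hx0, sub_zero, zero_div]
    linarith

/-- A function that is Lipschitz on finitely many closed sets, and vanishes on the rest of a
segment, is Lipschitz along the segment. -/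
theorem abs_sub_le_of_segment {ι : Type*} {s : Finset ι} {K : ι → Set (Space d)}
    (hK : ∀ j ∈ s, IsClosed (K j)) {f : Space d → ℝ} {L : ℝ} (hL : 0 ≤ L) {x y : Space d}
    (hlip : ∀ j ∈ s, ∀ u ∈ K j, ∀ v ∈ K j, |f u - f v| ≤ L * ‖u - v‖)
    (hc : ContinuousOn f (segment ℝ x y))
    (hout : ∀ u ∈ segment ℝ x y, (∀ j ∈ s, u ∉ K j) → f u = 0) :
    |f y - f x| ≤ L * ‖y - x‖ := by
  have hline : Continuous fun t : ℝ => (AffineMap.lineMap x y t : Space d) :=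
    AffineMap.lineMap_continuous
  have hmem : ∀ t ∈ Icc (0 : ℝ) 1, (AffineMap.lineMap x y t : Space d) ∈ segment ℝ x y :=
    fun t ht => by
      rw [segment_eq_image_lineMap]
      exact ⟨t, ht, rfl⟩
  have hdist : ∀ u v : ℝ, ‖(AffineMap.lineMap x y u : Space d) - AffineMap.lineMap x y v‖ =
      |u - v| * ‖y - x‖ := fun u v => by
    rw [AffineMap.lineMap_apply, AffineMap.lineMap_apply]
    simp only [vsub_eq_sub, vadd_eq_add, add_sub_add_right_eq_sub, ← sub_smul, norm_smul,
      Real.norm_eq_abs]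
  have key : ∀ g : Space d → ℝ, (∀ j ∈ s, ∀ u ∈ K j, ∀ v ∈ K j, |g u - g v| ≤ L * ‖u - v‖) →
      ContinuousOn g (segment ℝ x y) →
      (∀ u ∈ segment ℝ x y, (∀ j ∈ s, u ∉ K j) → g u = 0) → g y - g x ≤ L * ‖y - x‖ := by
    intro g hg1 hg2 hg3
    have h := sub_le_of_finite_closed_cover (s := s)
      (C := fun j => (fun t : ℝ => (AffineMap.lineMap x y t : Space d)) ⁻¹' K j)
      (fun j hj => (hK j hj).preimage hline)
      (φ := fun t => g (AffineMap.lineMap x y t)) (hg2.comp hline.continuousOn hmem)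
      (B := L * ‖y - x‖) (by positivity) (fun j hj u hu v hv => ?_)
      (fun u hu hu' => hg3 _ (hmem u hu) hu')
    · simpa using h
    · refine (hg1 j hj _ hu.1 _ hv.1).trans (le_of_eq ?_)
      rw [hdist]
      ring
  rw [abs_le]
  constructor
  · have := key (fun u => -f u) (fun j hj u hu v hv => by
      rw [← neg_sub', abs_neg]
      exact hlip j hj u hu v hv) hc.neg fun u hu hu' => by
      rw [hout u hu hu', neg_zero]
    linarith
  · exact key f hlip hc hout

theorem lipschitzWith_of_finite_closed_cover {ι : Type*} {s : Finset ι} {K : ι → Set (Space d)}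
    (hK : ∀ j ∈ s, IsClosed (K j)) {f : Space d → ℝ} {L : ℝ≥0}
    (hlip : ∀ j ∈ s, ∀ u ∈ K j, ∀ v ∈ K j, |f u - f v| ≤ L * ‖u - v‖) (hc : Continuous f)
    (hout : ∀ u, (∀ j ∈ s, u ∉ K j) → f u = 0) : LipschitzWith L f :=
  LipschitzWith.of_dist_le_mul fun x y => by
    rw [Real.dist_eq, dist_eq_norm]
    exact abs_sub_le_of_segment hK L.2 hlip hc.continuousOn fun u _ => hout u

/-- A function that is continuous on the closure of `Ω` and vanishes off `Ω` is continuous. -/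
theorem continuous_of_continuousOn_closure {f : Space d → ℝ}
    (hf : ContinuousOn f (closure (Ω : Set (Space d)))) (h0 : ∀ x ∉ Ω, f x = 0) :
    Continuous f := by
  have h1 : ContinuousOn f ((Ω : Set (Space d))ᶜ) :=
    continuousOn_const.congr fun x hx => h0 x hx
  have h2 := hf.union_of_isClosed h1 isClosed_closure Ω.isOpen.isClosed_compl
  rw [← continuousOn_univ]
  refine h2.mono fun x _ => ?_
  by_cases hx : x ∈ (Ω : Set (Space d))
  · exact Or.inl (subset_closure hx)
  · exact Or.inr hx

/-! ### Uniform meshes -/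

/-- The oscillation on a ball determines the slope; testing with a point at distance `ρ / 2` from
the centre gives the factor 2. -/
theorem abs_linear_le_of_ball {a : Space d →ᵃ[ℝ] ℝ} {c : Space d} {ρ : ℝ} (hρ : 0 < ρ) {m : ℝ}
    (h : ∀ x ∈ Metric.ball c ρ, ∀ y ∈ Metric.ball c ρ, |a x - a y| ≤ m) (x y : Space d) :
    |a x - a y| ≤ 2 * m / ρ * ‖x - y‖ := by
  have hm : 0 ≤ m := (abs_nonneg _).trans (h c (Metric.mem_ball_self hρ) c (Metric.mem_ball_self hρ))
  by_cases hxy : x = y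
  · simp [hxy]
  have hn : 0 < ‖x - y‖ := norm_pos_iff.2 (sub_ne_zero.2 hxy)
  have e : ∀ u v : Space d, a u - a v = a.linear (u - v) := fun u v => by
    rw [← vsub_eq_sub u v, AffineMap.linearMap_vsub, vsub_eq_sub]
  have hmem : c + (ρ / (2 * ‖x - y‖)) • (x - y) ∈ Metric.ball c ρ := by
    rw [mem_ball_iff_norm, add_sub_cancel_left, norm_smul, Real.norm_of_nonneg (by positivity)]
    have : ρ / (2 * ‖x - y‖) * ‖x - y‖ = ρ / 2 := by field_simp
    rw [this]
    linarith
  have h1 := h _ hmem c (Metric.mem_ball_self hρ)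
  rw [e, add_sub_cancel_left, map_smul, smul_eq_mul, abs_mul, abs_of_pos (by positivity)] at h1
  rw [e]
  have h2 : |a.linear (x - y)| = ρ / (2 * ‖x - y‖) * |a.linear (x - y)| * (2 / ρ * ‖x - y‖) := by
    field_simp
  rw [h2]
  calc ρ / (2 * ‖x - y‖) * |a.linear (x - y)| * (2 / ρ * ‖x - y‖) ≤ m * (2 / ρ * ‖x - y‖) := by
        gcongr
    _ = 2 * m / ρ * ‖x - y‖ := by ring

namespace SpatialMesh

variable {M : SpatialMesh Ω} {γ h : ℝ} {ω : Finset (Fin M.N)}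

theorem IsUniform.exists_ball (hM : M.IsUniform γ h) (hω : ω ∈ M.elems) :
    ∃ c, Metric.ball c (h / γ) ⊆ M.simplex ω := (hM _ ⟨ω, hω, rfl⟩).2

theorem IsUniform.norm_sub_le (hM : M.IsUniform γ h) (hω : ω ∈ M.elems) {x y : Space d}
    (hx : x ∈ M.simplex ω) (hy : y ∈ M.simplex ω) : ‖x - y‖ ≤ γ * h := by
  rw [← dist_eq_norm]
  exact (Metric.dist_le_diam_of_mem (M.isCompact_simplex ω).isBounded hx hy).trans
    (hM _ ⟨ω, hω, rfl⟩).1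

/-- The coordinates take values in `[0, 1]` on the inscribed ball of radius `h / γ`. -/
theorem abs_coord_sub_le (hM : M.IsUniform γ h) (hγ : 0 < γ) (hh : 0 < h) (hω : ω ∈ M.elems)
    (i : Fin M.N) (x y : Space d) :
    |M.coord ω i x - M.coord ω i y| ≤ 2 * γ / h * ‖x - y‖ := by
  obtain ⟨c, hc⟩ := hM.exists_ball hω
  have h1 := abs_linear_le_of_ball (a := M.coord ω i) (c := c) (ρ := h / γ) (by positivity)
    (m := 1) (fun x hx y hy => ?_) x y
  · convert h1 using 2
    field_simp
  · rw [coord_eq_hat hω (hc hx), coord_eq_hat hω (hc hy), abs_le]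
    have h2 : ∀ x, M.hat i x ≤ 1 := fun x =>
      (Finset.single_le_sum (f := fun i => M.hat i x) (fun j _ => M.hat_nonneg j x)
        (Finset.mem_univ i)).trans (M.sum_hat_le_one x)
    constructor <;> linarith [h2 x, h2 y, M.hat_nonneg i x, M.hat_nonneg i y]

theorem abs_hat_sub_le (hM : M.IsUniform γ h) (hγ : 0 < γ) (hh : 0 < h) (hω : ω ∈ M.elems)
    (i : Fin M.N) {x y : Space d} (hx : x ∈ M.simplex ω) (hy : y ∈ M.simplex ω) :
    |M.hat i x - M.hat i y| ≤ 2 * γ / h * ‖x - y‖ := by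
  rw [← coord_eq_hat hω hx, ← coord_eq_hat hω hy]
  exact abs_coord_sub_le hM hγ hh hω i x y

/-- Close to a boundary vertex, its hat function is positive. -/
theorem hat_pos_of_near (hM : M.IsUniform γ h) (hγ : 0 < γ) (hh : 0 < h) {i : Fin M.N} {r : ℝ}
    {Λ : ℝ≥0} {e : Space d} {η : Space d → ℝ} (hc : IsChart Ω (M.p i) r Λ e η) {x : Space d}
    (hx : x ∈ closure (Ω : Set (Space d))) (hxr : (Λ + 1) * ‖x - M.p i‖ < r)
    (hxh : 2 * γ / h * ((2 * Λ + 1) * ‖x - M.p i‖) < 1) : 0 < M.hat i x := by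
  set p := M.p i with hp
  set δ := ‖x - p‖ with hδ
  have hδ0 : 0 ≤ δ := norm_nonneg _
  have hΛ : (0 : ℝ) ≤ Λ := Λ.2
  have hr : 0 < r := lt_of_le_of_lt (by positivity) hxr
  have hpball : p ∈ Metric.ball p r := Metric.mem_ball_self hr
  have hxball : x ∈ Metric.ball p r := by
    rw [mem_ball_iff_norm]
    nlinarith
  have hηp : 0 ≤ η p := hc.nonneg_of_mem_closure hpball (M.vertex_mem_closure i)
  have hηx : 0 ≤ η x := hc.nonneg_of_mem_closure hxball hx
  have hseg : ∀ u v : Space d, segment ℝ u v ⊆ closure (Ω : Set (Space d)) →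
      |M.hat i v - M.hat i u| ≤ 2 * γ / h * ‖v - u‖ := fun u v huv =>
    abs_sub_le_of_segment (s := M.elems) (K := M.simplex) (fun ω _ => M.isClosed_simplex ω)
      (by positivity) (fun ω hω u hu v hv => abs_hat_sub_le hM hγ hh hω i hu hv)
      ((continuousOn_hat i).mono huv) (fun w hw hw' => by
        obtain ⟨ω, hω, hwω⟩ := M.exists_mem_simplex (huv hw)
        exact absurd hwω (hw' ω hω))
  -- The segment from `p` to `x` may leave the closure of `Ω`. The detour goes up by `Λ * δ` along
  -- `e`, across, and down again; `η` is nonnegative on it. Its length is `(2 * Λ + 1) * δ`, so the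
  -- hat function drops from 1 by less than 1.
  have hball : ∀ t ∈ Icc (0 : ℝ) 1, ∀ s ∈ Icc (0 : ℝ) (Λ * δ),
      p + t • (x - p) + s • e ∈ Metric.ball p r := by
    intro t ht s hs
    rw [mem_ball_iff_norm, add_assoc, add_sub_cancel_left]
    refine (norm_add_le _ _).trans_lt ?_
    rw [norm_smul, norm_smul, hc.norm_eq, Real.norm_of_nonneg ht.1, Real.norm_of_nonneg hs.1]
    nlinarith [ht.2, hs.2]
  have hL0 : 0 ≤ Λ * δ := by positivity
  have vert : ∀ y : Space d, ∀ t ∈ Icc (0 : ℝ) 1, y = p + t • (x - p) → 0 ≤ η y →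
      segment ℝ y (y + (Λ * δ) • e) ⊆ closure (Ω : Set (Space d)) := by
    intro y t ht hy hηy u hu
    rw [segment_eq_image'] at hu
    obtain ⟨θ, hθ, rfl⟩ := hu
    simp only [add_sub_cancel_left, smul_smul]
    refine hc.mem_closure_of_nonneg ?_ ?_
    · rw [hy]
      exact hball t ht _ ⟨mul_nonneg hθ.1 hL0, mul_le_of_le_one_left hL0 hθ.2⟩
    · rw [hc.add_smul]
      have := mul_nonneg hθ.1 hL0
      linarith
  have h1 := hseg _ _ (vert p 0 (by simp) (by simp) hηp)
  have h3 := hseg _ _ (vert x 1 (by simp) (by simp) hηx)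
  have h2 := hseg (p + (Λ * δ) • e) (x + (Λ * δ) • e) (by
    intro u hu
    rw [segment_eq_image'] at hu
    obtain ⟨θ, hθ, rfl⟩ := hu
    have e1 : p + (Λ * δ) • e + θ • (x + (Λ * δ) • e - (p + (Λ * δ) • e)) =
        p + θ • (x - p) + (Λ * δ) • e := by
      rw [add_sub_add_right_eq_sub]
      abel
    simp only [e1]
    refine hc.mem_closure_of_nonneg (hball θ hθ _ ⟨hL0, le_rfl⟩) ?_
    rw [hc.add_smul]
    have h4 := hc.abs_sub_le (p + θ • (x - p)) p
    rw [add_sub_cancel_left, norm_smul, Real.norm_of_nonneg hθ.1] at h4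
    have h5 := (abs_le.1 h4).1
    have h6 : Λ * (θ * ‖x - p‖) ≤ Λ * δ := by
      refine mul_le_mul_of_nonneg_left ?_ hΛ
      exact mul_le_of_le_one_left hδ0 hθ.2
    linarith)
  rw [add_sub_cancel_left, norm_smul, hc.norm_eq, Real.norm_of_nonneg hL0, mul_one] at h1 h3
  rw [add_sub_add_right_eq_sub, ← hδ] at h2
  have hone : M.hat i p = 1 := by rw [hp, M.hat_vertex, if_pos rfl]
  have h4 := (abs_le.1 h1).1
  have h5 := (abs_le.1 h2).1
  have h6 := (abs_le.1 h3).2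
  have : 2 * γ / h * ((2 * Λ + 1) * δ) = 2 * γ / h * (Λ * δ) + 2 * γ / h * δ + 2 * γ / h * (Λ * δ) := by
    ring
  linarith

/-- Close to a boundary vertex, the boundary is a cone. -/
theorem midpoint_mem_frontier (hint : interior (closure (Ω : Set (Space d))) ⊆ Ω) {i : Fin M.N}
    {x : Space d} (hx : x ∈ frontier (Ω : Set (Space d))) (hpos : 0 < M.hat i x) :
    M.p i + (1 / 2 : ℝ) • (x - M.p i) ∈ frontier (Ω : Set (Space d)) := by
  have e : M.p i + (1 / 2 : ℝ) • (x - M.p i) = AffineMap.lineMap (M.p i) x (1 / 2 : ℝ) := by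
    rw [AffineMap.lineMap_apply, vsub_eq_sub, vadd_eq_add, add_comm]
  have hxc := frontier_subset_closure hx
  rw [Ω.isOpen.frontier_eq] at hx ⊢
  refine ⟨?_, fun hmem => hx.2 ?_⟩
  · obtain ⟨ω, hω, hxω⟩ := M.exists_mem_simplex hxc
    have hi : i ∈ ω := M.mem_elem_of_hat_ne_zero hω hxω hpos.ne'
    rw [e]
    exact M.simplex_subset hω ((M.convex_simplex ω).lineMap_mem
      (subset_convexHull ℝ _ ⟨i, hi, rfl⟩) hxω (by norm_num))
  · rw [e] at hmem
    exact mem_of_mem_homothety hint hxc hpos (by norm_num) (by norm_num) hmem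

end SpatialMesh

end

section

variable {d : ℕ} {Ω : Opens (Space d)}

/-! ### The trace of `H¹₀` functions near a boundary vertex -/

/-- Restriction of square integrable functions to a smaller open set. -/
def restrictL2 {A : Opens (Space d)} (hA : A ≤ Ω) : L2 Ω →L[ℝ] L2 A :=
  LinearMap.mkContinuous
    { toFun := fun f => toL2 A f
      map_add' := fun f g => by
        rw [← toL2_add (memLp_L2_of_subset f hA) (memLp_L2_of_subset g hA)]
        have h := ae_restrict_of_ae_restrict_of_subset (s := A) hA (Lp.coeFn_add f g)
        have h1 : MemLp (fun x => f x + g x) 2 (volume.restrict (A : Set (Space d))) :=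
          (memLp_L2_of_subset f hA).add (memLp_L2_of_subset g hA)
        rw [toL2, toL2, dif_pos h1, dif_pos (memLp_L2_of_subset (f + g) hA)]
        exact MemLp.toLp_congr _ _ h
      map_smul' := fun c f => by
        have h := ae_restrict_of_ae_restrict_of_subset (s := A) hA (Lp.coeFn_smul c f)
        have h1 : MemLp (fun x => c * f x) 2 (volume.restrict (A : Set (Space d))) :=
          (memLp_L2_of_subset f hA).const_mul c
        rw [RingHom.id_apply, ← toL2_const_mul c (memLp_L2_of_subset f hA), toL2, toL2,
          dif_pos h1, dif_pos (memLp_L2_of_subset (c • f) hA)]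
        exact MemLp.toLp_congr _ _ h } 1 fun f => by
    rw [one_mul]
    refine (pow_le_pow_iff_left₀ (norm_nonneg _) (norm_nonneg _) two_ne_zero).1 ?_
    change ‖toL2 A f‖ ^ 2 ≤ _
    rw [norm_sq_toL2 (memLp_L2_of_subset f hA), norm_sq_L2]
    exact setIntegral_sq_mono hA (memLp_L2 f)

theorem restrictL2_apply {A : Opens (Space d)} (hA : A ≤ Ω) (f : L2 Ω) :
    restrictL2 hA f = toL2 A f := rfl

theorem sq_intervalIntegral_le {k : ℝ → ℝ} (hk : Continuous k) {b : ℝ} (hb : 0 ≤ b) :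
    (∫ t in (0 : ℝ)..b, k t) ^ 2 ≤ b * ∫ t in Ioo 0 b, k t ^ 2 := by
  have hm : ∀ {u : ℝ → ℝ}, Continuous u → MemLp u 2 (volume.restrict (Ioo 0 b)) := by
    intro u hu
    obtain ⟨C, hC⟩ := isCompact_Icc.exists_bound_of_continuousOn (s := Icc 0 b) hu.continuousOn
    exact MemLp.of_bound hu.aestronglyMeasurable C
      ((ae_restrict_mem measurableSet_Ioo).mono fun t ht => hC t (Ioo_subset_Icc_self ht))
  have h := abs_integral_mul_le_sqrt (hm hk) (hm (continuous_const (y := (1 : ℝ))))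
  simp only [mul_one, one_pow, integral_const, smul_eq_mul, measureReal_restrict_apply_univ,
    Real.volume_real_Ioo_of_le hb, sub_zero] at h
  rw [intervalIntegral.integral_of_le hb, integral_Ioc_eq_integral_Ioo, ← sq_abs]
  refine (pow_le_pow_left₀ (abs_nonneg _) h 2).trans (le_of_eq ?_)
  rw [mul_pow, Real.sq_sqrt hb, Real.sq_sqrt (integral_nonneg fun _ => sq_nonneg _), mul_comm]

/-- `A` is a strip of width `s` above the graph `η = 0`, which is in the boundary of `Ω`. -/
structure IsStrip (Ω A : Opens (Space d)) (s : ℝ) (e : Space d) (η : Space d → ℝ) : Prop where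
  continuous : Continuous η
  pos : ∀ x ∈ A, 0 < η x
  le : ∀ x ∈ A, η x ≤ s
  notMem : ∀ x ∈ A, x - η x • e ∉ Ω
  mem : ∀ x ∈ A, ∀ t ∈ Ico 0 (η x), x - t • e ∈ A

/-- The test function vanishes at the foot `x - η x • e`. Integrate its derivative from there to `x`
along `e`, with the constant slope `g` subtracted, and apply Cauchy-Schwarz. The indicator allows
the range of integration to be enlarged to `(0, s)`, which no longer depends on `x`. -/
theorem IsStrip.sq_le_integral {A : Opens (Space d)} {s : ℝ} {e : Space d} {η : Space d → ℝ}
    (hA : IsStrip Ω A s e η) (φ : 𝓓(Ω, ℝ)) (g : ℝ) {x : Space d} (hx : x ∈ A) :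
    (φ x - η x * g) ^ 2 ≤ s * ∫ t in Ioo 0 s,
      indicator (A : Set (Space d)) (fun y => (fderiv ℝ φ y e - g) ^ 2) (x - t • e) := by
  have hφ1 : ContDiff ℝ 1 φ := φ.contDiff.of_le (by exact_mod_cast le_top)
  have hc : Continuous fun y => fderiv ℝ φ y e - g :=
    ((hφ1.continuous_fderiv (by simp)).clm_apply continuous_const).sub continuous_const
  have hk : Continuous fun t : ℝ => fderiv ℝ φ (x - t • e) e - g := hc.comp (by fun_prop)
  have hη := (hA.pos x hx).le
  have h0 : φ (x - η x • e) = 0 :=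
    image_eq_zero_of_notMem_tsupport fun h => hA.notMem x hx (φ.tsupport_subset h)
  have hd : ∀ t : ℝ, HasDerivAt (fun t : ℝ => -φ (x - t • e) - t * g)
      (fderiv ℝ φ (x - t • e) e - g) t := by
    intro t
    have h1 : HasDerivAt (fun s : ℝ => x - s • e) (-e) t := by
      simpa using ((hasDerivAt_id t).smul_const e).const_sub x
    have h2 := ((hφ1.differentiable (by simp) (x - t • e)).hasFDerivAt).comp_hasDerivAt t h1
    have h3 := h2.neg.sub ((hasDerivAt_id t).mul_const g)
    refine HasDerivAt.congr_deriv (f := fun t : ℝ => -φ (x - t • e) - t * g) h3 ?_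
    simp
  have hint := intervalIntegral.integral_eq_sub_of_hasDerivAt (a := 0) (b := η x)
    (fun t _ => hd t) (hk.intervalIntegrable _ _)
  simp only [h0, zero_smul, sub_zero, zero_mul, neg_zero, sub_neg_eq_add] at hint
  have h4 := sq_intervalIntegral_le hk hη
  rw [hint] at h4
  set F := indicator (A : Set (Space d)) (fun y => (fderiv ℝ φ y e - g) ^ 2) with hF
  have hF0 : ∀ y, 0 ≤ F y := fun y => indicator_nonneg (fun _ _ => sq_nonneg _) y
  obtain ⟨C, hC⟩ : ∃ C, ∀ t ∈ Icc 0 s, ‖(fderiv ℝ φ (x - t • e) e - g) ^ 2‖ ≤ C :=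
    isCompact_Icc.exists_bound_of_continuousOn (hk.pow 2).continuousOn
  have hmeas : Measurable F := (hc.pow 2).measurable.indicator A.isOpen.measurableSet
  have hFi : Integrable (fun t : ℝ => F (x - t • e)) (volume.restrict (Ioo 0 s)) := by
    refine Integrable.of_bound (hmeas.comp (by fun_prop)).aestronglyMeasurable C ?_
    filter_upwards [ae_restrict_mem measurableSet_Ioo] with t ht
    exact (norm_indicator_le_norm_self _ _).trans (hC t (Ioo_subset_Icc_self ht))
  have h5 : ∫ t in Ioo 0 (η x), (fderiv ℝ φ (x - t • e) e - g) ^ 2 ≤ ∫ t in Ioo 0 s, F (x - t • e) := by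
    rw [setIntegral_congr_fun (g := fun t => F (x - t • e)) measurableSet_Ioo fun t ht => ?_]
    · exact setIntegral_mono_set hFi (.of_forall fun _ => hF0 _)
        (Ioo_subset_Ioo_right (hA.le x hx)).eventuallyLE
    · simp only [hF]
      rw [indicator_of_mem]
      exact hA.mem x hx t ⟨ht.1.le, ht.2⟩
  have h6 : φ x - η x * g = -(η x * g) + φ x := by ring
  have h7 : (-(η x * g) + φ x) ^ 2 ≤ η x * ∫ t in Ioo 0 (η x), (fderiv ℝ φ (x - t • e) e - g) ^ 2 := by
    convert h4 using 2
    ring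
  rw [h6]
  refine h7.trans (mul_le_mul (hA.le x hx) h5 (integral_nonneg fun _ => sq_nonneg _)
    (hη.trans (hA.le x hx)))

/-- Integrate the bound along lines over `A` and exchange the integrals. By translation invariance
each slice is at most the integral over `A`, and integrating over `t` yields the second factor `s`.
-/
theorem IsStrip.integral_testFunction_le (hb : Bornology.IsBounded (Ω : Set (Space d)))
    {A : Opens (Space d)} (hAΩ : A ≤ Ω) {s : ℝ} (hs : 0 ≤ s) {e : Space d} {η : Space d → ℝ}
    (hA : IsStrip Ω A s e η) (φ : 𝓓(Ω, ℝ)) (g : ℝ) :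
    ∫ x in (A : Set (Space d)), (φ x - η x * g) ^ 2 ≤
      s ^ 2 * ∫ x in (A : Set (Space d)), (fderiv ℝ φ x e - g) ^ 2 := by
  have hφ1 : ContDiff ℝ 1 φ := φ.contDiff.of_le (by exact_mod_cast le_top)
  have hc : Continuous fun y => fderiv ℝ φ y e - g :=
    ((hφ1.continuous_fderiv (by simp)).clm_apply continuous_const).sub continuous_const
  set F := indicator (A : Set (Space d)) (fun y => (fderiv ℝ φ y e - g) ^ 2) with hF
  have hAb : Bornology.IsBounded (A : Set (Space d)) := hb.subset hAΩ
  have := isFiniteMeasure_restrict hAb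
  obtain ⟨C, hC⟩ := hAb.isCompact_closure.exists_bound_of_continuousOn (hc.pow 2).continuousOn
  have hC0 : ∀ y, ‖F y‖ ≤ max C 0 := by
    intro y
    by_cases hy : y ∈ (A : Set (Space d))
    · rw [hF, indicator_of_mem hy]
      exact (hC y (subset_closure hy)).trans (le_max_left _ _)
    · rw [hF, indicator_of_notMem hy, norm_zero]
      exact le_max_right _ _
  have hF0 : ∀ y, 0 ≤ F y := fun y => indicator_nonneg (fun _ _ => sq_nonneg _) y
  have hmeas : Measurable F := (hc.pow 2).measurable.indicator A.isOpen.measurableSet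
  have hprod : Integrable (Function.uncurry fun (x : Space d) (t : ℝ) => F (x - t • e))
      ((volume.restrict (A : Set (Space d))).prod (volume.restrict (Ioo 0 s))) := by
    refine Integrable.of_bound ?_ (max C 0) (.of_forall fun z => hC0 _)
    exact (hmeas.comp (by fun_prop : Continuous fun z : Space d × ℝ =>
      z.1 - z.2 • e).measurable).aestronglyMeasurable
  have hFint : Integrable F := by
    rw [hF, integrable_indicator_iff A.isOpen.measurableSet]
    exact Integrable.of_bound (hc.pow 2).aestronglyMeasurable C
      ((ae_restrict_mem A.isOpen.measurableSet).mono fun y hy => hC y (subset_closure hy))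
  have h1 : ∫ x in (A : Set (Space d)), (φ x - η x * g) ^ 2 ≤
      ∫ x in (A : Set (Space d)), s * ∫ t in Ioo 0 s, F (x - t • e) := by
    refine integral_mono_of_nonneg (.of_forall fun _ => sq_nonneg _)
      (hprod.integral_prod_left.const_mul s) ?_
    filter_upwards [ae_restrict_mem A.isOpen.measurableSet] with x hx
    exact hA.sq_le_integral φ g hx
  refine h1.trans ?_
  rw [integral_const_mul, integral_integral_swap hprod, sq, mul_assoc]
  refine mul_le_mul_of_nonneg_left ?_ hs
  have h2 : ∀ t : ℝ, ∫ x in (A : Set (Space d)), F (x - t • e) ≤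
      ∫ x in (A : Set (Space d)), (fderiv ℝ φ x e - g) ^ 2 := by
    intro t
    refine (setIntegral_le_integral (hFint.comp_sub_right _) (.of_forall fun _ => hF0 _)).trans
      (le_of_eq ?_)
    rw [integral_sub_right_eq_self F, hF, integral_indicator A.isOpen.measurableSet]
  refine (integral_mono_of_nonneg (.of_forall fun t => integral_nonneg fun _ => hF0 _)
    (integrable_const (∫ x in (A : Set (Space d)), (fderiv ℝ φ x e - g) ^ 2)) (.of_forall h2)).trans
    (le_of_eq ?_)
  rw [integral_const, measureReal_restrict_apply_univ, Real.volume_real_Ioo_of_le hs, sub_zero,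
    smul_eq_mul]

/-- The strip inequality is quadratic and does not pass through sums, so the span has to be
recognized as the set of test jets itself before taking the closure. -/
theorem mem_range_of_mem_span_testJet {V : Jet1 Ω}
    (hV : V ∈ Submodule.span ℝ (Set.range (testJet Ω))) : ∃ φ, testJet Ω φ = V := by
  have hdiff : ∀ φ : 𝓓(Ω, ℝ), Differentiable ℝ φ := fun φ =>
    (φ.contDiff.of_le (m := 1) (by exact_mod_cast le_top)).differentiable (by simp)
  induction hV using Submodule.span_induction with
  | mem x h => exact h
  | zero =>
    refine ⟨0, ?_⟩
    ext1 o
    cases o with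
    | none => exact toL2_zero
    | some i =>
      refine Eq.trans (congrArg (toL2 Ω) ?_) toL2_zero
      funext x
      have h : fderiv ℝ (fun _ : Space d => (0 : ℝ)) x = 0 := fderiv_const_apply 0
      change fderiv ℝ (fun _ : Space d => (0 : ℝ)) x (EuclideanSpace.single i 1) = 0
      rw [h]
      rfl
  | add V W _ _ hV hW =>
    obtain ⟨φ, rfl⟩ := hV
    obtain ⟨ψ, rfl⟩ := hW
    refine ⟨φ + ψ, ?_⟩
    ext1 o
    cases o with
    | none => exact toL2_add (memLp_testFunction φ) (memLp_testFunction ψ)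
    | some i =>
      refine Eq.trans (congrArg (toL2 Ω) ?_) (toL2_add (memLp_partial φ i) (memLp_partial ψ i))
      funext x
      exact congrArg (· (EuclideanSpace.single i 1)) (fderiv_add (hdiff φ x) (hdiff ψ x))
  | smul c V _ hV =>
    obtain ⟨φ, rfl⟩ := hV
    refine ⟨c • φ, ?_⟩
    ext1 o
    cases o with
    | none => exact toL2_const_mul c (memLp_testFunction φ)
    | some i =>
      refine Eq.trans (congrArg (toL2 Ω) ?_) (toL2_const_mul c (memLp_partial φ i))
      funext x
      exact congrArg (· (EuclideanSpace.single i 1)) (fderiv_const_smul (hdiff φ x) c)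

/-- The Friedrichs inequality in a strip. -/
theorem IsStrip.integral_H10_le (hb : Bornology.IsBounded (Ω : Set (Space d)))
    {A : Opens (Space d)} (hAΩ : A ≤ Ω) {s : ℝ} (hs : 0 ≤ s) {e : Space d} {η : Space d → ℝ}
    (hA : IsStrip Ω A s e η) {V : Jet1 Ω} (hV : V ∈ H10 Ω) (g : ℝ) :
    ∫ x in (A : Set (Space d)), (V none x - η x * g) ^ 2 ≤
      s ^ 2 * ∫ x in (A : Set (Space d)), (∑ i, e i * V (some i) x - g) ^ 2 := by
  have hAb : Bornology.IsBounded (A : Set (Space d)) := hb.subset hAΩ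
  have hηm : MemLp (fun x => η x * g) 2 (volume.restrict (A : Set (Space d))) :=
    memLp_of_continuousOn hAb (hA.continuous.mul continuous_const).continuousOn
  have hgm : MemLp (fun _ : Space d => g) 2 (volume.restrict (A : Set (Space d))) :=
    memLp_of_continuousOn hAb continuousOn_const
  have e1 : ∀ W : Jet1 Ω, ‖restrictL2 hAΩ (W none) - toL2 A fun x => η x * g‖ ^ 2 =
      ∫ x in (A : Set (Space d)), (W none x - η x * g) ^ 2 := by
    intro W
    rw [restrictL2_apply, ← toL2_sub (memLp_L2_of_subset _ hAΩ) hηm,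
      norm_sq_toL2 (f := fun x => W none x - η x * g) ((memLp_L2_of_subset _ hAΩ).sub hηm)]
  have e2 : ∀ W : Jet1 Ω, ‖∑ i, e i • restrictL2 hAΩ (W (some i)) - toL2 A fun _ => g‖ ^ 2 =
      ∫ x in (A : Set (Space d)), (∑ i, e i * W (some i) x - g) ^ 2 := by
    intro W
    have hm : ∀ i ∈ Finset.univ, MemLp (fun x => e i * W (some i) x) 2
        (volume.restrict (A : Set (Space d))) := fun i _ =>
      (memLp_L2_of_subset _ hAΩ).const_mul _
    have : ∑ i, e i • restrictL2 hAΩ (W (some i)) = toL2 A fun x => ∑ i, e i * W (some i) x := by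
      rw [toL2_sum _ hm]
      refine Finset.sum_congr rfl fun i _ => ?_
      rw [toL2_const_mul _ (memLp_L2_of_subset _ hAΩ), restrictL2_apply]
    rw [this, ← toL2_sub (memLp_finsetSum _ hm) hgm,
      norm_sq_toL2 (f := fun x => ∑ i, e i * W (some i) x - g) ((memLp_finsetSum _ hm).sub hgm)]
  have key : ‖restrictL2 hAΩ (V none) - toL2 A fun x => η x * g‖ ^ 2 ≤
      s ^ 2 * ‖∑ i, e i • restrictL2 hAΩ (V (some i)) - toL2 A fun _ => g‖ ^ 2 := by
    have hc : IsClosed {W : Jet1 Ω | ‖restrictL2 hAΩ (W none) - toL2 A fun x => η x * g‖ ^ 2 ≤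
        s ^ 2 * ‖∑ i, e i • restrictL2 hAΩ (W (some i)) - toL2 A fun _ => g‖ ^ 2} :=
      isClosed_le (by fun_prop) (by fun_prop)
    have hV' : V ∈ closure (Submodule.span ℝ (Set.range (testJet Ω)) : Set (Jet1 Ω)) := hV
    refine closure_minimal ?_ hc hV'
    intro W hW
    obtain ⟨φ, rfl⟩ := mem_range_of_mem_span_testJet hW
    rw [mem_ofPred_eq, e1, e2]
    have h := hA.integral_testFunction_le hb hAΩ hs φ g
    have c1 : ∀ᵐ x ∂(volume.restrict (A : Set (Space d))), testJet Ω φ none x = φ x :=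
      ae_restrict_of_ae_restrict_of_subset hAΩ (coeFn_toL2 (memLp_testFunction φ))
    have c2 : ∀ᵐ x ∂(volume.restrict (A : Set (Space d))), ∀ i,
        testJet Ω φ (some i) x = partialDeriv i φ x :=
      ae_all_iff.2 fun i =>
        ae_restrict_of_ae_restrict_of_subset hAΩ (coeFn_toL2 (memLp_partial φ i))
    rw [integral_congr_ae (g := fun x => (φ x - η x * g) ^ 2)
      (by filter_upwards [c1] with x hx; rw [hx]),
      integral_congr_ae (f := fun x => (∑ i, e i * testJet Ω φ (some i) x - g) ^ 2)
      (g := fun x => (fderiv ℝ φ x e - g) ^ 2)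
      (by filter_upwards [c2] with x hx; simp only [hx, fderiv_eq_sum_partialDeriv])]
    exact h
  rwa [e1, e2] at key

theorem integral_comp_midpoint (F : Space d → ℝ) (p : Space d) :
    ∫ x, F (p + (1 / 2 : ℝ) • (x - p)) = 2 ^ d * ∫ x, F x := by
  rw [integral_sub_right_eq_self (μ := volume) (fun x => F (p + (1 / 2 : ℝ) • x)) p,
    Measure.integral_comp_smul volume (fun x => F (p + x)), integral_add_left_eq_self F p]
  simp

theorem memLp_of_isAffine (hb : Bornology.IsBounded (Ω : Set (Space d))) {q : Space d → ℝ}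
    {g : Space d} (hq : ∀ x y, q x - q y = inner ℝ g (x - y)) :
    MemLp q 2 (volume.restrict (Ω : Set (Space d))) := by
  have : q = fun x => q 0 + inner ℝ g x := by
    funext x
    have := hq x 0
    rw [sub_zero] at this
    linarith
  rw [this]
  have hc : Continuous fun x => q 0 + inner ℝ g x := by fun_prop
  exact memLp_of_continuousOn hb hc.continuousOn

theorem volume_real_ball (x : Space d) {r : ℝ} (hr : 0 < r) :
    volume.real (Metric.ball x r) = r ^ d * volume.real (Metric.ball (0 : Space d) 1) := by
  rw [measureReal_def, Measure.addHaar_ball_of_pos _ _ hr, ENNReal.toReal_mul,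
    ENNReal.toReal_ofReal (by positivity), finrank_euclideanSpace_fin, ← measureReal_def]

theorem volume_real_unitBall_pos : 0 < volume.real (Metric.ball (0 : Space d) 1) :=
  ENNReal.toReal_pos (Metric.measure_ball_pos _ _ one_pos).ne' measure_ball_lt_top.ne

namespace IsChart

variable {p : Space d} {r : ℝ} {Λ : ℝ≥0} {e : Space d} {η : Space d → ℝ}

/-- The part of a strip above the graph which is close to `p`. -/
def strip (h : IsChart Ω p r Λ e η) (s : ℝ) : Opens (Space d) :=
  ⟨{x | 0 < η x ∧ η x < s ∧ ‖x - p - inner ℝ e (x - p) • e‖ < s}, by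
    have h1 := h.lipschitz.continuous
    have h2 : Continuous fun x : Space d => ‖x - p - inner ℝ e (x - p) • e‖ := by fun_prop
    exact (isOpen_lt continuous_const h1).inter ((isOpen_lt h1 continuous_const).inter
      (isOpen_lt h2 continuous_const))⟩

variable {s : ℝ}

theorem mem_strip (h : IsChart Ω p r Λ e η) {x : Space d} : x ∈ h.strip s ↔
    0 < η x ∧ η x < s ∧ ‖x - p - inner ℝ e (x - p) • e‖ < s := Iff.rfl

theorem inner_self (h : IsChart Ω p r Λ e η) : inner ℝ e e = (1 : ℝ) := by
  rw [real_inner_self_eq_norm_sq, h.norm_eq, one_pow]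

theorem add_smul_sub_proj (h : IsChart Ω p r Λ e η) (x : Space d) (t : ℝ) :
    x + t • e - p - inner ℝ e (x + t • e - p) • e = x - p - inner ℝ e (x - p) • e := by
  have : x + t • e - p = (x - p) + t • e := by abel
  rw [this, inner_add_right, real_inner_smul_right, h.inner_self, mul_one, _root_.add_smul]
  abel

theorem norm_sub_lt_of_proj (h : IsChart Ω p r Λ e η) (hp : η p = 0) {x : Space d} (h0 : 0 ≤ η x) (h1 : η x ≤ s)
    (h2 : ‖x - p - inner ℝ e (x - p) • e‖ < s) : ‖x - p‖ < (Λ + 3) * s := by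
  have hs : 0 < s := (norm_nonneg _).trans_lt h2
  set w := x - p - inner ℝ e (x - p) • e with hw
  have e1 : x = p + w + inner ℝ e (x - p) • e := by rw [hw]; abel
  have e2 : η x = η (p + w) + inner ℝ e (x - p) := by
    conv_lhs => rw [e1, h.add_smul]
  have e3 := h.abs_sub_le (p + w) p
  rw [hp, sub_zero, add_sub_cancel_left] at e3
  have e4 : (Λ : ℝ) * ‖w‖ ≤ Λ * s := mul_le_mul_of_nonneg_left h2.le Λ.2
  have e5 : |inner ℝ e (x - p)| ≤ s + Λ * s := by
    rw [abs_le] at e3 ⊢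
    constructor <;> linarith
  have e6 : ‖x - p‖ ≤ ‖w‖ + |inner ℝ e (x - p)| := by
    calc ‖x - p‖ = ‖w + inner ℝ e (x - p) • e‖ := by rw [hw]; congr 1; abel
      _ ≤ _ := (norm_add_le _ _).trans (by rw [norm_smul, h.norm_eq, mul_one, Real.norm_eq_abs])
  linarith

theorem ball_subset_strip (h : IsChart Ω p r Λ e η) (hp : η p = 0) :
    Metric.ball (p + (s / 2) • e) (s / (2 * (Λ + 1))) ⊆ h.strip s := by
  intro x hx
  rw [mem_ball_iff_norm] at hx
  have hΛ : (0 : ℝ) ≤ Λ := Λ.2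
  set w := x - (p + (s / 2) • e) with hw
  have hx' : x = p + w + (s / 2) • e := by rw [hw]; abel
  have hws : (Λ + 1) * ‖w‖ < s / 2 := by
    rw [lt_div_iff₀ (by positivity)] at hx
    linarith
  have e3 := abs_le.1 (h.abs_sub_le (p + w) p)
  rw [hp, sub_zero, add_sub_cancel_left] at e3
  have hw0 := norm_nonneg w
  rw [SetLike.mem_coe, mem_strip, hx', h.add_smul_sub_proj, h.add_smul, add_sub_cancel_left]
  refine ⟨by nlinarith, by nlinarith, ?_⟩
  have e5 : |inner ℝ e w| ≤ ‖w‖ := by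
    have := abs_real_inner_le_norm e w
    rwa [h.norm_eq, one_mul] at this
  calc ‖w - inner ℝ e w • e‖ ≤ ‖w‖ + ‖w‖ := by
        refine (norm_sub_le _ _).trans ?_
        rw [norm_smul, h.norm_eq, mul_one, Real.norm_eq_abs]
        linarith
    _ < s := by nlinarith

theorem strip_le (h : IsChart Ω p r Λ e η) (hp : η p = 0) (hr : (Λ + 3) * s ≤ r) : h.strip s ≤ Ω := fun x hx =>
  (h.mem_iff x (mem_ball_iff_norm.2
    ((h.norm_sub_lt_of_proj hp hx.1.le hx.2.1.le hx.2.2).trans_le hr))).2 hx.1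

theorem strip_subset_ball (h : IsChart Ω p r Λ e η) (hp : η p = 0) :
    (h.strip s : Set (Space d)) ⊆ Metric.ball p ((Λ + 3) * s) := fun _ hx =>
  mem_ball_iff_norm.2 (h.norm_sub_lt_of_proj hp hx.1.le hx.2.1.le hx.2.2)

theorem foot (h : IsChart Ω p r Λ e η) {x : Space d} (hx : x ∈ h.strip s) :
    η (x - η x • e) = 0 ∧
      ‖x - η x • e - p - inner ℝ e (x - η x • e - p) • e‖ < s := by
  have e1 : x - η x • e = x + (-η x) • e := by rw [neg_smul, sub_eq_add_neg]
  rw [e1, h.add_smul_sub_proj, h.add_smul]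
  exact ⟨by ring, hx.2.2⟩

theorem norm_foot_sub_lt (h : IsChart Ω p r Λ e η) (hp : η p = 0) {x : Space d} (hx : x ∈ h.strip s) :
    ‖x - η x • e - p‖ < (Λ + 3) * s := by
  have hs : 0 < s := hx.1.trans hx.2.1
  obtain ⟨h1, h2⟩ := h.foot hx
  exact h.norm_sub_lt_of_proj hp h1.ge (h1.le.trans hs.le) h2

theorem isStrip_strip (h : IsChart Ω p r Λ e η) (hp : η p = 0) (hr : (Λ + 3) * s ≤ r) :
    IsStrip Ω (h.strip s) s e η where
  continuous := h.lipschitz.continuous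
  pos _ hx := hx.1
  le _ hx := hx.2.1.le
  notMem x hx := by
    have hball : x - η x • e ∈ Metric.ball p r :=
      mem_ball_iff_norm.2 ((h.norm_foot_sub_lt hp hx).trans_le hr)
    rw [h.mem_iff _ hball, (h.foot hx).1]
    exact lt_irrefl _
  mem x hx t ht := by
    have e1 : x - t • e = x + (-t) • e := by rw [neg_smul, sub_eq_add_neg]
    rw [mem_strip, e1, h.add_smul_sub_proj, h.add_smul]
    exact ⟨by linarith [ht.2], by linarith [ht.1, hx.2.1], hx.2.2⟩

end IsChart

namespace SpatialMesh

variable {M : SpatialMesh Ω} {γ h : ℝ}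

/-- The foot of `x` is a boundary point so close to `p i` that the hat function is positive there.
By the cone property the midpoint of `p i` and the foot is again on the boundary, and the midpoint
of `p i` and `x` lies `η x / 2` above it. -/
theorem chart_midpoint (hint : interior (closure (Ω : Set (Space d))) ⊆ Ω) (hM : M.IsUniform γ h)
    (hγ : 0 < γ) (hh : 0 < h) {i : Fin M.N} {r s : ℝ} {Λ : ℝ≥0} {e : Space d} {η : Space d → ℝ}
    (hc : IsChart Ω (M.p i) r Λ e η) (hp : η (M.p i) = 0)
    (h1 : (Λ + 1) * ((Λ + 3) * s) < r) (h2 : 2 * γ / h * ((2 * Λ + 1) * ((Λ + 3) * s)) < 1)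
    {x : Space d} (hx : x ∈ hc.strip s) :
    η (M.p i + (1 / 2 : ℝ) • (x - M.p i)) = η x / 2 := by
  have hs : 0 < s := hx.1.trans hx.2.1
  have hΛ : (0 : ℝ) ≤ Λ := Λ.2
  set p := M.p i
  have hy := hc.norm_foot_sub_lt hp hx
  have hr : (Λ + 3) * s < r := by nlinarith [mul_nonneg hΛ (by positivity : 0 ≤ (Λ + 3) * s)]
  set y := x - η x • e with hyd
  have hyb : y ∈ Metric.ball p r := mem_ball_iff_norm.2 (hy.trans hr)
  have hyf : y ∈ frontier (Ω : Set (Space d)) := hc.mem_frontier_of_eq_zero hyb (hc.foot hx).1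
  have hpos : 0 < M.hat i y := by
    refine hat_pos_of_near hM hγ hh hc (frontier_subset_closure hyf) (lt_of_le_of_lt ?_ h1)
      (lt_of_le_of_lt ?_ h2)
    · exact mul_le_mul_of_nonneg_left hy.le (by positivity)
    · exact mul_le_mul_of_nonneg_left (mul_le_mul_of_nonneg_left hy.le (by positivity))
        (by positivity)
  have hm := midpoint_mem_frontier hint hyf hpos
  have hmb : p + (1 / 2 : ℝ) • (y - p) ∈ Metric.ball p r := by
    rw [mem_ball_iff_norm, add_sub_cancel_left, norm_smul]
    norm_num
    linarith [norm_nonneg (y - p)]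
  have h0 := hc.eq_zero_of_mem_frontier hmb hm
  have e1 : p + (1 / 2 : ℝ) • (x - p) = p + (1 / 2 : ℝ) • (y - p) + (η x / 2) • e := by
    rw [hyd]
    module
  rw [e1, hc.add_smul, h0, zero_add]

/-- An affine function that is close to a function in `H¹₀` is small at boundary vertices. -/
theorem sq_mul_volume_le (hint : interior (closure (Ω : Set (Space d))) ⊆ Ω)
    (hb : Bornology.IsBounded (Ω : Set (Space d))) (hM : M.IsUniform γ h)
    (hγ : 0 < γ) (hh : 0 < h) {i : Fin M.N} {r s : ℝ} {Λ : ℝ≥0} {e : Space d} {η : Space d → ℝ}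
    (hc : IsChart Ω (M.p i) r Λ e η) (hp : η (M.p i) = 0) (hs : 0 < s)
    (h1 : (Λ + 1) * ((Λ + 3) * s) < r) (h2 : 2 * γ / h * ((2 * Λ + 1) * ((Λ + 3) * s)) < 1)
    {V : Jet1 Ω} (hV : V ∈ H10 Ω) {q : Space d → ℝ} {g : Space d}
    (hq : ∀ x y, q x - q y = inner ℝ g (x - y)) :
    q (M.p i) ^ 2 * volume.real (hc.strip s : Set (Space d)) ≤
      2 * (8 * 2 ^ d + 2) * ((∫ x in (hc.strip s : Set (Space d)), (V none x - q x) ^ 2) +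
        s ^ 2 * ∑ j, ∫ x in (hc.strip s : Set (Space d)), (V (some j) x - g j) ^ 2) := by
  have hΛ : (0 : ℝ) ≤ Λ := Λ.2
  have hr : (Λ + 3) * s ≤ r := by nlinarith [mul_nonneg hΛ (by positivity : 0 ≤ (Λ + 3) * s)]
  set p := M.p i with hpdef
  set A := hc.strip s with hA
  have hAΩ : A ≤ Ω := hc.strip_le hp hr
  have hAb : Bornology.IsBounded (A : Set (Space d)) := hb.subset hAΩ
  have := isFiniteMeasure_restrict hAb
  have hηc : Continuous η := hc.lipschitz.continuous
  have hqc : Continuous q := by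
    have : q = fun x => q 0 + inner ℝ g x := by
      funext x
      have := hq x 0
      rw [sub_zero] at this
      linarith
    rw [this]
    fun_prop
  set Q : Space d → ℝ := fun x => q (x - η x • e) with hQ
  have hQc : Continuous Q := hqc.comp (by fun_prop)
  have hQm : MemLp Q 2 (volume.restrict (A : Set (Space d))) :=
    memLp_of_continuousOn hAb hQc.continuousOn
  set mid : Space d → Space d := fun x => p + (1 / 2 : ℝ) • (x - p) with hmid
  have hmidA : ∀ x ∈ A, mid x ∈ A := by
    intro x hx
    have hη := chart_midpoint hint hM hγ hh hc hp h1 h2 hx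
    refine (hc.mem_strip).2 ⟨?_, ?_, ?_⟩
    · rw [hη]; linarith [hx.1]
    · rw [hη]; linarith [hx.1, hx.2.1]
    · have : mid x - p - inner ℝ e (mid x - p) • e =
          (1 / 2 : ℝ) • (x - p - inner ℝ e (x - p) • e) := by
        rw [hmid]
        simp only [add_sub_cancel_left, real_inner_smul_right]
        module
      rw [this, norm_smul]
      norm_num
      have h3 := hx.2.2
      linarith [norm_nonneg (x - p - inner ℝ e (x - p) • e)]
  -- The foot of the midpoint is the midpoint of `p` and the foot of `x`. As `q` is affine, its
  -- value at `p` is extrapolated from two boundary points.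
  have hqp : ∀ x ∈ A, q p = 2 * Q (mid x) - Q x := by
    intro x hx
    have hη := chart_midpoint hint hM hγ hh hc hp h1 h2 hx
    have e1 := hq p (mid x - η (mid x) • e)
    have e2 := hq (mid x - η (mid x) • e) (x - η x • e)
    have e3 : p - (mid x - η (mid x) • e) = mid x - η (mid x) • e - (x - η x • e) := by
      rw [hη, hmid]
      module
    rw [e3] at e1
    simp only [hQ]
    linarith
  set F := indicator (A : Set (Space d)) (fun y => Q y ^ 2) with hF
  have hF0 : ∀ y, 0 ≤ F y := fun y => indicator_nonneg (fun _ _ => sq_nonneg _) y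
  have hFi : Integrable F := by
    rw [hF, integrable_indicator_iff A.isOpen.measurableSet]
    exact hQm.integrable_sq
  have hFm : Integrable fun x => F (mid x) := by
    have h3 := (hFi.comp_add_left p).comp_smul (R := (1 / 2 : ℝ)) (by norm_num)
    exact h3.comp_sub_right p
  have hFe : ∫ x, F x = ∫ x in (A : Set (Space d)), Q x ^ 2 :=
    integral_indicator A.isOpen.measurableSet
  -- From `(2a - b)² ≤ 8a² + 2b²`; the factor `2 ^ d` is the Jacobian of halving the distance to
  -- `p`, which maps the strip into itself.
  have hA1 : q p ^ 2 * volume.real (A : Set (Space d)) ≤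
      (8 * 2 ^ d + 2) * ∫ x in (A : Set (Space d)), Q x ^ 2 := by
    have h3 : q p ^ 2 * volume.real (A : Set (Space d)) = ∫ _ in (A : Set (Space d)), q p ^ 2 := by
      rw [integral_const, measureReal_restrict_apply_univ, smul_eq_mul, mul_comm]
    rw [h3]
    have h4 : ∫ _ in (A : Set (Space d)), q p ^ 2 ≤
        ∫ x in (A : Set (Space d)), (8 * F (mid x) + 2 * Q x ^ 2) := by
      refine setIntegral_mono_on (integrable_const _)
        ((hFm.integrableOn.const_mul 8).add (hQm.integrable_sq.const_mul 2))
        A.isOpen.measurableSet fun x hx => ?_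
      rw [hqp x hx, hF, indicator_of_mem (hmidA x hx)]
      nlinarith [sq_nonneg (2 * Q (mid x) + Q x)]
    refine h4.trans ?_
    rw [integral_add (hFm.integrableOn.const_mul 8) (hQm.integrable_sq.const_mul 2),
      integral_const_mul, integral_const_mul]
    have h5 : ∫ x in (A : Set (Space d)), F (mid x) ≤ 2 ^ d * ∫ x in (A : Set (Space d)), Q x ^ 2 := by
      rw [← hFe, ← integral_comp_midpoint F p]
      exact setIntegral_le_integral hFm (.of_forall fun x => hF0 _)
    linarith
  have hV0 : MemLp (V none) 2 (volume.restrict (A : Set (Space d))) := memLp_L2_of_subset _ hAΩ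
  have hqm : MemLp q 2 (volume.restrict (A : Set (Space d))) := memLp_of_isAffine hAb hq
  have hηm : MemLp (fun x => η x * inner ℝ g e) 2 (volume.restrict (A : Set (Space d))) :=
    memLp_of_continuousOn hAb (hηc.mul continuous_const).continuousOn
  have hVj : ∀ j, MemLp (fun x => V (some j) x - g j) 2 (volume.restrict (A : Set (Space d))) :=
    fun j => (memLp_L2_of_subset (V (some j)) hAΩ).sub (memLp_const _)
  -- At the foot, `q` equals `q x - η x * ⟨g, e⟩`. Both terms are compared with `V`: the first by
  -- the distance of `V` and `q`, the second by the Friedrichs inequality, because `V` has zero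
  -- trace at the foot.
  have hQ2 : ∫ x in (A : Set (Space d)), Q x ^ 2 ≤
      2 * (∫ x in (A : Set (Space d)), (V none x - q x) ^ 2) +
        2 * ∫ x in (A : Set (Space d)), (V none x - η x * inner ℝ g e) ^ 2 := by
    have h3 := integral_add_sq_le (f := fun x => -(V none x - q x))
      (g := fun x => V none x - η x * inner ℝ g e) (hV0.sub hqm).neg (hV0.sub hηm)
    simp only [neg_sq] at h3
    refine (le_of_eq (integral_congr_ae (.of_forall fun x => ?_))).trans h3
    simp only [hQ]
    have h4 := hq (x - η x • e) x
    rw [sub_sub_cancel_left, ← neg_smul, real_inner_smul_right] at h4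
    have : q (x - η x • e) = q x + -η x * inner ℝ g e := by linarith
    rw [this]
    ring
  have hst := (hc.isStrip_strip hp hr).integral_H10_le hb hAΩ hs.le hV (inner ℝ g e)
  have hgr : ∫ x in (A : Set (Space d)), (∑ i, e i * V (some i) x - inner ℝ g e) ^ 2 ≤
      ∑ j, ∫ x in (A : Set (Space d)), (V (some j) x - g j) ^ 2 := by
    rw [← integral_finsetSum _ fun j _ => (hVj j).integrable_sq]
    refine integral_mono_of_nonneg (.of_forall fun _ => sq_nonneg _)
      (integrable_finsetSum _ fun j _ => (hVj j).integrable_sq) (.of_forall fun x => ?_)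
    have h3 : ∑ i, e i * V (some i) x - inner ℝ g e = ∑ i, e i * (V (some i) x - g i) := by
      simp only [mul_sub, Finset.sum_sub_distrib]
      congr 1
    have h4 : ∑ i, e i ^ 2 = 1 := by
      have := EuclideanSpace.norm_sq_eq e
      rw [hc.norm_eq] at this
      simpa using this.symm
    simp only [h3]
    refine (Finset.sum_mul_sq_le_sq_mul_sq _ _ _).trans ?_
    rw [h4, one_mul]
  have h6 := mul_le_mul_of_nonneg_left hgr (sq_nonneg s)
  refine hA1.trans ?_
  have h7 : (0 : ℝ) ≤ 8 * 2 ^ d + 2 := by positivity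
  rw [mul_comm 2, mul_assoc]
  refine mul_le_mul_of_nonneg_left ?_ h7
  linarith

/-- An affine function that is close to a function in `H¹₀` is small at boundary vertices. -/
theorem exists_sq_mul_pow_le (hb : Bornology.IsBounded (Ω : Set (Space d)))
    (hL : HasLipschitzBoundary (Ω : Set (Space d))) (hγ : 0 < γ) :
    ∃ h₀ > 0, ∃ C > 0, ∀ (M : SpatialMesh Ω) (h : ℝ), 0 < h → h ≤ h₀ → M.IsUniform γ h →
      ∀ i, M.p i ∈ frontier (Ω : Set (Space d)) → ∀ V ∈ H10 Ω, ∀ (q : Space d → ℝ) (g : Space d),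
        (∀ x y, q x - q y = inner ℝ g (x - y)) →
        q (M.p i) ^ 2 * h ^ d ≤
          C * ((∫ x in (Ω : Set (Space d)) ∩ Metric.ball (M.p i) h, (V none x - q x) ^ 2) +
            h ^ 2 * ∑ j, ∫ x in (Ω : Set (Space d)) ∩ Metric.ball (M.p i) h,
              (V (some j) x - g j) ^ 2) := by
  obtain ⟨r, hr, Λ, hch⟩ := exists_uniform_chart hb hL
  have hΛ : (0 : ℝ) ≤ Λ := Λ.2
  -- Strips of width `c * h` are used. The factor `1 / (Λ + 3)` puts them in the ball of radius `h`
  -- about the vertex, and the other factor keeps the hat function of the vertex positive at the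
  -- feet.
  set c : ℝ := 1 / ((Λ + 3) * (1 + 4 * γ * (2 * Λ + 1))) with hc
  have hc0 : 0 < c := by positivity
  have hc1 : (Λ + 3) * c ≤ 1 := by
    rw [hc, mul_one_div, div_le_one (by positivity)]
    nlinarith [(by positivity : 0 ≤ (Λ + 3) * (4 * γ * (2 * Λ + 1)))]
  have hc2 : 2 * γ * ((2 * Λ + 1) * ((Λ + 3) * c)) < 1 := by
    have : 2 * γ * ((2 * Λ + 1) * ((Λ + 3) * c)) =
        2 * γ * (2 * Λ + 1) / (1 + 4 * γ * (2 * Λ + 1)) := by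
      rw [hc]
      field_simp
    rw [this, div_lt_one (by positivity)]
    nlinarith [(by positivity : 0 ≤ γ * (2 * Λ + 1))]
  have hc1' : c ≤ 1 := by nlinarith
  set β := volume.real (Metric.ball (0 : Space d) 1) with hβ
  have hβ0 : 0 < β := volume_real_unitBall_pos
  set κ : ℝ := c / (2 * (Λ + 1)) with hκ
  have hκ0 : 0 < κ := by positivity
  refine ⟨r / (2 * (Λ + 1)), by positivity, 2 * (8 * 2 ^ d + 2) / (β * κ ^ d), by positivity, ?_⟩
  intro M h hh hh0 hM i hi V hV q g hq
  obtain ⟨e, η, hc'⟩ := hch _ hi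
  have hp := hc'.eq_zero_of_mem_frontier (Metric.mem_ball_self hr) hi
  have hs : 0 < c * h := by positivity
  have hch : (Λ + 3) * (c * h) ≤ h := by nlinarith
  rw [le_div_iff₀ (by positivity)] at hh0
  have h1 : (Λ + 1) * ((Λ + 3) * (c * h)) < r := by
    have := mul_le_mul_of_nonneg_left hch (by positivity : (0 : ℝ) ≤ Λ + 1)
    nlinarith
  have h2 : 2 * γ / h * ((2 * Λ + 1) * ((Λ + 3) * (c * h))) < 1 := by
    refine lt_of_eq_of_lt ?_ hc2
    field_simp
  have key := sq_mul_volume_le (interior_closure_subset hL) hb hM hγ hh hc' hp hs h1 h2 hV hq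
  have hsub : (hc'.strip (c * h) : Set (Space d)) ⊆ (Ω : Set (Space d)) ∩ Metric.ball (M.p i) h :=
    subset_inter (hc'.strip_le hp (by nlinarith [mul_nonneg hΛ (by positivity : 0 ≤ (Λ + 3) * (c * h))]))
      ((hc'.strip_subset_ball hp).trans (Metric.ball_subset_ball hch))
  have hb' : Bornology.IsBounded ((Ω : Set (Space d)) ∩ Metric.ball (M.p i) h) :=
    hb.subset inter_subset_left
  have hvol : β * κ ^ d * h ^ d ≤ volume.real (hc'.strip (c * h) : Set (Space d)) := by
    have h3 : volume.real (Metric.ball (M.p i + (c * h / 2) • e) (c * h / (2 * (Λ + 1)))) =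
        β * κ ^ d * h ^ d := by
      rw [volume_real_ball _ (by positivity), ← hβ, mul_assoc, ← mul_pow, hκ, mul_comm]
      congr 2
      ring
    rw [← h3]
    exact measureReal_mono (hc'.ball_subset_strip hp)
      (hb'.subset hsub).measure_lt_top.ne
  have hm : ∀ f : L2 Ω, MemLp f 2 (volume.restrict ((Ω : Set (Space d)) ∩ Metric.ball (M.p i) h)) :=
    fun f => memLp_L2_of_subset f inter_subset_left
  have hmono := setIntegral_sq_mono hsub ((hm (V none)).sub
    ((memLp_of_isAffine hb hq).mono_measure (Measure.restrict_mono inter_subset_left le_rfl)))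
  have hmono' : ∀ j, ∫ x in (hc'.strip (c * h) : Set (Space d)), (V (some j) x - g j) ^ 2 ≤
      ∫ x in (Ω : Set (Space d)) ∩ Metric.ball (M.p i) h, (V (some j) x - g j) ^ 2 := fun j => by
    have := isFiniteMeasure_restrict hb
    exact setIntegral_sq_mono hsub ((hm (V (some j))).sub
      ((memLp_const (g j)).mono_measure (Measure.restrict_mono inter_subset_left le_rfl)))
  have hsum := Finset.sum_le_sum fun j (_ : j ∈ Finset.univ) => hmono' j
  rw [div_mul_eq_mul_div, le_div_iff₀ (by positivity)]
  calc q (M.p i) ^ 2 * h ^ d * (β * κ ^ d) = q (M.p i) ^ 2 * (β * κ ^ d * h ^ d) := by ring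
    _ ≤ q (M.p i) ^ 2 * volume.real (hc'.strip (c * h) : Set (Space d)) :=
        mul_le_mul_of_nonneg_left hvol (sq_nonneg _)
    _ ≤ _ := key
    _ ≤ _ := by
        refine mul_le_mul_of_nonneg_left (add_le_add hmono ?_) (by positivity)
        refine mul_le_mul ?_ hsum (Finset.sum_nonneg fun j _ => integral_nonneg fun _ => sq_nonneg _)
          (sq_nonneg _)
        exact pow_le_pow_left₀ hs.le (by nlinarith) 2

end SpatialMesh

end

section

variable {d : ℕ} {Ω : Opens (Space d)}

/-! ### Local polynomial approximation up to the boundary -/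

/-- The shift by `(Λ + 1) * ρ` along `e` moves the ball about the boundary point to a ball inside
`Ω`. The Poincaré inequality there supplies `m`, and the translation estimate compares `f` with its
shift, since the paths stay in `Ω`. -/
theorem IsChart.exists_integral_sub_sq_le (hb : Bornology.IsBounded (Ω : Set (Space d)))
    {z : Space d} {r : ℝ} {Λ : ℝ≥0} {e : Space d} {η : Space d → ℝ} (h : IsChart Ω z r Λ e η)
    (hz : η z = 0) {ρ : ℝ} (hρ : 0 < ρ) (hr : (Λ + 2) * ρ ≤ r) {f : L2 Ω} {g : Fin d → L2 Ω}
    (hfg : ∀ i, IsWeakPartial Ω i f (g i)) :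
    ∃ m, ∫ x in (Ω : Set (Space d)) ∩ Metric.ball z ρ, (f x - m) ^ 2 ≤
      (2 * (Λ + 1) ^ 2 + 8 * 2 ^ d) * ρ ^ 2 *
        ∑ i, ∫ x in (Ω : Set (Space d)) ∩ Metric.ball z ((Λ + 2) * ρ), g i x ^ 2 := by
  have hΛ : (0 : ℝ) ≤ Λ := Λ.2
  set S : Space d := ((Λ + 1) * ρ) • e with hS
  have hSn : ‖S‖ = (Λ + 1) * ρ := by
    rw [hS, norm_smul, h.norm_eq, mul_one, Real.norm_of_nonneg (by positivity)]
  set A : Opens (Space d) := ⟨(Ω : Set (Space d)) ∩ Metric.ball z ρ, Ω.isOpen.inter Metric.isOpen_ball⟩ with hA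
  set B : Set (Space d) := (Ω : Set (Space d)) ∩ Metric.ball z ((Λ + 2) * ρ) with hB
  have hAΩ : A ≤ Ω := fun x hx => hx.1
  have hbB : Metric.ball (z + S) ρ ⊆ B := by
    intro y hy
    rw [mem_ball_iff_norm] at hy
    have hyb : y ∈ Metric.ball z ((Λ + 2) * ρ) := by
      rw [mem_ball_iff_norm]
      calc ‖y - z‖ = ‖(y - (z + S)) + S‖ := by congr 1; abel
        _ < (Λ + 2) * ρ := by linarith [norm_add_le (y - (z + S)) S]
    refine ⟨(h.mem_iff y (Metric.ball_subset_ball hr hyb)).2 ?_, hyb⟩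
    have e1 : y = z + (y - (z + S)) + ((Λ + 1) * ρ) • e := by rw [hS]; abel
    have e2 := abs_le.1 (h.abs_sub_le (z + (y - (z + S))) z)
    rw [hz, sub_zero, add_sub_cancel_left] at e2
    rw [e1, h.add_smul]
    nlinarith [mul_le_mul_of_nonneg_left hy.le hΛ]
  have hAB : ∀ x ∈ A, ∀ t ∈ Icc (0 : ℝ) 1, x + t • S ∈ B := by
    intro x hx t ht
    have hx2 := mem_ball_iff_norm.1 hx.2
    have hyb : x + t • S ∈ Metric.ball z ((Λ + 2) * ρ) := by
      rw [mem_ball_iff_norm]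
      calc ‖x + t • S - z‖ = ‖(x - z) + t • S‖ := by congr 1; abel
        _ ≤ ‖x - z‖ + t * ((Λ + 1) * ρ) := (norm_add_le _ _).trans (by
          rw [norm_smul, Real.norm_of_nonneg ht.1, hSn])
        _ < (Λ + 2) * ρ := by
          nlinarith [mul_le_mul_of_nonneg_right ht.2 (by positivity : 0 ≤ (Λ + 1) * ρ)]
    refine ⟨(h.mem_iff _ (Metric.ball_subset_ball hr hyb)).2 ?_, hyb⟩
    have hx0 : 0 < η x := (h.mem_iff x (Metric.ball_subset_ball (by nlinarith) hx.2)).1 hx.1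
    rw [hS, smul_smul, h.add_smul]
    have := mul_nonneg ht.1 (by positivity : 0 ≤ (Λ + 1) * ρ)
    linarith
  obtain ⟨m, hm⟩ := exists_integral_ball_sub_sq_le hb hfg hρ (hbB.trans inter_subset_left)
  have ht := integral_translate_sub_sq_le hb hfg (A := A) (B := B) inter_subset_left hAB
  have hAz : ∀ x ∈ A, x + S ∈ Ω := fun x hx => by simpa using (hAB x hx 1 (by simp)).1
  have := isFiniteMeasure_restrict hb
  have := isFiniteMeasure_restrict (Ω := A) (hb.subset hAΩ)
  have hf1 := memLp_translate f S hAz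
  have hf2 := memLp_L2_of_subset f hAΩ
  have hc : MemLp (fun _ : Space d => m) 2 (volume.restrict (A : Set (Space d))) := memLp_const m
  have h1 := integral_add_sq_le (f := fun x => -(f (x + S) - f x)) (g := fun x => f (x + S) - m)
    (hf1.sub hf2).neg (hf1.sub hc)
  have h2 : ∫ x in (A : Set (Space d)), (f (x + S) - m) ^ 2 ≤
      ∫ x in Metric.ball (z + S) ρ, (f x - m) ^ 2 := by
    set F := indicator (Metric.ball (z + S) ρ) (fun y => (f y - m) ^ 2) with hF
    have hF0 : ∀ y, 0 ≤ F y := fun y => indicator_nonneg (fun _ _ => sq_nonneg _) y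
    have hFi : Integrable F := by
      rw [hF, integrable_indicator_iff measurableSet_ball]
      exact ((memLp_L2_of_subset f (hbB.trans inter_subset_left)).sub
        ((memLp_const m).mono_measure
          (Measure.restrict_mono (hbB.trans inter_subset_left) le_rfl))).integrable_sq
    calc ∫ x in (A : Set (Space d)), (f (x + S) - m) ^ 2
        = ∫ x in (A : Set (Space d)), F (x + S) := by
          refine setIntegral_congr_fun A.isOpen.measurableSet fun x hx => ?_
          have hx2 : x + S ∈ Metric.ball (z + S) ρ := by
            have := hx.2
            rw [mem_ball_iff_norm] at this ⊢
            rwa [add_sub_add_right_eq_sub]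
          simp only [hF, indicator_of_mem hx2]
      _ ≤ ∫ x, F (x + S) :=
          setIntegral_le_integral (hFi.comp_add_right S) (.of_forall fun x => hF0 _)
      _ = _ := by
          rw [integral_add_right_eq_self F S, hF, integral_indicator measurableSet_ball]
  refine ⟨m, ?_⟩
  have h3 : ∫ x in (A : Set (Space d)), (f x - m) ^ 2 =
      ∫ x in (A : Set (Space d)), (-(f (x + S) - f x) + (f (x + S) - m)) ^ 2 := by
    refine integral_congr_ae (.of_forall fun x => ?_)
    ring_nf
  have h4 : ∑ i, ∫ x in Metric.ball (z + S) ρ, g i x ^ 2 ≤ ∑ i, ∫ x in B, g i x ^ 2 :=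
    Finset.sum_le_sum fun i _ => setIntegral_sq_mono hbB (memLp_L2_of_subset (g i) inter_subset_left)
  have h5 := mul_le_mul_of_nonneg_left h4 (by positivity : (0 : ℝ) ≤ 2 ^ d * (2 * ρ) ^ 2)
  simp only [neg_sq] at h1
  rw [hSn] at ht
  change ∫ x in (A : Set (Space d)), (f x - m) ^ 2 ≤ _
  rw [h3]
  refine h1.trans ?_
  calc _ ≤ 2 * (((Λ + 1) * ρ) ^ 2 * ∑ i, ∫ x in B, g i x ^ 2) +
        2 * (2 ^ d * (2 * ρ) ^ 2 * ∑ i, ∫ x in B, g i x ^ 2) := by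
        refine add_le_add (mul_le_mul_of_nonneg_left ht (by norm_num))
          (mul_le_mul_of_nonneg_left (h2.trans (hm.trans h5)) (by norm_num))
    _ = _ := by ring

theorem inter_frontier_nonempty_of_isPreconnected {B : Set (Space d)} (hB : IsPreconnected B)
    (h1 : (B ∩ (Ω : Set (Space d))).Nonempty) (h2 : ∃ y ∈ B, y ∉ (Ω : Set (Space d))) :
    ∃ z ∈ B, z ∈ frontier (Ω : Set (Space d)) := by
  by_contra hcon
  push Not at hcon
  have hout : ∀ z ∈ B, z ∉ (Ω : Set (Space d)) → z ∈ (closure (Ω : Set (Space d)))ᶜ := by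
    intro z hz hzΩ hzc
    refine hcon z hz ?_
    rw [Ω.isOpen.frontier_eq]
    exact ⟨hzc, hzΩ⟩
  obtain ⟨y, hy, hyΩ⟩ := h2
  obtain ⟨z, -, hz1, hz2⟩ := hB _ _ Ω.isOpen isClosed_closure.isOpen_compl
    (fun z hz => or_iff_not_imp_left.2 (hout z hz)) h1 ⟨y, hy, hout y hy hyΩ⟩
  exact hz2 (subset_closure hz1)

/-- The Poincaré inequality on small balls that may meet the boundary. -/
theorem exists_local_poincare (hb : Bornology.IsBounded (Ω : Set (Space d)))
    (hL : HasLipschitzBoundary (Ω : Set (Space d))) {R : ℝ} (hR : 0 < R) :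
    ∃ R' ≥ R, ∃ C > 0, ∃ h₀ > 0, ∀ h, 0 < h → h ≤ h₀ → ∀ x ∈ closure (Ω : Set (Space d)),
      ∀ (f : L2 Ω) (g : Fin d → L2 Ω), (∀ i, IsWeakPartial Ω i f (g i)) →
      ∃ m, ∫ y in (Ω : Set (Space d)) ∩ Metric.ball x (R * h), (f y - m) ^ 2 ≤
        C * h ^ 2 * ∑ i, ∫ y in (Ω : Set (Space d)) ∩ Metric.ball x (R' * h), g i y ^ 2 := by
  obtain ⟨r, hr, Λ, hch⟩ := exists_uniform_chart hb hL
  have hΛ : (0 : ℝ) ≤ Λ := Λ.2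
  refine ⟨(2 * Λ + 5) * R, by nlinarith, (2 * (Λ + 1) ^ 2 + 8 * 2 ^ d) * (2 * R) ^ 2, by positivity,
    r / ((Λ + 2) * (2 * R)), by positivity, ?_⟩
  intro h hh hh0 x hx f g hfg
  rw [le_div_iff₀ (by positivity)] at hh0
  have hRh : 0 < R * h := by positivity
  have hmono : ∀ B ⊆ (Ω : Set (Space d)) ∩ Metric.ball x ((2 * Λ + 5) * R * h),
      ∑ i, ∫ y in B, g i y ^ 2 ≤
        ∑ i, ∫ y in (Ω : Set (Space d)) ∩ Metric.ball x ((2 * Λ + 5) * R * h), g i y ^ 2 :=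
    fun B hB => Finset.sum_le_sum fun i _ =>
      setIntegral_sq_mono hB (memLp_L2_of_subset (g i) inter_subset_left)
  by_cases hball : Metric.ball x (R * h) ⊆ Ω
  · obtain ⟨m, hm⟩ := exists_integral_ball_sub_sq_le hb hfg hRh hball
    refine ⟨m, ?_⟩
    rw [inter_eq_self_of_subset_right hball]
    refine hm.trans ?_
    have h1 := hmono _ (subset_inter hball (Metric.ball_subset_ball
      (by nlinarith [mul_nonneg hΛ hRh.le])))
    refine mul_le_mul ?_ h1 (Finset.sum_nonneg fun i _ => integral_nonneg fun _ => sq_nonneg _)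
      (by positivity)
    have : (0 : ℝ) ≤ (2 * (Λ + 1) ^ 2 + 7 * 2 ^ d) * (2 * R) ^ 2 * h ^ 2 := by positivity
    nlinarith
  · obtain ⟨y, hy, hyΩ⟩ := not_subset.1 hball
    have hne : (Metric.ball x (R * h) ∩ (Ω : Set (Space d))).Nonempty :=
      mem_closure_iff_nhds.1 hx _ (Metric.ball_mem_nhds x hRh)
    -- A ball that meets `Ω` without being contained in it has a boundary point `z`; the ball of
    -- twice the radius about `z` contains it, and the chart at `z` applies.
    obtain ⟨z, hz, hzf⟩ := inter_frontier_nonempty_of_isPreconnected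
      (convex_ball x (R * h)).isPreconnected hne ⟨y, hy, hyΩ⟩
    obtain ⟨e, η, hc⟩ := hch z hzf
    have hz0 := hc.eq_zero_of_mem_frontier (Metric.mem_ball_self hr) hzf
    obtain ⟨m, hm⟩ := hc.exists_integral_sub_sq_le hb hz0 (ρ := 2 * R * h) (by positivity)
      (by linarith) hfg
    refine ⟨m, ?_⟩
    have := isFiniteMeasure_restrict hb
    have hzd := Metric.mem_ball.1 hz
    have h0 : ∫ y in (Ω : Set (Space d)) ∩ Metric.ball x (R * h), (f y - m) ^ 2 ≤
        ∫ y in (Ω : Set (Space d)) ∩ Metric.ball z (2 * R * h), (f y - m) ^ 2 := by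
      refine setIntegral_sq_mono (inter_subset_inter_right _ ?_)
        ((memLp_L2_of_subset f inter_subset_left).sub
          ((memLp_const m).mono_measure (Measure.restrict_mono inter_subset_left le_rfl)))
      refine Metric.ball_subset_ball' ?_
      rw [dist_comm]
      linarith
    refine h0.trans (hm.trans ?_)
    have h1 := hmono ((Ω : Set (Space d)) ∩ Metric.ball z ((Λ + 2) * (2 * R * h)))
      (inter_subset_inter_right _ (Metric.ball_subset_ball' (by linarith)))
    refine mul_le_mul (le_of_eq (by ring)) h1
      (Finset.sum_nonneg fun i _ => integral_nonneg fun _ => sq_nonneg _) (by positivity)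

/-- Local approximation of `H²` functions by affine functions, up to the boundary. -/
theorem exists_local_affine (hb : Bornology.IsBounded (Ω : Set (Space d)))
    (hL : HasLipschitzBoundary (Ω : Set (Space d))) {R : ℝ} (hR : 0 < R) :
    ∃ R' ≥ R, ∃ C > 0, ∃ h₀ > 0, ∀ h, 0 < h → h ≤ h₀ → ∀ x ∈ closure (Ω : Set (Space d)),
      ∀ (f : L2 Ω) (G : Fin d → L2 Ω) (K : Fin d → Fin d → L2 Ω),
      (∀ i, IsWeakPartial Ω i f (G i)) → (∀ i j, IsWeakPartial Ω j (G i) (K i j)) →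
      ∃ (q : Space d → ℝ) (g : Space d), (∀ x y, q x - q y = inner ℝ g (x - y)) ∧
        (∫ y in (Ω : Set (Space d)) ∩ Metric.ball x (R * h), (f y - q y) ^ 2) +
          h ^ 2 * ∑ i, ∫ y in (Ω : Set (Space d)) ∩ Metric.ball x (R * h), (G i y - g i) ^ 2 ≤
        C * h ^ 4 * ∑ i, ∑ j, ∫ y in (Ω : Set (Space d)) ∩ Metric.ball x (R' * h), K i j y ^ 2 := by
  obtain ⟨R1, hR1, C1, hC1, h1, hh1, H1⟩ := exists_local_poincare hb hL hR
  obtain ⟨R2, hR2, C2, hC2, h2, hh2, H2⟩ := exists_local_poincare hb hL (hR.trans_le hR1)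
  refine ⟨R2, hR1.trans hR2, C1 * C2 + C2, by positivity, min h1 h2, lt_min hh1 hh2, ?_⟩
  intro h hh hh0 x hx f G K hfG hGK
  have := isFiniteMeasure_restrict hb
  -- The Poincaré inequality for each first derivative supplies the slope `m`. A second application,
  -- to `f` minus the linear function with this slope, gains another power of `h`, as the gradient
  -- of this difference is already small.
  choose m hm using fun i => H2 h hh (hh0.trans (min_le_right _ _)) x hx (G i) (K i) (hGK i)
  set g : Space d := WithLp.toLp 2 m with hg
  have hgi : ∀ i, g i = m i := fun i => rfl
  have hlin : ContDiff ℝ 1 fun y : Space d => inner ℝ g y := (innerSL ℝ g).contDiff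
  have hpd : ∀ i, partialDeriv i (fun y : Space d => inner ℝ g y) = fun _ => m i := by
    intro i
    funext y
    have : fderiv ℝ (fun y : Space d => inner ℝ g y) y = innerSL ℝ g :=
      (innerSL ℝ g).hasFDerivAt.fderiv
    rw [partialDeriv, this]
    exact (EuclideanSpace.inner_single_right i 1 g).trans (by simp [hgi])
  have hlm : MemLp (fun y : Space d => inner ℝ g y) 2 (volume.restrict (Ω : Set (Space d))) :=
    memLp_of_continuousOn hb hlin.continuous.continuousOn
  have hcm : ∀ i, MemLp (fun _ : Space d => m i) 2 (volume.restrict (Ω : Set (Space d))) :=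
    fun i => memLp_const _
  have hw : ∀ i, IsWeakPartial Ω i (f - toL2 Ω fun y => inner ℝ g y) (G i - toL2 Ω fun _ => m i) := by
    intro i
    refine (hfG i).sub ?_
    have := isWeakPartial_of_contDiff (Ω := Ω) hlin i hlm (by rw [hpd]; exact hcm i)
    rwa [hpd] at this
  obtain ⟨m0, hm0⟩ := H1 h hh (hh0.trans (min_le_left _ _)) x hx _ _ hw
  have hae : ∀ B ⊆ (Ω : Set (Space d)), ∀ᵐ y ∂(volume.restrict B),
      (f - toL2 Ω fun y => inner ℝ g y : L2 Ω) y = f y - inner ℝ g y := fun B hB => by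
    refine ae_restrict_of_ae_restrict_of_subset hB ?_
    filter_upwards [Lp.coeFn_sub f (toL2 Ω fun y => inner ℝ g y), coeFn_toL2 hlm] with y h3 h4
    rw [h3, Pi.sub_apply, h4]
  have hae' : ∀ i, ∀ B ⊆ (Ω : Set (Space d)), ∀ᵐ y ∂(volume.restrict B),
      (G i - toL2 Ω fun _ => m i : L2 Ω) y = G i y - m i := fun i B hB => by
    refine ae_restrict_of_ae_restrict_of_subset hB ?_
    filter_upwards [Lp.coeFn_sub (G i) (toL2 Ω fun _ => m i), coeFn_toL2 (hcm i)] with y h3 h4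
    rw [h3, Pi.sub_apply, h4]
  refine ⟨fun y => inner ℝ g y + m0, g, fun x y => by rw [inner_sub_right]; ring, ?_⟩
  have e1 : ∫ y in (Ω : Set (Space d)) ∩ Metric.ball x (R * h), (f y - (inner ℝ g y + m0)) ^ 2 ≤
      C1 * h ^ 2 * ∑ i, ∫ y in (Ω : Set (Space d)) ∩ Metric.ball x (R1 * h), (G i y - m i) ^ 2 := by
    refine (le_of_eq (integral_congr_ae ?_)).trans (hm0.trans (le_of_eq ?_))
    · filter_upwards [hae _ inter_subset_left] with y hy
      rw [hy]
      ring
    · congr 1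
      refine Finset.sum_congr rfl fun i _ => integral_congr_ae ?_
      filter_upwards [hae' i _ inter_subset_left] with y hy
      rw [hy]
  have e2 : ∑ i, ∫ y in (Ω : Set (Space d)) ∩ Metric.ball x (R1 * h), (G i y - m i) ^ 2 ≤
      C2 * h ^ 2 * ∑ i, ∑ j, ∫ y in (Ω : Set (Space d)) ∩ Metric.ball x (R2 * h), K i j y ^ 2 := by
    rw [Finset.mul_sum]
    exact Finset.sum_le_sum fun i _ => hm i
  have e3 : ∑ i, ∫ y in (Ω : Set (Space d)) ∩ Metric.ball x (R * h), (G i y - g i) ^ 2 ≤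
      ∑ i, ∫ y in (Ω : Set (Space d)) ∩ Metric.ball x (R1 * h), (G i y - m i) ^ 2 := by
    refine Finset.sum_le_sum fun i _ => ?_
    refine setIntegral_sq_mono (inter_subset_inter_right _ (Metric.ball_subset_ball (by gcongr)))
        ((memLp_L2_of_subset (G i) inter_subset_left).sub
          ((memLp_const (m i)).mono_measure (Measure.restrict_mono inter_subset_left le_rfl)))
  calc _ ≤ C1 * h ^ 2 * (C2 * h ^ 2 * ∑ i, ∑ j, ∫ y in (Ω : Set (Space d)) ∩ Metric.ball x (R2 * h), K i j y ^ 2) +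
        h ^ 2 * (C2 * h ^ 2 * ∑ i, ∑ j, ∫ y in (Ω : Set (Space d)) ∩ Metric.ball x (R2 * h), K i j y ^ 2) :=
        add_le_add (e1.trans (mul_le_mul_of_nonneg_left e2 (by positivity)))
          (mul_le_mul_of_nonneg_left (e3.trans e2) (by positivity))
    _ = _ := by ring

end

section

variable {d : ℕ} {Ω : Opens (Space d)}

/-! ### Integration over meshes and inverse estimates -/

theorem exists_affineMap {q : Space d → ℝ} {g : Space d}
    (hq : ∀ x y, q x - q y = inner ℝ g (x - y)) :
    ∃ a : Space d →ᵃ[ℝ] ℝ, (∀ x, a x = q x) ∧ ∀ v, a.linear v = inner ℝ g v := by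
  refine ⟨(innerSL ℝ g).toLinearMap.toAffineMap + AffineMap.const ℝ _ (q 0), fun x => ?_, fun v => ?_⟩
  · have := hq x 0
    rw [sub_zero] at this
    change inner ℝ g x + q 0 = q x
    linarith
  · simp

/-- Point values of an affine function are bounded by its mean square on a ball. -/
theorem sq_mul_volume_ball_le {q : Space d → ℝ} {g : Space d}
    (hq : ∀ x y, q x - q y = inner ℝ g (x - y)) {c p : Space d} {ρ K : ℝ} (hρ : 0 < ρ)
    (hK : 1 ≤ K) (hp : ‖p - c‖ ≤ K * ρ) :
    q p ^ 2 * (ρ ^ d * volume.real (Metric.ball (0 : Space d) 1)) ≤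
      2 ^ d * (3 * (9 * K ^ 2)) * ∫ x in Metric.ball c ρ, q x ^ 2 := by
  set β := volume.real (Metric.ball (0 : Space d) 1) with hβ
  set u : Space d := (1 / (2 * K)) • (p - c) with hu
  have hun : ‖u‖ ≤ ρ / 2 := by
    rw [hu, norm_smul, Real.norm_of_nonneg (by positivity), div_mul_eq_mul_div, one_mul,
      div_le_div_iff₀ (by positivity) (by norm_num)]
    nlinarith
  set F := indicator (Metric.ball c ρ) (fun y => q y ^ 2) with hF
  have hF0 : ∀ y, 0 ≤ F y := fun y => indicator_nonneg (fun _ _ => sq_nonneg _) y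
  have hFi : Integrable F := by
    rw [hF, integrable_indicator_iff measurableSet_ball]
    exact (memLp_of_isAffine (Ω := ⟨Metric.ball c ρ, Metric.isOpen_ball⟩) Metric.isBounded_ball
      hq).integrable_sq
  have hFe : ∫ x, F x = ∫ x in Metric.ball c ρ, q x ^ 2 := integral_indicator measurableSet_ball
  set B := Metric.ball (0 : Space d) (ρ / 2) with hB
  have hBf : IsFiniteMeasure (volume.restrict B) :=
    ⟨by rw [Measure.restrict_apply_univ]; exact measure_ball_lt_top⟩
  have h1 : ∀ w ∈ B, q p ^ 2 ≤ 9 * K ^ 2 * (F (c + w) + F (c - w) + F (c + u + w)) := by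
    intro w hw
    have hw' : ‖w‖ < ρ / 2 := by simpa [hB] using hw
    rw [hF, indicator_of_mem, indicator_of_mem, indicator_of_mem]
    · have e1 := hq p c
      have e2 := hq (c + u + w) (c + w)
      have e3 := hq (c + w) c
      have e4 := hq (c - w) c
      rw [add_sub_cancel_left] at e3
      rw [sub_sub_cancel_left, inner_neg_right] at e4
      have e5 : c + u + w - (c + w) = u := by abel
      have e6 : p - c = (2 * K) • u := by
        rw [hu, smul_smul]
        field_simp
        rw [one_smul]
      rw [e5] at e2
      rw [e6, real_inner_smul_right, ← e2] at e1
      -- The value at `p` is extrapolated from three points of the ball; `u` is `p - c` scaled to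
      -- length at most `ρ / 2`. Averaging over `w` turns point values into a mean square.
      have e7 : q p = (1 / 2 - 2 * K) * q (c + w) + 1 / 2 * q (c - w) + 2 * K * q (c + u + w) := by
        linarith
      set X := q (c + w)
      set Y := q (c - w)
      set Z := q (c + u + w)
      rw [e7]
      have cs : ((1 / 2 - 2 * K) * X + 1 / 2 * Y + 2 * K * Z) ^ 2 ≤
          ((1 / 2 - 2 * K) ^ 2 + (1 / 2) ^ 2 + (2 * K) ^ 2) * (X ^ 2 + Y ^ 2 + Z ^ 2) := by
        nlinarith [sq_nonneg ((1 / 2 - 2 * K) * Y - 1 / 2 * X),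
          sq_nonneg ((1 / 2 - 2 * K) * Z - 2 * K * X), sq_nonneg (1 / 2 * Z - 2 * K * Y)]
      refine cs.trans (mul_le_mul_of_nonneg_right ?_ (by positivity))
      nlinarith
    · rw [mem_ball_iff_norm, add_assoc, add_sub_cancel_left]
      exact (norm_add_le _ _).trans_lt (by linarith)
    · rw [mem_ball_iff_norm, sub_sub_cancel_left, norm_neg]
      linarith
    · rw [mem_ball_iff_norm, add_sub_cancel_left]
      linarith
  have i1 : Integrable fun w => F (c + w) := hFi.comp_add_left c
  have i2 : Integrable fun w => F (c - w) := hFi.comp_sub_left c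
  have i3 : Integrable fun w => F (c + u + w) := hFi.comp_add_left (c + u)
  have h2 : q p ^ 2 * volume.real B ≤ 9 * K ^ 2 * (3 * ∫ x, F x) := by
    have h3 : q p ^ 2 * volume.real B = ∫ _ in B, q p ^ 2 := by
      rw [integral_const, measureReal_restrict_apply_univ, smul_eq_mul, mul_comm]
    rw [h3]
    refine (setIntegral_mono_on (integrable_const _)
      (((i1.add i2).add i3).integrableOn.const_mul (9 * K ^ 2)) measurableSet_ball h1).trans ?_
    rw [integral_const_mul]
    refine mul_le_mul_of_nonneg_left ?_ (by positivity)
    refine (setIntegral_le_integral ((i1.add i2).add i3) (.of_forall fun w =>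
      add_nonneg (add_nonneg (hF0 _) (hF0 _)) (hF0 _))).trans (le_of_eq ?_)
    have h4 := integral_add (i1.add i2) i3
    have h5 := integral_add i1 i2
    simp only [Pi.add_apply] at h4 h5 ⊢
    rw [h4, h5, integral_add_left_eq_self F c, integral_sub_left_eq_self F volume c,
      integral_add_left_eq_self F (c + u)]
    ring
  rw [volume_real_ball _ (by positivity), ← hβ, hFe] at h2
  have h6 : ρ ^ d = 2 ^ d * (ρ / 2) ^ d := by
    rw [← mul_pow]
    congr 1
    ring
  rw [h6]
  calc q p ^ 2 * (2 ^ d * (ρ / 2) ^ d * β) = 2 ^ d * (q p ^ 2 * ((ρ / 2) ^ d * β)) := by ring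
    _ ≤ 2 ^ d * (9 * K ^ 2 * (3 * ∫ x in Metric.ball c ρ, q x ^ 2)) := by gcongr
    _ = _ := by ring

namespace SpatialMesh

variable {M : SpatialMesh Ω} {γ h : ℝ} {ω : Finset (Fin M.N)}

variable (M) in
/-- The interior of an element. -/
def cell (ω : Finset (Fin M.N)) : Set (Space d) := interior (M.simplex ω)

theorem isOpen_cell : IsOpen (M.cell ω) := isOpen_interior

theorem cell_subset_simplex : M.cell ω ⊆ M.simplex ω := interior_subset

theorem cell_subset (hint : interior (closure (Ω : Set (Space d))) ⊆ Ω) (hω : ω ∈ M.elems) :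
    M.cell ω ⊆ Ω := (interior_mono (M.simplex_subset hω)).trans hint

/-- Distinct elements have as many vertices, so some vertex `i` of the first is not one of the
second. On a common open set its coordinate would vanish, hence everywhere by affinity, but it is 1
at `p i`. -/
theorem disjoint_cell {ω' : Finset (Fin M.N)} (hω : ω ∈ M.elems) (hω' : ω' ∈ M.elems)
    (hne : ω ≠ ω') : Disjoint (M.cell ω) (M.cell ω') := by
  rw [Set.disjoint_left]
  intro x hx hx'
  obtain ⟨i, hi, hi'⟩ : ∃ i ∈ ω, i ∉ ω' := by
    by_contra hcon
    push Not at hcon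
    exact hne (Finset.eq_of_subset_of_card_le hcon (by rw [M.card_elem hω, M.card_elem hω']))
  obtain ⟨ρ, hρ, hball⟩ := Metric.isOpen_iff.1 (isOpen_cell.inter isOpen_cell) x ⟨hx, hx'⟩
  have h0 : ∀ y ∈ Metric.ball x ρ, M.coord ω i y = 0 := fun y hy => by
    rw [coord_eq_hat hω (cell_subset_simplex (hball hy).1)]
    by_contra hcon
    exact hi' (M.mem_elem_of_hat_ne_zero hω' (cell_subset_simplex (hball hy).2) hcon)
  have h1 := abs_linear_le_of_ball (a := M.coord ω i) hρ (m := 0)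
    (fun y hy z hz => by rw [h0 y hy, h0 z hz]; simp) (M.p i) x
  rw [h0 x (Metric.mem_ball_self hρ), coord_vertex hω i hi, if_pos rfl] at h1
  norm_num at h1

theorem iUnion_cell_ae_eq (hint : interior (closure (Ω : Set (Space d))) ⊆ Ω) :
    (⋃ ω ∈ M.elems, M.cell ω) =ᵐ[volume] (Ω : Set (Space d)) := by
  have hnull : ∀ᵐ x ∂(volume : Measure (Space d)), ∀ ω ∈ M.elems, x ∉ frontier (M.simplex ω) := by
    rw [Filter.eventually_all_finset]
    intro ω _
    exact measure_eq_zero_iff_ae_notMem.1 ((M.convex_simplex ω).addHaar_frontier volume)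
  filter_upwards [hnull] with x hx
  refine propext ⟨fun h => ?_, fun h => ?_⟩
  · obtain ⟨ω, hω, hxω⟩ := mem_iUnion₂.1 h
    exact cell_subset hint hω hxω
  · obtain ⟨ω, hω, hxω⟩ := M.exists_mem_simplex (subset_closure h)
    refine mem_iUnion₂.2 ⟨ω, hω, ?_⟩
    by_contra hcon
    exact hx ω hω ⟨subset_closure hxω, hcon⟩

theorem integral_eq_sum_cell (hint : interior (closure (Ω : Set (Space d))) ⊆ Ω) {F : Space d → ℝ}
    (hF : IntegrableOn F (Ω : Set (Space d))) :
    ∫ x in (Ω : Set (Space d)), F x = ∑ ω ∈ M.elems, ∫ x in M.cell ω, F x := by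
  rw [← setIntegral_congr_set (iUnion_cell_ae_eq (M := M) hint)]
  refine integral_biUnion_finset _ (fun ω _ => isOpen_cell.measurableSet) ?_
    fun ω hω => hF.mono_set (cell_subset hint hω)
  exact fun ω hω ω' hω' hne => disjoint_cell hω hω' hne

theorem ball_subset_cell {c : Space d} (hc : Metric.ball c (h / γ) ⊆ M.simplex ω) :
    Metric.ball c (h / γ) ⊆ M.cell ω := interior_maximal hc Metric.isOpen_ball

theorem simplex_subset_ball (hM : M.IsUniform γ h) (hγ : 0 < γ) (hh : 0 < h) (hω : ω ∈ M.elems)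
    {c : Space d} (hc : c ∈ M.simplex ω) : M.simplex ω ⊆ Metric.ball c (2 * γ * h) := fun x hx =>
  mem_ball_iff_norm.2 ((hM.norm_sub_le hω hx hc).trans_lt (by nlinarith [mul_pos hγ hh]))

theorem center_mem (hγ : 0 < γ) (hh : 0 < h) {c : Space d}
    (hc : Metric.ball c (h / γ) ⊆ M.simplex ω) : c ∈ M.simplex ω :=
  hc (Metric.mem_ball_self (by positivity))

theorem volume_cell_le (hM : M.IsUniform γ h) (hγ : 0 < γ) (hh : 0 < h) (hω : ω ∈ M.elems) :
    volume.real (M.cell ω) ≤ (2 * γ * h) ^ d * volume.real (Metric.ball (0 : Space d) 1) := by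
  obtain ⟨c, hc⟩ := hM.exists_ball hω
  rw [← volume_real_ball c (by positivity : 0 < 2 * γ * h)]
  exact measureReal_mono (cell_subset_simplex.trans
    (simplex_subset_ball hM hγ hh hω (center_mem hγ hh hc))) measure_ball_lt_top.ne

theorem volume_cell_ne_top (hb : Bornology.IsBounded (Ω : Set (Space d)))
    (hint : interior (closure (Ω : Set (Space d))) ⊆ Ω) (hω : ω ∈ M.elems) :
    volume (M.cell ω) ≠ ∞ := (hb.subset (cell_subset hint hω)).measure_lt_top.ne

/-- Packing: the inscribed balls of radius `h / γ` are disjoint and lie in the ball of radius `R * h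
+ h / γ` about `x`. -/
theorem card_le_of_mem_ball (hγ : 0 < γ) (hh : 0 < h) {c : Finset (Fin M.N) → Space d}
    (hc : ∀ ω ∈ M.elems, Metric.ball (c ω) (h / γ) ⊆ M.simplex ω) {R : ℝ} (hR : 0 < R)
    (x : Space d) (s : Finset (Finset (Fin M.N))) (hs : ∀ ω ∈ s, ω ∈ M.elems ∧
      x ∈ Metric.ball (c ω) (R * h)) : (s.card : ℝ) ≤ (R * γ + 1) ^ d := by
  set β := volume.real (Metric.ball (0 : Space d) 1) with hβ
  have hβ0 : 0 < β := volume_real_unitBall_pos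
  have h1 : volume.real (⋃ ω ∈ s, Metric.ball (c ω) (h / γ)) = s.card * ((h / γ) ^ d * β) := by
    rw [measureReal_biUnion_finset]
    · rw [Finset.sum_congr rfl fun ω _ => volume_real_ball (c ω) (by positivity : 0 < h / γ),
        Finset.sum_const, nsmul_eq_mul]
    · intro ω hω ω' hω' hne
      exact (disjoint_cell (hs ω hω).1 (hs ω' hω').1 hne).mono
        (ball_subset_cell (hc ω (hs ω hω).1)) (ball_subset_cell (hc ω' (hs ω' hω').1))
    · exact fun _ _ => measurableSet_ball
  have h2 : volume.real (⋃ ω ∈ s, Metric.ball (c ω) (h / γ)) ≤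
      volume.real (Metric.ball x (R * h + h / γ)) := by
    refine measureReal_mono (iUnion₂_subset fun ω hω => Metric.ball_subset_ball' ?_)
      measure_ball_lt_top.ne
    have := Metric.mem_ball'.1 (hs ω hω).2
    linarith
  rw [h1, volume_real_ball _ (by positivity)] at h2
  have h3 : R * h + h / γ = (R * γ + 1) * (h / γ) := by field_simp
  rw [h3, mul_pow, mul_assoc] at h2
  exact le_of_mul_le_mul_right h2 (by positivity)

/-- The balls around the elements overlap boundedly often. -/
theorem sum_integral_ball_le (hγ : 0 < γ) (hh : 0 < h) {c : Finset (Fin M.N) → Space d}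
    (hc : ∀ ω ∈ M.elems, Metric.ball (c ω) (h / γ) ⊆ M.simplex ω) {R : ℝ} (hR : 0 < R)
    {F : Space d → ℝ} (hF : IntegrableOn F (Ω : Set (Space d))) (hF0 : ∀ x, 0 ≤ F x) :
    ∑ ω ∈ M.elems, ∫ x in (Ω : Set (Space d)) ∩ Metric.ball (c ω) (R * h), F x ≤
      (R * γ + 1) ^ d * ∫ x in (Ω : Set (Space d)), F x := by
  classical
  have h1 : ∀ ω, ∫ x in (Ω : Set (Space d)) ∩ Metric.ball (c ω) (R * h), F x =
      ∫ x in (Ω : Set (Space d)), indicator (Metric.ball (c ω) (R * h)) F x := fun ω =>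
    (setIntegral_indicator measurableSet_ball).symm
  have hi : ∀ ω ∈ M.elems, IntegrableOn (indicator (Metric.ball (c ω) (R * h)) F)
      (Ω : Set (Space d)) := fun ω _ => hF.indicator measurableSet_ball
  rw [Finset.sum_congr rfl fun ω _ => h1 ω, ← integral_finsetSum _ hi, ← integral_const_mul]
  refine integral_mono (integrable_finsetSum _ hi) (hF.const_mul _) fun x => ?_
  simp only [indicator_apply]
  rw [← Finset.sum_filter, Finset.sum_const, nsmul_eq_mul]
  refine mul_le_mul_of_nonneg_right ?_ (hF0 x)
  exact card_le_of_mem_ball hγ hh hc hR x _ fun ω hω => Finset.mem_filter.1 hω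

/-! ### Gradients of nodal functions -/

variable (M) in
/-- The partial derivatives of the barycentric coordinates. -/
def coordGrad (ω : Finset (Fin M.N)) (i : Fin M.N) (j : Fin d) : ℝ :=
  (M.coord ω i).linear (EuclideanSpace.single j 1)

theorem abs_coordGrad_le (hM : M.IsUniform γ h) (hγ : 0 < γ) (hh : 0 < h) (hω : ω ∈ M.elems)
    (i : Fin M.N) (j : Fin d) : |M.coordGrad ω i j| ≤ 2 * γ / h := by
  have h1 := abs_coord_sub_le hM hγ hh hω i (EuclideanSpace.single j 1) 0
  rw [← vsub_eq_sub (M.coord ω i _), ← AffineMap.linearMap_vsub, vsub_eq_sub, sub_zero,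
    PiLp.norm_single, norm_one, mul_one] at h1
  exact h1

theorem partialDeriv_nodal (hω : ω ∈ M.elems) (a : Fin M.N → ℝ) (j : Fin d) {x : Space d}
    (hx : x ∈ M.cell ω) : partialDeriv j (M.nodal a) x = ∑ i ∈ ω, a i * M.coordGrad ω i j := by
  have h1 : ∀ i, HasFDerivAt (M.coord ω i) (LinearMap.toContinuousLinearMap (M.coord ω i).linear) x := by
    intro i
    have e : ∀ y, M.coord ω i y = (M.coord ω i).linear y + M.coord ω i 0 := fun y => by
      have := AffineMap.linearMap_vsub (M.coord ω i) y 0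
      rw [vsub_eq_sub, vsub_eq_sub, sub_zero] at this
      rw [this]
      ring
    have h2 := (LinearMap.toContinuousLinearMap (M.coord ω i).linear).hasFDerivAt (x := x)
    exact (h2.add_const (M.coord ω i 0)).congr_of_eventuallyEq (.of_forall e)
  have h2 : HasFDerivAt (fun y => ∑ i ∈ ω, a i * M.coord ω i y)
      (∑ i ∈ ω, a i • LinearMap.toContinuousLinearMap (M.coord ω i).linear) x :=
    HasFDerivAt.fun_sum fun i _ => (h1 i).const_mul (a i)
  have h3 : M.nodal a =ᶠ[nhds x] fun y => ∑ i ∈ ω, a i * M.coord ω i y := by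
    filter_upwards [isOpen_cell.mem_nhds hx] with y hy
    exact nodal_eq_of_mem hω (cell_subset_simplex hy) a
  rw [partialDeriv, (h2.congr_of_eventuallyEq h3).fderiv]
  simp [coordGrad]

theorem sum_coordGrad (hω : ω ∈ M.elems) {q : Space d → ℝ} {g : Space d}
    (hq : ∀ x y, q x - q y = inner ℝ g (x - y)) (j : Fin d) :
    ∑ i ∈ ω, q (M.p i) * M.coordGrad ω i j = g j := by
  obtain ⟨a, ha, hal⟩ := exists_affineMap hq
  have h1 : ∀ i, M.coordGrad ω i j = M.coord ω i (EuclideanSpace.single j 1) - M.coord ω i 0 := by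
    intro i
    rw [coordGrad, ← vsub_eq_sub (M.coord ω i _), ← AffineMap.linearMap_vsub, vsub_eq_sub, sub_zero]
  simp only [h1, mul_sub, Finset.sum_sub_distrib, ← ha]
  rw [← affineMap_eq_sum_coord hω, ← affineMap_eq_sum_coord hω, ← vsub_eq_sub,
    ← AffineMap.linearMap_vsub, hal, vsub_eq_sub, sub_zero]
  exact (EuclideanSpace.inner_single_right j 1 g).trans (by simp)

theorem abs_nodal_sub_le (hω : ω ∈ M.elems) {q : Space d → ℝ} {g : Space d}
    (hq : ∀ x y, q x - q y = inner ℝ g (x - y)) {a : Fin M.N → ℝ} {B : ℝ}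
    (hB : ∀ i ∈ ω, |a i - q (M.p i)| ≤ B) {x : Space d} (hx : x ∈ M.simplex ω) :
    |M.nodal a x - q x| ≤ B := by
  obtain ⟨A, hA, -⟩ := exists_affineMap hq
  rw [nodal_eq_of_mem hω hx, ← hA x, affineMap_eq_sum_coord hω, ← Finset.sum_sub_distrib]
  have h0 : ∀ i, 0 ≤ M.coord ω i x := fun i => by
    rw [coord_eq_hat hω hx]
    exact M.hat_nonneg i x
  calc |∑ i ∈ ω, (a i * M.coord ω i x - A (M.p i) * M.coord ω i x)|
      ≤ ∑ i ∈ ω, B * M.coord ω i x := by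
        refine (Finset.abs_sum_le_sum_abs _ _).trans (Finset.sum_le_sum fun i hi => ?_)
        rw [← sub_mul, abs_mul, abs_of_nonneg (h0 i), hA]
        exact mul_le_mul_of_nonneg_right (hB i hi) (h0 i)
    _ = B := by rw [← Finset.mul_sum, sum_coord hω, mul_one]

theorem abs_partialDeriv_nodal_sub_le (hM : M.IsUniform γ h) (hγ : 0 < γ) (hh : 0 < h)
    (hω : ω ∈ M.elems) {q : Space d → ℝ} {g : Space d}
    (hq : ∀ x y, q x - q y = inner ℝ g (x - y)) {a : Fin M.N → ℝ} {B : ℝ}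
    (hB : ∀ i ∈ ω, |a i - q (M.p i)| ≤ B) (j : Fin d) {x : Space d} (hx : x ∈ M.cell ω) :
    |partialDeriv j (M.nodal a) x - g j| ≤ (d + 1) * (2 * γ / h) * B := by
  rw [partialDeriv_nodal hω a j hx, ← sum_coordGrad hω hq, ← Finset.sum_sub_distrib]
  calc |∑ i ∈ ω, (a i * M.coordGrad ω i j - q (M.p i) * M.coordGrad ω i j)|
      ≤ ∑ i ∈ ω, B * (2 * γ / h) := by
        refine (Finset.abs_sum_le_sum_abs _ _).trans (Finset.sum_le_sum fun i hi => ?_)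
        rw [← sub_mul, abs_mul]
        exact mul_le_mul (hB i hi) (abs_coordGrad_le hM hγ hh hω i j) (abs_nonneg _)
          ((abs_nonneg _).trans (hB i hi))
    _ = _ := by
        rw [Finset.sum_const, M.card_elem hω, nsmul_eq_mul]
        push_cast
        ring

end SpatialMesh

end

section

variable {d : ℕ} {Ω : Opens (Space d)}

/-! ### Quasi-interpolation -/

theorem isAffine_sub {q q' : Space d → ℝ} {g g' : Space d}
    (hq : ∀ x y, q x - q y = inner ℝ g (x - y)) (hq' : ∀ x y, q' x - q' y = inner ℝ g' (x - y)) :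
    ∀ x y, (q x - q' x) - (q y - q' y) = inner ℝ (g - g') (x - y) := fun x y => by
  rw [inner_sub_left, ← hq, ← hq']
  ring

namespace SpatialMesh

variable {M : SpatialMesh Ω} {γ h : ℝ} {ω : Finset (Fin M.N)}

theorem continuous_nodal (hint : interior (closure (Ω : Set (Space d))) ⊆ Ω) {a : Fin M.N → ℝ}
    (ha : ∀ i, M.p i ∉ Ω → a i = 0) : Continuous (M.nodal a) :=
  continuous_of_continuousOn_closure (isPiecewiseAffine_nodal a).1 fun _ hx =>
    nodal_eq_zero hint ha hx

theorem exists_lipschitzWith_nodal (hint : interior (closure (Ω : Set (Space d))) ⊆ Ω)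
    (hM : M.IsUniform γ h) (hγ : 0 < γ) (hh : 0 < h) {a : Fin M.N → ℝ}
    (ha : ∀ i, M.p i ∉ Ω → a i = 0) : ∃ L, LipschitzWith L (M.nodal a) := by
  have hL0 : 0 ≤ (∑ i, |a i|) * (2 * γ / h) :=
    mul_nonneg (Finset.sum_nonneg fun i _ => abs_nonneg _) (by positivity)
  refine ⟨⟨_, hL0⟩, lipschitzWith_of_finite_closed_cover (s := M.elems)
    (K := M.simplex) (fun ω _ => M.isClosed_simplex ω) (fun ω hω u hu v hv => ?_)
    (continuous_nodal hint ha) fun u hu => ?_⟩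
  · rw [nodal, nodal, ← Finset.sum_sub_distrib]
    refine (Finset.abs_sum_le_sum_abs _ _).trans ?_
    change _ ≤ (∑ i, |a i|) * (2 * γ / h) * ‖u - v‖
    rw [mul_assoc, Finset.sum_mul]
    refine Finset.sum_le_sum fun i _ => ?_
    rw [← mul_sub, abs_mul]
    exact mul_le_mul_of_nonneg_left (abs_hat_sub_le hM hγ hh hω i hu hv) (abs_nonneg _)
  · refine nodal_eq_zero hint ha fun hu' => ?_
    obtain ⟨ω, hω, huω⟩ := M.exists_mem_simplex (subset_closure hu')
    exact hu ω hω huω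

theorem memLp_nodal (hb : Bornology.IsBounded (Ω : Set (Space d))) (a : Fin M.N → ℝ) :
    MemLp (M.nodal a) 2 (volume.restrict (Ω : Set (Space d))) :=
  memLp_of_continuousOn hb (isPiecewiseAffine_nodal a).1

/-- Both terms are compared with the affine `q`. Nodal interpolation reproduces `q`, so the
difference is at most `B` and its gradient is of order `B / h`; the weight `h ^ 2` cancels the
negative power. -/
theorem cell_estimate (hb : Bornology.IsBounded (Ω : Set (Space d)))
    (hint : interior (closure (Ω : Set (Space d))) ⊆ Ω)
    (hM : M.IsUniform γ h) (hγ : 0 < γ) (hh : 0 < h)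
    (hω : ω ∈ M.elems) (V : Jet1 Ω) {q : Space d → ℝ} {g : Space d}
    (hq : ∀ x y, q x - q y = inner ℝ g (x - y)) {a : Fin M.N → ℝ}
    (ha : ∀ i, M.p i ∉ Ω → a i = 0) {B : ℝ} (hB : ∀ i ∈ ω, |a i - q (M.p i)| ≤ B) :
    (∫ x in M.cell ω, (V none x - M.nodal a x) ^ 2) +
        h ^ 2 * ∑ j, ∫ x in M.cell ω, (V (some j) x - partialDeriv j (M.nodal a) x) ^ 2 ≤
      2 * ((∫ x in M.cell ω, (V none x - q x) ^ 2) +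
        h ^ 2 * ∑ j, ∫ x in M.cell ω, (V (some j) x - g j) ^ 2) +
        (2 + 2 * d * ((d + 1) * (2 * γ)) ^ 2) * (B ^ 2 * volume.real (M.cell ω)) := by
  have hsub := cell_subset hint hω
  have hle : (volume.restrict (M.cell ω)) ≤ volume.restrict (Ω : Set (Space d)) :=
    Measure.restrict_mono hsub le_rfl
  have := isFiniteMeasure_restrict hb
  obtain ⟨L, hL⟩ := exists_lipschitzWith_nodal hint hM hγ hh ha
  have hqm := (memLp_of_isAffine hb hq).mono_measure hle
  have hnm := (memLp_nodal hb a).mono_measure hle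
  have hvol := volume_cell_ne_top hb hint hω
  have h1 : ∫ x in M.cell ω, (V none x - M.nodal a x) ^ 2 ≤
      2 * (∫ x in M.cell ω, (V none x - q x) ^ 2) + 2 * (B ^ 2 * volume.real (M.cell ω)) := by
    have h2 := integral_add_sq_le (f := fun x => V none x - q x) (g := fun x => q x - M.nodal a x)
      ((memLp_L2_of_subset (V none) hsub).sub hqm) (hqm.sub hnm)
    simp only [sub_add_sub_cancel] at h2
    refine h2.trans (add_le_add_right (mul_le_mul_of_nonneg_left ?_ (by norm_num)) _)
    refine setIntegral_sq_le hvol fun x hx => ?_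
    rw [abs_sub_comm]
    exact abs_nodal_sub_le hω hq hB (cell_subset_simplex hx)
  have h3 : ∀ j, h ^ 2 * ∫ x in M.cell ω, (V (some j) x - partialDeriv j (M.nodal a) x) ^ 2 ≤
      h ^ 2 * (2 * ∫ x in M.cell ω, (V (some j) x - g j) ^ 2) +
        2 * ((d + 1) * (2 * γ)) ^ 2 * (B ^ 2 * volume.real (M.cell ω)) := by
    intro j
    have hcm : MemLp (fun _ : Space d => g j) 2 (volume.restrict (M.cell ω)) :=
      (memLp_const (g j)).mono_measure hle
    have hdm := (memLp_partialDeriv_of_lipschitz hb hL j).mono_measure hle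
    have h2 := integral_add_sq_le (f := fun x => V (some j) x - g j)
      (g := fun x => g j - partialDeriv j (M.nodal a) x)
      ((memLp_L2_of_subset (V (some j)) hsub).sub hcm) (hcm.sub hdm)
    simp only [sub_add_sub_cancel] at h2
    have h4 : ∫ x in M.cell ω, (g j - partialDeriv j (M.nodal a) x) ^ 2 ≤
        ((d + 1) * (2 * γ / h) * B) ^ 2 * volume.real (M.cell ω) := by
      refine setIntegral_sq_le hvol fun x hx => ?_
      rw [abs_sub_comm]
      exact abs_partialDeriv_nodal_sub_le hM hγ hh hω hq hB j hx
    calc _ ≤ h ^ 2 * (2 * (∫ x in M.cell ω, (V (some j) x - g j) ^ 2) +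
          2 * (((d + 1) * (2 * γ / h) * B) ^ 2 * volume.real (M.cell ω))) := by
          refine mul_le_mul_of_nonneg_left (h2.trans ?_) (sq_nonneg h)
          exact add_le_add_right (mul_le_mul_of_nonneg_left h4 (by norm_num)) _
      _ = _ := by
          field_simp
  have h5 := Finset.sum_le_sum fun j (_ : j ∈ Finset.univ) => h3 j
  rw [← Finset.mul_sum, Finset.sum_add_distrib, ← Finset.mul_sum, ← Finset.mul_sum,
    Finset.sum_const, Finset.card_univ, Fintype.card_fin, nsmul_eq_mul] at h5
  calc _ ≤ _ := add_le_add h1 h5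
    _ = _ := by ring

/-- From local to global approximation. The local functions of two elements with a common vertex
differ little at it, as both are close to `V` on an inscribed ball; at boundary vertices they are
small by `exists_sq_mul_pow_le`. The radius `(2 * γ + 2) * h` about the centre of an element covers
the elements that share a vertex with it and the balls of radius `h` about its vertices. With
general `G` and `ε` this serves both `H¹` and `H²`. -/
theorem exists_quasiInterp (hb : Bornology.IsBounded (Ω : Set (Space d)))
    (hL : HasLipschitzBoundary (Ω : Set (Space d))) (hγ : 0 < γ) {R' : ℝ} (hR' : 0 < R') :
    ∃ h₀ > 0, ∃ C > 0, ∀ (M : SpatialMesh Ω) (h : ℝ), 0 < h → h ≤ h₀ → M.IsUniform γ h →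
      ∀ V ∈ H10 Ω, ∀ (G : Space d → ℝ), IntegrableOn G (Ω : Set (Space d)) → (∀ x, 0 ≤ G x) →
      ∀ ε : ℝ, 0 ≤ ε → (∀ x ∈ closure (Ω : Set (Space d)), ∃ (q : Space d → ℝ) (g : Space d),
        (∀ x y, q x - q y = inner ℝ g (x - y)) ∧
          (∫ y in (Ω : Set (Space d)) ∩ Metric.ball x ((2 * γ + 2) * h), (V none y - q y) ^ 2) +
            h ^ 2 * ∑ j, ∫ y in (Ω : Set (Space d)) ∩ Metric.ball x ((2 * γ + 2) * h),
              (V (some j) y - g j) ^ 2 ≤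
            ε * ∫ y in (Ω : Set (Space d)) ∩ Metric.ball x (R' * h), G y) →
      ∃ a : Fin M.N → ℝ, (∀ i, M.p i ∉ Ω → a i = 0) ∧
        ‖V none - toL2 Ω (M.nodal a)‖ ^ 2 +
            h ^ 2 * ∑ j, ‖V (some j) - toL2 Ω (partialDeriv j (M.nodal a))‖ ^ 2 ≤
          C * ε * ∫ y in (Ω : Set (Space d)), G y := by
  classical
  obtain ⟨h₀, hh₀, C2, hC2, Hbd⟩ := exists_sq_mul_pow_le hb hL hγ
  have hint := interior_closure_subset hL
  set β := volume.real (Metric.ball (0 : Space d) 1) with hβ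
  have hβ0 : 0 < β := volume_real_unitBall_pos
  set C1 : ℝ := 2 ^ d * (3 * (9 * (1 + γ ^ 2) ^ 2)) with hC1
  set C3 : ℝ := γ ^ d / β * C1 * 2 + C2 with hC3
  have hC30 : 0 < C3 := by positivity
  set R2 : ℝ := R' + 2 * γ with hR2
  refine ⟨h₀, hh₀, (2 + (2 + 2 * d * ((d + 1) * (2 * γ)) ^ 2) * ((2 * γ) ^ d * β * (2 * C3))) *
    (R2 * γ + 1) ^ d, by positivity, ?_⟩
  intro M h hh hhh hM V hV G hG hG0 ε hε hloc
  have hcen : ∀ ω : Finset (Fin M.N), ∃ c, ω ∈ M.elems → Metric.ball c (h / γ) ⊆ M.simplex ω :=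
    fun ω => by
      by_cases hω : ω ∈ M.elems
      · obtain ⟨c, hc⟩ := hM.exists_ball hω
        exact ⟨c, fun _ => hc⟩
      · exact ⟨0, fun h => absurd h hω⟩
  choose c hc using hcen
  have hcm : ∀ ω ∈ M.elems, c ω ∈ M.simplex ω := fun ω hω => center_mem hγ hh (hc ω hω)
  have hq' : ∀ ω : Finset (Fin M.N), ∃ (q : Space d → ℝ) (g : Space d),
      (∀ x y, q x - q y = inner ℝ g (x - y)) ∧ (ω ∈ M.elems →
          (∫ y in (Ω : Set (Space d)) ∩ Metric.ball (c ω) ((2 * γ + 2) * h), (V none y - q y) ^ 2) +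
            h ^ 2 * ∑ j, ∫ y in (Ω : Set (Space d)) ∩ Metric.ball (c ω) ((2 * γ + 2) * h),
              (V (some j) y - g j) ^ 2 ≤
            ε * ∫ y in (Ω : Set (Space d)) ∩ Metric.ball (c ω) (R' * h), G y) := fun ω => by
    by_cases hω : ω ∈ M.elems
    · obtain ⟨q, g, h1, h2⟩ := hloc (c ω) (M.simplex_subset hω (hcm ω hω))
      exact ⟨q, g, h1, fun _ => h2⟩
    · exact ⟨0, 0, fun x y => by simp, fun h => absurd h hω⟩
  choose q g hq hE using hq'
  choose W hW hiW using M.vertex_mem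
  -- Each interior vertex takes the value of the local function of one chosen element `W i`;
  -- boundary vertices take 0.
  set a : Fin M.N → ℝ := fun i => if M.p i ∈ Ω then q (W i) (M.p i) else 0 with ha
  have ha0 : ∀ i, M.p i ∉ Ω → a i = 0 := fun i hi => if_neg hi
  set E : Finset (Fin M.N) → ℝ := fun ω =>
    (∫ y in (Ω : Set (Space d)) ∩ Metric.ball (c ω) ((2 * γ + 2) * h), (V none y - q ω y) ^ 2) +
      h ^ 2 * ∑ j, ∫ y in (Ω : Set (Space d)) ∩ Metric.ball (c ω) ((2 * γ + 2) * h),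
        (V (some j) y - g ω j) ^ 2 with hEdef
  set I : Finset (Fin M.N) → ℝ := fun ω =>
    ∫ y in (Ω : Set (Space d)) ∩ Metric.ball (c ω) (R2 * h), G y with hI
  have hI0 : ∀ ω, 0 ≤ I ω := fun ω => integral_nonneg hG0
  have := isFiniteMeasure_restrict hb
  have hm0 : ∀ ω, MemLp (fun y => V none y - q ω y) 2 (volume.restrict (Ω : Set (Space d))) :=
    fun ω => (memLp_L2 (V none)).sub (memLp_of_isAffine hb (hq ω))
  have hmj : ∀ ω j, MemLp (fun y => V (some j) y - g ω j) 2 (volume.restrict (Ω : Set (Space d))) :=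
    fun ω j => (memLp_L2 (V (some j))).sub (memLp_const _)
  have hmono : ∀ (ω : Finset (Fin M.N)) (S : Set (Space d)), S ⊆ Ω →
      S ⊆ Metric.ball (c ω) ((2 * γ + 2) * h) →
      (∫ y in S, (V none y - q ω y) ^ 2) + h ^ 2 * ∑ j, ∫ y in S, (V (some j) y - g ω j) ^ 2 ≤
        E ω := by
    intro ω S hS1 hS2
    have hS := subset_inter hS1 hS2
    have hle : (volume.restrict ((Ω : Set (Space d)) ∩ Metric.ball (c ω) ((2 * γ + 2) * h))) ≤
        volume.restrict (Ω : Set (Space d)) := Measure.restrict_mono inter_subset_left le_rfl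
    exact add_le_add (setIntegral_sq_mono hS ((hm0 ω).mono_measure hle))
      (mul_le_mul_of_nonneg_left (Finset.sum_le_sum fun j _ =>
        setIntegral_sq_mono hS ((hmj ω j).mono_measure hle)) (sq_nonneg h))
  have hsum0 : ∀ (ω : Finset (Fin M.N)) (S : Set (Space d)),
      0 ≤ h ^ 2 * ∑ j, ∫ y in S, (V (some j) y - g ω j) ^ 2 := fun ω S =>
    mul_nonneg (sq_nonneg h) (Finset.sum_nonneg fun j _ => integral_nonneg fun _ => sq_nonneg _)
  have hE0 : ∀ ω, 0 ≤ E ω := fun ω =>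
    add_nonneg (integral_nonneg fun _ => sq_nonneg _) (hsum0 ω _)
  have hnear : ∀ ω ∈ M.elems, ∀ i ∈ ω, ‖M.p i - c ω‖ ≤ γ * h := fun ω hω i hi =>
    hM.norm_sub_le hω (subset_convexHull ℝ _ ⟨i, hi, rfl⟩) (hcm ω hω)
  have hEI : ∀ ω ∈ M.elems, ∀ ω' ∈ M.elems, dist (c ω') (c ω) ≤ 2 * γ * h → E ω' ≤ ε * I ω := by
    intro ω hω ω' hω' hd
    refine (hE ω' hω').trans (mul_le_mul_of_nonneg_left ?_ hε)
    refine setIntegral_mono_set (hG.mono_set inter_subset_left) (.of_forall hG0)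
      (inter_subset_inter_right _ (Metric.ball_subset_ball' ?_)).eventuallyLE
    rw [hR2]
    linarith
  have hcellball : ∀ ω ∈ M.elems, ∀ i ∈ ω, ∀ ω' ∈ M.elems, i ∈ ω' →
      M.cell ω ⊆ Metric.ball (c ω') ((2 * γ + 2) * h) := by
    intro ω hω i hi ω' hω' hi' x hx
    rw [mem_ball_iff_norm]
    have h1 := hM.norm_sub_le hω (cell_subset_simplex hx) (subset_convexHull ℝ _ ⟨i, hi, rfl⟩)
    have h2 := hnear ω' hω' i hi'
    calc ‖x - c ω'‖ = ‖(x - M.p i) + (M.p i - c ω')‖ := by congr 1; abel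
      _ ≤ _ := norm_add_le _ _
      _ < _ := by nlinarith
  have hdist : ∀ ω ∈ M.elems, ∀ i ∈ ω, dist (c (W i)) (c ω) ≤ 2 * γ * h := by
    intro ω hω i hi
    have h1 := hnear ω hω i hi
    have h2 := hnear (W i) (hW i) i (hiW i)
    rw [dist_eq_norm]
    calc ‖c (W i) - c ω‖ = ‖(M.p i - c ω) - (M.p i - c (W i))‖ := by congr 1; abel
      _ ≤ _ := norm_sub_le _ _
      _ ≤ _ := by linarith
  -- The nodal values are close to those of the local function of every element at the vertex, not
  -- only of the chosen one. Interior vertices compare two local functions; boundary vertices use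
  -- the trace estimate.
  have hvert : ∀ ω ∈ M.elems, ∀ i ∈ ω, (a i - q ω (M.p i)) ^ 2 * h ^ d ≤ 2 * C3 * (ε * I ω) := by
    intro ω hω i hi
    have hself : E ω ≤ ε * I ω := hEI ω hω ω hω (by rw [dist_self]; positivity)
    have hoth : E (W i) ≤ ε * I ω := hEI ω hω (W i) (hW i) (hdist ω hω i hi)
    have key : (a i - q ω (M.p i)) ^ 2 * h ^ d ≤ C3 * (E ω + E (W i)) := by
      by_cases hi' : M.p i ∈ Ω
      · have hai : a i = q (W i) (M.p i) := if_pos hi'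
        rw [hai]
        have hbc := ball_subset_cell (hc ω hω)
        have h1 := sq_mul_volume_ball_le (isAffine_sub (hq (W i)) (hq ω)) (c := c ω) (p := M.p i)
          (ρ := h / γ) (K := 1 + γ ^ 2) (by positivity) (by nlinarith) (by
            refine (hnear ω hω i hi).trans ?_
            have : (1 + γ ^ 2) * (h / γ) = h / γ + γ * h := by field_simp
            rw [this]
            have : 0 < h / γ := by positivity
            linarith)
        have hbΩ : Metric.ball (c ω) (h / γ) ⊆ Ω := hbc.trans (cell_subset hint hω)
        have hle : (volume.restrict (Metric.ball (c ω) (h / γ))) ≤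
          volume.restrict (Ω : Set (Space d)) := Measure.restrict_mono hbΩ le_rfl
        have h2 := integral_add_sq_le (f := fun y => V none y - q ω y)
          (g := fun y => -(V none y - q (W i) y)) ((hm0 ω).mono_measure hle)
          ((hm0 (W i)).mono_measure hle).neg
        have h3 : ∫ y in Metric.ball (c ω) (h / γ), (q (W i) y - q ω y) ^ 2 =
            ∫ y in Metric.ball (c ω) (h / γ),
              (V none y - q ω y + -(V none y - q (W i) y)) ^ 2 := by
          refine integral_congr_ae (.of_forall fun y => ?_)
          ring_nf
        simp only [neg_sq] at h2
        have h4 := hmono ω _ hbΩ (hbc.trans (hcellball ω hω i hi ω hω hi))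
        have h5 := hmono (W i) _ hbΩ (hbc.trans (hcellball ω hω i hi (W i) (hW i) (hiW i)))
        have h6 := hsum0 ω (Metric.ball (c ω) (h / γ))
        have h7 := hsum0 (W i) (Metric.ball (c ω) (h / γ))
        rw [← hβ, ← hC1, h3] at h1
        have h8 : (q (W i) (M.p i) - q ω (M.p i)) ^ 2 * ((h / γ) ^ d * β) ≤
            C1 * (2 * (E ω + E (W i))) :=
          h1.trans (mul_le_mul_of_nonneg_left (by linarith) (by positivity))
        calc (q (W i) (M.p i) - q ω (M.p i)) ^ 2 * h ^ d =
            γ ^ d / β * ((q (W i) (M.p i) - q ω (M.p i)) ^ 2 * ((h / γ) ^ d * β)) := by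
              rw [div_pow]
              field_simp
          _ ≤ γ ^ d / β * (C1 * (2 * (E ω + E (W i)))) :=
              mul_le_mul_of_nonneg_left h8 (by positivity)
          _ = γ ^ d / β * C1 * 2 * (E ω + E (W i)) := by ring
          _ ≤ C3 * (E ω + E (W i)) :=
              mul_le_mul_of_nonneg_right (by rw [hC3]; linarith) (add_nonneg (hE0 _) (hE0 _))
      · have hfr : M.p i ∈ frontier (Ω : Set (Space d)) := by
          rw [Ω.isOpen.frontier_eq]
          exact ⟨M.vertex_mem_closure i, hi'⟩
        rw [ha0 i hi', zero_sub, neg_sq]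
        have h1 := Hbd M h hh hhh hM i hfr V hV (q ω) (g ω) (hq ω)
        have h2 := hmono ω ((Ω : Set (Space d)) ∩ Metric.ball (M.p i) h) inter_subset_left
          (inter_subset_right.trans (Metric.ball_subset_ball' (by
            rw [dist_eq_norm]
            linarith [hnear ω hω i hi, mul_pos hγ hh])))
        calc _ ≤ C2 * E ω := h1.trans (mul_le_mul_of_nonneg_left h2 hC2.le)
          _ ≤ C3 * (E ω + E (W i)) := by
            refine mul_le_mul ?_ (by linarith [hE0 (W i)]) (hE0 ω) hC30.le
            rw [hC3]
            linarith [(by positivity : 0 ≤ γ ^ d / β * C1 * 2)]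
    calc _ ≤ _ := key
      _ ≤ C3 * (ε * I ω + ε * I ω) := mul_le_mul_of_nonneg_left (add_le_add hself hoth) hC30.le
      _ = _ := by ring
  obtain ⟨L, hLip⟩ := exists_lipschitzWith_nodal hint hM hγ hh ha0
  refine ⟨a, ha0, ?_⟩
  have hLHS : ‖V none - toL2 Ω (M.nodal a)‖ ^ 2 +
        h ^ 2 * ∑ j, ‖V (some j) - toL2 Ω (partialDeriv j (M.nodal a))‖ ^ 2 =
      ∑ ω ∈ M.elems, ((∫ x in M.cell ω, (V none x - M.nodal a x) ^ 2) +
        h ^ 2 * ∑ j, ∫ x in M.cell ω, (V (some j) x - partialDeriv j (M.nodal a) x) ^ 2) := by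
    rw [Finset.sum_add_distrib, ← Finset.mul_sum, Finset.sum_comm]
    have e1 : ∀ (f : L2 Ω) {φ : Space d → ℝ}, MemLp φ 2 (volume.restrict (Ω : Set (Space d))) →
        ‖f - toL2 Ω φ‖ ^ 2 = ∑ ω ∈ M.elems, ∫ x in M.cell ω, (f x - φ x) ^ 2 := by
      intro f φ hφ
      rw [norm_sq_L2, ← integral_eq_sum_cell hint (F := fun x => (f x - φ x) ^ 2)
        ((memLp_L2 f).sub hφ).integrable_sq]
      refine integral_congr_ae ?_
      filter_upwards [Lp.coeFn_sub f (toL2 Ω φ), coeFn_toL2 hφ] with x h1 h2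
      rw [h1, Pi.sub_apply, h2]
    rw [e1 _ (memLp_nodal hb a)]
    congr 2
    exact Finset.sum_congr rfl fun j _ => e1 _ (memLp_partialDeriv_of_lipschitz hb hLip j)
  rw [hLHS]
  have hcell : ∀ ω ∈ M.elems, (∫ x in M.cell ω, (V none x - M.nodal a x) ^ 2) +
        h ^ 2 * ∑ j, ∫ x in M.cell ω, (V (some j) x - partialDeriv j (M.nodal a) x) ^ 2 ≤
      (2 + (2 + 2 * d * ((d + 1) * (2 * γ)) ^ 2) * ((2 * γ) ^ d * β * (2 * C3))) * ε * I ω := by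
    intro ω hω
    have hεI : 0 ≤ ε * I ω := mul_nonneg hε (hI0 ω)
    set B := √(2 * C3 * (ε * I ω) / h ^ d) with hB
    have hB2 : B ^ 2 = 2 * C3 * (ε * I ω) / h ^ d := Real.sq_sqrt (by positivity)
    have h1 : ∀ i ∈ ω, |a i - q ω (M.p i)| ≤ B := fun i hi => by
      refine Real.abs_le_sqrt ?_
      rw [le_div_iff₀ (by positivity)]
      exact hvert ω hω i hi
    have h2 := cell_estimate hb hint hM hγ hh hω V (hq ω) ha0 h1
    have hne : ω.Nonempty := Finset.card_pos.1 (by rw [M.card_elem hω]; omega)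
    obtain ⟨i, hi⟩ := hne
    have h3 := hmono ω _ (cell_subset hint hω) (hcellball ω hω i hi ω hω hi)
    have h4 : E ω ≤ ε * I ω := hEI ω hω ω hω (by rw [dist_self]; positivity)
    have h5 : B ^ 2 * volume.real (M.cell ω) ≤ (2 * γ) ^ d * β * (2 * C3) * (ε * I ω) := by
      calc B ^ 2 * volume.real (M.cell ω) ≤ B ^ 2 * ((2 * γ * h) ^ d * β) :=
            mul_le_mul_of_nonneg_left (volume_cell_le hM hγ hh hω) (sq_nonneg _)
        _ = _ := by
            rw [hB2, mul_pow]
            field_simp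
    calc _ ≤ _ := h2
      _ ≤ 2 * (ε * I ω) + (2 + 2 * d * ((d + 1) * (2 * γ)) ^ 2) *
          ((2 * γ) ^ d * β * (2 * C3) * (ε * I ω)) :=
          add_le_add (mul_le_mul_of_nonneg_left (h3.trans h4) (by norm_num))
            (mul_le_mul_of_nonneg_left h5 (by positivity))
      _ = _ := by ring
  refine (Finset.sum_le_sum hcell).trans ?_
  rw [← Finset.mul_sum]
  have h6 := sum_integral_ball_le hγ hh hc (R := R2) (by positivity) hG hG0
  calc _ ≤ _ := mul_le_mul_of_nonneg_left h6 (by positivity)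
    _ = _ := by ring

end SpatialMesh

end

section

variable {d : ℕ} {Ω : Opens (Space d)}

/-! ### The `L²` projection -/

theorem norm_sq_Jet1 (V : Jet1 Ω) : ‖V‖ ^ 2 = ‖V none‖ ^ 2 + ∑ i, ‖V (some i)‖ ^ 2 := by
  rw [PiLp.norm_sq_eq_of_L2, Fintype.sum_option]

theorem norm_sq_H2 (F : H2 Ω) : ‖F‖ ^ 2 = ‖(F : Jet2 Ω) none‖ ^ 2 +
    (∑ i, ‖(F : Jet2 Ω) (some (.inl i))‖ ^ 2 +
      ∑ i, ∑ j, ‖(F : Jet2 Ω) (some (.inr (i, j)))‖ ^ 2) := by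
  rw [Submodule.coe_norm, PiLp.norm_sq_eq_of_L2, Fintype.sum_option, Fintype.sum_sum_type,
    Fintype.sum_prod_type]

/-- The first order part of an `H²` function that is in `H¹₀`. -/
theorem some_eq_of_H2 {V : Jet1 Ω} (hV : V ∈ H10 Ω) (F : H2 Ω) (hF : (F : Jet2 Ω) none = V none)
    (i : Fin d) : V (some i) = (F : Jet2 Ω) (some (.inl i)) := by
  have h1 := F.2.1 i
  rw [hF] at h1
  exact (isWeakPartial_of_mem_H10 hV i).unique h1

theorem norm_sq_le_of_H2 {V : Jet1 Ω} (hV : V ∈ H10 Ω) (F : H2 Ω)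
    (hF : (F : Jet2 Ω) none = V none) : ‖V‖ ^ 2 ≤ ‖F‖ ^ 2 := by
  rw [norm_sq_Jet1, norm_sq_H2, hF]
  simp only [some_eq_of_H2 hV F hF]
  have : 0 ≤ ∑ i, ∑ j, ‖(F : Jet2 Ω) (some (.inr (i, j)))‖ ^ 2 := by positivity
  linarith

namespace SpatialMesh

variable {M : SpatialMesh Ω} {γ h : ℝ} {ω : Finset (Fin M.N)}

/-- The error of a discrete function in a weighted norm. -/
def quasiError (M : SpatialMesh Ω) (h : ℝ) (V : Jet1 Ω) (a : Fin M.N → ℝ) : ℝ :=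
  ‖V none - toL2 Ω (M.nodal a)‖ ^ 2 +
    h ^ 2 * ∑ j, ‖V (some j) - toL2 Ω (partialDeriv j (M.nodal a))‖ ^ 2

theorem quasiError_zero (V : Jet1 Ω) :
    M.quasiError h V 0 = ‖V none‖ ^ 2 + h ^ 2 * ∑ j, ‖V (some j)‖ ^ 2 := by
  have h1 : M.nodal (0 : Fin M.N → ℝ) = fun _ => 0 := by
    funext x
    simp [nodal]
  have h2 : ∀ j, partialDeriv j (fun _ : Space d => (0 : ℝ)) = fun _ => 0 := by
    intro j
    funext x
    have : fderiv ℝ (fun _ : Space d => (0 : ℝ)) x = 0 := fderiv_const_apply 0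
    rw [partialDeriv, this]
    rfl
  rw [quasiError, h1]
  simp only [h2, toL2_zero, sub_zero]

/-- Constants as local functions, with the squared length of the gradient as density `G`. -/
theorem exists_quasiError_le_H1 (hb : Bornology.IsBounded (Ω : Set (Space d)))
    (hL : HasLipschitzBoundary (Ω : Set (Space d))) (hγ : 0 < γ) :
    ∃ C > 0, ∀ (M : SpatialMesh Ω) (h : ℝ), 0 < h → M.IsUniform γ h → ∀ V ∈ H10 Ω,
      ∃ a : Fin M.N → ℝ, (∀ i, M.p i ∉ Ω → a i = 0) ∧ M.quasiError h V a ≤ C * h ^ 2 * ‖V‖ ^ 2 := by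
  obtain ⟨R', hR', C1, hC1, h1, hh1, H1⟩ := exists_local_poincare hb hL
    (R := 2 * γ + 2) (by positivity)
  have hR'0 : 0 < R' := lt_of_lt_of_le (by positivity) hR'
  obtain ⟨h2, hh2, C2, hC2, H2⟩ := exists_quasiInterp hb hL hγ hR'0
  set h₀ := min h1 h2 with hh₀
  have hh₀0 : 0 < h₀ := lt_min hh1 hh2
  refine ⟨C2 * (C1 + 1) + (1 / h₀ ^ 2 + 1), by positivity, fun M h hh hM V hV => ?_⟩
  have hVs := norm_sq_Jet1 V
  have hS0 : 0 ≤ ∑ j, ‖V (some j)‖ ^ 2 := by positivity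
  by_cases hle : h ≤ h₀
  · have hi : ∀ j ∈ Finset.univ, IntegrableOn (fun x => V (some j) x ^ 2) (Ω : Set (Space d)) :=
      fun j _ => (memLp_L2 _).integrable_sq
    obtain ⟨a, ha, hae⟩ := H2 M h hh (hle.trans (min_le_right _ _)) hM V hV
      (fun x => ∑ j, V (some j) x ^ 2) (integrable_finsetSum _ hi)
      (fun x => Finset.sum_nonneg fun j _ => sq_nonneg _) ((C1 + 1) * h ^ 2) (by positivity)
      fun x hx => by
        obtain ⟨m, hm⟩ := H1 h hh (hle.trans (min_le_left _ _)) x hx (V none) (fun j => V (some j))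
          (isWeakPartial_of_mem_H10 hV)
        refine ⟨fun _ => m, 0, fun x y => by simp, ?_⟩
        rw [integral_finsetSum _ fun j hj => (hi j hj).mono_set inter_subset_left]
        have h3 : ∑ j, ∫ y in (Ω : Set (Space d)) ∩ Metric.ball x ((2 * γ + 2) * h),
            (V (some j) y - (0 : Space d) j) ^ 2 ≤
            ∑ j, ∫ y in (Ω : Set (Space d)) ∩ Metric.ball x (R' * h), V (some j) y ^ 2 := by
          refine Finset.sum_le_sum fun j _ => ?_
          simp only [PiLp.zero_apply, sub_zero]
          exact setIntegral_sq_mono (inter_subset_inter_right _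
            (Metric.ball_subset_ball (by gcongr))) (memLp_L2_of_subset _ inter_subset_left)
        calc _ ≤ _ := add_le_add hm (mul_le_mul_of_nonneg_left h3 (sq_nonneg h))
          _ = _ := by ring
    refine ⟨a, ha, hae.trans ?_⟩
    rw [integral_finsetSum _ hi]
    simp only [← norm_sq_L2]
    have h4 : ∑ j, ‖V (some j)‖ ^ 2 ≤ ‖V‖ ^ 2 := by rw [hVs]; linarith [sq_nonneg ‖V none‖]
    calc _ ≤ C2 * ((C1 + 1) * h ^ 2) * ‖V‖ ^ 2 := mul_le_mul_of_nonneg_left h4 (by positivity)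
      _ ≤ (C2 * (C1 + 1) + (1 / h₀ ^ 2 + 1)) * h ^ 2 * ‖V‖ ^ 2 := by
        have : 0 ≤ (1 / h₀ ^ 2 + 1) * h ^ 2 * ‖V‖ ^ 2 := by positivity
        linarith
  -- On a coarse mesh the zero function suffices, because `h / h₀ ≥ 1`.
  · push Not at hle
    refine ⟨0, fun _ _ => rfl, ?_⟩
    rw [quasiError_zero]
    have h3 : 1 ≤ 1 / h₀ ^ 2 * h ^ 2 := by
      rw [one_div, inv_mul_eq_div, one_le_div (by positivity)]
      exact pow_le_pow_left₀ hh₀0.le hle.le 2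
    have h4 : 0 ≤ C2 * (C1 + 1) * h ^ 2 * ‖V‖ ^ 2 := by positivity
    have h5 : ‖V none‖ ^ 2 ≤ 1 / h₀ ^ 2 * h ^ 2 * ‖V none‖ ^ 2 :=
      le_mul_of_one_le_left (sq_nonneg _) h3
    have h6 : 0 ≤ 1 / h₀ ^ 2 * h ^ 2 * ∑ j, ‖V (some j)‖ ^ 2 := by positivity
    have h7 : 0 ≤ h ^ 2 * ‖V none‖ ^ 2 := by positivity
    calc _ ≤ C2 * (C1 + 1) * h ^ 2 * ‖V‖ ^ 2 + (1 / h₀ ^ 2 + 1) * h ^ 2 *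
          (‖V none‖ ^ 2 + ∑ j, ‖V (some j)‖ ^ 2) := by linarith
      _ = _ := by rw [← hVs]; ring

theorem integrableOn_sum_sum_sq (K : Fin d → Fin d → L2 Ω) {S : Set (Space d)} (hS : S ⊆ Ω) :
    IntegrableOn (fun x => ∑ i, ∑ j, K i j x ^ 2) S :=
  integrable_finsetSum _ fun i _ => integrable_finsetSum _ fun j _ =>
    (memLp_L2_of_subset (K i j) hS).integrable_sq

theorem integral_sum_sum_sq (K : Fin d → Fin d → L2 Ω) {S : Set (Space d)} (hS : S ⊆ Ω) :
    ∫ x in S, ∑ i, ∑ j, K i j x ^ 2 = ∑ i, ∑ j, ∫ x in S, K i j x ^ 2 := by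
  have h1 : ∀ i j, IntegrableOn (fun x => K i j x ^ 2) S := fun i j =>
    (memLp_L2_of_subset (K i j) hS).integrable_sq
  rw [integral_finsetSum _ fun i _ => integrable_finsetSum _ fun j _ => h1 i j]
  exact Finset.sum_congr rfl fun i _ => integral_finsetSum _ fun j _ => h1 i j

/-- Affine local functions, with the squared second derivatives as density `G`. The gradient of `V`
is the one contained in `F`, by uniqueness of weak derivatives. -/
theorem exists_quasiError_le_H2 (hb : Bornology.IsBounded (Ω : Set (Space d)))
    (hL : HasLipschitzBoundary (Ω : Set (Space d))) (hγ : 0 < γ) :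
    ∃ C > 0, ∀ (M : SpatialMesh Ω) (h : ℝ), 0 < h → M.IsUniform γ h → ∀ V ∈ H10 Ω,
      ∀ F : H2 Ω, (F : Jet2 Ω) none = V none →
      ∃ a : Fin M.N → ℝ, (∀ i, M.p i ∉ Ω → a i = 0) ∧ M.quasiError h V a ≤ C * h ^ 4 * ‖F‖ ^ 2 := by
  obtain ⟨R', hR', C1, hC1, h1, hh1, H1⟩ := exists_local_affine hb hL
    (R := 2 * γ + 2) (by positivity)
  have hR'0 : 0 < R' := lt_of_lt_of_le (by positivity) hR'
  obtain ⟨h2, hh2, C2, hC2, H2⟩ := exists_quasiInterp hb hL hγ hR'0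
  set h₀ := min h1 h2 with hh₀
  have hh₀0 : 0 < h₀ := lt_min hh1 hh2
  refine ⟨C2 * C1 + (1 / h₀ ^ 4 + 1 / h₀ ^ 2), by positivity, fun M h hh hM V hV F hF => ?_⟩
  have hFs := norm_sq_H2 F
  have hS0 : 0 ≤ ∑ i, ‖(F : Jet2 Ω) (some (.inl i))‖ ^ 2 :=
    Finset.sum_nonneg fun i _ => sq_nonneg _
  have hS1 : 0 ≤ ∑ i, ∑ j, ‖(F : Jet2 Ω) (some (.inr (i, j)))‖ ^ 2 :=
    Finset.sum_nonneg fun i _ => Finset.sum_nonneg fun j _ => sq_nonneg _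
  have hVF := some_eq_of_H2 hV F hF
  by_cases hle : h ≤ h₀
  · set K : Fin d → Fin d → L2 Ω := fun i j => (F : Jet2 Ω) (some (.inr (i, j))) with hK
    obtain ⟨a, ha, hae⟩ := H2 M h hh (hle.trans (min_le_right _ _)) hM V hV
      (fun x => ∑ i, ∑ j, K i j x ^ 2) (integrableOn_sum_sum_sq K (Set.Subset.refl (Ω : Set (Space d))))
      (fun x => Finset.sum_nonneg fun i _ => Finset.sum_nonneg fun j _ => sq_nonneg _)
      (C1 * h ^ 4) (by positivity)
      fun x hx => by
        obtain ⟨q, g, hq, hm⟩ := H1 h hh (hle.trans (min_le_left _ _)) x hx (V none)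
          (fun j => V (some j)) K
          (isWeakPartial_of_mem_H10 hV) (fun i j => by rw [hVF]; exact F.2.2 i j)
        refine ⟨q, g, hq, hm.trans (le_of_eq ?_)⟩
        rw [integral_sum_sum_sq K inter_subset_left]
    refine ⟨a, ha, hae.trans ?_⟩
    rw [integral_sum_sum_sq K (Set.Subset.refl (Ω : Set (Space d)))]
    simp only [← norm_sq_L2]
    have h4 : ∑ i, ∑ j, ‖K i j‖ ^ 2 ≤ ‖F‖ ^ 2 := by
      rw [hFs]
      linarith [sq_nonneg ‖(F : Jet2 Ω) none‖]
    calc _ ≤ C2 * (C1 * h ^ 4) * ‖F‖ ^ 2 := mul_le_mul_of_nonneg_left h4 (by positivity)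
      _ ≤ (C2 * C1 + (1 / h₀ ^ 4 + 1 / h₀ ^ 2)) * h ^ 4 * ‖F‖ ^ 2 := by
        have : 0 ≤ (1 / h₀ ^ 4 + 1 / h₀ ^ 2) * h ^ 4 * ‖F‖ ^ 2 := by positivity
        linarith
  · push Not at hle
    refine ⟨0, fun _ _ => rfl, ?_⟩
    rw [quasiError_zero]
    simp only [hVF]
    rw [← hF]
    have h3 : 1 ≤ 1 / h₀ ^ 4 * h ^ 4 := by
      rw [one_div, inv_mul_eq_div, one_le_div (by positivity)]
      exact pow_le_pow_left₀ hh₀0.le hle.le 4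
    have h3' : h ^ 2 ≤ 1 / h₀ ^ 2 * h ^ 4 := by
      rw [one_div, inv_mul_eq_div, le_div_iff₀ (by positivity)]
      have := pow_le_pow_left₀ hh₀0.le hle.le 2
      nlinarith [sq_nonneg h]
    have h4 : 0 ≤ C2 * C1 * h ^ 4 * ‖F‖ ^ 2 := by positivity
    have hFn : ‖(F : Jet2 Ω) none‖ ^ 2 ≤ ‖F‖ ^ 2 := by rw [hFs]; linarith
    have hFg : ∑ i, ‖(F : Jet2 Ω) (some (.inl i))‖ ^ 2 ≤ ‖F‖ ^ 2 := by
      rw [hFs]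
      linarith [sq_nonneg ‖(F : Jet2 Ω) none‖]
    have h5 : ‖(F : Jet2 Ω) none‖ ^ 2 ≤ 1 / h₀ ^ 4 * h ^ 4 * ‖F‖ ^ 2 :=
      hFn.trans (le_mul_of_one_le_left (sq_nonneg _) h3)
    have h6 : h ^ 2 * ∑ i, ‖(F : Jet2 Ω) (some (.inl i))‖ ^ 2 ≤ 1 / h₀ ^ 2 * h ^ 4 * ‖F‖ ^ 2 :=
      mul_le_mul h3' hFg hS0 (by positivity)
    calc _ ≤ C2 * C1 * h ^ 4 * ‖F‖ ^ 2 + (1 / h₀ ^ 4 * h ^ 4 * ‖F‖ ^ 2 +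
          1 / h₀ ^ 2 * h ^ 4 * ‖F‖ ^ 2) := by linarith
      _ = _ := by ring

/-! #### Inverse estimates -/

theorem exists_affine_eq_nodal (hω : ω ∈ M.elems) (a : Fin M.N → ℝ) :
    ∃ (q : Space d → ℝ) (g : Space d), (∀ x y, q x - q y = inner ℝ g (x - y)) ∧
      ∀ x ∈ M.simplex ω, q x = M.nodal a x := by
  set A : Space d →ᵃ[ℝ] ℝ := ∑ i ∈ ω, a i • M.coord ω i with hA
  set ℓ : StrongDual ℝ (Space d) := LinearMap.toContinuousLinearMap A.linear with hℓ
  refine ⟨A, (InnerProductSpace.toDual ℝ (Space d)).symm ℓ, fun x y => ?_, fun x hx => ?_⟩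
  · rw [InnerProductSpace.toDual_symm_apply, hℓ, LinearMap.coe_toContinuousLinearMap',
      ← vsub_eq_sub x y, AffineMap.linearMap_vsub, vsub_eq_sub]
  · rw [nodal_eq_of_mem hω hx, hA, affineMap_sum_apply]
    rfl

/-- The nodal function is affine on the element, and the vertices are at most `1 + γ ^ 2` radii away
from the centre of the inscribed ball. -/
theorem sq_vertex_le (hb : Bornology.IsBounded (Ω : Set (Space d)))
    (hint : interior (closure (Ω : Set (Space d))) ⊆ Ω) (hM : M.IsUniform γ h) (hγ : 0 < γ)
    (hh : 0 < h) (hω : ω ∈ M.elems) (a : Fin M.N → ℝ) {i : Fin M.N} (hi : i ∈ ω) :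
    a i ^ 2 * ((h / γ) ^ d * volume.real (Metric.ball (0 : Space d) 1)) ≤
      2 ^ d * (3 * (9 * (1 + γ ^ 2) ^ 2)) * ∫ x in M.cell ω, M.nodal a x ^ 2 := by
  obtain ⟨q, g, hq, hqn⟩ := exists_affine_eq_nodal hω a
  obtain ⟨c, hc⟩ := hM.exists_ball hω
  have hpi : M.p i ∈ M.simplex ω := subset_convexHull ℝ _ ⟨i, hi, rfl⟩
  have h1 := sq_mul_volume_ball_le hq (c := c) (p := M.p i)
    (ρ := h / γ) (K := 1 + γ ^ 2) (by positivity) (by nlinarith) (by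
      refine (hM.norm_sub_le hω hpi (center_mem hγ hh hc)).trans ?_
      have : (1 + γ ^ 2) * (h / γ) = h / γ + γ * h := by field_simp
      rw [this]
      have : 0 < h / γ := by positivity
      linarith)
  rw [hqn _ hpi, nodal_vertex] at h1
  refine h1.trans (mul_le_mul_of_nonneg_left ?_ (by positivity))
  have hbc := ball_subset_cell hc
  rw [setIntegral_congr_fun measurableSet_ball fun x hx =>
    show q x ^ 2 = M.nodal a x ^ 2 by rw [hqn x (cell_subset_simplex (hbc hx))]]
  exact setIntegral_sq_mono hbc ((memLp_nodal hb a).mono_measure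
    (Measure.restrict_mono (cell_subset hint hω) le_rfl))

theorem norm_sq_toL2_eq_sum (hint : interior (closure (Ω : Set (Space d))) ⊆ Ω) (M : SpatialMesh Ω)
    {f : Space d → ℝ} (hf : MemLp f 2 (volume.restrict (Ω : Set (Space d)))) :
    ‖toL2 Ω f‖ ^ 2 = ∑ ω ∈ M.elems, ∫ x in M.cell ω, f x ^ 2 := by
  rw [norm_sq_toL2 hf, integral_eq_sum_cell hint hf.integrable_sq]

/-- Scaling on each cell: squared nodal values are at most of order `h ^ (-d)` times the squared
`L²` norm, the gradient is at most of order `1 / h` times the largest nodal value, and the volume is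
of order `h ^ d`. -/
theorem exists_inverse_estimate (hb : Bornology.IsBounded (Ω : Set (Space d)))
    (hint : interior (closure (Ω : Set (Space d))) ⊆ Ω) (hγ : 0 < γ) :
    ∃ C > 0, ∀ (M : SpatialMesh Ω) (h : ℝ), 0 < h → M.IsUniform γ h → ∀ a : Fin M.N → ℝ,
      (∀ i, M.p i ∉ Ω → a i = 0) →
      h ^ 2 * ∑ j, ‖toL2 Ω (partialDeriv j (M.nodal a))‖ ^ 2 ≤ C * ‖toL2 Ω (M.nodal a)‖ ^ 2 := by
  set β := volume.real (Metric.ball (0 : Space d) 1) with hβ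
  have hβ0 : 0 < β := volume_real_unitBall_pos
  set C1 : ℝ := 2 ^ d * (3 * (9 * (1 + γ ^ 2) ^ 2)) with hC1
  refine ⟨d * (((d + 1) * (2 * γ)) ^ 2 * (C1 * γ ^ d * (2 * γ) ^ d)) + 1, by positivity,
    fun M h hh hM a ha => ?_⟩
  obtain ⟨L, hL⟩ := exists_lipschitzWith_nodal hint hM hγ hh ha
  have hcell : ∀ ω ∈ M.elems, ∀ j, h ^ 2 * ∫ x in M.cell ω, partialDeriv j (M.nodal a) x ^ 2 ≤
      ((d + 1) * (2 * γ)) ^ 2 * (C1 * γ ^ d * (2 * γ) ^ d) * ∫ x in M.cell ω, M.nodal a x ^ 2 := by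
    intro ω hω j
    set I := ∫ x in M.cell ω, M.nodal a x ^ 2 with hI
    have hI0 : 0 ≤ I := integral_nonneg fun _ => sq_nonneg _
    set B := √(C1 * I / ((h / γ) ^ d * β)) with hB
    have hB2 : B ^ 2 = C1 * I / ((h / γ) ^ d * β) := Real.sq_sqrt (by positivity)
    have h1 : ∀ i ∈ ω, |a i - (fun _ => (0 : ℝ)) (M.p i)| ≤ B := fun i hi => by
      refine Real.abs_le_sqrt ?_
      rw [le_div_iff₀ (by positivity), sub_zero]
      exact sq_vertex_le hb hint hM hγ hh hω a hi
    have h2 : ∫ x in M.cell ω, partialDeriv j (M.nodal a) x ^ 2 ≤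
        ((d + 1) * (2 * γ / h) * B) ^ 2 * volume.real (M.cell ω) := by
      refine setIntegral_sq_le (volume_cell_ne_top hb hint hω) fun x hx => ?_
      have := abs_partialDeriv_nodal_sub_le hM hγ hh hω (q := fun _ => 0) (g := 0) (by simp) h1 j hx
      simpa using this
    have h3 : B ^ 2 * volume.real (M.cell ω) ≤ C1 * γ ^ d * (2 * γ) ^ d * I := by
      calc B ^ 2 * volume.real (M.cell ω) ≤ B ^ 2 * ((2 * γ * h) ^ d * β) :=
            mul_le_mul_of_nonneg_left (volume_cell_le hM hγ hh hω) (sq_nonneg _)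
        _ = _ := by
            rw [hB2, mul_pow, div_pow]
            field_simp
    calc _ ≤ h ^ 2 * (((d + 1) * (2 * γ / h) * B) ^ 2 * volume.real (M.cell ω)) :=
          mul_le_mul_of_nonneg_left h2 (sq_nonneg h)
      _ = ((d + 1) * (2 * γ)) ^ 2 * (B ^ 2 * volume.real (M.cell ω)) := by field_simp
      _ ≤ ((d + 1) * (2 * γ)) ^ 2 * (C1 * γ ^ d * (2 * γ) ^ d * I) :=
          mul_le_mul_of_nonneg_left h3 (sq_nonneg _)
      _ = _ := by ring
  rw [norm_sq_toL2_eq_sum hint M (memLp_nodal hb a),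
    Finset.sum_congr rfl fun j _ => norm_sq_toL2_eq_sum hint M
      (memLp_partialDeriv_of_lipschitz hb hL j), Finset.mul_sum]
  set I := ∑ ω ∈ M.elems, ∫ x in M.cell ω, M.nodal a x ^ 2 with hI
  have hI0 : 0 ≤ I := Finset.sum_nonneg fun ω _ => integral_nonneg fun _ => sq_nonneg _
  have h1 : ∀ j ∈ (Finset.univ : Finset (Fin d)),
      h ^ 2 * ∑ ω ∈ M.elems, ∫ x in M.cell ω, partialDeriv j (M.nodal a) x ^ 2 ≤
      ((d + 1) * (2 * γ)) ^ 2 * (C1 * γ ^ d * (2 * γ) ^ d) * I := fun j _ => by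
    rw [Finset.mul_sum, hI, Finset.mul_sum]
    exact Finset.sum_le_sum fun ω hω => hcell ω hω j
  refine (Finset.sum_le_sum h1).trans ?_
  rw [Finset.sum_const, Finset.card_univ, Fintype.card_fin, nsmul_eq_mul]
  linarith

/-! #### The discrete space -/

/-- `S¹₀(Ω_h)` as a subspace of `L²(Ω)`. -/
def discrete (M : SpatialMesh Ω) : Submodule ℝ (L2 Ω) :=
  Submodule.span ℝ (Set.range fun i : {i : Fin M.N // M.p i ∈ Ω} => toL2 Ω (M.hat i))

instance (M : SpatialMesh Ω) : FiniteDimensional ℝ M.discrete :=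
  FiniteDimensional.span_of_finite ℝ (Set.finite_range _)

theorem toL2_nodal (hb : Bornology.IsBounded (Ω : Set (Space d))) (a : Fin M.N → ℝ) :
    toL2 Ω (M.nodal a) = ∑ i, a i • toL2 Ω (M.hat i) := by
  have hm : ∀ i, MemLp (M.hat i) 2 (volume.restrict (Ω : Set (Space d))) := fun i =>
    memLp_of_continuousOn hb (continuousOn_hat i)
  have : M.nodal a = fun x => ∑ i, a i * M.hat i x := rfl
  rw [this, toL2_sum _ fun i _ => (hm i).const_mul (a i)]
  exact Finset.sum_congr rfl fun i _ => toL2_const_mul _ (hm i)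

theorem toL2_nodal_mem (hb : Bornology.IsBounded (Ω : Set (Space d))) {a : Fin M.N → ℝ}
    (ha : ∀ i, M.p i ∉ Ω → a i = 0) : toL2 Ω (M.nodal a) ∈ M.discrete := by
  rw [toL2_nodal hb]
  refine Submodule.sum_mem _ fun i _ => ?_
  by_cases hi : M.p i ∈ Ω
  · exact Submodule.smul_mem _ _ (Submodule.subset_span ⟨⟨i, hi⟩, rfl⟩)
  · rw [ha i hi, zero_smul]
    exact Submodule.zero_mem _

theorem exists_nodal_of_mem (hb : Bornology.IsBounded (Ω : Set (Space d))) {f : L2 Ω}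
    (hf : f ∈ M.discrete) :
    ∃ a : Fin M.N → ℝ, (∀ i, M.p i ∉ Ω → a i = 0) ∧ toL2 Ω (M.nodal a) = f := by
  classical
  simp only [toL2_nodal hb]
  induction hf using Submodule.span_induction with
  | mem f hf =>
    obtain ⟨⟨i, hi⟩, rfl⟩ := hf
    refine ⟨Pi.single i 1, fun j hj => Pi.single_eq_of_ne (fun h : j = i => hj (by rw [h]; exact hi)) _, ?_⟩
    simp [Pi.single_apply]
  | zero => exact ⟨0, fun _ _ => rfl, by simp⟩
  | add f f' _ _ h1 h2 =>
    obtain ⟨a, ha, rfl⟩ := h1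
    obtain ⟨a', ha', rfl⟩ := h2
    refine ⟨a + a', fun i hi => by simp [ha i hi, ha' i hi], ?_⟩
    simp only [Pi.add_apply, add_smul, Finset.sum_add_distrib]
  | smul c f _ h1 =>
    obtain ⟨a, ha, rfl⟩ := h1
    refine ⟨c • a, fun i hi => by simp [ha i hi], ?_⟩
    simp only [Pi.smul_apply, smul_eq_mul, mul_smul, Finset.smul_sum]

theorem nodal_sub (a b : Fin M.N → ℝ) (x : Space d) :
    M.nodal (a - b) x = M.nodal a x - M.nodal b x := by
  simp only [nodal, Pi.sub_apply, sub_mul, Finset.sum_sub_distrib]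

/-- `L²` classes determine the nodal values, so the projection fixes the interpolant at every
vertex. This is the source of uniqueness. -/
theorem toL2_nodal_injective (hb : Bornology.IsBounded (Ω : Set (Space d)))
    (hint : interior (closure (Ω : Set (Space d))) ⊆ Ω) (hM : M.IsUniform γ h) (hγ : 0 < γ)
    (hh : 0 < h) {a b : Fin M.N → ℝ} (hab : toL2 Ω (M.nodal a) = toL2 Ω (M.nodal b)) : a = b := by
  have h0 : ‖toL2 Ω (M.nodal (a - b))‖ ^ 2 = 0 := by
    have : M.nodal (a - b) = fun x => M.nodal a x - M.nodal b x := funext fun x => nodal_sub a b x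
    rw [this, toL2_sub (memLp_nodal hb a) (memLp_nodal hb b), hab, sub_self]
    simp
  rw [norm_sq_toL2_eq_sum hint M (memLp_nodal hb _), Finset.sum_eq_zero_iff_of_nonneg
    fun ω _ => integral_nonneg fun _ => sq_nonneg _] at h0
  funext i
  obtain ⟨ω, hω, hi⟩ := M.vertex_mem i
  have h1 := sq_vertex_le hb hint hM hγ hh hω (a - b) hi
  rw [h0 ω hω, mul_zero] at h1
  have hpos : 0 < (h / γ) ^ d * volume.real (Metric.ball (0 : Space d) 1) :=
    mul_pos (by positivity) volume_real_unitBall_pos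
  have h2 : (a - b) i ^ 2 = 0 := le_antisymm (by nlinarith) (sq_nonneg _)
  have h3 := pow_eq_zero_iff (two_ne_zero) |>.1 h2
  rw [Pi.sub_apply] at h3
  linarith

end SpatialMesh

end

/-! ### Stability and approximation properties of the `L²` projection on `H¹₀(Ω)`. -/

section

variable {d : ℕ} {Ω : Opens (Space d)}

theorem le_sqrt_mul_of_sq_le {x y K : ℝ} (hy : 0 ≤ y) (hK : 0 ≤ K) (h : x ^ 2 ≤ K * y ^ 2) :
    x ≤ √K * y := by
  rw [← Real.sqrt_sq hy, ← Real.sqrt_mul hK]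
  exact Real.le_sqrt_of_sq_le h

namespace SpatialMesh

variable {M : SpatialMesh Ω} {γ h : ℝ}

theorem exists_H10_nodal (hb : Bornology.IsBounded (Ω : Set (Space d)))
    (hint : interior (closure (Ω : Set (Space d))) ⊆ Ω)
    (hM : M.IsUniform γ h) (hγ : 0 < γ) (hh : 0 < h) {a : Fin M.N → ℝ}
    (ha : ∀ i, M.p i ∉ Ω → a i = 0) :
    ∃ V : H10 Ω, H10toL2 Ω V = toL2 Ω (M.nodal a) ∧
      ∀ j, (V : Jet1 Ω) (some j) = toL2 Ω (partialDeriv j (M.nodal a)) := by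
  obtain ⟨L, hL⟩ := exists_lipschitzWith_nodal hint hM hγ hh ha
  exact exists_H10_of_lipschitz hb hL fun x hx => nodal_eq_zero hint ha hx

/-- Stability of the projection with respect to the best approximation. -/
theorem quasi_optimal (hb : Bornology.IsBounded (Ω : Set (Space d)))
    (hint : interior (closure (Ω : Set (Space d))) ⊆ Ω)
    (hM : M.IsUniform γ h) (hγ : 0 < γ) (hh : 0 < h) {C : ℝ}
    (hC : ∀ a : Fin M.N → ℝ, (∀ i, M.p i ∉ Ω → a i = 0) →
      h ^ 2 * ∑ j, ‖toL2 Ω (partialDeriv j (M.nodal a))‖ ^ 2 ≤ C * ‖toL2 Ω (M.nodal a)‖ ^ 2)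
    (hC0 : 0 ≤ C) {V W : H10 Ω} (hW : H10toL2 Ω W = M.discrete.starProjection (H10toL2 Ω V))
    {a : Fin M.N → ℝ} (ha : ∀ i, M.p i ∉ Ω → a i = 0) :
    ‖H10toL2 Ω V - H10toL2 Ω W‖ ^ 2 ≤ 4 * M.quasiError h V a ∧
      h ^ 2 * ∑ j, ‖(V : Jet1 Ω) (some j) - (W : Jet1 Ω) (some j)‖ ^ 2 ≤
        (2 + 2 * C) * M.quasiError h V a := by
  obtain ⟨Φ, hΦ, hΦj⟩ := exists_H10_nodal hb hint hM hγ hh ha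
  have hWm : H10toL2 Ω W ∈ M.discrete := by
    rw [hW]
    exact Submodule.starProjection_apply_mem _ _
  have hΦm : H10toL2 Ω Φ ∈ M.discrete := hΦ ▸ toL2_nodal_mem hb ha
  obtain ⟨e, he, heW⟩ := exists_nodal_of_mem hb (Submodule.sub_mem _ hWm hΦm)
  obtain ⟨Ψ, hΨ, hΨj⟩ := exists_H10_nodal hb hint hM hγ hh he
  have hΨW : Ψ = W - Φ := H10toL2_injective (by rw [hΨ, heW, map_sub])
  have hD0 : ‖H10toL2 Ω V - H10toL2 Ω Φ‖ ^ 2 +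
      h ^ 2 * ∑ j, ‖(V : Jet1 Ω) (some j) - (Φ : Jet1 Ω) (some j)‖ ^ 2 = M.quasiError h V a := by
    rw [quasiError, hΦ, H10toL2_apply]
    simp only [hΦj]
  have hn0 : 0 ≤ h ^ 2 * ∑ j, ‖(V : Jet1 Ω) (some j) - (Φ : Jet1 Ω) (some j)‖ ^ 2 :=
    mul_nonneg (sq_nonneg h) (Finset.sum_nonneg fun _ _ => sq_nonneg _)
  -- The projection fixes the discrete function `Φ`, so `W - Φ` is the projection of `V - Φ`.
  have h1 : ‖H10toL2 Ω W - H10toL2 Ω Φ‖ ≤ ‖H10toL2 Ω V - H10toL2 Ω Φ‖ := by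
    have : H10toL2 Ω W - H10toL2 Ω Φ =
        M.discrete.starProjection (H10toL2 Ω V - H10toL2 Ω Φ) := by
      rw [map_sub, ← hW, Submodule.starProjection_eq_self_iff.2 hΦm]
    rw [this]
    exact Submodule.norm_starProjection_apply_le _ _
  have h1s := pow_le_pow_left₀ (norm_nonneg _) h1 2
  constructor
  · have h2 : ‖H10toL2 Ω V - H10toL2 Ω W‖ ≤ 2 * ‖H10toL2 Ω V - H10toL2 Ω Φ‖ := by
      have := norm_sub_le (H10toL2 Ω V - H10toL2 Ω Φ) (H10toL2 Ω W - H10toL2 Ω Φ)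
      rw [sub_sub_sub_cancel_right] at this
      linarith
    have h3 := pow_le_pow_left₀ (norm_nonneg _) h2 2
    rw [mul_pow] at h3
    linarith
  -- `W - Φ` is discrete, so the inverse estimate converts its `L²` bound into a gradient bound; the
  -- triangle inequality then compares `V` with `W`.
  · have h4 := hC e he
    rw [← hΨ, hΨW, map_sub] at h4
    simp only [← hΨj, hΨW] at h4
    have h5 : ∀ j, ‖(V : Jet1 Ω) (some j) - (W : Jet1 Ω) (some j)‖ ^ 2 ≤
        2 * ‖(V : Jet1 Ω) (some j) - (Φ : Jet1 Ω) (some j)‖ ^ 2 +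
          2 * ‖((W - Φ : H10 Ω) : Jet1 Ω) (some j)‖ ^ 2 := by
      intro j
      have h6 : ((W - Φ : H10 Ω) : Jet1 Ω) (some j) =
          (W : Jet1 Ω) (some j) - (Φ : Jet1 Ω) (some j) := rfl
      have h7 := norm_sub_le ((V : Jet1 Ω) (some j) - (Φ : Jet1 Ω) (some j))
        ((W : Jet1 Ω) (some j) - (Φ : Jet1 Ω) (some j))
      rw [sub_sub_sub_cancel_right] at h7
      rw [h6]
      nlinarith [norm_nonneg ((V : Jet1 Ω) (some j) - (W : Jet1 Ω) (some j)),
        sq_nonneg (‖(V : Jet1 Ω) (some j) - (Φ : Jet1 Ω) (some j)‖ -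
          ‖(W : Jet1 Ω) (some j) - (Φ : Jet1 Ω) (some j)‖)]
    have h8 := mul_le_mul_of_nonneg_left (Finset.sum_le_sum fun j (_ : j ∈ Finset.univ) => h5 j)
      (sq_nonneg h)
    rw [Finset.sum_add_distrib, ← Finset.mul_sum, ← Finset.mul_sum] at h8
    have h9 := mul_le_mul_of_nonneg_left h1s hC0
    have h10 : C * ‖H10toL2 Ω V - H10toL2 Ω Φ‖ ^ 2 ≤ C * M.quasiError h V a :=
      mul_le_mul_of_nonneg_left (by linarith) hC0
    have h11 := sq_nonneg ‖H10toL2 Ω V - H10toL2 Ω Φ‖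
    linarith

/-- The `L²` projection on `H¹₀`. -/
theorem exists_projection (hb : Bornology.IsBounded (Ω : Set (Space d)))
    (hL : HasLipschitzBoundary (Ω : Set (Space d))) (hγ : 0 < γ) :
    ∃ C > 0, ∀ (M : SpatialMesh Ω) (h : ℝ), 0 < h → M.IsUniform γ h →
      ∃ P : H10 Ω →L[ℝ] H10 Ω,
        (∀ V, H10toL2 Ω (P V) = M.discrete.starProjection (H10toL2 Ω V)) ∧
        (∀ V, ‖P V‖ ≤ C * ‖V‖) ∧
        (∀ V, ‖H10toL2 Ω V - H10toL2 Ω (P V)‖ ≤ C * h * ‖V‖) ∧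
        ∀ V, ∀ F : H2 Ω, H2toL2 Ω F = H10toL2 Ω V → ‖V - P V‖ ≤ C * h * ‖F‖ := by
  have hint := interior_closure_subset hL
  obtain ⟨Ci, hCi, Hi⟩ := exists_inverse_estimate hb hint hγ
  obtain ⟨C1, hC1, H1⟩ := exists_quasiError_le_H1 hb hL hγ
  obtain ⟨C2, hC2, H2⟩ := exists_quasiError_le_H2 hb hL hγ
  set K : ℝ := 4 + 4 * C1 + (2 + 2 * Ci) * (C1 + C2) with hK
  have hK0 : 0 ≤ K := by positivity
  refine ⟨1 + √K, by positivity, fun M h hh hM => ?_⟩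
  have hlift : ∀ V : H10 Ω, ∃ W : H10 Ω, H10toL2 Ω W = M.discrete.starProjection (H10toL2 Ω V) := by
    intro V
    obtain ⟨a, ha, haV⟩ := exists_nodal_of_mem hb
      (Submodule.starProjection_apply_mem M.discrete (H10toL2 Ω V))
    obtain ⟨W, hW, -⟩ := exists_H10_nodal hb hint hM hγ hh ha
    exact ⟨W, hW.trans haV⟩
  -- A discrete function has only one lift to `H¹₀`, so this choice is forced, and linearity of the
  -- lift is inherited from the orthogonal projection.
  choose Q hQ using hlift
  have hjet : ∀ V : H10 Ω, ‖V - Q V‖ ^ 2 = ‖H10toL2 Ω V - H10toL2 Ω (Q V)‖ ^ 2 +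
      ∑ j, ‖(V : Jet1 Ω) (some j) - ((Q V : H10 Ω) : Jet1 Ω) (some j)‖ ^ 2 := fun V =>
    norm_sq_H10 (V - Q V)
  have hA : ∀ V : H10 Ω, ‖H10toL2 Ω V - H10toL2 Ω (Q V)‖ ^ 2 ≤ 4 * C1 * h ^ 2 * ‖V‖ ^ 2 ∧
      ∑ j, ‖(V : Jet1 Ω) (some j) - ((Q V : H10 Ω) : Jet1 Ω) (some j)‖ ^ 2 ≤
        (2 + 2 * Ci) * C1 * ‖V‖ ^ 2 := by
    intro V
    obtain ⟨a, ha, hD⟩ := H1 M h hh hM V V.2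
    obtain ⟨h1, h2⟩ := quasi_optimal hb hint hM hγ hh (Hi M h hh hM) hCi.le (hQ V) ha
    rw [← Submodule.coe_norm] at hD
    refine ⟨by linarith, ?_⟩
    refine le_of_mul_le_mul_left ?_ (by positivity : 0 < h ^ 2)
    calc _ ≤ _ := h2
      _ ≤ (2 + 2 * Ci) * (C1 * h ^ 2 * ‖V‖ ^ 2) := mul_le_mul_of_nonneg_left hD (by positivity)
      _ = _ := by ring
  have hB : ∀ V, ‖V - Q V‖ ≤ √K * ‖V‖ := by
    intro V
    refine le_sqrt_mul_of_sq_le (norm_nonneg _) hK0 ?_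
    have h3 : ‖H10toL2 Ω V - H10toL2 Ω (Q V)‖ ≤ 2 * ‖V‖ := by
      rw [hQ]
      have h4 := norm_sub_le (H10toL2 Ω V) (M.discrete.starProjection (H10toL2 Ω V))
      have h5 := Submodule.norm_starProjection_apply_le M.discrete (H10toL2 Ω V)
      have h6 := norm_H10toL2_le V
      linarith
    have h4 := pow_le_pow_left₀ (norm_nonneg _) h3 2
    rw [mul_pow] at h4
    rw [hjet, hK]
    have := (hA V).2
    have h7 : 0 ≤ 4 * C1 * ‖V‖ ^ 2 := by positivity
    have h8 : 0 ≤ (2 + 2 * Ci) * C2 * ‖V‖ ^ 2 := by positivity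
    linarith
  have hQn : ∀ V, ‖Q V‖ ≤ (1 + √K) * ‖V‖ := by
    intro V
    have h1 := hB V
    have h2 := norm_sub_le V (V - Q V)
    rw [sub_sub_cancel] at h2
    linarith
  let P₀ : H10 Ω →ₗ[ℝ] H10 Ω :=
    { toFun := Q
      map_add' := fun V W => H10toL2_injective (by simp only [map_add, hQ])
      map_smul' := fun c V => H10toL2_injective (by simp only [map_smul, hQ, RingHom.id_apply]) }
  refine ⟨P₀.mkContinuous (1 + √K) hQn, hQ, hQn, fun V => ?_, fun V F hF => ?_⟩
  · change ‖H10toL2 Ω V - H10toL2 Ω (Q V)‖ ≤ _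
    have h1 : ‖H10toL2 Ω V - H10toL2 Ω (Q V)‖ ≤ √K * (h * ‖V‖) := by
      refine le_sqrt_mul_of_sq_le (by positivity) hK0 ((hA V).1.trans ?_)
      rw [mul_pow, mul_assoc]
      refine mul_le_mul_of_nonneg_right ?_ (by positivity)
      rw [hK]
      nlinarith [mul_pos hCi hC1, mul_pos hCi hC2]
    have : 0 ≤ h * ‖V‖ := by positivity
    linarith
  · change ‖V - Q V‖ ≤ _
    have hF' : (F : Jet2 Ω) none = (V : Jet1 Ω) none := hF
    obtain ⟨a, ha, hD⟩ := H2 M h hh hM V V.2 F hF'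
    obtain ⟨-, h2⟩ := quasi_optimal hb hint hM hγ hh (Hi M h hh hM) hCi.le (hQ V) ha
    have h3 : ∑ j, ‖(V : Jet1 Ω) (some j) - ((Q V : H10 Ω) : Jet1 Ω) (some j)‖ ^ 2 ≤
        (2 + 2 * Ci) * C2 * (h * ‖F‖) ^ 2 := by
      refine le_of_mul_le_mul_left ?_ (by positivity : 0 < h ^ 2)
      calc _ ≤ _ := h2
        _ ≤ (2 + 2 * Ci) * (C2 * h ^ 4 * ‖F‖ ^ 2) := mul_le_mul_of_nonneg_left hD (by positivity)
        _ = _ := by ring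
    have hVF : ‖V‖ ^ 2 ≤ ‖F‖ ^ 2 := norm_sq_le_of_H2 V.2 F hF'
    have h4 : ‖H10toL2 Ω V - H10toL2 Ω (Q V)‖ ^ 2 ≤ 4 * C1 * (h * ‖F‖) ^ 2 := by
      refine (hA V).1.trans ?_
      rw [mul_pow, ← mul_assoc]
      exact mul_le_mul_of_nonneg_left hVF (by positivity)
    have h1 : ‖V - Q V‖ ≤ √K * (h * ‖F‖) := by
      refine le_sqrt_mul_of_sq_le (by positivity) hK0 ?_
      rw [hjet, hK]
      have h7 : 0 ≤ 4 * (h * ‖F‖) ^ 2 := by positivity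
      have h8 : 0 ≤ (2 + 2 * Ci) * C1 * (h * ‖F‖) ^ 2 := by positivity
      linarith
    have : 0 ≤ h * ‖F‖ := by positivity
    linarith

/-! #### The projection in terms of nodal values -/

theorem toL2_eq_of_isS10 {v : Space d → ℝ} (hv : M.IsS10 v) :
    toL2 Ω v = toL2 Ω (M.nodal fun i => v (M.p i)) :=
  toL2_congr fun _ hx => eq_nodal_of_isPiecewiseAffine hv.1 (subset_closure hx)

theorem inner_sub_toL2 (hb : Bornology.IsBounded (Ω : Set (Space d))) (f : L2 Ω)
    {v φ : Space d → ℝ} (hv : M.IsS10 v) (hφ : M.IsS10 φ) :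
    inner ℝ (f - toL2 Ω v) (toL2 Ω φ) = ∫ x in (Ω : Set (Space d)), (f x - v x) * φ x := by
  rw [inner_toL2 _ (memLp_of_continuousOn hb hφ.1.1)]
  refine integral_congr_ae ?_
  filter_upwards [Lp.coeFn_sub f (toL2 Ω v), coeFn_toL2 (memLp_of_continuousOn hb hv.1.1)]
    with x h1 h2
  rw [h1, Pi.sub_apply, h2]

theorem isL2Projection_nodal (hb : Bornology.IsBounded (Ω : Set (Space d)))
    (hint : interior (closure (Ω : Set (Space d))) ⊆ Ω) {f : L2 Ω} {a : Fin M.N → ℝ}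
    (ha : ∀ i, M.p i ∉ Ω → a i = 0) (hf : toL2 Ω (M.nodal a) = M.discrete.starProjection f) :
    M.IsL2Projection f (M.nodal a) := by
  refine ⟨isS10_nodal hint ha, fun φ hφ => ?_⟩
  rw [← inner_sub_toL2 hb f (isS10_nodal hint ha) hφ, hf, toL2_eq_of_isS10 hφ]
  exact Submodule.starProjection_inner_eq_zero _ _ (toL2_nodal_mem hb hφ.vertex_eq_zero)

theorem IsL2Projection.toL2_eq (hb : Bornology.IsBounded (Ω : Set (Space d)))
    (hint : interior (closure (Ω : Set (Space d))) ⊆ Ω) {f : L2 Ω} {v : Space d → ℝ}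
    (hv : M.IsL2Projection f v) :
    toL2 Ω (M.nodal fun i => v (M.p i)) = M.discrete.starProjection f := by
  rw [← toL2_eq_of_isS10 hv.1]
  refine (Submodule.eq_starProjection_of_mem_of_inner_eq_zero ?_ fun s hs => ?_).symm
  · rw [toL2_eq_of_isS10 hv.1]
    exact toL2_nodal_mem hb hv.1.vertex_eq_zero
  · obtain ⟨c, hc, rfl⟩ := exists_nodal_of_mem hb hs
    rw [inner_sub_toL2 hb f hv.1 (isS10_nodal hint hc)]
    exact hv.2 _ (isS10_nodal hint hc)

end SpatialMesh

end

section

variable {d : ℕ} {Ω : Opens (Space d)}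

/-! ### The difference of the simplicial and the tensor product interpolant -/

namespace SpatialMesh

variable {M : SpatialMesh Ω} {γ h : ℝ} {ω : Finset (Fin M.N)}

/-- On a time slab, the simplicial and the tensor product interpolant differ by this function of
the relative height, with the increments of the values over the slab as coefficients. -/
def corr (M : SpatialMesh Ω) (b : Fin M.N → ℝ) (s : ℝ) (x : Space d) : ℝ :=
  ∑ i, b i * (M.cut s i x - s * M.hat i x)

/-- The functions `cut s i` and `s * hat i` both sum to `s`, so adding a constant to `b` changes
nothing. Only the oscillation of `b` over the element remains, which is where a power of `h` is
gained. -/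
theorem corr_eq_sum {s : ℝ} (hs : s ∈ Icc (0 : ℝ) 1) (hω : ω ∈ M.elems) (b : Fin M.N → ℝ) (c : ℝ)
    {x : Space d} (hx : x ∈ M.simplex ω) :
    M.corr b s x = ∑ i ∈ ω, (b i - c) * (M.cut s i x - s * M.hat i x) := by
  have hxc : x ∈ closure (Ω : Set (Space d)) := M.simplex_subset hω hx
  have h1 : ∑ i, c * (M.cut s i x - s * M.hat i x) = 0 := by
    rw [← Finset.mul_sum, Finset.sum_sub_distrib, M.sum_cut hs hxc, ← Finset.mul_sum,
      M.sum_hat hxc]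
    ring
  have h2 : M.corr b s x = ∑ i, (b i - c) * (M.cut s i x - s * M.hat i x) := by
    simp only [sub_mul, Finset.sum_sub_distrib, h1, sub_zero, corr]
  rw [h2]
  refine (Finset.sum_subset (Finset.subset_univ ω) fun i _ hi => ?_).symm
  have h3 := (M.isConvexComb_hat hω hx).eq_zero i hi
  rw [h3, M.cut_eq_zero h3]
  ring

theorem abs_cut_sub_le (s s' : ℝ) (i : Fin M.N) (x : Space d) :
    |M.cut s i x - M.cut s' i x| ≤ 2 * |s - s'| := by
  have h1 : ∀ a : ℝ, |min a s - min a s'| ≤ |s - s'| := fun a => by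
    have := abs_min_sub_min_le_max a s a s'
    rwa [sub_self, abs_zero, max_eq_right (abs_nonneg _)] at this
  have e : M.cut s i x - M.cut s' i x = (min (M.lev (i.1 + 1) x) s - min (M.lev (i.1 + 1) x) s') -
      (min (M.lev i.1 x) s - min (M.lev i.1 x) s') := by
    rw [cut, cut]
    ring
  rw [e]
  exact (abs_sub _ _).trans (by linarith [h1 (M.lev (i.1 + 1) x), h1 (M.lev i.1 x)])

theorem abs_lev_sub_le (hM : M.IsUniform γ h) (hγ : 0 < γ) (hh : 0 < h) (hω : ω ∈ M.elems)
    (m : ℕ) {x y : Space d} (hx : x ∈ M.simplex ω) (hy : y ∈ M.simplex ω) :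
    |M.lev m x - M.lev m y| ≤ (d + 1) * (2 * γ / h * ‖x - y‖) := by
  rw [lev, lev, ← Finset.sum_sub_distrib]
  calc |∑ j : Fin M.N with j.1 < m, (M.hat j x - M.hat j y)|
      ≤ ∑ j : Fin M.N with j.1 < m, |M.hat j x - M.hat j y| := Finset.abs_sum_le_sum_abs _ _
    _ ≤ ∑ j, |M.hat j x - M.hat j y| :=
        Finset.sum_le_sum_of_subset_of_nonneg (Finset.filter_subset _ _) fun _ _ _ => abs_nonneg _
    _ = ∑ j ∈ ω, |M.hat j x - M.hat j y| := by
        refine (Finset.sum_subset (Finset.subset_univ ω) fun j _ hj => ?_).symm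
        rw [(M.isConvexComb_hat hω hx).eq_zero j hj, (M.isConvexComb_hat hω hy).eq_zero j hj, sub_self, abs_zero]
    _ ≤ ∑ j ∈ ω, 2 * γ / h * ‖x - y‖ :=
        Finset.sum_le_sum fun j _ => abs_hat_sub_le hM hγ hh hω j hx hy
    _ = _ := by rw [Finset.sum_const, M.card_elem hω, nsmul_eq_mul]; push_cast; ring

theorem abs_cut_sub_le_of_mem (hM : M.IsUniform γ h) (hγ : 0 < γ) (hh : 0 < h) (hω : ω ∈ M.elems)
    (s : ℝ) (i : Fin M.N) {x y : Space d} (hx : x ∈ M.simplex ω) (hy : y ∈ M.simplex ω) :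
    |M.cut s i x - M.cut s i y| ≤ 2 * ((d + 1) * (2 * γ / h * ‖x - y‖)) := by
  have h1 : ∀ a b : ℝ, |min a s - min b s| ≤ |a - b| := fun a b => by
    have := abs_min_sub_min_le_max a s b s
    rwa [sub_self, abs_zero, max_eq_left (abs_nonneg _)] at this
  have e : M.cut s i x - M.cut s i y = (min (M.lev (i.1 + 1) x) s - min (M.lev (i.1 + 1) y) s) -
      (min (M.lev i.1 x) s - min (M.lev i.1 y) s) := by
    rw [cut, cut]
    ring
  rw [e]
  refine (abs_sub _ _).trans ?_
  linarith [h1 (M.lev (i.1 + 1) x) (M.lev (i.1 + 1) y), h1 (M.lev i.1 x) (M.lev i.1 y),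
    abs_lev_sub_le hM hγ hh hω (i.1 + 1) hx hy, abs_lev_sub_le hM hγ hh hω i.1 hx hy]

theorem abs_corr_sub_le_time (hω : ω ∈ M.elems) {b : Fin M.N → ℝ} {c β : ℝ}
    (hβ : ∀ i ∈ ω, |b i - c| ≤ β) {s s' : ℝ} (hs : s ∈ Icc (0 : ℝ) 1) (hs' : s' ∈ Icc (0 : ℝ) 1)
    {x : Space d} (hx : x ∈ M.simplex ω) :
    |M.corr b s x - M.corr b s' x| ≤ (d + 1) * 3 * |s - s'| * β := by
  rw [corr_eq_sum hs hω b c hx, corr_eq_sum hs' hω b c hx, ← Finset.sum_sub_distrib]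
  calc _ ≤ ∑ i ∈ ω, β * (3 * |s - s'|) := by
        refine (Finset.abs_sum_le_sum_abs _ _).trans (Finset.sum_le_sum fun i hi => ?_)
        rw [← mul_sub, abs_mul]
        refine mul_le_mul (hβ i hi) ?_ (abs_nonneg _) ((abs_nonneg _).trans (hβ i hi))
        have h1 := M.abs_cut_sub_le s s' i x
        have h2 : |(s - s') * M.hat i x| ≤ |s - s'| := by
          rw [abs_mul, abs_of_nonneg (M.hat_nonneg i x)]
          refine mul_le_of_le_one_right (abs_nonneg _) ?_
          exact (Finset.single_le_sum (f := fun i => M.hat i x) (fun j _ => M.hat_nonneg j x)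
            (Finset.mem_univ i)).trans (M.sum_hat_le_one x)
        calc |M.cut s i x - s * M.hat i x - (M.cut s' i x - s' * M.hat i x)|
            = |(M.cut s i x - M.cut s' i x) - (s - s') * M.hat i x| := by congr 1; ring
          _ ≤ _ := (abs_sub _ _).trans (by linarith)
    _ = _ := by rw [Finset.sum_const, M.card_elem hω, nsmul_eq_mul]; push_cast; ring

/-- There are `d + 1` vertices in the element. In `2 * d + 3`, the two truncated prefix sums
contribute `d + 1` each, and the term with the hat function contributes 1. -/
theorem abs_corr_sub_le_space (hM : M.IsUniform γ h) (hγ : 0 < γ) (hh : 0 < h) (hω : ω ∈ M.elems)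
    {b : Fin M.N → ℝ} {c β : ℝ} (hβ : ∀ i ∈ ω, |b i - c| ≤ β) {s : ℝ} (hs : s ∈ Icc (0 : ℝ) 1)
    {x y : Space d} (hx : x ∈ M.simplex ω) (hy : y ∈ M.simplex ω) :
    |M.corr b s x - M.corr b s y| ≤ (d + 1) * (2 * d + 3) * (2 * γ / h) * β * ‖x - y‖ := by
  rw [corr_eq_sum hs hω b c hx, corr_eq_sum hs hω b c hy, ← Finset.sum_sub_distrib]
  have h0 : 0 ≤ 2 * γ / h * ‖x - y‖ := by positivity
  calc _ ≤ ∑ i ∈ ω, β * ((2 * d + 3) * (2 * γ / h * ‖x - y‖)) := by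
        refine (Finset.abs_sum_le_sum_abs _ _).trans (Finset.sum_le_sum fun i hi => ?_)
        rw [← mul_sub, abs_mul]
        refine mul_le_mul (hβ i hi) ?_ (abs_nonneg _) ((abs_nonneg _).trans (hβ i hi))
        have h1 := abs_cut_sub_le_of_mem hM hγ hh hω s i hx hy
        have h2 : |s * (M.hat i x - M.hat i y)| ≤ 2 * γ / h * ‖x - y‖ := by
          rw [abs_mul, abs_of_nonneg hs.1]
          exact (mul_le_of_le_one_left (abs_nonneg _) hs.2).trans
            (abs_hat_sub_le hM hγ hh hω i hx hy)
        calc |M.cut s i x - s * M.hat i x - (M.cut s i y - s * M.hat i y)|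
            = |(M.cut s i x - M.cut s i y) - s * (M.hat i x - M.hat i y)| := by congr 1; ring
          _ ≤ _ := (abs_sub _ _).trans (by linarith)
    _ = _ := by rw [Finset.sum_const, M.card_elem hω, nsmul_eq_mul]; push_cast; ring

theorem corr_eq_zero (hint : interior (closure (Ω : Set (Space d))) ⊆ Ω) {b : Fin M.N → ℝ}
    (hb : ∀ i, M.p i ∉ Ω → b i = 0) (s : ℝ) {x : Space d} (hx : x ∉ Ω) : M.corr b s x = 0 := by
  classical
  refine Finset.sum_eq_zero fun i _ => ?_
  by_cases hi : M.p i ∈ Ω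
  · have h1 : M.nodal (Pi.single i 1) x = 0 := nodal_eq_zero hint (fun j hj =>
      Pi.single_eq_of_ne (fun h : j = i => hj (by rw [h]; exact hi)) _) hx
    have h2 : M.hat i x = 0 := by
      rwa [nodal, Finset.sum_eq_single i (fun j _ hj => by rw [Pi.single_eq_of_ne hj, zero_mul])
        (fun h => absurd (Finset.mem_univ i) h), Pi.single_eq_same, one_mul] at h1
    rw [h2, M.cut_eq_zero h2]
    ring
  · rw [hb i hi, zero_mul]

theorem continuousOn_cut (s : ℝ) (i : Fin M.N) :
    ContinuousOn (M.cut s i) (closure (Ω : Set (Space d))) :=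
  ((M.continuousOn_lev _).inf continuousOn_const).sub
    ((M.continuousOn_lev _).inf continuousOn_const)

theorem continuousOn_corr (b : Fin M.N → ℝ) (s : ℝ) :
    ContinuousOn (M.corr b s) (closure (Ω : Set (Space d))) :=
  continuousOn_finsetSum _ fun i _ => continuousOn_const.mul
    ((continuousOn_cut s i).sub (continuousOn_const.mul (continuousOn_hat i)))

theorem memLp_corr (hb : Bornology.IsBounded (Ω : Set (Space d))) (b : Fin M.N → ℝ) (s : ℝ) :
    MemLp (M.corr b s) 2 (volume.restrict (Ω : Set (Space d))) :=
  memLp_of_continuousOn hb (continuousOn_corr b s)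

/-- The gradient of a nodal function on each cell, which also controls the oscillation. -/
theorem exists_cell_gradient (hM : M.IsUniform γ h) (b : Fin M.N → ℝ) :
    ∃ g : Finset (Fin M.N) → Space d, ∃ c : Finset (Fin M.N) → ℝ, ∀ ω ∈ M.elems,
      (∀ i ∈ ω, |b i - c ω| ≤ γ * h * ‖g ω‖) ∧
      ∀ x ∈ M.cell ω, ∀ j, partialDeriv j (M.nodal b) x = g ω j := by
  have key : ∀ ω, ∃ (g : Space d) (c : ℝ), ω ∈ M.elems → (∀ i ∈ ω, |b i - c| ≤ γ * h * ‖g‖) ∧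
      ∀ x ∈ M.cell ω, ∀ j, partialDeriv j (M.nodal b) x = g j := by
    intro ω
    by_cases hω : ω ∈ M.elems
    · obtain ⟨q, g, hq, hqn⟩ := exists_affine_eq_nodal hω b
      have hp : ∀ i ∈ ω, M.p i ∈ M.simplex ω := fun i hi => subset_convexHull ℝ _ ⟨i, hi, rfl⟩
      have hqb : ∀ i ∈ ω, q (M.p i) = b i := fun i hi => by
        rw [hqn _ (hp i hi), nodal_vertex]
      obtain ⟨i₀, hi₀⟩ : ω.Nonempty := by
        rw [← Finset.card_pos, M.card_elem hω]
        omega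
      refine ⟨g, b i₀, fun _ => ⟨fun i hi => ?_, fun x hx j => ?_⟩⟩
      · rw [← hqb i hi, ← hqb i₀ hi₀, hq, mul_comm]
        exact (abs_real_inner_le_norm _ _).trans (mul_le_mul_of_nonneg_left
          (hM.norm_sub_le hω (hp i hi) (hp i₀ hi₀)) (norm_nonneg _))
      · rw [partialDeriv_nodal hω b j hx, ← sum_coordGrad hω hq j]
        exact Finset.sum_congr rfl fun i hi => by rw [hqb i hi]
    · exact ⟨0, 0, fun h => absurd h hω⟩
  choose g c hgc using key
  exact ⟨g, c, hgc⟩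

theorem sum_norm_sq_cell (hb : Bornology.IsBounded (Ω : Set (Space d)))
    (hint : interior (closure (Ω : Set (Space d))) ⊆ Ω) (hM : M.IsUniform γ h) (hγ : 0 < γ)
    (hh : 0 < h) {b : Fin M.N → ℝ} (hb0 : ∀ i, M.p i ∉ Ω → b i = 0)
    {g : Finset (Fin M.N) → Space d}
    (hg : ∀ ω ∈ M.elems, ∀ x ∈ M.cell ω, ∀ j, partialDeriv j (M.nodal b) x = g ω j) :
    ∑ ω ∈ M.elems, ‖g ω‖ ^ 2 * volume.real (M.cell ω) =
      ∑ j, ‖toL2 Ω (partialDeriv j (M.nodal b))‖ ^ 2 := by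
  obtain ⟨L, hL⟩ := exists_lipschitzWith_nodal hint hM hγ hh hb0
  simp only [norm_sq_toL2_eq_sum hint M (memLp_partialDeriv_of_lipschitz hb hL _)]
  rw [Finset.sum_comm]
  refine Finset.sum_congr rfl fun ω hω => ?_
  rw [EuclideanSpace.norm_sq_eq, Finset.sum_mul]
  refine Finset.sum_congr rfl fun j _ => ?_
  rw [setIntegral_congr_fun isOpen_cell.measurableSet (g := fun _ => g ω j ^ 2)
    fun x hx => by simp only [hg ω hω x hx j], setIntegral_const, smul_eq_mul, Real.norm_eq_abs,
    sq_abs, mul_comm]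

theorem norm_sq_le_of_cell (hint : interior (closure (Ω : Set (Space d))) ⊆ Ω)
    (hb : Bornology.IsBounded (Ω : Set (Space d))) {f : Space d → ℝ}
    (hf : MemLp f 2 (volume.restrict (Ω : Set (Space d)))) {c : ℝ}
    {g : Finset (Fin M.N) → Space d}
    (hfg : ∀ ω ∈ M.elems, ∀ x ∈ M.cell ω, |f x| ≤ c * ‖g ω‖) :
    ‖toL2 Ω f‖ ^ 2 ≤ c ^ 2 * ∑ ω ∈ M.elems, ‖g ω‖ ^ 2 * volume.real (M.cell ω) := by
  rw [norm_sq_toL2_eq_sum hint M hf, Finset.mul_sum]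
  refine Finset.sum_le_sum fun ω hω => ?_
  refine (setIntegral_sq_le (volume_cell_ne_top hb hint hω) (hfg ω hω)).trans_eq ?_
  ring

theorem abs_partialDeriv_le_of_open {f : Space d → ℝ} {S : Set (Space d)} (hS : IsOpen S) {c : ℝ}
    (hc : 0 ≤ c) (hf : ∀ x ∈ S, ∀ y ∈ S, |f x - f y| ≤ c * ‖x - y‖) (j : Fin d) {x : Space d}
    (hx : x ∈ S) : |partialDeriv j f x| ≤ c := by
  have h1 : ‖fderiv ℝ f x‖ ≤ c := by
    refine norm_fderiv_le_of_lip' ℝ hc ?_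
    filter_upwards [hS.mem_nhds hx] with y hy using hf y hy x hx
  have h2 := (fderiv ℝ f x).le_opNorm (EuclideanSpace.single j 1)
  rw [PiLp.norm_single, norm_one, mul_one] at h2
  exact h2.trans h1

/-- The correction is controlled by the gradient of the increment. -/
theorem exists_corr_bound (hb : Bornology.IsBounded (Ω : Set (Space d)))
    (hint : interior (closure (Ω : Set (Space d))) ⊆ Ω) (hγ : 0 < γ) {T : ℝ} (hT : 0 < T) :
    ∃ C > 0, ∀ (M : SpatialMesh Ω) (h : ℝ), 0 < h → h ≤ T → M.IsUniform γ h →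
      ∀ (b : Fin M.N → ℝ) (B : H10 Ω), (∀ i, M.p i ∉ Ω → b i = 0) →
        H10toL2 Ω B = toL2 Ω (M.nodal b) →
        (∀ s ∈ Icc (0 : ℝ) 1, ∃ R : H10 Ω, H10toL2 Ω R = toL2 Ω (M.corr b s) ∧
          ‖R‖ ≤ C * ‖B‖) ∧
        ∀ s ∈ Icc (0 : ℝ) 1, ∀ s' ∈ Icc (0 : ℝ) 1,
          ‖toL2 Ω (M.corr b s) - toL2 Ω (M.corr b s')‖ ≤ C * h * |s - s'| * ‖B‖ := by
  -- The oscillation `γ * h * ‖g ω‖` enters both bounds. The time bound keeps the factor `h`; in the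
  -- gradient bound it cancels against the slope `2 * γ / h` of the hat functions.
  set c₁ : ℝ := (d + 1) * 3 * γ with hc₁
  set c₂ : ℝ := (d + 1) * (2 * d + 3) * (2 * γ) * γ with hc₂
  have hc₁0 : 0 < c₁ := by positivity
  have hc₂0 : 0 < c₂ := by positivity
  refine ⟨√((c₁ * T) ^ 2 + d * c₂ ^ 2) + c₁, by positivity, ?_⟩
  intro M h hh hhT hM b B hb0 hB
  obtain ⟨g, c, hgc⟩ := exists_cell_gradient hM b
  have hsum := sum_norm_sq_cell hb hint hM hγ hh hb0 fun ω hω => (hgc ω hω).2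
  obtain ⟨B', hB', hB'j⟩ := exists_H10_nodal hb hint hM hγ hh hb0
  obtain rfl : B = B' := H10toL2_injective (by rw [hB, hB'])
  have hG : ∑ ω ∈ M.elems, ‖g ω‖ ^ 2 * volume.real (M.cell ω) ≤ ‖B‖ ^ 2 := by
    rw [hsum, Submodule.coe_norm, norm_sq_Jet1]
    simp only [hB'j]
    exact le_add_of_nonneg_left (sq_nonneg _)
  have hsq : ∀ (f : Space d → ℝ), MemLp f 2 (volume.restrict (Ω : Set (Space d))) → ∀ k : ℝ,
      (∀ ω ∈ M.elems, ∀ x ∈ M.cell ω, |f x| ≤ k * ‖g ω‖) →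
      ‖toL2 Ω f‖ ^ 2 ≤ k ^ 2 * ‖B‖ ^ 2 := fun f hf k hk =>
    (norm_sq_le_of_cell hint hb hf hk).trans (mul_le_mul_of_nonneg_left hG (sq_nonneg _))
  have htime : ∀ s ∈ Icc (0 : ℝ) 1, ∀ s' ∈ Icc (0 : ℝ) 1, ∀ ω ∈ M.elems, ∀ x ∈ M.cell ω,
      |M.corr b s x - M.corr b s' x| ≤ c₁ * h * |s - s'| * ‖g ω‖ := by
    intro s hs s' hs' ω hω x hx
    refine (abs_corr_sub_le_time hω (hgc ω hω).1 hs hs' (cell_subset_simplex hx)).trans_eq ?_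
    rw [hc₁]
    ring
  have htimeL2 : ∀ s ∈ Icc (0 : ℝ) 1, ∀ s' ∈ Icc (0 : ℝ) 1,
      ‖toL2 Ω (M.corr b s) - toL2 Ω (M.corr b s')‖ ≤ c₁ * h * |s - s'| * ‖B‖ := by
    intro s hs s' hs'
    rw [← toL2_sub (memLp_corr hb b s) (memLp_corr hb b s')]
    have := hsq _ ((memLp_corr hb b s).sub (memLp_corr hb b s')) _ (htime s hs s' hs')
    rw [← mul_pow] at this
    exact le_of_sq_le_sq this (by positivity)
  have hcorr0 : M.corr b 0 = fun _ => 0 := by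
    funext x
    refine Finset.sum_eq_zero fun i _ => ?_
    rw [M.cut_zero]
    ring
  constructor
  · intro s hs
    set Lc : Finset (Fin M.N) → ℝ := fun ω => (d + 1) * (2 * d + 3) * (2 * γ / h) *
      (γ * h * ‖g ω‖) with hLc
    have hLc0 : ∀ ω, 0 ≤ Lc ω := fun ω => by positivity
    have hLc' : ∀ ω, Lc ω = c₂ * ‖g ω‖ := fun ω => by
      simp only [hLc, hc₂]
      field_simp
    have hspace : ∀ ω ∈ M.elems, ∀ x ∈ M.simplex ω, ∀ y ∈ M.simplex ω,
        |M.corr b s x - M.corr b s y| ≤ Lc ω * ‖x - y‖ := fun ω hω x hx y hy =>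
      abs_corr_sub_le_space hM hγ hh hω (hgc ω hω).1 hs hx hy
    have hlip : LipschitzWith ⟨∑ ω ∈ M.elems, Lc ω, Finset.sum_nonneg fun ω _ => hLc0 ω⟩
        (M.corr b s) := by
      refine lipschitzWith_of_finite_closed_cover (s := M.elems) (K := M.simplex)
        (fun ω _ => M.isClosed_simplex ω) (fun ω hω u hu v hv => ?_)
        (continuous_of_continuousOn_closure (continuousOn_corr b s) fun x hx =>
          corr_eq_zero hint hb0 s hx) fun u hu => ?_
      · refine (hspace ω hω u hu v hv).trans (mul_le_mul_of_nonneg_right ?_ (norm_nonneg _))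
        exact Finset.single_le_sum (fun ω _ => hLc0 ω) hω
      · refine corr_eq_zero hint hb0 s fun hu' => ?_
        obtain ⟨ω, hω, huω⟩ := M.exists_mem_simplex (subset_closure hu')
        exact hu ω hω huω
    obtain ⟨R, hR, hRj⟩ := exists_H10_of_lipschitz hb hlip fun x hx => corr_eq_zero hint hb0 s hx
    refine ⟨R, hR, ?_⟩
    have h1 : ‖toL2 Ω (M.corr b s)‖ ^ 2 ≤ (c₁ * T) ^ 2 * ‖B‖ ^ 2 := by
      refine hsq _ (memLp_corr hb b s) _ fun ω hω x hx => ?_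
      -- The correction vanishes at relative height 0, so its Lipschitz bound in time is also a
      -- bound for its size.
      have h2 := htime s hs 0 ⟨le_rfl, zero_le_one⟩ ω hω x hx
      rw [hcorr0, sub_zero, sub_zero, abs_of_nonneg hs.1] at h2
      refine h2.trans (mul_le_mul_of_nonneg_right ?_ (norm_nonneg _))
      calc c₁ * h * s ≤ c₁ * h * 1 := by gcongr; exact hs.2
        _ ≤ c₁ * T := by rw [mul_one]; gcongr
    have h3 : ∀ j, ‖toL2 Ω (partialDeriv j (M.corr b s))‖ ^ 2 ≤ c₂ ^ 2 * ‖B‖ ^ 2 := fun j =>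
      hsq _ (memLp_partialDeriv_of_lipschitz hb hlip j) _ fun ω hω x hx => by
        rw [← hLc']
        exact abs_partialDeriv_le_of_open isOpen_cell (hLc0 ω) (fun x hx y hy => hspace ω hω x
          (cell_subset_simplex hx) y (cell_subset_simplex hy)) j hx
    have h4 : ‖R‖ ^ 2 ≤ ((c₁ * T) ^ 2 + d * c₂ ^ 2) * ‖B‖ ^ 2 := by
      rw [Submodule.coe_norm, norm_sq_Jet1, hR]
      simp only [hRj]
      have := Finset.sum_le_sum fun j (_ : j ∈ Finset.univ) => h3 j
      rw [Finset.sum_const, Finset.card_univ, Fintype.card_fin, nsmul_eq_mul] at this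
      linarith
    refine (le_sqrt_mul_of_sq_le (norm_nonneg _) (by positivity) h4).trans ?_
    exact mul_le_mul_of_nonneg_right (le_add_of_nonneg_right hc₁0.le) (norm_nonneg _)
  · intro s hs s' hs'
    refine (htimeL2 s hs s' hs').trans ?_
    gcongr
    exact le_add_of_nonneg_left (Real.sqrt_nonneg _)

end SpatialMesh

end

section

/-! ### Weak time derivatives -/

theorem integrable_of_memLp_time {X : Type*} [NormedAddCommGroup X] {T : ℝ} {f : ℝ → X}
    (hf : MemLp f 2 (timeMeasure T)) : Integrable f (timeMeasure T) :=
  hf.integrable (by norm_num)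

section

variable {X : Type*} [NormedAddCommGroup X] [NormedSpace ℝ X] {T : ℝ} {f g : ℝ → X}

theorem integral_testFunction_smul (φ : 𝓓(timeInterval T, ℝ)) (f : ℝ → X) :
    ∫ t in Ioo 0 T, φ t • f t = ∫ t, φ t • f t :=
  setIntegral_eq_integral_of_forall_compl_eq_zero fun t ht => by
    rw [image_eq_zero_of_notMem_tsupport fun h => ht (φ.tsupport_subset h), zero_smul]

theorem hasDerivAt_testFunction (φ : 𝓓(timeInterval T, ℝ)) (t : ℝ) :
    HasDerivAt φ (deriv φ t) t :=
  ((φ.contDiff.differentiable (by simp)) t).hasDerivAt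

theorem continuous_deriv_testFunction (φ : 𝓓(timeInterval T, ℝ)) : Continuous (deriv φ) :=
  φ.contDiff.continuous_deriv (by simp)

theorem testFunction_eq_zero (φ : 𝓓(timeInterval T, ℝ)) {t : ℝ} (ht : t ∉ Ioo 0 T) : φ t = 0 :=
  image_eq_zero_of_notMem_tsupport fun h => ht (φ.tsupport_subset h)

theorem exists_bound_testFunction (φ : 𝓓(timeInterval T, ℝ)) :
    (∃ C, ∀ t, ‖φ t‖ ≤ C) ∧ ∃ C, ∀ t, ‖deriv φ t‖ ≤ C :=
  ⟨φ.hasCompactSupport.exists_bound_of_continuous φ.continuous,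
    φ.hasCompactSupport.deriv.exists_bound_of_continuous (continuous_deriv_testFunction φ)⟩

theorem integrable_testFunction_smul (φ : 𝓓(timeInterval T, ℝ))
    (hf : Integrable f (timeMeasure T)) :
    Integrable (fun t => φ t • f t) (timeMeasure T) ∧
      Integrable (fun t => deriv φ t • f t) (timeMeasure T) := by
  obtain ⟨⟨C, hC⟩, C', hC'⟩ := exists_bound_testFunction φ
  exact ⟨hf.bdd_smul C φ.continuous.aestronglyMeasurable (.of_forall hC),
    hf.bdd_smul C' (continuous_deriv_testFunction φ).aestronglyMeasurable (.of_forall hC')⟩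

theorem HasWeakTimeDeriv.congr {f' : ℝ → X} (h : HasWeakTimeDeriv T f g)
    (hf : f =ᵐ[timeMeasure T] f') : HasWeakTimeDeriv T f' g where
  memLp := h.memLp.ae_eq hf
  memLp_deriv := h.memLp_deriv
  integral_eq φ := by
    rw [h.integral_eq φ]
    congr 1
    refine integral_congr_ae ?_
    filter_upwards [hf] with t ht
    rw [ht]

theorem HasWeakTimeDeriv.sub {f' g' : ℝ → X} (h : HasWeakTimeDeriv T f g)
    (h' : HasWeakTimeDeriv T f' g') :
    HasWeakTimeDeriv T (fun t => f t - f' t) (fun t => g t - g' t) where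
  memLp := h.memLp.sub h'.memLp
  memLp_deriv := h.memLp_deriv.sub h'.memLp_deriv
  integral_eq φ := by
    simp only [smul_sub]
    rw [integral_sub (integrable_testFunction_smul φ (integrable_of_memLp_time h.memLp_deriv)).1
        (integrable_testFunction_smul φ (integrable_of_memLp_time h'.memLp_deriv)).1,
      integral_sub (integrable_testFunction_smul φ (integrable_of_memLp_time h.memLp)).2
        (integrable_testFunction_smul φ (integrable_of_memLp_time h'.memLp)).2, h.integral_eq φ,
      h'.integral_eq φ]
    abel

/-- A test function with the same integral as a multiple of a fixed one differs from it by the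
derivative of a test function. -/
theorem exists_testFunction_deriv {ρ : ℝ → ℝ} (hρ : ContDiff ℝ (⊤ : ℕ∞) ρ) {a b : ℝ} (ha : 0 < a)
    (hbT : b < T) (hs : ∀ t ∉ Icc a b, ρ t = 0) (hi : ∫ t, ρ t = 0) :
    ∃ ψ : 𝓓(timeInterval T, ℝ), deriv ψ = ρ := by
  set ψ : ℝ → ℝ := fun t => ∫ s in (0)..t, ρ s with hψ
  have hd : ∀ t, HasDerivAt ψ (ρ t) t := fun t =>
    (hρ.continuous.integral_hasStrictDerivAt 0 t).hasDerivAt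
  have hderiv : deriv ψ = ρ := funext fun t => (hd t).deriv
  have hsupp : tsupport ψ ⊆ Icc a b := by
    refine closure_minimal (fun t ht => ?_) isClosed_Icc
    by_contra hcon
    refine ht ?_
    rcases lt_or_ge t a with hta | hta
    · rw [hψ]
      simp only
      rw [intervalIntegral.integral_congr (g := fun _ => (0 : ℝ)) fun s hsu => ?_]
      · simp
      · refine hs s fun hs' => ?_
        have : s ≤ max 0 t := hsu.2
        exact absurd (hs'.1.trans this) (not_le.2 (max_lt ha hta))
    · have htb : b < t := by
        by_contra h
        exact hcon ⟨hta, not_lt.1 h⟩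
      change ∫ s in (0)..t, ρ s = 0
      rw [intervalIntegral.integral_eq_integral_of_support_subset, hi]
      intro s hs0
      by_contra h
      refine hs0 (hs s fun hs' => h ⟨ha.trans_le hs'.1, hs'.2.trans htb.le⟩)
  refine ⟨⟨ψ, ?_, ?_, ?_⟩, hderiv⟩
  · exact contDiff_infty_iff_deriv.2 ⟨fun t => (hd t).differentiableAt, by rwa [hderiv]⟩
  · exact isCompact_Icc.of_isClosed_subset (isClosed_tsupport ψ) hsupp
  · exact hsupp.trans fun t ht => ⟨ha.trans_le ht.1, ht.2.trans_lt hbT⟩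

/-- A function with a vanishing weak derivative is constant. -/
theorem exists_const_of_integral_deriv_eq_zero [CompleteSpace X] (hT : 0 < T)
    (hf : Integrable f (timeMeasure T))
    (h : ∀ φ : 𝓓(timeInterval T, ℝ), ∫ t in Ioo 0 T, deriv φ t • f t = 0) :
    ∃ c, ∀ᵐ t ∂(timeMeasure T), f t = c := by
  set B : ContDiffBump (T / 2) := ⟨T / 8, T / 4, by positivity, by linarith⟩ with hB
  set χ : ℝ → ℝ := B.normed volume with hχ
  have hχd : ContDiff ℝ (⊤ : ℕ∞) χ := B.contDiff_normed
  have hχs : tsupport χ ⊆ Ioo 0 T := by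
    rw [hχ, B.tsupport_normed_eq, Real.closedBall_eq_Icc]
    intro t ht
    simp only [hB] at ht
    constructor <;> linarith [ht.1, ht.2]
  have hχc : HasCompactSupport χ := B.hasCompactSupport_normed
  have hχi : ∫ t, χ t = 1 := B.integral_normed
  set χ' : 𝓓(timeInterval T, ℝ) := ⟨χ, hχd, hχc, hχs⟩ with hχ'
  set c : X := ∫ t in Ioo 0 T, χ' t • f t with hc
  refine ⟨c, ?_⟩
  have key := isOpen_Ioo.ae_eq_zero_of_integral_contDiff_smul_eq_zero (μ := volume)
    (f := fun t => f t - c) (U := Ioo 0 T) ?_ ?_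
  · filter_upwards [ae_restrict_mem measurableSet_Ioo, ae_restrict_of_ae key] with t ht hk
    exact sub_eq_zero.1 (hk ht)
  · exact IntegrableOn.locallyIntegrableOn (hf.sub (integrable_const c))
  · intro φ hφ hφc hφs
    set φ' : 𝓓(timeInterval T, ℝ) := ⟨φ, hφ, hφc, hφs⟩ with hφ'
    set m : ℝ := ∫ t, φ t with hm
    -- The extreme points of the two supports are in the open interval, so the function with
    -- integral 0 below vanishes off a compact subinterval.
    obtain ⟨a, ha, hamin⟩ := ((hφc.union hχc).exists_isLeast
      ⟨T / 2, Or.inr (subset_tsupport _ (by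
        rw [hχ, B.support_normed_eq]; exact Metric.mem_ball_self B.rOut_pos))⟩)
    obtain ⟨b, hb, hbmax⟩ := ((hφc.union hχc).exists_isGreatest ⟨a, ha⟩)
    have hsub : tsupport φ ∪ tsupport χ ⊆ Ioo 0 T := union_subset hφs hχs
    -- Subtracting the multiple `m` of the bump of integral 1 leaves a function with integral 0,
    -- hence the derivative of a test function. The hypothesis then says that `f` and the constant
    -- `c` have the same pairing with `φ`.
    obtain ⟨ψ, hψ⟩ := exists_testFunction_deriv (T := T) (ρ := fun t => φ t - m * χ t)
      (hφ.sub (contDiff_const.mul hχd)) (hsub ha).1 (hsub hb).2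
      (fun t ht => by
        have ht' : t ∉ tsupport φ ∪ tsupport χ := fun h => ht ⟨hamin h, hbmax h⟩
        rw [image_eq_zero_of_notMem_tsupport fun h => ht' (Or.inl h),
          image_eq_zero_of_notMem_tsupport fun h => ht' (Or.inr h)]
        ring) (by
        rw [integral_sub (hφ.continuous.integrable_of_hasCompactSupport hφc)
          ((hχd.continuous.integrable_of_hasCompactSupport hχc).const_mul m), integral_const_mul,
          hχi, ← hm]
        ring)
    have h1 := h ψ
    rw [hψ] at h1
    have e1 : ∫ t in Ioo 0 T, φ' t • f t = m • c := by
      have e := integral_sub (integrable_testFunction_smul φ' hf).1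
        ((integrable_testFunction_smul χ' hf).1.smul m)
      simp only [Pi.smul_apply] at e
      rw [hc, ← integral_smul, ← sub_eq_zero, ← e, ← h1]
      refine integral_congr_ae (.of_forall fun t => ?_)
      change φ t • f t - m • χ t • f t = (φ t - m * χ t) • f t
      rw [sub_smul, mul_smul]
    have e2 : ∫ t in Ioo 0 T, φ' t • c = m • c := by
      rw [integral_testFunction_smul]
      exact integral_smul_const _ _
    have e3 := integral_testFunction_smul φ' fun t => f t - c
    change _ = ∫ t, φ t • (f t - c) at e3
    rw [← e3]
    simp only [smul_sub]
    rw [integral_sub (integrable_testFunction_smul φ' hf).1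
      (integrable_testFunction_smul φ' (integrable_const c)).1, e1, e2, sub_self]

theorem continuousOn_primitive_time (hg : Integrable g (timeMeasure T)) :
    ContinuousOn (fun t => ∫ s in (0)..t, g s) (Icc 0 T) := by
  have h1 : IntegrableOn g (Icc 0 T) := by
    rw [integrableOn_Icc_iff_integrableOn_Ioo]
    exact hg
  rcases le_or_gt 0 T with hT | hT
  · have := intervalIntegral.continuousOn_primitive_interval (μ := volume) (f := g) (a := 0) (b := T)
      (by rwa [uIcc_of_le hT])
    rwa [uIcc_of_le hT] at this
  · rw [Icc_eq_empty hT.not_ge]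
    exact continuousOn_empty _

/-- Fubini on the triangle `s < t`: the inner integral of `deriv φ` over `(s, T)` is `-φ s`, because
`φ` vanishes at `T`. -/
theorem integral_deriv_smul_primitive [CompleteSpace X] (hg : Integrable g (timeMeasure T))
    (φ : 𝓓(timeInterval T, ℝ)) :
    ∫ t in Ioo 0 T, deriv φ t • (∫ s in (0)..t, g s) = -∫ t in Ioo 0 T, φ t • g t := by
  set k : ℝ → ℝ → X := fun t s => (Ioi s).indicator (fun t => deriv φ t • g s) t with hk
  have hφi : Integrable (deriv φ) (timeMeasure T) :=
    ((continuous_deriv_testFunction φ).integrable_of_hasCompactSupport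
      φ.hasCompactSupport.deriv).restrict
  have hki : Integrable (Function.uncurry k) ((timeMeasure T).prod (timeMeasure T)) := by
    have h1 := (hφi.smul_prod hg).indicator
      (measurableSet_lt measurable_snd measurable_fst : MeasurableSet {z : ℝ × ℝ | z.2 < z.1})
    refine h1.congr (.of_forall fun z => ?_)
    simp only [Function.uncurry, hk, indicator, mem_Ioi, mem_ofPred_eq]
  have hsw := integral_integral_swap hki
  have e1 : ∫ t in Ioo 0 T, ∫ s in Ioo 0 T, k t s =
      ∫ t in Ioo 0 T, deriv φ t • (∫ s in (0)..t, g s) := by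
    refine setIntegral_congr_fun measurableSet_Ioo fun t ht => ?_
    have : ∀ s, k t s = (Iio t).indicator (fun s => deriv φ t • g s) s := fun s => by
      simp only [hk, indicator, mem_Ioi, mem_Iio]
    simp only [this]
    rw [setIntegral_indicator measurableSet_Iio, integral_smul,
      intervalIntegral.integral_of_le ht.1.le, integral_Ioc_eq_integral_Ioo]
    congr 3
    ext s
    simp only [mem_inter_iff, mem_Ioo, mem_Iio]
    exact ⟨fun h => ⟨h.1.1, h.2⟩, fun h => ⟨⟨h.1, h.2.trans ht.2⟩, h.2⟩⟩
  have e2 : ∫ s in Ioo 0 T, ∫ t in Ioo 0 T, k t s = ∫ s in Ioo 0 T, -(φ s • g s) := by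
    refine setIntegral_congr_fun measurableSet_Ioo fun s hs => ?_
    simp only [hk]
    rw [setIntegral_indicator measurableSet_Ioi, integral_smul_const]
    have : Ioo 0 T ∩ Ioi s = Ioo s T := by
      ext t
      simp only [mem_inter_iff, mem_Ioo, mem_Ioi]
      exact ⟨fun h => ⟨h.2, h.1.2⟩, fun h => ⟨⟨hs.1.trans h.1, h.2⟩, h.1⟩⟩
    rw [this, ← integral_Ioc_eq_integral_Ioo, ← intervalIntegral.integral_of_le hs.2.le,
      intervalIntegral.integral_eq_sub_of_hasDerivAt (fun t _ => hasDerivAt_testFunction φ t)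
        ((continuous_deriv_testFunction φ).intervalIntegrable _ _),
      testFunction_eq_zero φ fun h => lt_irrefl _ h.2, zero_sub, neg_smul]
  rw [← e1, hsw, e2, integral_neg]

/-- The fundamental theorem of calculus for weak time derivatives. -/
theorem HasWeakTimeDeriv.exists_primitive [CompleteSpace X] (hT : 0 < T)
    (h : HasWeakTimeDeriv T f g) :
    ∃ c, ∀ᵐ t ∂(timeMeasure T), f t = c + ∫ s in (0)..t, g s := by
  have hg := (integrable_of_memLp_time h.memLp_deriv)
  have hf := (integrable_of_memLp_time h.memLp)
  have hF : Integrable (fun t => ∫ s in (0)..t, g s) (timeMeasure T) :=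
    ((continuousOn_primitive_time hg).integrableOn_Icc).mono_set Ioo_subset_Icc_self
  obtain ⟨c, hc⟩ := exists_const_of_integral_deriv_eq_zero hT (hf.sub hF) fun φ => by
    simp only [Pi.sub_apply, smul_sub]
    rw [integral_sub (integrable_testFunction_smul φ hf).2 (integrable_testFunction_smul φ hF).2,
      integral_deriv_smul_primitive hg, h.integral_eq φ]
    simp
  refine ⟨c, ?_⟩
  filter_upwards [hc] with t ht
  rw [← ht, Pi.sub_apply, sub_add_cancel]

end

end

section

variable {d : ℕ} {Ω : Opens (Space d)}

/-! ### Functions with a bounded right derivative -/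

section

variable {X : Type*} [NormedAddCommGroup X] [NormedSpace ℝ X]

/-- `f` is continuous and has the bounded right derivative `g`. -/
def HasBoundedRightDeriv (f g : ℝ → X) : Prop :=
  Continuous f ∧ (∃ C, ∀ t, ‖g t‖ ≤ C) ∧ ∀ t, HasDerivWithinAt f (g t) (Ioi t) t

theorem hasBoundedRightDeriv_const (c : X) : HasBoundedRightDeriv (fun _ => c) fun _ => 0 :=
  ⟨continuous_const, ⟨0, fun _ => by simp⟩, fun _ => hasDerivWithinAt_const _ _ _⟩

theorem HasBoundedRightDeriv.add {f g f' g' : ℝ → X} (h : HasBoundedRightDeriv f g)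
    (h' : HasBoundedRightDeriv f' g') :
    HasBoundedRightDeriv (fun t => f t + f' t) fun t => g t + g' t := by
  obtain ⟨h1, ⟨C, hC⟩, h2⟩ := h
  obtain ⟨h1', ⟨C', hC'⟩, h2'⟩ := h'
  exact ⟨h1.add h1', ⟨C + C', fun t => (norm_add_le _ _).trans (add_le_add (hC t) (hC' t))⟩,
    fun t => (h2 t).add (h2' t)⟩

theorem HasBoundedRightDeriv.const_smul {f g : ℝ → X} (h : HasBoundedRightDeriv f g) (c : ℝ) :
    HasBoundedRightDeriv (fun t => c • f t) fun t => c • g t := by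
  obtain ⟨h1, ⟨C, hC⟩, h2⟩ := h
  refine ⟨h1.const_smul c, ⟨|c| * C, fun t => ?_⟩, fun t => (h2 t).const_smul c⟩
  rw [norm_smul, Real.norm_eq_abs]
  exact mul_le_mul_of_nonneg_left (hC t) (abs_nonneg c)

theorem HasBoundedRightDeriv.sum {ι : Type*} (s : Finset ι) {f g : ι → ℝ → X}
    (h : ∀ i ∈ s, HasBoundedRightDeriv (f i) (g i)) :
    HasBoundedRightDeriv (fun t => ∑ i ∈ s, f i t) fun t => ∑ i ∈ s, g i t := by
  classical
  induction s using Finset.induction_on with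
  | empty => simpa using hasBoundedRightDeriv_const (0 : X)
  | insert i s hi ih =>
    simp only [Finset.sum_insert hi]
    exact (h i (Finset.mem_insert_self i s)).add
      (ih fun j hj => h j (Finset.mem_insert_of_mem hj))

theorem HasBoundedRightDeriv.comp_clm {Y : Type*} [NormedAddCommGroup Y] [NormedSpace ℝ Y]
    {f g : ℝ → X} (h : HasBoundedRightDeriv f g) (κ : X →L[ℝ] Y) :
    HasBoundedRightDeriv (fun t => κ (f t)) fun t => κ (g t) := by
  obtain ⟨h1, ⟨C, hC⟩, h2⟩ := h
  exact ⟨κ.continuous.comp h1, ⟨‖κ‖ * C, fun t => (κ.le_opNorm _).trans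
    (mul_le_mul_of_nonneg_left (hC t) (norm_nonneg κ))⟩,
    fun t => κ.hasFDerivAt.comp_hasDerivWithinAt t (h2 t)⟩

/-- Change of the time scale. -/
theorem HasBoundedRightDeriv.comp_sub_div {f g : ℝ → X} (h : HasBoundedRightDeriv f g) (c : ℝ)
    {r : ℝ} (hr : 0 < r) :
    HasBoundedRightDeriv (fun t => f ((t - c) / r)) fun t => (1 / r) • g ((t - c) / r) := by
  obtain ⟨h1, ⟨C, hC⟩, h2⟩ := h
  refine ⟨h1.comp (by fun_prop), ⟨1 / r * C, fun t => ?_⟩, fun t => ?_⟩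
  · rw [norm_smul, Real.norm_eq_abs, abs_of_pos (by positivity)]
    exact mul_le_mul_of_nonneg_left (hC _) (by positivity)
  · have hd : HasDerivWithinAt (fun t => (t - c) / r) (1 / r) (Ioi t) t :=
      (((hasDerivAt_id t).sub_const c).div_const r).hasDerivWithinAt
    refine (h2 ((t - c) / r)).scomp t hd fun s hs => ?_
    exact div_lt_div_of_pos_right (sub_lt_sub_right hs c) hr

/-- The fundamental theorem of calculus needs only a right derivative, applied here to `φ • f`.
One-sided derivatives are the natural choice: the right and left derivatives of `min ℓ s` in `s`
differ on the level set of `ℓ`, which may have positive measure. -/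
theorem HasBoundedRightDeriv.hasWeakTimeDeriv [CompleteSpace X] {f g : ℝ → X}
    (h : HasBoundedRightDeriv f g) {T : ℝ} (hT : 0 < T) : HasWeakTimeDeriv T f g := by
  obtain ⟨h1, ⟨C, hC⟩, h2⟩ := h
  have hg : g = fun t => derivWithin f (Ioi t) t := funext fun t =>
    ((h2 t).derivWithin (uniqueDiffWithinAt_Ioi t)).symm
  have hgm : AEStronglyMeasurable g (timeMeasure T) := by
    rw [hg]
    exact aestronglyMeasurable_derivWithin_Ioi f _
  have hgp : MemLp g 2 (timeMeasure T) := MemLp.of_bound hgm C (.of_forall hC)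
  have hfp : MemLp f 2 (timeMeasure T) := by
    obtain ⟨C', hC'⟩ := (isCompact_Icc (a := (0 : ℝ)) (b := T)).exists_bound_of_continuousOn
      h1.continuousOn
    refine MemLp.of_bound h1.aestronglyMeasurable C' ?_
    filter_upwards [ae_restrict_mem measurableSet_Ioo] with t ht using hC' t ⟨ht.1.le, ht.2.le⟩
  refine ⟨hfp, hgp, fun φ => ?_⟩
  have hi := integrable_testFunction_smul φ (integrable_of_memLp_time hgp)
  have hi' := integrable_testFunction_smul φ (integrable_of_memLp_time hfp)
  have key := intervalIntegral.integral_eq_sub_of_hasDeriv_right_of_le (f := fun t => φ t • f t)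
    (f' := fun t => φ t • g t + deriv φ t • f t) hT.le
    (φ.continuous.smul h1).continuousOn
    (fun t _ => ((hasDerivAt_testFunction φ t).hasDerivWithinAt).smul (h2 t))
    (by
      rw [intervalIntegrable_iff_integrableOn_Ioo_of_le hT.le]
      exact hi.1.add hi'.2)
  rw [testFunction_eq_zero φ fun h => lt_irrefl _ h.1,
    testFunction_eq_zero φ fun h => lt_irrefl _ h.2, zero_smul, zero_smul, sub_zero,
    intervalIntegral.integral_of_le hT.le, integral_Ioc_eq_integral_Ioo,
    integral_add hi.1 hi'.2] at key
  exact eq_neg_of_add_eq_zero_left key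

/-- Bounds the right derivative by comparing `f` with a motion at constant velocity `m`, so no
formula for the derivative of the interpolant is needed. -/
theorem norm_sub_le_of_rightDeriv {f : ℝ → X} {v m : X} {t : ℝ} {L : ℝ}
    (hf : HasDerivWithinAt f v (Ioi t) t)
    (hL : ∀ᶠ s in nhdsWithin t (Ioi t), ‖f s - f t - (s - t) • m‖ ≤ L * (s - t)) :
    ‖v - m‖ ≤ L := by
  rw [hasDerivWithinAt_iff_tendsto_slope' self_notMem_Ioi] at hf
  refine le_of_tendsto (hf.sub_const m).norm ?_
  filter_upwards [hL, self_mem_nhdsWithin] with s hs hst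
  have hst' : 0 < s - t := sub_pos.2 hst
  have e : slope f t s - m = (s - t)⁻¹ • (f s - f t - (s - t) • m) := by
    rw [slope_def_module, smul_sub _ (f s - f t), smul_smul, inv_mul_cancel₀ hst'.ne', one_smul]
  rw [e, norm_smul, norm_inv, Real.norm_eq_abs, abs_of_pos hst', inv_mul_le_iff₀ hst', mul_comm]
  exact hs

end

/-! ### Truncations -/

theorem aemeasurable_truncation {ℓ : Space d → ℝ}
    (hℓ : AEStronglyMeasurable ℓ (volume.restrict (Ω : Set (Space d)))) (s : ℝ) :
    AEStronglyMeasurable (fun x => min (ℓ x) s) (volume.restrict (Ω : Set (Space d))) ∧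
    AEStronglyMeasurable (fun x => if s < ℓ x then (1 : ℝ) else 0)
      (volume.restrict (Ω : Set (Space d))) := by
  refine ⟨hℓ.inf aestronglyMeasurable_const, ?_⟩
  have h1 : Measurable fun r : ℝ => if s < r then (1 : ℝ) else 0 :=
    Measurable.ite measurableSet_Ioi measurable_const measurable_const
  exact (h1.comp_aemeasurable hℓ.aemeasurable).aestronglyMeasurable

/-- The truncations of a bounded function have a right derivative in `L²(Ω)` with respect to the
height of the truncation. -/
theorem hasBoundedRightDeriv_truncation (hb : Bornology.IsBounded (Ω : Set (Space d)))
    {ℓ : Space d → ℝ} (hℓ : MemLp ℓ 2 (volume.restrict (Ω : Set (Space d)))) :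
    HasBoundedRightDeriv (fun s => toL2 Ω fun x => min (ℓ x) s)
      fun s => toL2 Ω fun x => if s < ℓ x then 1 else 0 := by
  have := isFiniteMeasure_restrict hb
  have hm := hℓ.1
  have hvol : volume (Ω : Set (Space d)) ≠ ∞ := hb.measure_lt_top.ne
  have hmin : ∀ s, MemLp (fun x => min (ℓ x) s) 2 (volume.restrict (Ω : Set (Space d))) := by
    intro s
    refine (hℓ.norm.add (memLp_const |s|)).mono (aemeasurable_truncation hm s).1
      (.of_forall fun x => ?_)
    simp only [Pi.add_apply, Real.norm_eq_abs]
    rw [abs_of_nonneg (by positivity : 0 ≤ |ℓ x| + |s|)]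
    rcases min_choice (ℓ x) s with h | h <;> rw [h]
    · linarith [abs_nonneg s]
    · linarith [abs_nonneg (ℓ x)]
  have hind1 : ∀ s x, |if s < ℓ x then (1 : ℝ) else 0| ≤ 1 := fun s x => by split_ifs <;> simp
  have hind : ∀ s, MemLp (fun x => if s < ℓ x then (1 : ℝ) else 0) 2
      (volume.restrict (Ω : Set (Space d))) := fun s =>
    MemLp.of_bound (aemeasurable_truncation hm s).2 1 (.of_forall (hind1 s))
  have hlip1 : ∀ s s' x, |min (ℓ x) s - min (ℓ x) s'| ≤ |s - s'| := fun s s' x => by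
    have := abs_min_sub_min_le_max (ℓ x) s (ℓ x) s'
    rwa [sub_self, abs_zero, max_eq_right (abs_nonneg _)] at this
  have hlip : ∀ s s', ‖(toL2 Ω fun x => min (ℓ x) s) - toL2 Ω fun x => min (ℓ x) s'‖ ≤
      √(volume.real (Ω : Set (Space d))) * |s - s'| := by
    intro s s'
    rw [← toL2_sub (hmin s) (hmin s')]
    refine le_sqrt_mul_of_sq_le (abs_nonneg _) measureReal_nonneg ?_
    rw [norm_sq_toL2 (f := fun x => min (ℓ x) s - min (ℓ x) s') ((hmin s).sub (hmin s')), mul_comm]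
    exact setIntegral_sq_le hvol fun x _ => hlip1 s s' x
  refine ⟨?_, ⟨√(volume.real (Ω : Set (Space d))) * 1, fun s => ?_⟩, fun s => ?_⟩
  · refine LipschitzWith.continuous (K := ⟨√(volume.real (Ω : Set (Space d))), Real.sqrt_nonneg _⟩)
      (LipschitzWith.of_dist_le_mul fun s s' => ?_)
    rw [dist_eq_norm, Real.dist_eq]
    exact hlip s s'
  · refine le_sqrt_mul_of_sq_le zero_le_one measureReal_nonneg ?_
    rw [norm_sq_toL2 (hind s), mul_comm]
    exact setIntegral_sq_le hvol fun x _ => hind1 s x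
  · rw [hasDerivWithinAt_iff_tendsto_slope' self_notMem_Ioi, tendsto_iff_norm_sub_tendsto_zero]
    set D : ℝ → Space d → ℝ := fun s' x =>
      (s' - s)⁻¹ * (min (ℓ x) s' - min (ℓ x) s) - if s < ℓ x then 1 else 0 with hD
    have hDm : ∀ s', MemLp (D s') 2 (volume.restrict (Ω : Set (Space d))) := fun s' =>
      (((hmin s').sub (hmin s)).const_mul _).sub (hind s)
    have hDn : ∀ s', ‖slope (fun s => toL2 Ω fun x => min (ℓ x) s) s s' -
        toL2 Ω fun x => if s < ℓ x then 1 else 0‖ =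
        √(∫ x in (Ω : Set (Space d)), D s' x ^ 2) := by
      intro s'
      rw [slope_def_module, ← toL2_sub (hmin s') (hmin s),
        ← toL2_const_mul (f := fun x => min (ℓ x) s' - min (ℓ x) s) _ ((hmin s').sub (hmin s)),
        ← toL2_sub (f := fun x => (s' - s)⁻¹ * (min (ℓ x) s' - min (ℓ x) s))
          (((hmin s').sub (hmin s)).const_mul _) (hind s),
        ← norm_sq_toL2 (hDm s'), Real.sqrt_sq (norm_nonneg _)]
    simp only [hDn]
    rw [← Real.sqrt_zero]
    refine (Real.continuous_sqrt.tendsto 0).comp ?_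
    have h0 : ∫ x in (Ω : Set (Space d)), (0 : ℝ) = 0 := by simp
    rw [← h0]
    -- The difference quotients are bounded by 1 and, at each `x`, equal the indicator for all `s'`
    -- close enough to `s` on the right. Their deviation `D` is thus bounded by 2 and tends to 0
    -- pointwise.
    refine tendsto_integral_filter_of_dominated_convergence (fun _ => (2 : ℝ) ^ 2)
      (.of_forall fun s' => (hDm s').1.pow 2) ?_ (integrable_const _) (.of_forall fun x => ?_)
    · filter_upwards [self_mem_nhdsWithin] with s' hs'
      have hs'0 : 0 < s' - s := sub_pos.2 hs'
      refine .of_forall fun x => ?_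
      rw [Real.norm_eq_abs, abs_pow]
      refine pow_le_pow_left₀ (abs_nonneg _) ?_ 2
      have h1 : |(s' - s)⁻¹ * (min (ℓ x) s' - min (ℓ x) s)| ≤ 1 := by
        rw [abs_mul, abs_inv, abs_of_pos hs'0, inv_mul_le_iff₀ hs'0, mul_one]
        exact (hlip1 s' s x).trans_eq (abs_of_pos hs'0)
      exact (abs_sub _ _).trans (by linarith [hind1 s x])
    · refine (tendsto_const_nhds).congr' ?_
      by_cases hx : s < ℓ x
      · filter_upwards [Ioc_mem_nhdsGT hx] with s' hs'
        have hs'0 : s' - s ≠ 0 := (sub_pos.2 hs'.1).ne'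
        simp only [hD]
        rw [min_eq_right hs'.2, min_eq_right hx.le, if_pos hx, inv_mul_cancel₀ hs'0]
        norm_num
      · filter_upwards [self_mem_nhdsWithin] with s' hs'
        have hx' := not_lt.1 hx
        simp only [hD]
        rw [min_eq_left (hx'.trans (le_of_lt hs')), min_eq_left hx', if_neg hx]
        norm_num

/-! ### Measurability in `H¹₀(Ω)` -/

/-- An injective continuous map between Polish spaces is a measurable embedding, so measurability in
`H¹₀` can be read off in `L²`, and continuity of `W` in `H¹₀` does not have to be shown. -/
theorem aestronglyMeasurable_H10 {W : ℝ → H10 Ω} {E : ℝ → L2 Ω} {T : ℝ}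
    (hE : Continuous E) (hW : ∀ t ∈ Ioo 0 T, H10toL2 Ω (W t) = E t) :
    AEStronglyMeasurable W (timeMeasure T) := by
  have : Fact ((2 : ℝ≥0∞) ≠ ∞) := ⟨by norm_num⟩
  have hsL2 : SecondCountableTopology (L2 Ω) := inferInstance
  borelize (↥(H10 Ω)) (L2 Ω)
  have hcs : CompleteSpace (H10 Ω) := (Submodule.isClosed_topologicalClosure _).completeSpace_coe
  have hsc : SecondCountableTopology (Jet1 Ω) :=
    (PiLp.homeomorph 2 (fun _ : Option (Fin d) => L2 Ω)).secondCountableTopology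
  have hemb := (H10toL2 Ω).continuous.measurableEmbedding H10toL2_injective
  have hm : AEMeasurable (fun t => H10toL2 Ω (W t)) (timeMeasure T) :=
    ⟨E, hE.measurable, by
      filter_upwards [ae_restrict_mem measurableSet_Ioo] with t ht using hW t ht⟩
  exact (hemb.aemeasurable_comp_iff.1 hm).aestronglyMeasurable

end

section

variable {d : ℕ} {Ω : Opens (Space d)}

/-! ### Integrals over time slabs -/

section Slab

variable {h T : ℝ} {n : ℕ}

/-- The `k`-th time slab. -/
def slab (h : ℝ) (k : ℕ) : Set ℝ := Ico (k * h) ((k + 1 : ℕ) * h)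

/-- The integral over the time slab that contains `t`. -/
def slabInt (h : ℝ) (ψ : ℝ → ℝ) (t : ℝ) : ℝ := ∫ s in slab h ⌊t / h⌋₊, ψ s

theorem mem_slab (hh : 0 < h) {t : ℝ} (ht : 0 ≤ t) : t ∈ slab h ⌊t / h⌋₊ := by
  constructor
  · rw [← le_div_iff₀ hh]
    exact Nat.floor_le (div_nonneg ht hh.le)
  · rw [← div_lt_iff₀ hh]
    push_cast
    exact Nat.lt_floor_add_one _

theorem floor_of_mem_slab (hh : 0 < h) {k : ℕ} {t : ℝ} (ht : t ∈ slab h k) : ⌊t / h⌋₊ = k := by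
  have h1 := (le_div_iff₀ hh).2 ht.1
  have h2 := (div_lt_iff₀ hh).2 ht.2
  push_cast at h2
  rw [Nat.floor_eq_iff ((Nat.cast_nonneg k).trans h1)]
  exact ⟨h1, h2⟩

theorem floor_lt (hh : 0 < h) (hn : n * h = T) {t : ℝ} (ht : 0 ≤ t) (htT : t < T) :
    ⌊t / h⌋₊ < n := by
  rw [Nat.floor_lt (div_nonneg ht hh.le), div_lt_iff₀ hh, hn]
  exact htT

theorem slab_endpoints (hh : 0 < h) (hn : n * h = T) {k : ℕ} (hk : k < n) :
    (0 : ℝ) ≤ k * h ∧ (k : ℝ) * h ≤ (k + 1 : ℕ) * h ∧ ((k + 1 : ℕ) : ℝ) * h ≤ T := by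
  refine ⟨by positivity, ?_, ?_⟩
  · exact mul_le_mul_of_nonneg_right (by exact_mod_cast Nat.le_succ k) hh.le
  · rw [← hn]
    exact mul_le_mul_of_nonneg_right (by exact_mod_cast hk) hh.le

theorem Icc_slab_subset (hh : 0 < h) (hn : n * h = T) {k : ℕ} (hk : k < n) :
    Icc (k * h) ((k + 1 : ℕ) * h) ⊆ Icc 0 T := by
  obtain ⟨h1, -, h3⟩ := slab_endpoints hh hn hk
  exact Icc_subset_Icc h1 h3

theorem integrableOn_slab {X : Type*} [NormedAddCommGroup X] {ψ : ℝ → X} (hh : 0 < h)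
    (hn : n * h = T) {k : ℕ} (hk : k < n) (hψ : Integrable ψ (timeMeasure T)) :
    IntegrableOn ψ (slab h k) := by
  have h1 : IntegrableOn ψ (Icc 0 T) := by
    rw [integrableOn_Icc_iff_integrableOn_Ioo]
    exact hψ
  exact h1.mono_set (Ico_subset_Icc_self.trans (Icc_slab_subset hh hn hk))

theorem volume_slab (k : ℕ) : volume (slab h k) = ENNReal.ofReal h := by
  rw [slab, Real.volume_Ico]
  congr 1
  push_cast
  ring

theorem norm_primitive_sub_le {X : Type*} [NormedAddCommGroup X] [NormedSpace ℝ X]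
    {ψ : ℝ → X} {c : X} (hh : 0 < h) (hn : n * h = T) {k : ℕ} (hk : k < n)
    (hψ : Integrable ψ (timeMeasure T)) {s t : ℝ} (hs : s ∈ Icc (k * h) ((k + 1 : ℕ) * h))
    (ht : t ∈ Icc (k * h) ((k + 1 : ℕ) * h)) :
    ‖(c + ∫ r in (0)..s, ψ r) - (c + ∫ r in (0)..t, ψ r)‖ ≤ ∫ r in slab h k, ‖ψ r‖ := by
  have hsub := Icc_slab_subset hh hn hk
  have hi : ∀ r ∈ Icc 0 T, IntervalIntegrable ψ volume 0 r := fun r hr => by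
    rw [intervalIntegrable_iff_integrableOn_Ioo_of_le hr.1]
    exact hψ.mono_measure (Measure.restrict_mono (Ioo_subset_Ioo_right hr.2) le_rfl)
  rw [add_sub_add_left_eq_sub, intervalIntegral.integral_interval_sub_left (hi s (hsub hs))
    (hi t (hsub ht))]
  refine intervalIntegral.norm_integral_le_integral_norm_uIoc.trans ?_
  have h2 : IntegrableOn (fun r => ‖ψ r‖) (Icc (k * h) ((k + 1 : ℕ) * h)) :=
    (integrableOn_Icc_iff_integrableOn_Ico (by simp)).2 (integrableOn_slab hh hn hk hψ).norm
  rw [slab, ← integral_Icc_eq_integral_Ico]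
  refine setIntegral_mono_set h2 (.of_forall fun _ => norm_nonneg _)
    ((uIoc_subset_uIcc.trans (uIcc_subset_Icc ht hs)).eventuallyLE)

theorem eLpNorm_two_sq {X : Type*} [NormedAddCommGroup X] {μ : Measure ℝ} (f : ℝ → X) :
    eLpNorm f 2 μ ^ 2 = ∫⁻ t, ‖f t‖ₑ ^ 2 ∂μ := by
  have := eLpNorm_nnreal_pow_eq_lintegral (μ := μ) (f := f) (p := 2) (by norm_num)
  simpa using this

theorem enorm_setIntegral_sq_le {ψ : ℝ → ℝ} {S : Set ℝ}
    (hψ : AEStronglyMeasurable ψ (volume.restrict S)) :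
    ‖∫ s in S, ψ s‖ₑ ^ 2 ≤ volume S * ∫⁻ s in S, ‖ψ s‖ₑ ^ 2 := by
  have h1 : ‖∫ s in S, ψ s‖ₑ ≤ eLpNorm ψ 1 (volume.restrict S) := by
    rw [eLpNorm_one_eq_lintegral_enorm]
    exact enorm_integral_le_lintegral_enorm _
  have h2 := h1.trans (eLpNorm_le_eLpNorm_mul_rpow_measure_univ
    (show (1 : ℝ≥0∞) ≤ 2 by norm_num) hψ)
  refine (pow_le_pow_left' h2 2).trans_eq ?_
  rw [mul_pow, eLpNorm_two_sq, Measure.restrict_apply_univ, mul_comm, ← ENNReal.rpow_natCast,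
    ← ENNReal.rpow_mul]
  norm_num

theorem slabInt_eq (hh : 0 < h) {ψ : ℝ → ℝ} {k : ℕ} {t : ℝ} (ht : t ∈ slab h k) :
    slabInt h ψ t = ∫ s in slab h k, ψ s := by
  rw [slabInt, floor_of_mem_slab hh ht]

theorem measurable_slabInt (ψ : ℝ → ℝ) : Measurable (slabInt h ψ) := by
  have h1 : Measurable fun k : ℕ => ∫ s in slab h k, ψ s := measurable_from_top
  exact h1.comp (Nat.measurable_floor.comp (measurable_id.div_const h))

/-- The slab integral is constant on each slab. Cauchy-Schwarz bounds its square by `h` times the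
integral of the square, and integrating over the slab gives a second `h`. This produces the factor
`h` from increments in time. -/
theorem eLpNorm_slabInt_le (hh : 0 < h) (hn : n * h = T) {ψ : ℝ → ℝ}
    (hψ : AEStronglyMeasurable ψ (timeMeasure T)) :
    eLpNorm (slabInt h ψ) 2 (timeMeasure T) ≤ ENNReal.ofReal h * eLpNorm ψ 2 (timeMeasure T) := by
  have hψ' : AEStronglyMeasurable ψ (volume.restrict (Ico 0 T)) := by
    rwa [Measure.restrict_congr_set Ioo_ae_eq_Ico.symm]
  have hU : Ico 0 T = ⋃ k ∈ Finset.range n, slab h k := by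
    ext t
    simp only [mem_iUnion, Finset.mem_range, exists_prop]
    constructor
    · exact fun ht => ⟨_, floor_lt hh hn ht.1 ht.2, mem_slab hh ht.1⟩
    · rintro ⟨k, hk, ht⟩
      obtain ⟨h1, -, h3⟩ := slab_endpoints hh hn hk
      exact ⟨h1.trans ht.1, ht.2.trans_le h3⟩
  have hd : (Finset.range n : Set ℕ).PairwiseDisjoint (slab h) := by
    intro k _ l _ hkl
    refine Set.disjoint_left.2 fun t hk hl => hkl ?_
    rw [← floor_of_mem_slab hh hk, ← floor_of_mem_slab hh hl]
  have hsum : ∀ f : ℝ → ℝ≥0∞, ∫⁻ t in Ioo 0 T, f t =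
      ∑ k ∈ Finset.range n, ∫⁻ t in slab h k, f t := fun f => by
    rw [Measure.restrict_congr_set Ioo_ae_eq_Ico, hU,
      lintegral_biUnion_finset hd fun _ _ => measurableSet_Ico]
  rw [← ENNReal.pow_le_pow_left_iff two_ne_zero, mul_pow, eLpNorm_two_sq, eLpNorm_two_sq, hsum,
    hsum, Finset.mul_sum]
  refine Finset.sum_le_sum fun k hk => ?_
  have hk' := Finset.mem_range.1 hk
  have hsub : slab h k ⊆ Ico 0 T := by
    rw [hU]
    exact subset_biUnion_of_mem (u := slab h) hk
  calc ∫⁻ t in slab h k, ‖slabInt h ψ t‖ₑ ^ 2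
      = ∫⁻ t in slab h k, ‖∫ s in slab h k, ψ s‖ₑ ^ 2 :=
        setLIntegral_congr_fun measurableSet_Ico fun t ht => by
          rw [slabInt_eq hh ht]
    _ = ‖∫ s in slab h k, ψ s‖ₑ ^ 2 * ENNReal.ofReal h := by
        rw [setLIntegral_const, volume_slab]
    _ ≤ (ENNReal.ofReal h * ∫⁻ s in slab h k, ‖ψ s‖ₑ ^ 2) * ENNReal.ofReal h := by
        gcongr
        rw [← volume_slab (h := h) k]
        exact enorm_setIntegral_sq_le (hψ'.mono_measure (Measure.restrict_mono hsub le_rfl))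
    _ = _ := by ring

/-- The difference of a function and its mean over a time slab. -/
theorem norm_sub_average_le {X : Type*} [NormedAddCommGroup X] [NormedSpace ℝ X] [CompleteSpace X]
    {N₀ N₁ N₂ : ℝ → X} {c₀ c₁ : X} (hh : 0 < h) (hn : n * h = T)
    (h₁ : Integrable N₁ (timeMeasure T)) (h₂ : Integrable N₂ (timeMeasure T))
    (hN₀ : ∀ t ∈ Icc 0 T, N₀ t = c₀ + ∫ s in (0)..t, N₁ s)
    (hN₁ : ∀ᵐ t ∂(timeMeasure T), N₁ t = c₁ + ∫ s in (0)..t, N₂ s) :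
    ∀ᵐ t ∂(timeMeasure T), ‖N₁ t - (1 / h) • (N₀ ((⌊t / h⌋₊ + 1 : ℕ) * h) - N₀ (⌊t / h⌋₊ * h))‖ ≤
      slabInt h (fun s => ‖N₂ s‖) t := by
  filter_upwards [hN₁, ae_restrict_mem measurableSet_Ioo] with t ht htT
  set k := ⌊t / h⌋₊ with hk
  have hkn : k < n := floor_lt hh hn htT.1.le htT.2
  have htk : t ∈ slab h k := mem_slab hh htT.1.le
  obtain ⟨e1, e2, e3⟩ := slab_endpoints hh hn hkn
  have hi : ∀ r ∈ Icc 0 T, IntervalIntegrable N₁ volume 0 r := fun r hr => by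
    rw [intervalIntegrable_iff_integrableOn_Ioo_of_le hr.1]
    exact h₁.mono_measure (Measure.restrict_mono (Ioo_subset_Ioo_right hr.2) le_rfl)
  have hsub := Icc_slab_subset hh hn hkn
  have hd : N₀ ((k + 1 : ℕ) * h) - N₀ (k * h) = ∫ s in slab h k, N₁ s := by
    rw [hN₀ _ (hsub (right_mem_Icc.2 e2)), hN₀ _ (hsub (left_mem_Icc.2 e2)),
      add_sub_add_left_eq_sub, intervalIntegral.integral_interval_sub_left
        (hi _ (hsub (right_mem_Icc.2 e2))) (hi _ (hsub (left_mem_Icc.2 e2))),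
      intervalIntegral.integral_of_le e2, slab, integral_Ico_eq_integral_Ioo,
      integral_Ioc_eq_integral_Ioo]
  have hvol : volume.real (slab h k) = h := by
    rw [Measure.real, volume_slab, ENNReal.toReal_ofReal hh.le]
  -- The deviation from the mean is the mean of the differences, each of which is at most the
  -- integral of `‖N₂‖` over the slab.
  have hmean : N₁ t - (1 / h) • ∫ s in slab h k, N₁ s =
      (1 / h) • ∫ s in slab h k, (N₁ t - N₁ s) := by
    have hc : IntegrableOn (fun _ => N₁ t) (slab h k) :=
      integrableOn_const (by rw [volume_slab]; exact ENNReal.ofReal_ne_top)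
    rw [integral_sub hc (integrableOn_slab hh hn hkn h₁), setIntegral_const,
      hvol, smul_sub, smul_smul, one_div, inv_mul_cancel₀ hh.ne', one_smul]
  rw [hd, hmean, norm_smul, Real.norm_eq_abs, abs_of_pos (by positivity), slabInt_eq hh htk]
  have hbound := norm_setIntegral_le_of_norm_le_const_ae' (μ := volume) (s := slab h k)
    (f := fun s => N₁ t - N₁ s) (C := ∫ r in slab h k, ‖N₂ r‖)
    (by rw [volume_slab]; exact ENNReal.ofReal_lt_top) ?_
  · rw [hvol] at hbound
    calc _ ≤ 1 / h * ((∫ r in slab h k, ‖N₂ r‖) * h) := by gcongr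
      _ = _ := by field_simp
  · rw [ae_restrict_iff' measurableSet_Ioo] at hN₁
    filter_upwards [hN₁, Measure.ae_ne volume (0 : ℝ)] with s hs hs0 hsk
    have hs' : s ∈ Ioo 0 T :=
      ⟨(e1.trans hsk.1).lt_of_ne (Ne.symm hs0), hsk.2.trans_le e3⟩
    rw [ht, hs hs']
    exact norm_primitive_sub_le hh hn hkn h₂ (Ico_subset_Icc_self htk) (Ico_subset_Icc_self hsk)

end Slab

namespace SpatialMesh

variable {M : SpatialMesh Ω} {γ h : ℝ} {n : ℕ}

theorem _root_.SpaceTimeFEM.HasBoundedRightDeriv.congr {X : Type*} [NormedAddCommGroup X]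
    [NormedSpace ℝ X] {f f' g : ℝ → X} (hf : HasBoundedRightDeriv f g) (e : f' = f) :
    HasBoundedRightDeriv f' g := e ▸ hf

/-! ### The interpolant as a function with values in `L²(Ω)` -/

/-- Removes the clipping from `interp`, so that its dependence on time is truncation at a height
affine in time. -/
theorem cut_max_zero (s : ℝ) (i : Fin M.N) (x : Space d) :
    M.cut (max 0 s) i x = M.cut s i x := by
  rcases le_total 0 s with hs | hs
  · rw [max_eq_right hs]
  · rw [max_eq_left hs, M.cut_zero, cut, min_eq_right (hs.trans (M.lev_nonneg _ x)),
      min_eq_right (hs.trans (M.lev_nonneg _ x)), sub_self]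

theorem memLp_lev (hb : Bornology.IsBounded (Ω : Set (Space d))) (m : ℕ) :
    MemLp (M.lev m) 2 (volume.restrict (Ω : Set (Space d))) :=
  memLp_of_continuousOn hb (M.continuousOn_lev m)

theorem memLp_cut (hb : Bornology.IsBounded (Ω : Set (Space d))) (s : ℝ) (i : Fin M.N) :
    MemLp (M.cut s i) 2 (volume.restrict (Ω : Set (Space d))) :=
  memLp_of_continuousOn hb (continuousOn_cut s i)

theorem memLp_hat (hb : Bornology.IsBounded (Ω : Set (Space d))) (i : Fin M.N) :
    MemLp (M.hat i) 2 (volume.restrict (Ω : Set (Space d))) :=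
  memLp_of_continuousOn hb (continuousOn_hat i)

theorem exists_hasBoundedRightDeriv_cut (hb : Bornology.IsBounded (Ω : Set (Space d)))
    (i : Fin M.N) : ∃ g, HasBoundedRightDeriv (fun s => toL2 Ω (M.cut s i)) g := by
  have h1 := (hasBoundedRightDeriv_truncation hb (M.memLp_lev hb (i.1 + 1))).add
    ((hasBoundedRightDeriv_truncation hb (M.memLp_lev hb i.1)).const_smul (-1))
  refine ⟨_, h1.congr ?_⟩
  funext s
  have hm : ∀ m, MemLp (fun x => min (M.lev m x) s) 2 (volume.restrict (Ω : Set (Space d))) :=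
    fun m => memLp_of_continuousOn hb ((M.continuousOn_lev m).inf continuousOn_const)
  rw [neg_smul, one_smul, ← sub_eq_add_neg, ← toL2_sub (hm _) (hm _)]
  rfl

theorem exists_hasBoundedRightDeriv_interp (hb : Bornology.IsBounded (Ω : Set (Space d)))
    (hh : 0 < h) (n : ℕ) (a : Fin M.N → ℕ → ℝ) :
    ∃ g, HasBoundedRightDeriv (fun t => toL2 Ω fun x => M.interp h n a (t, x)) g := by
  choose g hg using fun i => exists_hasBoundedRightDeriv_cut (M := M) hb i
  have h1 := HasBoundedRightDeriv.sum Finset.univ fun i (_ : i ∈ Finset.univ) =>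
    (hasBoundedRightDeriv_const (a i 0 • toL2 Ω (M.hat i))).add
      (HasBoundedRightDeriv.sum (Finset.range n) fun k (_ : k ∈ Finset.range n) =>
        ((hg i).comp_sub_div (k * h) hh).const_smul (a i (k + 1) - a i k))
  refine ⟨_, h1.congr ?_⟩
  funext t
  simp only [interp, cut_max_zero]
  have hc : ∀ i k, MemLp (fun x => (a i (k + 1) - a i k) * M.cut ((t - k * h) / h) i x) 2
      (volume.restrict (Ω : Set (Space d))) := fun i k => (M.memLp_cut hb _ i).const_mul _
  have hs : ∀ i, MemLp (fun x => ∑ k ∈ Finset.range n,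
      (a i (k + 1) - a i k) * M.cut ((t - k * h) / h) i x) 2
      (volume.restrict (Ω : Set (Space d))) := fun i => memLp_finsetSum _ fun k _ => hc i k
  have hh' : ∀ i, MemLp (fun x => a i 0 * M.hat i x) 2 (volume.restrict (Ω : Set (Space d))) :=
    fun i => (M.memLp_hat hb i).const_mul _
  rw [toL2_sum (f := fun i x => a i 0 * M.hat i x + ∑ k ∈ Finset.range n,
    (a i (k + 1) - a i k) * M.cut ((t - k * h) / h) i x) _ fun i _ => (hh' i).add (hs i)]
  refine Finset.sum_congr rfl fun i _ => ?_
  rw [toL2_add (hh' i) (hs i), toL2_const_mul _ (M.memLp_hat hb i), toL2_sum _ fun k _ => hc i k]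
  congr 1
  exact Finset.sum_congr rfl fun k _ => toL2_const_mul _ (M.memLp_cut hb _ i)

/-- The first two terms are the tensor product interpolant on the slab, the last one is what the
simplicial splitting adds. -/
theorem toL2_interp (hb : Bornology.IsBounded (Ω : Set (Space d))) (hh : 0 < h) {K : ℕ}
    (hK : K < n) (a : Fin M.N → ℕ → ℝ) {t : ℝ} (ht : t ∈ Icc (K * h) ((K + 1 : ℕ) * h)) :
    (toL2 Ω fun x => M.interp h n a (t, x)) = toL2 Ω (M.nodal fun i => a i K) +
      ((t - K * h) / h) • toL2 Ω (M.nodal fun i => a i (K + 1) - a i K) +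
      toL2 Ω (M.corr (fun i => a i (K + 1) - a i K) ((t - K * h) / h)) := by
  have h1 := memLp_nodal hb (M := M) fun i => a i K
  have h2 := memLp_nodal hb (M := M) fun i => a i (K + 1) - a i K
  rw [← toL2_const_mul _ h2, ← toL2_add h1 (h2.const_mul _),
    ← toL2_add (f := fun x => M.nodal (fun i => a i K) x +
      (t - K * h) / h * M.nodal (fun i => a i (K + 1) - a i K) x) (h1.add (h2.const_mul _))
      (memLp_corr hb _ _)]
  congr 1
  funext x
  rw [M.interp_eq_of_mem hh hK a ht x, nodal, nodal, corr, Finset.mul_sum,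
    ← Finset.sum_add_distrib, ← Finset.sum_add_distrib]
  refine Finset.sum_congr rfl fun i _ => ?_
  ring

theorem relative_height_mem (hh : 0 < h) {K : ℕ} {t : ℝ}
    (ht : t ∈ Icc (K * h) ((K + 1 : ℕ) * h)) : (t - K * h) / h ∈ Icc (0 : ℝ) 1 := by
  refine ⟨div_nonneg (sub_nonneg.2 ht.1) hh.le, ?_⟩
  rw [div_le_one hh]
  have := ht.2
  push_cast at this
  linarith

/-- The affine part of the interpolant moves with velocity `1 / h` times the increment, and the
correction is Lipschitz in time with constant `L` after rescaling. A point of the half-open slab has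
room to its right. -/
theorem norm_rightDeriv_interp_sub_le (hb : Bornology.IsBounded (Ω : Set (Space d))) (hh : 0 < h)
    {K : ℕ} (hK : K < n) {a : Fin M.N → ℕ → ℝ} {g : ℝ → L2 Ω}
    (hg : HasBoundedRightDeriv (fun t => toL2 Ω fun x => M.interp h n a (t, x)) g) {L : ℝ}
    (hL : ∀ s ∈ Icc (0 : ℝ) 1, ∀ s' ∈ Icc (0 : ℝ) 1,
      ‖toL2 Ω (M.corr (fun i => a i (K + 1) - a i K) s) -
        toL2 Ω (M.corr (fun i => a i (K + 1) - a i K) s')‖ ≤ L * h * |s - s'|)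
    {t : ℝ} (ht : t ∈ slab h K) :
    ‖g t - (1 / h) • toL2 Ω (M.nodal fun i => a i (K + 1) - a i K)‖ ≤ L := by
  refine norm_sub_le_of_rightDeriv (hg.2.2 t) ?_
  filter_upwards [Ioo_mem_nhdsGT ht.2] with s hs
  have ht' : t ∈ Icc (K * h) ((K + 1 : ℕ) * h) := Ico_subset_Icc_self ht
  have hs' : s ∈ Icc (K * h) ((K + 1 : ℕ) * h) := ⟨ht.1.trans hs.1.le, hs.2.le⟩
  rw [toL2_interp hb hh hK a ht', toL2_interp hb hh hK a hs', smul_smul]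
  have h1 := hL _ (relative_height_mem hh hs') _ (relative_height_mem hh ht')
  have e1 : (s - K * h) / h - (t - K * h) / h = (s - t) / h := by ring
  rw [e1, abs_of_nonneg (div_nonneg (sub_nonneg.2 hs.1.le) hh.le)] at h1
  have e2 : (s - t) * (1 / h) = (s - K * h) / h - (t - K * h) / h := by ring
  rw [e2, sub_smul]
  refine (le_of_eq ?_).trans (h1.trans_eq (by field_simp))
  congr 1
  abel

end SpatialMesh

end

section

variable {d : ℕ} {Ω : Opens (Space d)}

namespace SpatialMesh

variable {M : SpatialMesh Ω} {γ h T : ℝ} {n : ℕ}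

/-! ### Existence and uniqueness of the interpolant -/

theorem exists_vertex_values (hb : Bornology.IsBounded (Ω : Set (Space d))) (f : ℕ → L2 Ω) :
    ∃ a : Fin M.N → ℕ → ℝ, (∀ i, M.p i ∉ Ω → ∀ k, a i k = 0) ∧
      ∀ k, toL2 Ω (M.nodal fun i => a i k) = M.discrete.starProjection (f k) := by
  choose a ha haf using fun k => exists_nodal_of_mem hb (M := M)
    (Submodule.starProjection_apply_mem M.discrete (f k))
  exact ⟨fun i k => a k i, fun i hi k => ha k i hi, haf⟩

/-- The tensor product interpolant with given values at the vertices. -/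
def tensorInterp (M : SpatialMesh Ω) (h : ℝ) (a : Fin M.N → ℕ → ℝ) (z : ℝ × Space d) : ℝ :=
  (M.nodal (fun i => a i (⌊z.1 / h⌋₊ + 1)) z.2 * (z.1 - ⌊z.1 / h⌋₊ * h) +
    M.nodal (fun i => a i ⌊z.1 / h⌋₊) z.2 * ((⌊z.1 / h⌋₊ + 1 : ℕ) * h - z.1)) / h

theorem tensorInterp_node (hh : 0 < h) (a : Fin M.N → ℕ → ℝ) (k : ℕ) (x : Space d) :
    M.tensorInterp h a (k * h, x) = M.nodal (fun i => a i k) x := by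
  have e : ⌊(k : ℝ) * h / h⌋₊ = k := by
    rw [mul_div_cancel_right₀ _ hh.ne', Nat.floor_natCast]
  simp only [tensorInterp, e]
  push_cast
  field_simp
  ring

theorem tensorInterp_eq (hh : 0 < h) (a : Fin M.N → ℕ → ℝ) {k : ℕ} {t : ℝ}
    (ht : t ∈ Icc (k * h) ((k + 1 : ℕ) * h)) (x : Space d) :
    M.tensorInterp h a (t, x) =
      (M.tensorInterp h a ((k + 1 : ℕ) * h, x) * (t - k * h) +
        M.tensorInterp h a (k * h, x) * ((k + 1 : ℕ) * h - t)) / h := by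
  rw [tensorInterp_node hh, tensorInterp_node hh]
  rcases ht.2.eq_or_lt with h1 | h1
  · rw [h1, tensorInterp_node hh]
    push_cast
    field_simp
    ring
  · have e := floor_of_mem_slab hh (t := t) (k := k) ⟨ht.1, h1⟩
    simp only [tensorInterp, e]

theorem isSimplicialInterpolant_interp (hb : Bornology.IsBounded (Ω : Set (Space d)))
    (hint : interior (closure (Ω : Set (Space d))) ⊆ Ω) (hh : 0 < h) {a : Fin M.N → ℕ → ℝ}
    (ha : ∀ i, M.p i ∉ Ω → ∀ k, a i k = 0) {u : ℝ → L2 Ω}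
    (hu : ∀ k : ℕ, toL2 Ω (M.nodal fun i => a i k) = M.discrete.starProjection (u (k * h)))
    (hn : 1 ≤ n) : M.IsSimplicialInterpolant h n u (M.interp h n a) := by
  refine ⟨M.isSpaceTimeS10_interp hint hh ha, M.tensorInterp h a, ⟨fun k _ => ?_, fun k _ t ht x _ =>
    tensorInterp_eq hh a ht x⟩, fun k hk i => ?_⟩
  · have e : (fun x => M.tensorInterp h a (k * h, x)) = M.nodal fun i => a i k :=
      funext fun x => tensorInterp_node hh a k x
    rw [e]
    exact isL2Projection_nodal hb hint (fun i hi => ha i hi k) (hu k)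
  · rw [tensorInterp_node hh, nodal_vertex]
    -- No slab begins at the final time, so its values are read at the upper end of the last slab,
    -- where the relative height is 1.
    rcases hk.eq_or_lt with rfl | hk'
    · obtain ⟨m, rfl⟩ := Nat.exists_eq_succ_of_ne_zero (Nat.one_le_iff_ne_zero.1 hn)
      have hle : ((m : ℕ) : ℝ) * h ≤ (m + 1 : ℕ) * h :=
        mul_le_mul_of_nonneg_right (by exact_mod_cast Nat.le_succ m) hh.le
      rw [M.interp_eq_of_mem hh (Nat.lt_succ_self m) a (right_mem_Icc.2 hle)]
      have e : (((m + 1 : ℕ) : ℝ) * h - m * h) / h = 1 := by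
        push_cast
        field_simp
        ring
      rw [Nat.succ_eq_add_one, e]
      simp only [M.cut_of_one_le le_rfl]
      rw [← nodal_vertex (fun i => a i (m + 1)) i, nodal]
      exact Finset.sum_congr rfl fun j _ => by ring
    · have hle : ((k : ℕ) : ℝ) * h ≤ (k + 1 : ℕ) * h :=
        mul_le_mul_of_nonneg_right (by exact_mod_cast Nat.le_succ k) hh.le
      rw [M.interp_eq_of_mem hh hk' a (left_mem_Icc.2 hle), sub_self, zero_div]
      simp only [M.cut_zero, mul_zero, add_zero]
      exact nodal_vertex (fun i => a i k) i

/-- The `L²` projections are unique and determine their nodal values, and a function of the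
space-time finite element space is determined by its values at the vertices. -/
theorem IsSimplicialInterpolant.eq_interp (hb : Bornology.IsBounded (Ω : Set (Space d)))
    (hint : interior (closure (Ω : Set (Space d))) ⊆ Ω) (hM : M.IsUniform γ h) (hγ : 0 < γ)
    (hh : 0 < h) (hn : 1 ≤ n) {a : Fin M.N → ℕ → ℝ} {u : ℝ → L2 Ω}
    (hu : ∀ k : ℕ, toL2 Ω (M.nodal fun i => a i k) = M.discrete.starProjection (u (k * h)))
    {w : ℝ × Space d → ℝ} (hw : M.IsSimplicialInterpolant h n u w) {z : ℝ × Space d}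
    (hz : z ∈ Icc 0 (n * h) ×ˢ closure (Ω : Set (Space d))) : w z = M.interp h n a z := by
  obtain ⟨hw1, v, hv, hwv⟩ := hw
  have hval : ∀ k ≤ n, ∀ i, w (k * h, M.p i) = a i k := fun k hk i => by
    have h1 := (hv.1 k hk).toL2_eq hb hint
    have h2 := toL2_nodal_injective hb hint hM hγ hh (h1.trans (hu k).symm)
    rw [hwv k hk i]
    exact congrFun h2 i
  rw [M.eq_interp_of_isSpaceTimeS10 hh hn hw1 hz, interp, interp]
  refine Finset.sum_congr rfl fun i _ => ?_
  rw [hval 0 (Nat.zero_le n)]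
  congr 1
  refine Finset.sum_congr rfl fun k hk => ?_
  have hk' := Finset.mem_range.1 hk
  rw [hval k hk'.le, hval (k + 1) hk']

/-! ### Error bounds at a fixed time -/

/-- Splits both errors on a slab into parts controlled by `exists_projection` and
`exists_corr_bound`. Apart from the approximation error of `u t` itself, every part is an increment
of `U` within the slab, measured in `H¹₀`. -/
theorem exists_pointwise_bounds (hb : Bornology.IsBounded (Ω : Set (Space d)))
    (hL : HasLipschitzBoundary (Ω : Set (Space d))) (hγ : 0 < γ) (hT : 0 < T) :
    ∃ C > 0, ∀ (n : ℕ) (h : ℝ) (M : SpatialMesh Ω), 0 < h → n * h = T → M.IsUniform γ h →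
      ∀ (u : ℝ → L2 Ω) (a : Fin M.N → ℕ → ℝ), (∀ i, M.p i ∉ Ω → ∀ k, a i k = 0) →
      (∀ k : ℕ, toL2 Ω (M.nodal fun i => a i k) = M.discrete.starProjection (u (k * h))) →
      ∀ U : ℝ → H10 Ω, (∀ t ∈ Icc 0 T, H10toL2 Ω (U t) = u t) →
      ∀ k < n, ∀ t ∈ slab h k,
      (∃ W : H10 Ω, H10toL2 Ω W = (toL2 Ω fun x => M.interp h n a (t, x)) ∧
        ∀ F : H2 Ω, H2toL2 Ω F = u t → ‖U t - W‖ ≤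
          C * (h * ‖F‖ + ‖U t - U (k * h)‖ + ‖U ((k + 1 : ℕ) * h) - U (k * h)‖)) ∧
      ∀ g, HasBoundedRightDeriv (fun t => toL2 Ω fun x => M.interp h n a (t, x)) g →
        ‖(1 / h) • (u ((k + 1 : ℕ) * h) - u (k * h)) - g t‖ ≤
          C * ‖U ((k + 1 : ℕ) * h) - U (k * h)‖ := by
  have hint := interior_closure_subset hL
  obtain ⟨CP, hCP, HP⟩ := exists_projection hb hL hγ
  obtain ⟨CR, hCR, HR⟩ := exists_corr_bound hb hint hγ hT
  refine ⟨CP * (1 + CR) + CP, by positivity, ?_⟩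
  intro n h M hh hn hM u a ha hau U hU k hk t ht
  obtain ⟨P, hP1, hP2, hP3, hP4⟩ := HP M h hh hM
  obtain ⟨e1, e2, e3⟩ := slab_endpoints hh hn hk
  have hsub := Icc_slab_subset hh hn hk
  have ht' : t ∈ Icc (k * h) ((k + 1 : ℕ) * h) := Ico_subset_Icc_self ht
  have hhT : h ≤ T := by
    rw [← hn]
    exact le_mul_of_one_le_left hh.le (by exact_mod_cast Nat.one_le_of_lt hk)
  set Δ : H10 Ω := U ((k + 1 : ℕ) * h) - U (k * h) with hΔ
  set b : Fin M.N → ℝ := fun i => a i (k + 1) - a i k with hbdef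
  have hUk : H10toL2 Ω (U (k * h)) = u (k * h) := hU _ (hsub (left_mem_Icc.2 e2))
  have hUk' : H10toL2 Ω (U ((k + 1 : ℕ) * h)) = u ((k + 1 : ℕ) * h) :=
    hU _ (hsub (right_mem_Icc.2 e2))
  have hnb : toL2 Ω (M.nodal b) = H10toL2 Ω (P Δ) := by
    have : M.nodal b = fun x => M.nodal (fun i => a i (k + 1)) x - M.nodal (fun i => a i k) x :=
      funext fun x => nodal_sub (fun i => a i (k + 1)) (fun i => a i k) x
    rw [this, toL2_sub (memLp_nodal hb _) (memLp_nodal hb _), hau, hau, hP1, hΔ, map_sub, hUk,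
      hUk', map_sub]
  have hb0 : ∀ i, M.p i ∉ Ω → b i = 0 := fun i hi => by
    simp only [hbdef, ha i hi, sub_self]
  obtain ⟨hR1, hR2⟩ := HR M h hh hhT hM b (P Δ) hb0 hnb.symm
  have hPΔ : ‖P Δ‖ ≤ CP * ‖Δ‖ := hP2 Δ
  constructor
  · set τ := (t - k * h) / h with hτ
    have hτm : τ ∈ Icc (0 : ℝ) 1 := relative_height_mem hh ht'
    obtain ⟨R, hR, hRn⟩ := hR1 τ hτm
    refine ⟨P (U (k * h)) + τ • P Δ + R, ?_, fun F hF => ?_⟩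
    · rw [toL2_interp hb hh hk a ht', map_add, map_add, map_smul, hR, ← hnb, hau, hP1, hUk]
    · have h1 := hP4 (U t) F (by rw [hF, hU t (hsub ht')])
      -- The projection error at time `t`, an increment under the stable projection, and the two
      -- terms that come from the increment over the slab.
      have e : U t - (P (U (k * h)) + τ • P Δ + R) =
          (U t - P (U t)) + P (U t - U (k * h)) - τ • P Δ - R := by
        rw [map_sub P (U t) (U (k * h))]
        abel
      have h2 := hP2 (U t - U (k * h))
      have h3 : ‖τ • P Δ‖ ≤ CP * ‖Δ‖ := by
        rw [norm_smul, Real.norm_eq_abs, abs_of_nonneg hτm.1]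
        exact (mul_le_of_le_one_left (norm_nonneg _) hτm.2).trans hPΔ
      have h4 : ‖R‖ ≤ CR * (CP * ‖Δ‖) := hRn.trans (mul_le_mul_of_nonneg_left hPΔ hCR.le)
      rw [e]
      have h5 := (norm_sub_le ((U t - P (U t)) + P (U t - U (k * h)) - τ • P Δ) R).trans
        (add_le_add_left (norm_sub_le ((U t - P (U t)) + P (U t - U (k * h))) (τ • P Δ)) _)
      have h6 := norm_add_le (U t - P (U t)) (P (U t - U (k * h)))
      have h7 : 0 ≤ CP * CR * (h * ‖F‖ + ‖U t - U (k * h)‖) := by positivity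
      have h8 : 0 ≤ CP * (h * ‖F‖ + ‖U t - U (k * h)‖ + ‖Δ‖) := by positivity
      linarith
  · intro g hg
    have h1 := norm_rightDeriv_interp_sub_le hb hh hk hg (L := CR * ‖P Δ‖)
      (fun s hs s' hs' => (hR2 s hs s' hs').trans_eq (by ring)) ht
    have h2 : ‖(1 / h) • (H10toL2 Ω Δ - H10toL2 Ω (P Δ))‖ ≤ CP * ‖Δ‖ := by
      rw [norm_smul, Real.norm_eq_abs, abs_of_pos (by positivity)]
      calc _ ≤ 1 / h * (CP * h * ‖Δ‖) := mul_le_mul_of_nonneg_left (hP3 Δ) (by positivity)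
        _ = _ := by field_simp
    -- The first part uses the first order error of the projection in `L²` to absorb `1 / h`; the
    -- second is the contribution of the correction.
    have e : (1 / h) • (u ((k + 1 : ℕ) * h) - u (k * h)) - g t =
        (1 / h) • (H10toL2 Ω Δ - H10toL2 Ω (P Δ)) -
          (g t - (1 / h) • toL2 Ω (M.nodal b)) := by
      rw [hnb, hΔ, map_sub, hUk, hUk', smul_sub _ (_ - _)]
      abel
    rw [e]
    refine (norm_sub_le _ _).trans ?_
    have h3 : CR * ‖P Δ‖ ≤ CR * (CP * ‖Δ‖) := mul_le_mul_of_nonneg_left hPΔ hCR.le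
    have h4 : 0 ≤ CP * ‖Δ‖ := by positivity
    linarith

end SpatialMesh

end

section

variable {d : ℕ} {Ω : Opens (Space d)}

/-! ### Error bounds in the Bochner norms -/

instance : CompleteSpace (H10 Ω) := (Submodule.isClosed_topologicalClosure _).completeSpace_coe

theorem eLpNorm_le_sum_rpow {X : Type*} [NormedAddCommGroup X] {T : ℝ}
    {D : ℕ → ℝ → X} {k j : ℕ} (hj : j ≤ k) :
    eLpNorm (D j) 2 (timeMeasure T) ≤
      (∑ j ∈ Finset.range (k + 1), eLpNorm (D j) 2 (timeMeasure T) ^ 2) ^ (1 / 2 : ℝ) := by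
  have h1 := Finset.single_le_sum (f := fun j => eLpNorm (D j) 2 (timeMeasure T) ^ 2)
    (fun _ _ => zero_le) (Finset.mem_range.2 (Nat.lt_succ_of_le hj))
  have h2 := ENNReal.rpow_le_rpow h1 (show (0 : ℝ) ≤ 1 / 2 by norm_num)
  refine le_trans (le_of_eq ?_) h2
  rw [← ENNReal.rpow_natCast, ← ENNReal.rpow_mul]
  norm_num

theorem eLpNorm_le_of_norm_le_add {X : Type*} [NormedAddCommGroup X] {T : ℝ} {f : ℝ → X}
    {p q : ℝ → ℝ} {α β : ℝ} (hα : 0 ≤ α) (hβ : 0 ≤ β)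
    (hp : AEStronglyMeasurable p (timeMeasure T)) (hq : AEStronglyMeasurable q (timeMeasure T))
    (hf : ∀ᵐ t ∂(timeMeasure T), ‖f t‖ ≤ α * p t + β * q t) :
    eLpNorm f 2 (timeMeasure T) ≤ ENNReal.ofReal α * eLpNorm p 2 (timeMeasure T) +
      ENNReal.ofReal β * eLpNorm q 2 (timeMeasure T) := by
  have h1 := eLpNorm_mono_ae_real (p := 2) hf
  refine h1.trans ?_
  have h2 := eLpNorm_add_le (p := 2) (hp.const_smul α) (hq.const_smul β) (by norm_num)
  rw [eLpNorm_const_smul, eLpNorm_const_smul, Real.enorm_of_nonneg hα,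
    Real.enorm_of_nonneg hβ] at h2
  exact h2

section

variable {X Y : Type*} [NormedAddCommGroup X] [NormedSpace ℝ X] [NormedAddCommGroup Y]
  [NormedSpace ℝ Y] {T : ℝ}

/-- The continuous representative of a function with a weak time derivative. -/
theorem IsTimeDerivChain.exists_primitive [CompleteSpace X] (hT : 0 < T) {k : ℕ} (hk : 1 ≤ k)
    {ι : X →L[ℝ] Y} {f : ℝ → Y} (hf : ContinuousOn f (Icc 0 T)) {D : ℕ → ℝ → X}
    (hD : IsTimeDerivChain T k ι f D) :
    ∃ c, (∀ᵐ t ∂(timeMeasure T), D 0 t = c + ∫ s in (0)..t, D 1 s) ∧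
      ∀ t ∈ Icc 0 T, ι (c + ∫ s in (0)..t, D 1 s) = f t := by
  obtain ⟨c, hc⟩ := (hD.deriv 0 hk).exists_primitive hT
  refine ⟨c, hc, ?_⟩
  have hcont : ContinuousOn (fun t => ι (c + ∫ s in (0)..t, D 1 s)) (Icc 0 T) :=
    ι.continuous.comp_continuousOn (continuousOn_const.add
      (continuousOn_primitive_time (integrable_of_memLp_time (hD.memLp 1 hk))))
  -- Both sides are continuous on the closed interval, so equality almost everywhere holds at every
  -- time, in particular at the nodes where `u` is sampled.
  refine Measure.eqOn_Icc_of_ae_eq (μ := volume) hT.ne ?_ hcont hf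
  rw [← Measure.restrict_congr_set Ioo_ae_eq_Icc]
  filter_upwards [hc, hD.lift] with t h1 h2
  rw [← h1, h2]

end

theorem norm_L2toHneg1_le (f : L2 Ω) : ‖L2toHneg1 Ω f‖ ≤ ‖f‖ := by
  refine ContinuousLinearMap.opNorm_le_bound _ (norm_nonneg f) fun v => ?_
  exact (norm_inner_le_norm _ _).trans
    (mul_le_mul_of_nonneg_left (norm_H10toL2_le v) (norm_nonneg f))

theorem L2toHneg1_add (f g : L2 Ω) : L2toHneg1 Ω (f + g) = L2toHneg1 Ω f + L2toHneg1 Ω g := by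
  ext v
  simp [L2toHneg1]

theorem L2toHneg1_smul (c : ℝ) (f : L2 Ω) : L2toHneg1 Ω (c • f) = c • L2toHneg1 Ω f := by
  ext v
  simp [L2toHneg1]

namespace SpatialMesh

variable {γ T : ℝ}

/-- The map `κ` is the identity of `L²` or the embedding into `H⁻¹`. Being a contraction, it
preserves the `L²` bounds for the discrete part, while `u' - Δ/h` is estimated in the target space
by the second derivative there. -/
theorem exists_error_bounds (hb : Bornology.IsBounded (Ω : Set (Space d)))
    (hL : HasLipschitzBoundary (Ω : Set (Space d))) (hγ : 0 < γ) (hT : 0 < T) :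
    ∃ C > 0, ∀ (n : ℕ) (h : ℝ) (M : SpatialMesh Ω), 0 < h → n * h = T → M.IsUniform γ h →
      ∀ u : ℝ → L2 Ω, ContinuousOn u (Icc 0 T) → ∀ a : Fin M.N → ℕ → ℝ,
      (∀ i, M.p i ∉ Ω → ∀ k, a i k = 0) →
      (∀ k : ℕ, toL2 Ω (M.nodal fun i => a i k) = M.discrete.starProjection (u (k * h))) →
      ∀ D, IsTimeDerivChain T 1 (H10toL2 Ω) u D →
      (∀ G : ℝ → H2 Ω, AEStronglyMeasurable G (timeMeasure T) →
        (∀ᵐ t ∂(timeMeasure T), H2toL2 Ω (G t) = u t) →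
        bochnerNorm T 2 (H10toL2 Ω) (interpError u (M.interp h n a)) ≤
          ENNReal.ofReal (C * h) *
            (eLpNorm (D 1) 2 (timeMeasure T) + eLpNorm G ⊤ (timeMeasure T))) ∧
      ∀ (Y : Type) [NormedAddCommGroup Y] [NormedSpace ℝ Y] [CompleteSpace Y] (κ : L2 Ω → Y)
        (N : ℕ → ℝ → Y), (∀ f g, κ (f + g) = κ f + κ g) → (∀ (r : ℝ) f, κ (r • f) = r • κ f) →
        (∀ f, ‖κ f‖ ≤ ‖f‖) → IsTimeDerivChain T 2 (.id ℝ Y) (fun t => κ (u t)) N →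
        derivNorm T (fun t => κ (interpError u (M.interp h n a) t)) ≤
          ENNReal.ofReal (C * h) *
            (eLpNorm (D 1) 2 (timeMeasure T) + eLpNorm (N 2) 2 (timeMeasure T)) := by
  obtain ⟨C, hC, H⟩ := exists_pointwise_bounds hb hL hγ hT
  -- The 1 belongs to the slab integral of the second derivative, `C * 2` to the two increments of
  -- `U`, and `C * √T` to the passage from `L^∞` to `L²` in time for the `H²` norm.
  refine ⟨1 + C * 2 + C * √T, by positivity, ?_⟩
  intro n h M hh hn hM u hu a ha hau D hD
  obtain ⟨c, hc, hcu⟩ := hD.exists_primitive hT le_rfl hu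
  set U : ℝ → H10 Ω := fun t => c + ∫ s in (0)..t, D 1 s with hUdef
  have hD1 := integrable_of_memLp_time (hD.memLp 1 le_rfl)
  have hm1 : AEStronglyMeasurable (slabInt h fun s => ‖D 1 s‖) (timeMeasure T) :=
    (measurable_slabInt _).aestronglyMeasurable
  have hslab : eLpNorm (slabInt h fun s => ‖D 1 s‖) 2 (timeMeasure T) ≤
      ENNReal.ofReal h * eLpNorm (D 1) 2 (timeMeasure T) := by
    refine (eLpNorm_slabInt_le hh hn (hD.memLp 1 le_rfl).1.norm).trans_eq ?_
    rw [eLpNorm_norm]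
  obtain ⟨g, hg⟩ := M.exists_hasBoundedRightDeriv_interp hb hh n a
  have hk : ∀ t ∈ Ioo 0 T, ⌊t / h⌋₊ < n := fun t ht => floor_lt hh hn ht.1.le ht.2
  have hts : ∀ t ∈ Ioo 0 T, t ∈ slab h ⌊t / h⌋₊ := fun t ht => mem_slab hh ht.1.le
  have hU1 : ∀ t ∈ Ioo 0 T, ‖U t - U (⌊t / h⌋₊ * h)‖ ≤ slabInt h (fun s => ‖D 1 s‖) t := by
    intro t ht
    refine norm_primitive_sub_le hh hn (hk t ht) hD1 (Ico_subset_Icc_self (hts t ht)) ?_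
    exact left_mem_Icc.2 (slab_endpoints hh hn (hk t ht)).2.1
  have hU2 : ∀ t ∈ Ioo 0 T, ‖U ((⌊t / h⌋₊ + 1 : ℕ) * h) - U (⌊t / h⌋₊ * h)‖ ≤
      slabInt h (fun s => ‖D 1 s‖) t := by
    intro t ht
    have h2 := (slab_endpoints hh hn (hk t ht)).2.1
    exact norm_primitive_sub_le hh hn (hk t ht) hD1 (right_mem_Icc.2 h2) (left_mem_Icc.2 h2)
  constructor
  · intro G hG hGu
    have hW : ∀ t, ∃ W : H10 Ω, t ∈ Ioo 0 T →
        H10toL2 Ω W = (toL2 Ω fun x => M.interp h n a (t, x)) ∧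
        ∀ F : H2 Ω, H2toL2 Ω F = u t → ‖U t - W‖ ≤ C * (h * ‖F‖ +
          ‖U t - U (⌊t / h⌋₊ * h)‖ + ‖U ((⌊t / h⌋₊ + 1 : ℕ) * h) - U (⌊t / h⌋₊ * h)‖) := by
      intro t
      by_cases ht : t ∈ Ioo 0 T
      · obtain ⟨W, hW⟩ := (H n h M hh hn hM u a ha hau U hcu _ (hk t ht) t (hts t ht)).1
        exact ⟨W, fun _ => hW⟩
      · exact ⟨0, fun h => absurd h ht⟩
    choose W hW using hW
    have hWm := aestronglyMeasurable_H10 (T := T) hg.1 fun t ht => (hW t ht).1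
    have hGnorm : eLpNorm (fun t => ‖G t‖) 2 (timeMeasure T) ≤
        ENNReal.ofReal (√T) * eLpNorm G ⊤ (timeMeasure T) := by
      rw [eLpNorm_norm]
      refine (eLpNorm_le_eLpNorm_mul_rpow_measure_univ le_top hG).trans_eq ?_
      rw [Measure.restrict_apply_univ, Real.volume_Ioo, sub_zero, mul_comm, Real.sqrt_eq_rpow,
        ENNReal.ofReal_rpow_of_pos hT]
      norm_num
    have hle := eLpNorm_le_of_norm_le_add (T := T) (f := fun t => D 0 t - W t)
      (p := slabInt h fun s => ‖D 1 s‖) (q := fun t => ‖G t‖) (α := C * 2) (β := C * h)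
      (by positivity) (by positivity) hm1 hG.norm ?_
    · have hbn : bochnerNorm T 2 (H10toL2 Ω) (interpError u (M.interp h n a)) ≤
          eLpNorm (fun t => D 0 t - W t) 2 (timeMeasure T) := by
        refine iInf_le_of_le (fun t => D 0 t - W t) (iInf_le_of_le
          ((hD.memLp 0 zero_le_one).1.sub hWm) (iInf_le_of_le ?_ le_rfl))
        filter_upwards [hD.lift, ae_restrict_mem measurableSet_Ioo] with t ht htT
        rw [map_sub, ht, (hW t htT).1, interpError]
      refine hbn.trans (hle.trans ?_)
      have e1 : ENNReal.ofReal (C * 2) * (ENNReal.ofReal h * eLpNorm (D 1) 2 (timeMeasure T)) ≤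
          ENNReal.ofReal ((1 + C * 2 + C * √T) * h) * eLpNorm (D 1) 2 (timeMeasure T) := by
        rw [← mul_assoc, ← ENNReal.ofReal_mul (by positivity)]
        gcongr
        have : 0 ≤ C * √T := by positivity
        linarith
      have e2 : ENNReal.ofReal (C * h) * (ENNReal.ofReal (√T) * eLpNorm G ⊤ (timeMeasure T)) ≤
          ENNReal.ofReal ((1 + C * 2 + C * √T) * h) * eLpNorm G ⊤ (timeMeasure T) := by
        rw [← mul_assoc, ← ENNReal.ofReal_mul (by positivity)]
        refine mul_le_mul_left (ENNReal.ofReal_le_ofReal ?_) _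
        have : 0 ≤ C * 2 * h := by positivity
        linarith
      rw [mul_add]
      exact add_le_add ((mul_le_mul_right hslab _).trans e1) ((mul_le_mul_right hGnorm _).trans e2)
    · filter_upwards [hc, hGu, ae_restrict_mem measurableSet_Ioo] with t h1 h2 htT
      have h3 := (hW t htT).2 (G t) h2
      have h4 := hU1 t htT
      have h5 := hU2 t htT
      rw [h1]
      refine h3.trans ?_
      calc _ ≤ C * (h * ‖G t‖ + slabInt h (fun s => ‖D 1 s‖) t +
            slabInt h (fun s => ‖D 1 s‖) t) := by gcongr
        _ = _ := by ring
  · intro Y _ _ _ κ' N hadd hsmul hκ hN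
    obtain ⟨κ, rfl⟩ : ∃ κ : L2 Ω →L[ℝ] Y, ⇑κ = κ' :=
      ⟨LinearMap.mkContinuous ⟨⟨κ', hadd⟩, hsmul⟩ 1 fun f => (hκ f).trans_eq (one_mul _).symm, rfl⟩
    obtain ⟨c₀, -, hN0⟩ := hN.exists_primitive hT one_le_two (κ.continuous.comp_continuousOn hu)
    obtain ⟨c₁, hN1⟩ := (hN.deriv 1 one_lt_two).exists_primitive hT
    have hNd : HasWeakTimeDeriv T (fun t => κ (interpError u (M.interp h n a) t))
        fun t => N 1 t - κ (g t) := by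
      have h1 := ((hN.deriv 0 zero_lt_two).congr (f' := fun t => κ (u t))
        (by filter_upwards [hN.lift] with t ht using ht)).sub
        ((hg.comp_clm κ).hasWeakTimeDeriv hT)
      refine h1.congr (.of_forall fun t => ?_)
      simp only [interpError, map_sub]
    refine (iInf₂_le _ hNd).trans ?_
    have hm2 : AEStronglyMeasurable (slabInt h fun s => ‖N 2 s‖) (timeMeasure T) :=
      (measurable_slabInt _).aestronglyMeasurable
    have hslab2 : eLpNorm (slabInt h fun s => ‖N 2 s‖) 2 (timeMeasure T) ≤
        ENNReal.ofReal h * eLpNorm (N 2) 2 (timeMeasure T) := by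
      refine (eLpNorm_slabInt_le hh hn (hN.memLp 2 le_rfl).1.norm).trans_eq ?_
      rw [eLpNorm_norm]
    have havg := norm_sub_average_le (N₀ := fun t => κ (u t)) hh hn
      (integrable_of_memLp_time (hN.memLp 1 one_le_two))
      (integrable_of_memLp_time (hN.memLp 2 le_rfl)) (fun t ht => (hN0 t ht).symm) hN1
    have hle := eLpNorm_le_of_norm_le_add (T := T) (f := fun t => N 1 t - κ (g t))
      (p := slabInt h fun s => ‖D 1 s‖) (q := slabInt h fun s => ‖N 2 s‖) (α := C) (β := 1)
      hC.le zero_le_one hm1 hm2 ?_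
    · refine hle.trans ?_
      rw [mul_add]
      refine add_le_add ((mul_le_mul_right hslab _).trans ?_) ((mul_le_mul_right hslab2 _).trans ?_)
      · rw [← mul_assoc, ← ENNReal.ofReal_mul (by positivity)]
        refine mul_le_mul_left (ENNReal.ofReal_le_ofReal (mul_le_mul_of_nonneg_right ?_ hh.le)) _
        have h2 : 0 ≤ C * √T := by positivity
        linarith
      · rw [← mul_assoc, ← ENNReal.ofReal_mul zero_le_one]
        refine mul_le_mul_left (ENNReal.ofReal_le_ofReal (mul_le_mul_of_nonneg_right ?_ hh.le)) _
        have h1 : 0 ≤ C * 2 + C * √T := by positivity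
        linarith
    · filter_upwards [havg, ae_restrict_mem measurableSet_Ioo] with t h1 htT
      have h2 := (H n h M hh hn hM u a ha hau U hcu _ (hk t htT) t (hts t htT)).2 g hg
      -- The derivative minus the difference quotient of `κ u`, plus the image of the error between
      -- this quotient and the derivative of the interpolant.
      have e : N 1 t - κ (g t) = (N 1 t - (1 / h) •
          (κ (u ((⌊t / h⌋₊ + 1 : ℕ) * h)) - κ (u (⌊t / h⌋₊ * h)))) +
          κ ((1 / h) • (u ((⌊t / h⌋₊ + 1 : ℕ) * h) - u (⌊t / h⌋₊ * h)) - g t) := by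
        rw [map_sub κ (_ • _), map_smul, map_sub κ (u _)]
        abel
      rw [e]
      refine (norm_add_le _ _).trans ?_
      have h3 := (hκ ((1 / h) • (u ((⌊t / h⌋₊ + 1 : ℕ) * h) - u (⌊t / h⌋₊ * h)) - g t)).trans
        (h2.trans (mul_le_mul_of_nonneg_left (hU2 t htT) hC.le))
      linarith

end SpatialMesh

/-- The norms are infima over representatives, so a bound for each pair of representatives suffices.
As the factor `c` is neither 0 nor infinite it can be divided out, and the case of an infinite norm
takes care of itself. -/
theorem le_mul_sobolevNorm_add {X Y X' Y' : Type*} [NormedAddCommGroup X] [NormedSpace ℝ X]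
    [NormedAddCommGroup Y] [NormedSpace ℝ Y] [NormedAddCommGroup X'] [NormedSpace ℝ X']
    [NormedAddCommGroup Y'] [NormedSpace ℝ Y'] {T : ℝ} {k k' : ℕ} {ι : X →L[ℝ] Y} {f : ℝ → Y}
    {ι' : X' →L[ℝ] Y'} {f' : ℝ → Y'} {j j' : ℕ} (hj : j ≤ k) (hj' : j' ≤ k') {x c : ℝ≥0∞}
    (hc0 : c ≠ 0) (hc : c ≠ ∞)
    (h : ∀ D, IsTimeDerivChain T k ι f D → ∀ N, IsTimeDerivChain T k' ι' f' N →
      x ≤ c * (eLpNorm (D j) 2 (timeMeasure T) + eLpNorm (N j') 2 (timeMeasure T))) :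
    x ≤ c * (sobolevNorm T k ι f + sobolevNorm T k' ι' f') := by
  rw [← ENNReal.div_le_iff' hc0 hc]
  simp only [sobolevNorm, ENNReal.iInf_add, ENNReal.add_iInf, le_iInf_iff]
  intro D hD N hN
  rw [ENNReal.div_le_iff' hc0 hc]
  refine (h _ (by assumption) _ (by assumption)).trans ?_
  gcongr
  · exact eLpNorm_le_sum_rpow hj
  · exact eLpNorm_le_sum_rpow hj'

theorem le_mul_sobolevNorm_add_bochnerNorm {X Y X' Y' : Type*} [NormedAddCommGroup X]
    [NormedSpace ℝ X] [NormedAddCommGroup Y] [NormedSpace ℝ Y] [NormedAddCommGroup X']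
    [NormedSpace ℝ X'] [NormedAddCommGroup Y'] [NormedSpace ℝ Y'] {T : ℝ} {k : ℕ} {p : ℝ≥0∞}
    {ι : X →L[ℝ] Y} {f : ℝ → Y} {ι' : X' →L[ℝ] Y'} {f' : ℝ → Y'} {j : ℕ} (hj : j ≤ k)
    {x c : ℝ≥0∞} (hc0 : c ≠ 0) (hc : c ≠ ∞)
    (h : ∀ D, IsTimeDerivChain T k ι f D → ∀ G : ℝ → X', AEStronglyMeasurable G (timeMeasure T) →
      (∀ᵐ t ∂(timeMeasure T), ι' (G t) = f' t) →
      x ≤ c * (eLpNorm (D j) 2 (timeMeasure T) + eLpNorm G p (timeMeasure T))) :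
    x ≤ c * (sobolevNorm T k ι f + bochnerNorm T p ι' f') := by
  rw [← ENNReal.div_le_iff' hc0 hc]
  simp only [sobolevNorm, bochnerNorm, ENNReal.iInf_add, ENNReal.add_iInf, le_iInf_iff]
  intros
  rw [ENNReal.div_le_iff' hc0 hc]
  refine (h _ (by assumption) _ (by assumption) (by assumption)).trans ?_
  gcongr
  exact eLpNorm_le_sum_rpow hj

end

end SpaceTimeFEM

end

/-! ### Proof of the main theorem. -/

open SpaceTimeFEM in
theorem mainTheorem3 (d : ℕ) (hd : 1 ≤ d) (Ω : TopologicalSpace.Opens (Space d))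
    (hΩb : Bornology.IsBounded (Ω : Set (Space d)))
    (hΩL : HasLipschitzBoundary (Ω : Set (Space d)))
    (T : ℝ) (hT : 0 < T) (γ : ℝ) (hγ : 0 < γ) :
    ∃ C : ℝ, 0 < C ∧
      ∀ (n : ℕ) (h : ℝ) (M : SpatialMesh Ω), 1 ≤ n → n * h = T → M.IsUniform γ h →
        IsAdmissibleMesh (M.spaceTimeMesh h n)
          (Set.Icc 0 T ×ˢ closure (Ω : Set (Space d))) ∧
        ∀ u : ℝ → L2 Ω, ContinuousOn u (Set.Icc 0 T) →
          ∃ w : ℝ × Space d → ℝ, M.IsSimplicialInterpolant h n u w ∧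
            (∀ w', M.IsSimplicialInterpolant h n u w' →
              Set.EqOn w' w (Set.Icc 0 T ×ˢ closure (Ω : Set (Space d)))) ∧
            bochnerNorm T 2 (H10toL2 Ω) (interpError u w) ≤
              ENNReal.ofReal (C * h) *
                (sobolevNorm T 1 (H10toL2 Ω) u + bochnerNorm T ⊤ (H2toL2 Ω) u) ∧
            derivNorm T (fun t => L2toHneg1 Ω (interpError u w t)) ≤
              ENNReal.ofReal (C * h) *
                (sobolevNorm T 1 (H10toL2 Ω) u +
                  sobolevNorm (X := Hneg1 Ω) T 2 (.id ℝ _) (fun t => L2toHneg1 Ω (u t)) +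
                  bochnerNorm T ⊤ (H2toL2 Ω) u) ∧
            derivNorm T (interpError u w) ≤
              ENNReal.ofReal (C * h) *
                (sobolevNorm T 1 (H10toL2 Ω) u + sobolevNorm (X := L2 Ω) T 2 (.id ℝ _) u +
                  bochnerNorm T ⊤ (H2toL2 Ω) u) := by
  have hint := interior_closure_subset hΩL
  obtain ⟨C, hC, H⟩ := SpatialMesh.exists_error_bounds hΩb hΩL hγ hT
  refine ⟨C, hC, fun n h M hn hnT hM => ?_⟩
  have hh : 0 < h := by
    by_contra hcon
    have : (n : ℝ) * h ≤ 0 := mul_nonpos_of_nonneg_of_nonpos (Nat.cast_nonneg n) (not_lt.1 hcon)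
    linarith
  have hc0 : ENNReal.ofReal (C * h) ≠ 0 := (ENNReal.ofReal_pos.2 (by positivity)).ne'
  refine ⟨hnT ▸ M.isAdmissibleMesh_spaceTimeMesh hh hn, fun u hu => ?_⟩
  obtain ⟨a, ha, hau⟩ := SpatialMesh.exists_vertex_values (M := M) hΩb fun k => u (k * h)
  refine ⟨M.interp h n a, M.isSimplicialInterpolant_interp hΩb hint hh ha hau hn,
    fun w' hw' z hz => hw'.eq_interp hΩb hint hM hγ hh hn hau (hnT ▸ hz), ?_, ?_, ?_⟩
  · refine le_mul_sobolevNorm_add_bochnerNorm le_rfl hc0 ENNReal.ofReal_ne_top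
      fun D hD G hG hGu => ?_
    exact (H n h M hh hnT hM u hu a ha hau D hD).1 G hG hGu
  -- The bounds for the time derivative hold already with the first two norms; the third is added at
  -- the end.
  · refine le_trans ?_ (mul_le_mul_right le_self_add _)
    refine le_mul_sobolevNorm_add le_rfl le_rfl hc0 ENNReal.ofReal_ne_top fun D hD N hN => ?_
    exact (H n h M hh hnT hM u hu a ha hau D hD).2 (Hneg1 Ω) (L2toHneg1 Ω) N
      L2toHneg1_add L2toHneg1_smul norm_L2toHneg1_le hN
  · refine le_trans ?_ (mul_le_mul_right le_self_add _)
    refine le_mul_sobolevNorm_add le_rfl le_rfl hc0 ENNReal.ofReal_ne_top fun D hD N hN => ?_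
    exact (H n h M hh hnT hM u hu a ha hau D hD).2 (L2 Ω) id N
      (fun _ _ => rfl) (fun _ _ => rfl) (fun _ => le_rfl) hN
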